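/- **Setting.** Let $\mathfrak A$ be a commutative (not necessarily unital) real locally convex algebra, Hausdorff, sequentially complete, with continuous multiplication, and assume that $\mathfrak A$ is *strong*: for every continuous seminorm $p$ there is a continuous seminorm $\tilde p$ such that $p(a_1\cdots a_n)\le\tilde p(a_1)\cdots\tilde p(a_n)$ for all $n\ge 1$ and $a_1,\dots,a_n\in\mathfrak A$. Let $\mathfrak A^+=\mathbb R\oplus\mathfrak A$ be the unital extension, $I=\{0,1\}\times\mathbb N$, and let $\mathcal K_I(\mathfrak A)$ be the space of rapidly decreasing $I\times I$ matrices over $\mathfrak A$, topologized by the seminorms $\sup_{i,j}(1+|i|)^N(1+|j|)^Np(k_{i,j})$ ($p$ a continuous seminorm of $\mathfrak A$, $N\in\mathbb N$, $|(\varepsilon,n)|=n$). Let $\mathcal K_I(\mathfrak A)^\star$ be the group of invertible matrices in $1+\mathcal K_I(\mathfrak A)$, with the topology of $\mathcal K_I(\mathfrak A)$. Let $\mathbf R_0=0_{\mathbb N}\oplus 1_{\mathbb N}$ and $$\mathcal G_{\mathbb N}(\mathfrak A)=\{b : b^2=b,\ b-\mathbf R_0\in\mathcal K_I(\mathfrak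 A)\}.$$ A set of polynomial growth is a finite set with all its real functions, or a set with the real functions that correspond, under some bijection with $\mathbb N$, to the functions of at most polynomial growth; $\mathbb N$, finite sets, and disjoint unions and products of these carry natural such structures. A relabeling $r:\Omega\to\Omega'$ is an injection which is an isomorphism of $\Omega$ onto $r(\Omega)$ with the structure restricted from $\Omega'$, such that $r(\Omega)$ and $\Omega'\setminus r(\Omega)$ are sets of polynomial growth with the restricted structures; $r_*a$ is the $\Omega'\times\Omega'$ matrix with entry $a_{n,m}$ at $(r(n),r(m))$ and zeros elsewhere. For matrices $b,a$ over $\Omega$ put $\mathrm R\langle b,a\rangle=s(a)\,(b\oplus(1-a))\,s(a)$, $s(a)=\begin{bmatrix}1-a&a\\a&1-a\end{bmatrix}$ (a $\{0,1\}\times\Omega$ matrix). Fix any relabelings $\theta_1:I\,\dot\cup\,I\to\mathbb N$, $\theta_2:I\to\mathbb N$, $\theta_3:I\times I\to\mathbb N$, $\theta_4:\{0\}\to\mathbb N$, and let, for $b,d\in\mathcal G_{\mathbb N}(\mathfrak A)$, $$b\,\tilde+\,d=\mathrm R\langle\theta_{1*}(b\oplus d),\theta_{1*}(\mathbf R_0\oplus\mathbf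 R_0)\rangle,\qquad \tilde-b=\mathrm R\langle\theta_{2*}(1-b),\theta_{2*}(1-\mathbf R_0)\rangle,\qquad \tilde 0=\mathbf R_0;$$ let $b\,\tilde\otimes\,d$ be either $\mathrm R\langle\theta_{3*}(b\otimes d+(1-b)\otimes\mathbf R_0),\theta_{3*}(\mathbf R_0\otimes d+(1-\mathbf R_0)\otimes\mathbf R_0)\rangle$ or $\mathrm R\langle\theta_{3*}(b\otimes d+\mathbf R_0\otimes(1-d)),\theta_{3*}(b\otimes\mathbf R_0+\mathbf R_0\otimes(1-\mathbf R_0))\rangle$; and, if $\mathfrak A$ has a unit element $e$, let $\tilde 1=\mathrm R\langle\theta_{4*}(e),\theta_{4*}(0)\rangle$, where $(e)$ and $(0)$ denote $1\times1$ matrices. "Smooth" means Michal–Bastiani $C^\infty$; a map from a subset $S$ of a real topological vector space into $\mathcal G_{\mathbb N}(\mathfrak A)\subset\mathbf R_0+\mathcal K_I(\mathfrak A)$ or $\mathcal K_I(\mathfrak A)^\star\subset 1+\mathcal K_I(\mathfrak A)$ is smooth if, after subtraction of $\mathbf R_0$ or $1$, it is the restriction to $S$ of a smooth map from an open neighbourhood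 of $S$ into $\mathcal K_I(\mathfrak A)$. $X$ denotes a subset of a Hausdorff real locally convex space $E$. A smooth homotopy $H:X\times[0,1]\to\mathcal G_{\mathbb N}(\mathfrak A)$ is *induced by conjugation* if there is a smooth map $g:X\times[0,1]\to\mathcal K_I(\mathfrak A)^\star$, with $g^{-1}$ also smooth, such that $g(x,0)=1$ and $H(x,t)=g(x,t)H(x,0)g(x,t)^{-1}$ for all $x\in X$, $t\in[0,1]$. Write $f_0\simeq f_1$ for maps $f_0,f_1:X\to\mathcal G_{\mathbb N}(\mathfrak A)$ if some smooth homotopy from $f_0$ to $f_1$ is induced by conjugation. **Theorem.** With either choice of $\tilde\otimes$, $\mathcal G_{\mathbb N}(\mathfrak A)$ is a commutative "smooth topological algebraic" $H$-ring, which is unital if $\mathfrak A$ is unital. That is: 1. $\tilde+$, $\tilde-$, $\tilde\otimes$ are smooth maps $\mathcal G_{\mathbb N}(\mathfrak A)^k\to\mathcal G_{\mathbb N}(\mathfrak A)$ ($k=2,1,2$), and $\tilde0\in\mathcal G_{\mathbb N}(\mathfrak A)$. 2. As maps $\mathcal G_{\mathbb N}(\mathfrak A)^k\to\mathcal G_{\mathbb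 N}(\mathfrak A)$ ($k=1,2,3$): $(a\tilde+b)\tilde+c\simeq a\tilde+(b\tilde+c)$, $a\tilde+b\simeq b\tilde+a$, $a\tilde+\tilde0\simeq a\simeq\tilde0\tilde+a$, $a\tilde+(\tilde-a)\simeq\tilde0\simeq(\tilde-a)\tilde+a$, $(a\tilde\otimes b)\tilde\otimes c\simeq a\tilde\otimes(b\tilde\otimes c)$, $a\tilde\otimes b\simeq b\tilde\otimes a$, $a\tilde\otimes(b\tilde+c)\simeq(a\tilde\otimes b)\tilde+(a\tilde\otimes c)$, $(a\tilde+b)\tilde\otimes c\simeq(a\tilde\otimes c)\tilde+(b\tilde\otimes c)$; and, if $\mathfrak A$ is unital, $\tilde1\in\mathcal G_{\mathbb N}(\mathfrak A)$ and $\tilde1\tilde\otimes a\simeq a\simeq a\tilde\otimes\tilde1$. In particular the conjugating elements are smooth maps $\mathcal G_{\mathbb N}(\mathfrak A)^k\times[0,1]\to\mathcal K_{\{0,1\}\times\mathbb N}(\mathfrak A)^\star$. 3. The operations are compatible with $\simeq$: for all $X\subset E$ as above, if $f_0\simeq f_1$ and $h_0\simeq h_1$ on $X$, then $f_0\tilde+h_0\simeq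 f_1\tilde+h_1$, $\tilde-f_0\simeq\tilde-f_1$, $f_0\tilde\otimes h_0\simeq f_1\tilde\otimes h_1$. 4. The two choices of the product $\tilde\otimes$ are related by $\simeq$, as maps $\mathcal G_{\mathbb N}(\mathfrak A)^2\to\mathcal G_{\mathbb N}(\mathfrak A)$. 5. For all $X\subset E$ as above, every smooth homotopy $H:X\times[0,1]\to\mathcal G_{\mathbb N}(\mathfrak A)$ is induced by conjugation. -/

import Mathlib

open Filter Topology Set
open scoped Kronecker

universe u v w

namespace InfGrassmannian

/-! ### Index sets of polynomial growth -/

/-- A set of polynomial growth, presented by a size function. The admissible ("slow") real functions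
are those bounded by a polynomial of the size. -/
class GrowthIndex (Ω : Type*) where
  /-- The size of an index. -/
  size : Ω → ℕ

instance : GrowthIndex ℕ := ⟨fun n => n⟩
instance : GrowthIndex Unit := ⟨fun _ => 0⟩
instance (n : ℕ) : GrowthIndex (Fin n) := ⟨fun _ => 0⟩
instance {Ω Ξ : Type*} [GrowthIndex Ω] [GrowthIndex Ξ] : GrowthIndex (Ω ⊕ Ξ) :=
  ⟨Sum.elim GrowthIndex.size GrowthIndex.size⟩
instance {Ω Ξ : Type*} [GrowthIndex Ω] [GrowthIndex Ξ] : GrowthIndex (Ω × Ξ) :=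
  ⟨fun x => GrowthIndex.size x.1 + GrowthIndex.size x.2⟩

/-- The functions of at most polynomial growth on an index set. -/
def slow (Ω : Type*) [GrowthIndex Ω] : Set (Ω → ℝ) :=
  {f | ∃ (C : ℝ) (N : ℕ), ∀ x, |f x| ≤ C * (1 + (GrowthIndex.size x : ℝ)) ^ N}

/-- A family of real functions makes `Ω` a (finite or infinite) set of polynomial growth. -/
def IsSPG {Ω : Type*} (S : Set (Ω → ℝ)) : Prop :=
  (Finite Ω ∧ S = univ) ∨ ∃ q : Ω ≃ ℕ, S = {f | ∃ h ∈ slow ℕ, f = h ∘ q}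

/-- The restriction of the structure of `Ω` to a subset. -/
def slowOn {Ω : Type*} [GrowthIndex Ω] (s : Set Ω) : Set (s → ℝ) :=
  {f | ∃ F ∈ slow Ω, f = fun x => F x.1}

/-- A (not necessarily isomorphic) relabeling map: `Ω'` decomposes, as a set of polynomial growth,
into the image of `r` and its complement, and `r` is an isomorphism onto its image. -/
structure IsRelabeling {Ω Ω' : Type*} [GrowthIndex Ω] [GrowthIndex Ω'] (r : Ω → Ω') : Prop where
  injective : Function.Injective r
  slow_iff : slow Ω = {f | ∃ F ∈ slow Ω', f = F ∘ r}
  isSPG_range : IsSPG (slowOn (range r))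
  isSPG_compl : IsSPG (slowOn (range r)ᶜ)

/-! ### Assumptions on the algebra -/

/-- Every Cauchy sequence converges. -/
def SeqComplete (A : Type*) [AddCommGroup A] [TopologicalSpace A] : Prop :=
  ∀ u : ℕ → A, (∀ V ∈ 𝓝 (0 : A), ∃ N, ∀ m ≥ N, ∀ n ≥ N, u m - u n ∈ V) →
    ∃ a, Tendsto u atTop (𝓝 a)

/-- The locally convex algebra is strong: for every continuous seminorm `p` there is a continuous
seminorm `q` such that `p (a₁ ⋯ aₙ) ≤ q a₁ ⋯ q aₙ` for all `n ≥ 1`. -/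
def IsStrong (A : Type*) [NonUnitalCommRing A] [Module ℝ A] [TopologicalSpace A] : Prop :=
  ∀ p : Seminorm ℝ A, Continuous p → ∃ q : Seminorm ℝ A, Continuous q ∧
    ∀ (a : A) (l : List A), p (l.foldl (· * ·) a) ≤ q a * (l.map q).prod

/-! ### Rapidly decreasing matrices -/

section Rapid

variable (Ω : Type v) [GrowthIndex Ω] (A : Type u) [AddCommGroup A] [Module ℝ A]
  [TopologicalSpace A]

/-- The weight `(1 + |i|)^N (1 + |j|)^N`. -/
def weight {Ω : Type v} [GrowthIndex Ω] (N : ℕ) (i j : Ω) : ℝ :=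
  (1 + (GrowthIndex.size i : ℝ)) ^ N * (1 + (GrowthIndex.size j : ℝ)) ^ N

theorem weight_nonneg {Ω : Type v} [GrowthIndex Ω] (N : ℕ) (i j : Ω) : 0 ≤ weight N i j := by
  unfold weight; positivity

/-- The rapidly decreasing `Ω × Ω` matrices over `A`, as a subspace of all matrices. -/
def rapidSubmodule : Submodule ℝ (Matrix Ω Ω A) where
  carrier := {k | ∀ p : Seminorm ℝ A, Continuous p → ∀ N : ℕ,
    ∃ C : ℝ, ∀ i j, weight N i j * p (k i j) ≤ C}
  zero_mem' := fun p _ N => ⟨0, fun i j => by simp⟩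
  add_mem' := by
    intro a b ha hb p hp N
    obtain ⟨C, hC⟩ := ha p hp N
    obtain ⟨D, hD⟩ := hb p hp N
    refine ⟨C + D, fun i j => ?_⟩
    have h := mul_le_mul_of_nonneg_left (map_add_le_add p (a i j) (b i j)) (weight_nonneg N i j)
    have h1 := hC i j
    have h2 := hD i j
    rw [mul_add] at h
    exact h.trans (add_le_add h1 h2)
  smul_mem' := by
    intro c a ha p hp N
    obtain ⟨C, hC⟩ := ha p hp N
    refine ⟨‖c‖ * C, fun i j => ?_⟩
    have h := mul_le_mul_of_nonneg_left (hC i j) (norm_nonneg c)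
    rw [Matrix.smul_apply, map_smul_eq_mul, mul_left_comm]
    exact h

/-- The space of rapidly decreasing matrices, with the topology of the seminorms
`sup_{i,j} (1 + |i|)^N (1 + |j|)^N p (k i j)`. -/
def RapidMatrix : Type (max u v) := ↥(rapidSubmodule Ω A)

instance : AddCommGroup (RapidMatrix Ω A) := inferInstanceAs (AddCommGroup ↥(rapidSubmodule Ω A))
instance : Module ℝ (RapidMatrix Ω A) := inferInstanceAs (Module ℝ ↥(rapidSubmodule Ω A))

variable {Ω A}

/-- The underlying matrix. -/
def RapidMatrix.toMatrix (k : RapidMatrix Ω A) : Matrix Ω Ω A := k.1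

theorem RapidMatrix.bddAbove (k : RapidMatrix Ω A) {p : Seminorm ℝ A} (hp : Continuous p) (N : ℕ) :
    BddAbove (range fun x : Ω × Ω => weight N x.1 x.2 * p (k.toMatrix x.1 x.2)) := by
  obtain ⟨C, hC⟩ := k.2 p hp N
  exact ⟨C, by rintro _ ⟨x, rfl⟩; exact hC x.1 x.2⟩

/-- The defining seminorms of the space of rapidly decreasing matrices. -/
noncomputable def rapidSeminorm (p : {p : Seminorm ℝ A // Continuous p}) (N : ℕ) :
    Seminorm ℝ (RapidMatrix Ω A) :=
  Seminorm.of (fun k => ⨆ x : Ω × Ω, weight N x.1 x.2 * p.1 (k.toMatrix x.1 x.2))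
    (by
      intro k l
      refine Real.iSup_le (fun x => ?_) (add_nonneg
        (Real.iSup_nonneg fun x => mul_nonneg (weight_nonneg _ _ _) (apply_nonneg _ _))
        (Real.iSup_nonneg fun x => mul_nonneg (weight_nonneg _ _ _) (apply_nonneg _ _)))
      have h := mul_le_mul_of_nonneg_left
        (map_add_le_add p.1 (k.toMatrix x.1 x.2) (l.toMatrix x.1 x.2)) (weight_nonneg N x.1 x.2)
      rw [mul_add] at h
      exact h.trans (add_le_add (le_ciSup (k.bddAbove p.2 N) x) (le_ciSup (l.bddAbove p.2 N) x)))
    (by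
      intro c k
      rw [Real.mul_iSup_of_nonneg (norm_nonneg c)]
      refine congrArg _ (funext fun x => ?_)
      have h : (c • k).toMatrix x.1 x.2 = c • k.toMatrix x.1 x.2 := rfl
      rw [h, map_smul_eq_mul, mul_left_comm])

noncomputable instance : TopologicalSpace (RapidMatrix Ω A) :=
  SeminormFamily.moduleFilterBasis (𝕜 := ℝ)
    (fun i : {p : Seminorm ℝ A // Continuous p} × ℕ => rapidSeminorm (Ω := Ω) i.1 i.2) |>.topology

end Rapid

/-! ### Smooth maps (in the sense of Michal and Bastiani) -/

/-- `f` is `C^n` on the open set `U`: it is continuous and has directional derivatives which depend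
in a `C^(n-1)` manner on the point and the direction jointly. -/
def IsCk {F : Type v} [AddCommGroup F] [Module ℝ F] [TopologicalSpace F] :
    ℕ → ∀ {E : Type w} [AddCommGroup E] [Module ℝ E] [TopologicalSpace E], Set E → (E → F) → Prop
  | 0, _, _, _, _, U, f => ContinuousOn f U
  | n + 1, E, _, _, _, U, f => ContinuousOn f U ∧ ∃ df : E × E → F,
      (∀ x ∈ U, ∀ h : E,
        Tendsto (fun t : ℝ => t⁻¹ • (f (x + t • h) - f x)) (𝓝[≠] 0) (𝓝 (df (x, h)))) ∧
      IsCk n (U ×ˢ (univ : Set E)) df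

/-! ### Matrices over the unital extension -/

section Matrices

variable {A : Type u} [NonUnitalCommRing A] [Module ℝ A] [IsScalarTower ℝ A A]
  [SMulCommClass ℝ A A] [TopologicalSpace A]

/-- Product of (possibly infinite) matrices over the unital extension `ℝ ⊕ A`, the series being
summed componentwise. -/
noncomputable def mmul {I J L : Type*} (a : Matrix I J (Unitization ℝ A))
    (b : Matrix J L (Unitization ℝ A)) : Matrix I L (Unitization ℝ A) :=
  fun i l => Unitization.inl (∑' j, (a i j * b j l).fst) +
    Unitization.inr (∑' j, (a i j * b j l).snd)

/-- `base + k`, where `k` is a rapidly decreasing matrix over `A`. -/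
def perturb {Ω : Type*} [GrowthIndex Ω] (base : Matrix Ω Ω (Unitization ℝ A))
    (k : RapidMatrix Ω A) : Matrix Ω Ω (Unitization ℝ A) :=
  base + k.toMatrix.map (fun a : A => (a : Unitization ℝ A))

/-- The relabeling `r_*`: the entry of position `(n, m)` is put to position `(r n, r m)`, all other
entries are zero. -/
noncomputable def relabel {Ω Ω' : Type*} (r : Ω → Ω') (a : Matrix Ω Ω (Unitization ℝ A)) :
    Matrix Ω' Ω' (Unitization ℝ A) :=
  fun i j => Function.extend (Prod.map r r) (fun x : Ω × Ω => a x.1 x.2) 0 (i, j)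

/-- A `{0,1} × Ω` matrix out of four blocks. -/
def block {Ω : Type*} (a b c d : Matrix Ω Ω (Unitization ℝ A)) :
    Matrix (Fin 2 × Ω) (Fin 2 × Ω) (Unitization ℝ A) :=
  Matrix.comp _ _ _ _ _ !![a, b; c, d]

/-- The partial switch of the two blocks. -/
def sw {Ω : Type*} [DecidableEq Ω] (a : Matrix Ω Ω (Unitization ℝ A)) :
    Matrix (Fin 2 × Ω) (Fin 2 × Ω) (Unitization ℝ A) :=
  block (1 - a) a a (1 - a)

/-- The regularized matrix of the pair `⟨b, a⟩`. -/
noncomputable def regularize {Ω : Type*} [DecidableEq Ω] (b a : Matrix Ω Ω (Unitization ℝ A)) :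
    Matrix (Fin 2 × Ω) (Fin 2 × Ω) (Unitization ℝ A) :=
  mmul (mmul (sw a) (block b 0 0 (1 - a))) (sw a)

/-- The index set `{0,1} × ℕ`. -/
abbrev Idx : Type := Fin 2 × ℕ

/-- The matrices in which the elements of the Grassmannian live. -/
abbrev Mat (A : Type u) : Type u := Matrix Idx Idx (Unitization ℝ A)

/-- The base idempotent `0 ⊕ 1`. -/
def R0 : Mat A := block 0 0 0 1

variable (A) in
/-- The standard infinite Grassmannian: idempotents which differ from `0 ⊕ 1` by a rapidly
decreasing matrix over `A`. (The second members of the pairs are all equal to `0 ⊕ 1`, so they are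
not recorded.) -/
def Gr : Set (Mat A) := {b | mmul b b = b ∧ ∃ k : RapidMatrix Idx A, b = perturb R0 k}

/-! The operations on the Grassmannian. The argument `b` stands for the pair `⟨b, R0⟩`. -/

/-- Sum: direct sum of pairs, relabeled and regularized. -/
noncomputable def add (θ : Idx ⊕ Idx → ℕ) (b d : Mat A) : Mat A :=
  regularize (relabel θ (Matrix.fromBlocks b 0 0 d)) (relabel θ (Matrix.fromBlocks R0 0 0 R0))

/-- Additive inverse: the pair of complementary idempotents, relabeled and regularized. -/
noncomputable def neg (θ : Idx → ℕ) (b : Mat A) : Mat A :=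
  regularize (relabel θ (1 - b)) (relabel θ (1 - R0))

/-- The product `⟨b, a⟩ ⊗ ⟨d, c⟩ = ⟨b ⊗ d + (1 - b) ⊗ c, a ⊗ d + (1 - a) ⊗ c⟩` with `a = c = R0`,
relabeled and regularized. -/
noncomputable def mulLeft (θ : Idx × Idx → ℕ) (b d : Mat A) : Mat A :=
  regularize (relabel θ (b ⊗ₖ d + (1 - b) ⊗ₖ R0)) (relabel θ (R0 ⊗ₖ d + (1 - R0) ⊗ₖ R0))

/-- The product `⟨b, a⟩ ⊗ ⟨d, c⟩ = ⟨b ⊗ d + a ⊗ (1 - d), b ⊗ c + a ⊗ (1 - c)⟩` with `a = c = R0`,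
relabeled and regularized. -/
noncomputable def mulRight (θ : Idx × Idx → ℕ) (b d : Mat A) : Mat A :=
  regularize (relabel θ (b ⊗ₖ d + R0 ⊗ₖ (1 - d))) (relabel θ (b ⊗ₖ R0 + R0 ⊗ₖ (1 - R0)))

/-- The multiplicative unit: the pair `⟨e, 0⟩` of `1 × 1` matrices, relabeled and regularized; here
`e` is the unit element of `A`. -/
noncomputable def one (θ : Unit → ℕ) (e : A) : Mat A :=
  regularize (relabel θ (Matrix.of fun _ _ => (e : Unitization ℝ A))) (relabel θ 0)

/-! ### Smooth homotopies and conjugation -/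

section Homotopy

variable {E : Type w} [AddCommGroup E] [Module ℝ E] [TopologicalSpace E]

/-- `f` is a smooth map from the subset `S` into the affine space `base + 𝒦(A)`: it is the
restriction of a smooth map defined on an open neighbourhood of `S`. -/
def SmoothInto (base : Mat A) (S : Set E) (f : E → Mat A) : Prop :=
  ∃ U : Set E, IsOpen U ∧ S ⊆ U ∧ ∃ F : E → RapidMatrix Idx A,
    (∀ n, IsCk n U F) ∧ ∀ x ∈ S, f x = perturb base (F x)

/-- `f` is a smooth map from `S` into the Grassmannian. -/
def SmoothToGr (S : Set E) (f : E → Mat A) : Prop :=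
  SmoothInto R0 S f ∧ ∀ x ∈ S, f x ∈ Gr A

/-- `g` is a smooth map from `S` into the unit group of `𝒦(A)`, i.e. into the invertible elements of
`1 + 𝒦(A)`, and `g'` is its pointwise inverse, which is also smooth. -/
def SmoothUnits (S : Set E) (g g' : E → Mat A) : Prop :=
  SmoothInto 1 S g ∧ SmoothInto 1 S g' ∧ ∀ x ∈ S, mmul (g x) (g' x) = 1 ∧ mmul (g' x) (g x) = 1

/-- The smooth homotopy `H : X × [0,1] → 𝒢(A)` is induced by conjugating its initial map by a smooth
map `g` from `X × [0,1]` to the unit group, starting from the identity. -/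
def InducedByConj (X : Set E) (H : E × ℝ → Mat A) : Prop :=
  ∃ g g' : E × ℝ → Mat A, SmoothUnits (X ×ˢ Icc (0 : ℝ) 1) g g' ∧
    (∀ x ∈ X, g (x, 0) = 1) ∧
    ∀ x ∈ X, ∀ t ∈ Icc (0 : ℝ) 1, H (x, t) = mmul (mmul (g (x, t)) (H (x, 0))) (g' (x, t))

/-- The maps `f₀` and `f₁` from `X` to the Grassmannian are connected by a smooth homotopy which is
induced by conjugation. -/
def ConjHomotopic (X : Set E) (f₀ f₁ : E → Mat A) : Prop :=
  ∃ H : E × ℝ → Mat A, SmoothToGr (X ×ˢ Icc (0 : ℝ) 1) H ∧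
    (∀ x ∈ X, H (x, 0) = f₀ x ∧ H (x, 1) = f₁ x) ∧ InducedByConj X H

end Homotopy

/-- The element of `R0 + 𝒦(A)` with coordinate `x`. -/
def pt (x : RapidMatrix Idx A) : Mat A := perturb R0 x

variable (A) in
/-- The `k`-th power of the Grassmannian, in terms of coordinates. -/
def GrPow (k : ℕ) : Set (Fin k → RapidMatrix Idx A) := {x | ∀ i, pt (x i) ∈ Gr A}

/-- The operations are smooth, and make the Grassmannian a commutative ring up to smooth homotopies
which are induced by conjugation; furthermore the operations are compatible with such
homotopies. -/
structure IsSmoothConjHRing (add : Mat A → Mat A → Mat A) (neg : Mat A → Mat A) (zero : Mat A)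
    (mul : Mat A → Mat A → Mat A) : Prop where
  smooth_add : SmoothToGr (GrPow A 2) fun x => add (pt (x 0)) (pt (x 1))
  smooth_neg : SmoothToGr (GrPow A 1) fun x => neg (pt (x 0))
  zero_mem : zero ∈ Gr A
  smooth_mul : SmoothToGr (GrPow A 2) fun x => mul (pt (x 0)) (pt (x 1))
  add_assoc : ConjHomotopic (GrPow A 3)
    (fun x => add (add (pt (x 0)) (pt (x 1))) (pt (x 2)))
    (fun x => add (pt (x 0)) (add (pt (x 1)) (pt (x 2))))
  add_comm : ConjHomotopic (GrPow A 2)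
    (fun x => add (pt (x 0)) (pt (x 1))) (fun x => add (pt (x 1)) (pt (x 0)))
  add_zero : ConjHomotopic (GrPow A 1) (fun x => add (pt (x 0)) zero) (fun x => pt (x 0))
  zero_add : ConjHomotopic (GrPow A 1) (fun x => add zero (pt (x 0))) (fun x => pt (x 0))
  add_neg : ConjHomotopic (GrPow A 1) (fun x => add (pt (x 0)) (neg (pt (x 0)))) (fun _ => zero)
  neg_add : ConjHomotopic (GrPow A 1) (fun x => add (neg (pt (x 0))) (pt (x 0))) (fun _ => zero)
  mul_assoc : ConjHomotopic (GrPow A 3)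
    (fun x => mul (mul (pt (x 0)) (pt (x 1))) (pt (x 2)))
    (fun x => mul (pt (x 0)) (mul (pt (x 1)) (pt (x 2))))
  mul_comm : ConjHomotopic (GrPow A 2)
    (fun x => mul (pt (x 0)) (pt (x 1))) (fun x => mul (pt (x 1)) (pt (x 0)))
  mul_add : ConjHomotopic (GrPow A 3)
    (fun x => mul (pt (x 0)) (add (pt (x 1)) (pt (x 2))))
    (fun x => add (mul (pt (x 0)) (pt (x 1))) (mul (pt (x 0)) (pt (x 2))))
  add_mul : ConjHomotopic (GrPow A 3)
    (fun x => mul (add (pt (x 0)) (pt (x 1))) (pt (x 2)))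
    (fun x => add (mul (pt (x 0)) (pt (x 2))) (mul (pt (x 1)) (pt (x 2))))
  add_compat : ∀ (E : Type w) [AddCommGroup E] [Module ℝ E] [TopologicalSpace E]
    [IsTopologicalAddGroup E] [ContinuousSMul ℝ E] [LocallyConvexSpace ℝ E] [T2Space E]
    (X : Set E) (f₀ f₁ h₀ h₁ : E → Mat A), ConjHomotopic X f₀ f₁ → ConjHomotopic X h₀ h₁ →
    ConjHomotopic X (fun x => add (f₀ x) (h₀ x)) (fun x => add (f₁ x) (h₁ x))
  neg_compat : ∀ (E : Type w) [AddCommGroup E] [Module ℝ E] [TopologicalSpace E]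
    [IsTopologicalAddGroup E] [ContinuousSMul ℝ E] [LocallyConvexSpace ℝ E] [T2Space E]
    (X : Set E) (f₀ f₁ : E → Mat A), ConjHomotopic X f₀ f₁ →
    ConjHomotopic X (fun x => neg (f₀ x)) (fun x => neg (f₁ x))
  mul_compat : ∀ (E : Type w) [AddCommGroup E] [Module ℝ E] [TopologicalSpace E]
    [IsTopologicalAddGroup E] [ContinuousSMul ℝ E] [LocallyConvexSpace ℝ E] [T2Space E]
    (X : Set E) (f₀ f₁ h₀ h₁ : E → Mat A), ConjHomotopic X f₀ f₁ → ConjHomotopic X h₀ h₁ →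
    ConjHomotopic X (fun x => mul (f₀ x) (h₀ x)) (fun x => mul (f₁ x) (h₁ x))

/-- `one` is a unit element of the multiplication up to smooth homotopies which are induced by
conjugation. -/
structure IsSmoothConjUnit (mul : Mat A → Mat A → Mat A) (one : Mat A) : Prop where
  one_mem : one ∈ Gr A
  one_mul : ConjHomotopic (GrPow A 1) (fun x => mul one (pt (x 0))) (fun x => pt (x 0))
  mul_one : ConjHomotopic (GrPow A 1) (fun x => mul (pt (x 0)) one) (fun x => pt (x 0))

end Matrices

end InfGrassmannian

set_option linter.unusedSectionVars false
set_option linter.unusedVariables false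

namespace InfGrassmannian

/-- The unit interval of the real line. -/
local notation "𝕀" => Icc (0 : ℝ) 1

/-! ### Calculus of Michal–Bastiani smooth maps -/

section Calculus

theorem exists_linear_le_seminorm {F : Type*} [AddCommGroup F] [Module ℝ F] (p : Seminorm ℝ F)
    (y : F) : ∃ l : Module.Dual ℝ F, (∀ x, |l x| ≤ p x) ∧ l y = p y := by
  by_cases hy : y = 0
  · exact ⟨0, fun x => by simp, by simp [hy]⟩
  let e := LinearEquiv.toSpanNonzeroSingleton ℝ F y hy
  let f : Module.Dual ℝ (ℝ ∙ y : Submodule ℝ F) := p y • e.symm.toLinearMap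
  obtain ⟨g, hg, hl⟩ := Module.Dual.exists_extension_of_le_seminorm_real (p := p)
    (ℝ ∙ y : Submodule ℝ F) f (by
      intro x
      obtain ⟨c, rfl⟩ := e.surjective x
      have h1 : f (e c) = p y * c := by simp [f]
      have h2 : ((e c : (ℝ ∙ y : Submodule ℝ F)) : F) = c • y := by simp [e]
      rw [h1, h2, map_smul_eq_mul, mul_comm]
      exact mul_le_mul_of_nonneg_right (le_abs_self c) (apply_nonneg p y))
  refine ⟨g, hl, ?_⟩
  have h3 := hg (e 1)
  have h2 : ((e 1 : (ℝ ∙ y : Submodule ℝ F)) : F) = y := by simp [e]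
  have h1 : f (e 1) = p y := by simp [f]
  rwa [h1, h2] at h3

/-- The derivative of a curve at `t`, relative to a set of parameters. -/
def HasCurveDeriv {F : Type*} [AddCommGroup F] [Module ℝ F] [TopologicalSpace F]
    (γ : ℝ → F) (v : F) (S : Set ℝ) (t : ℝ) : Prop :=
  Tendsto (fun s => (s - t)⁻¹ • (γ s - γ t)) (𝓝[S \ {t}] t) (𝓝 v)

section

variable {F : Type*} [AddCommGroup F] [Module ℝ F] [TopologicalSpace F]

theorem tendsto_iff_seminorm [PolynormableSpace ℝ F] {X : Type*} {u : X → F} {l : Filter X}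
    {y : F} : Tendsto u l (𝓝 y) ↔
      ∀ p : Seminorm ℝ F, Continuous p → ∀ ε > 0, ∀ᶠ x in l, p (u x - y) < ε := by
  rw [(PolynormableSpace.withSeminorms ℝ F).tendsto_nhds]
  exact ⟨fun h p hp ε hε => h ⟨p, hp⟩ ε hε, fun h p ε hε => h p.1 p.2 ε hε⟩

/-- The mean value inequality for curves in a locally convex space. -/
theorem seminorm_sub_le_of_hasCurveDeriv [IsTopologicalAddGroup F] {p : Seminorm ℝ F}
    (hp : Continuous p) {γ γ' : ℝ → F}
    {B B' : ℝ → ℝ} {a b : ℝ} (hab : a ≤ b)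
    (hγ : ∀ t ∈ Icc a b, HasCurveDeriv γ (γ' t) (Icc a b) t)
    (hB : ∀ t ∈ Icc a b, HasDerivWithinAt B (B' t) (Icc a b) t)
    (hle : ∀ t ∈ Icc a b, p (γ' t) ≤ B' t) : p (γ b - γ a) ≤ B b - B a := by
  obtain ⟨l, hl, hly⟩ := exists_linear_le_seminorm p (γ b - γ a)
  have hd : ∀ t ∈ Icc a b, HasDerivWithinAt (fun s => l (γ s) - B s) (l (γ' t) - B' t)
      (Icc a b) t := by
    intro t ht
    refine HasDerivWithinAt.sub ?_ (hB t ht)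
    rw [hasDerivWithinAt_iff_tendsto_slope, Metric.tendsto_nhds]
    intro ε hε
    have h0 : Tendsto (fun s => p ((s - t)⁻¹ • (γ s - γ t) - γ' t)) (𝓝[Icc a b \ {t}] t) (𝓝 0) := by
      have := ((hp.tendsto _).comp ((hγ t ht).sub_const (γ' t)))
      simpa [Function.comp_def] using this
    filter_upwards [h0.eventually (gt_mem_nhds hε)] with s hs
    rw [Real.dist_eq]
    have h1 : slope (fun s => l (γ s)) t s - l (γ' t) = l ((s - t)⁻¹ • (γ s - γ t) - γ' t) := by
      simp [slope, map_sub, map_smul]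
    rw [h1]
    exact (hl _).trans_lt hs
  have hanti : AntitoneOn (fun s => l (γ s) - B s) (Icc a b) := by
    refine antitoneOn_of_hasDerivWithinAt_nonpos (f' := fun t => l (γ' t) - B' t) (convex_Icc a b)
      (fun t ht => (hd t ht).continuousWithinAt)
      (fun t ht => (hd t (interior_subset ht)).mono interior_subset) (fun t ht => ?_)
    have := (le_abs_self _).trans ((hl (γ' t)).trans (hle t (interior_subset ht)))
    linarith
  have := hanti (left_mem_Icc.2 hab) (right_mem_Icc.2 hab) hab
  simp only at this
  rw [← hly, map_sub]
  linarith

/-- The two-sided directional derivative of `f` at `x` in the direction `h` is `v`. -/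
def HasDirDeriv {E : Type*} [AddCommGroup E] [Module ℝ E] (f : E → F) (x h : E) (v : F) : Prop :=
  Tendsto (fun t : ℝ => t⁻¹ • (f (x + t • h) - f x)) (𝓝[≠] 0) (𝓝 v)

end

section

variable {E : Type*} [AddCommGroup E] [Module ℝ E] [TopologicalSpace E] [IsTopologicalAddGroup E]
  [ContinuousSMul ℝ E]
variable {F : Type*} [AddCommGroup F] [Module ℝ F] [TopologicalSpace F] [IsTopologicalAddGroup F]
  [ContinuousSMul ℝ F]
variable {G : Type*} [AddCommGroup G] [Module ℝ G] [TopologicalSpace G] [IsTopologicalAddGroup G]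
  [ContinuousSMul ℝ G]

theorem HasDirDeriv.hasCurveDeriv {f : E → F} {x h : E} {v : F} (hf : HasDirDeriv f x h v)
    {t : ℝ} {y : E} (hy : y = x - t • h) (S : Set ℝ) :
    HasCurveDeriv (fun s => f (y + s • h)) v S t := by
  have h1 : Tendsto (fun s : ℝ => s - t) (𝓝[S \ {t}] t) (𝓝[≠] 0) := by
    refine tendsto_nhdsWithin_iff.2 ⟨?_, ?_⟩
    · have : Tendsto (fun s : ℝ => s - t) (𝓝 t) (𝓝 (t - t)) := tendsto_id.sub_const t
      rw [sub_self] at this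
      exact this.mono_left nhdsWithin_le_nhds
    · filter_upwards [self_mem_nhdsWithin] with s hs
      exact sub_ne_zero.2 hs.2
  refine (hf.comp h1).congr fun s => ?_
  have h2 : x + (s - t) • h = y + s • h := by rw [hy, sub_smul]; abel
  have h3 : x = y + t • h := by rw [hy]; abel
  simp only [Function.comp_apply, h2]
  rw [← h3]

theorem HasDirDeriv.smul_dir {f : E → F} {x h : E} {v : F} (hf : HasDirDeriv f x h v) {c : ℝ}
    (hc : c ≠ 0) : HasDirDeriv f x (c • h) (c • v) := by
  have h1 : Tendsto (fun s : ℝ => s * c) (𝓝[≠] 0) (𝓝[≠] 0) := by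
    refine tendsto_nhdsWithin_iff.2 ⟨?_, ?_⟩
    · have : Tendsto (fun s : ℝ => s * c) (𝓝 0) (𝓝 (0 * c)) := tendsto_id.mul_const c
      rw [zero_mul] at this
      exact this.mono_left nhdsWithin_le_nhds
    · filter_upwards [self_mem_nhdsWithin] with s hs
      exact mul_ne_zero hs hc
  refine ((hf.comp h1).const_smul c).congr fun s => ?_
  simp only [Function.comp_apply, smul_smul, mul_inv]
  congr 1
  field_simp

/-- The difference quotients of a map with jointly continuous directional derivatives converge
jointly. -/
theorem tendsto_diffQuot [PolynormableSpace ℝ F] {U : Set E} (hU : IsOpen U) {f : E → F}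
    {df : E × E → F} (hd : ∀ x ∈ U, ∀ h, HasDirDeriv f x h (df (x, h)))
    (hc : ContinuousOn df (U ×ˢ univ)) {x₀ : E} (hx₀ : x₀ ∈ U) (h₀ : E) :
    Tendsto (fun q : (E × E) × ℝ => q.2⁻¹ • (f (q.1.1 + q.2 • q.1.2) - f q.1.1))
      (𝓝 (x₀, h₀) ×ˢ 𝓝[≠] 0) (𝓝 (df (x₀, h₀))) := by
  rw [tendsto_iff_seminorm]
  intro p hp ε hε
  have hcont : ContinuousAt df (x₀, h₀) :=
    hc.continuousAt ((hU.prod isOpen_univ).mem_nhds ⟨hx₀, mem_univ _⟩)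
  have h1 : ∀ᶠ z in 𝓝 (x₀, h₀), z.1 ∈ U ∧ p (df z - df (x₀, h₀)) < ε / 2 := by
    refine (continuous_fst.continuousAt.eventually (hU.mem_nhds hx₀)).and ?_
    have := ((hp.tendsto _).comp (hcont.tendsto.sub_const (df (x₀, h₀))))
    simp only [sub_self, map_zero] at this
    exact this.eventually (gt_mem_nhds (half_pos hε))
  have h2 : Tendsto (fun q : (E × E) × ℝ => (q.1.1 + q.2 • q.1.2, q.1.2))
      (𝓝 (x₀, h₀) ×ˢ 𝓝 0) (𝓝 (x₀, h₀)) := by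
    have : Continuous (fun q : (E × E) × ℝ => (q.1.1 + q.2 • q.1.2, q.1.2)) := by fun_prop
    have := this.tendsto ((x₀, h₀), 0)
    simpa [nhds_prod_eq] using this
  have h3 := h2.eventually h1
  rw [eventually_prod_iff] at h3
  obtain ⟨P, hP, Q, hQ, hPQ⟩ := h3
  obtain ⟨δ, hδ, hball⟩ := Metric.eventually_nhds_iff.1 hQ
  have hQ' : ∀ᶠ t : ℝ in 𝓝[≠] 0, t ≠ 0 ∧ |t| < δ := by
    refine eventually_nhdsWithin_of_eventually_nhds ?_ |>.and ?_ |>.mono fun t h => ⟨h.2, h.1⟩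
    · have := Metric.ball_mem_nhds (0 : ℝ) hδ
      filter_upwards [this] with t ht
      simpa using ht
    · exact eventually_mem_nhdsWithin
  filter_upwards [hP.prod_mk hQ'] with q hq
  obtain ⟨hq1, ht0, htδ⟩ := hq
  obtain ⟨⟨x, h⟩, t⟩ := q
  simp only at hq1 ht0 htδ ⊢
  have hmem : ∀ s ∈ 𝕀, x + (s * t) • h ∈ U ∧
      p (df (x + (s * t) • h, h) - df (x₀, h₀)) < ε / 2 := by
    intro s hs
    refine hPQ hq1 (y := s * t) (hball ?_)
    rw [dist_zero_right, Real.norm_eq_abs, abs_mul, abs_of_nonneg hs.1]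
    exact (mul_le_of_le_one_left (abs_nonneg t) hs.2).trans_lt htδ
  have hder : ∀ s ∈ 𝕀,
      HasCurveDeriv (fun s => f (x + s • (t • h)) - (s * t) • df (x₀, h₀))
        (t • (df (x + (s * t) • h, h) - df (x₀, h₀))) (Icc 0 1) s := by
    intro s hs
    have hA : HasCurveDeriv (fun s => f (x + s • (t • h))) (t • df (x + (s * t) • h, h))
        (Icc 0 1) s := by
      refine ((hd _ (hmem s hs).1 h).smul_dir ht0).hasCurveDeriv ?_ _
      rw [smul_smul]; abel
    have hB : HasCurveDeriv (fun s : ℝ => (s * t) • df (x₀, h₀)) (t • df (x₀, h₀))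
        (Icc 0 1) s := by
      refine tendsto_const_nhds.congr' ?_
      filter_upwards [self_mem_nhdsWithin] with r hr
      have : r - s ≠ 0 := sub_ne_zero.2 hr.2
      rw [← sub_smul, smul_smul]
      congr 1
      field_simp
    refine (hA.sub hB).congr' ?_ |>.trans (by rw [smul_sub])
    filter_upwards with r
    rw [← smul_sub]
    congr 1
    abel
  have hfin := seminorm_sub_le_of_hasCurveDeriv hp (B := fun s => s * (|t| * (ε / 2)))
    (B' := fun _ => |t| * (ε / 2)) zero_le_one hder
    (fun s _ => by
      simpa using ((hasDerivAt_id s).mul_const (|t| * (ε / 2))).hasDerivWithinAt)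
    (fun s hs => by
      rw [map_smul_eq_mul, Real.norm_eq_abs]
      exact mul_le_mul_of_nonneg_left (hmem s hs).2.le (abs_nonneg t))
  simp only [one_smul, one_mul, zero_smul, zero_mul, add_zero, sub_zero] at hfin
  have heq : t⁻¹ • (f (x + t • h) - f x) - df (x₀, h₀) =
      t⁻¹ • (f (x + t • h) - t • df (x₀, h₀) - f x) := by
    rw [sub_right_comm, smul_sub _ _ (t • _), smul_smul, inv_mul_cancel₀ ht0, one_smul]
  rw [heq, map_smul_eq_mul, norm_inv, Real.norm_eq_abs]
  have htpos : 0 < |t| := abs_pos.2 ht0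
  calc |t|⁻¹ * p (f (x + t • h) - t • df (x₀, h₀) - f x) ≤ |t|⁻¹ * (|t| * (ε / 2)) :=
        mul_le_mul_of_nonneg_left hfin (by positivity)
    _ = ε / 2 := by field_simp
    _ < ε := by linarith

end

section

variable {E : Type w} [AddCommGroup E] [Module ℝ E] [TopologicalSpace E]
variable {F : Type v} [AddCommGroup F] [Module ℝ F] [TopologicalSpace F]

theorem IsCk.continuousOn {n : ℕ} {U : Set E} {f : E → F} (h : IsCk n U f) : ContinuousOn f U := by
  cases n with
  | zero => exact h
  | succ n => exact h.1

theorem IsCk.mono {n : ℕ} {U V : Set E} {f : E → F} (h : IsCk n U f) (hVU : V ⊆ U) :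
    IsCk n V f := by
  induction n generalizing E with
  | zero => exact ContinuousOn.mono h hVU
  | succ n ih =>
    obtain ⟨hc, df, hd, hdf⟩ := h
    exact ⟨hc.mono hVU, df, fun x hx => hd x (hVU hx), ih hdf (prod_mono hVU le_rfl)⟩

theorem IsCk.of_succ {n : ℕ} {U : Set E} {f : E → F} (h : IsCk (n + 1) U f) : IsCk n U f := by
  induction n generalizing E with
  | zero => exact h.1
  | succ n ih =>
    obtain ⟨hc, df, hd, hdf⟩ := h
    exact ⟨hc, df, hd, ih hdf⟩

theorem IsCk.const (c : F) (n : ℕ) (U : Set E) : IsCk n U fun _ : E => c := by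
  have h0 : ∀ (n : ℕ) {E : Type w} [AddCommGroup E] [Module ℝ E] [TopologicalSpace E] (U : Set E),
      IsCk n U fun _ : E => (0 : F) := by
    intro n
    induction n with
    | zero => intro E _ _ _ U; exact continuousOn_const
    | succ n ih =>
      intro E _ _ _ U
      exact ⟨continuousOn_const, fun _ => 0, fun x _ h => by simp [tendsto_const_nhds], ih _⟩
  cases n with
  | zero => exact continuousOn_const
  | succ n => exact ⟨continuousOn_const, fun _ => 0, fun x _ h => by simp [tendsto_const_nhds], h0 n _⟩

variable [IsTopologicalAddGroup E] [ContinuousSMul ℝ E]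

theorem eventually_add_smul_mem {U : Set E} (hU : IsOpen U) {x : E} (hx : x ∈ U) (h : E) :
    ∀ᶠ t : ℝ in 𝓝[≠] 0, x + t • h ∈ U := by
  have : Tendsto (fun t : ℝ => x + t • h) (𝓝 0) (𝓝 (x + (0 : ℝ) • h)) :=
    Continuous.tendsto (by fun_prop) 0
  rw [zero_smul, add_zero] at this
  exact (this.eventually (hU.mem_nhds hx)).filter_mono nhdsWithin_le_nhds

theorem IsCk.congr {n : ℕ} {U : Set E} (hU : IsOpen U) {f g : E → F} (h : IsCk n U f)
    (hfg : EqOn g f U) : IsCk n U g := by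
  cases n with
  | zero => exact ContinuousOn.congr h hfg
  | succ n =>
    obtain ⟨hc, df, hd, hdf⟩ := h
    refine ⟨hc.congr hfg, df, fun x hx h => (hd x hx h).congr' ?_, hdf⟩
    filter_upwards [eventually_add_smul_mem hU hx h] with t ht
    rw [hfg ht, hfg hx]

theorem IsCk.pair {G : Type u} [AddCommGroup G] [Module ℝ G] [TopologicalSpace G]
    {n : ℕ} {U : Set E} {f : E → F} {g : E → G} (hf : IsCk n U f) (hg : IsCk n U g) :
    IsCk n U fun x => (f x, g x) := by
  induction n generalizing E with
  | zero => exact ContinuousOn.prodMk hf hg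
  | succ n ih =>
    obtain ⟨hfc, df, hfd, hdf⟩ := hf
    obtain ⟨hgc, dg, hgd, hdg⟩ := hg
    exact ⟨hfc.prodMk hgc, fun z => (df z, dg z),
      fun x hx h => (hfd x hx h).prodMk_nhds (hgd x hx h), ih hdf hdg⟩

theorem IsCk.clm (L : E →L[ℝ] F) (n : ℕ) (U : Set E) : IsCk n U L := by
  have key : ∀ (n : ℕ) {E : Type w} [AddCommGroup E] [Module ℝ E] [TopologicalSpace E]
      (L : E →L[ℝ] F) (U : Set E), IsCk n U L := by
    intro n
    induction n with
    | zero => intro E _ _ _ L U; exact L.continuous.continuousOn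
    | succ n ih =>
      intro E _ _ _ L U
      refine ⟨L.continuous.continuousOn, L.comp (ContinuousLinearMap.snd ℝ E E), fun x _ h => ?_,
        ih _ _⟩
      refine tendsto_const_nhds.congr' ?_
      filter_upwards [self_mem_nhdsWithin] with t ht
      rw [map_add, add_sub_cancel_left, map_smul, smul_smul, inv_mul_cancel₀ ht, one_smul]
      rfl
  exact key n L U

end

section

variable {E : Type w} [AddCommGroup E] [Module ℝ E] [TopologicalSpace E]
  [IsTopologicalAddGroup E] [ContinuousSMul ℝ E]

theorem IsCk.comp {F : Type v} [AddCommGroup F] [Module ℝ F] [TopologicalSpace F]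
    [IsTopologicalAddGroup F] [ContinuousSMul ℝ F]
    {G : Type u} [AddCommGroup G] [Module ℝ G] [TopologicalSpace G]
    [IsTopologicalAddGroup G] [ContinuousSMul ℝ G] [PolynormableSpace ℝ G]
    {n : ℕ} {U : Set E} {V : Set F} (hU : IsOpen U) (hV : IsOpen V) {g : F → G} {f : E → F}
    (hg : IsCk n V g) (hf : IsCk n U f) (hm : MapsTo f U V) : IsCk n U fun x => g (f x) := by
  induction n generalizing E F with
  | zero => exact ContinuousOn.comp hg hf hm
  | succ n ih =>
    obtain ⟨hfc, df, hfd, hdf⟩ := id hf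
    obtain ⟨hgc, dg, hgd, hdg⟩ := hg
    refine ⟨hgc.comp hfc hm, fun z => dg (f z.1, df z), fun x hx h => ?_, ?_⟩
    · have hlim := tendsto_diffQuot hV hgd hdg.continuousOn (hm hx) (df (x, h))
      have h1 : Tendsto (fun t : ℝ => ((f x, t⁻¹ • (f (x + t • h) - f x)), t)) (𝓝[≠] 0)
          (𝓝 (f x, df (x, h)) ×ˢ 𝓝[≠] 0) :=
        (tendsto_const_nhds.prodMk_nhds (hfd x hx h)).prodMk tendsto_id
      refine (hlim.comp h1).congr' ?_
      filter_upwards [self_mem_nhdsWithin] with t ht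
      simp only [Function.comp_apply]
      rw [smul_smul, mul_inv_cancel₀ ht, one_smul, add_sub_cancel]
    · refine ih (hU.prod isOpen_univ) (hV.prod isOpen_univ) hdg
        (f := fun z : E × E => (f z.1, df z)) ?_ fun z hz => ⟨hm hz.1, mem_univ _⟩
      refine IsCk.pair ?_ hdf
      have hcomp : ∀ (m : ℕ) {E : Type w} [AddCommGroup E] [Module ℝ E] [TopologicalSpace E]
          {E' : Type w} [AddCommGroup E'] [Module ℝ E'] [TopologicalSpace E']
          {U : Set E} {f : E → F} (L : E' →L[ℝ] E), IsCk m U f → IsCk m (L ⁻¹' U) (f ∘ L) := by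
        intro m
        induction m with
        | zero =>
          intro E _ _ _ E' _ _ _ U f L hf
          exact ContinuousOn.comp hf L.continuous.continuousOn fun _ h => h
        | succ m ihm =>
          intro E _ _ _ E' _ _ _ U f L hf
          obtain ⟨hc, df, hd, hdf⟩ := hf
          refine ⟨hc.comp L.continuous.continuousOn fun _ h => h, df ∘ (L.prodMap L),
            fun x hx h => ?_, ?_⟩
          · have := hd (L x) hx (L h)
            simpa [Function.comp_def, map_add, map_smul] using this
          · have := ihm (L.prodMap L) hdf
            exact this.mono fun z hz => ⟨hz.1, mem_univ _⟩
      have := hcomp n (ContinuousLinearMap.fst ℝ E E) hf.of_succ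
      exact this.mono fun z hz => hz.1

variable {F : Type v} [AddCommGroup F] [Module ℝ F] [TopologicalSpace F]
  [IsTopologicalAddGroup F] [ContinuousSMul ℝ F]
variable {G : Type u} [AddCommGroup G] [Module ℝ G] [TopologicalSpace G]
  [IsTopologicalAddGroup G] [ContinuousSMul ℝ G] [PolynormableSpace ℝ G]

theorem IsCk.clm_comp (L : F →L[ℝ] G) {n : ℕ} {U : Set E} (hU : IsOpen U) {f : E → F}
    (hf : IsCk n U f) : IsCk n U fun x => L (f x) :=
  (IsCk.clm L n univ).comp hU isOpen_univ hf (mapsTo_univ _ _)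

end

section

variable {E : Type w} [AddCommGroup E] [Module ℝ E] [TopologicalSpace E]
  [IsTopologicalAddGroup E] [ContinuousSMul ℝ E]
variable {F : Type v} [AddCommGroup F] [Module ℝ F] [TopologicalSpace F]
  [IsTopologicalAddGroup F] [ContinuousSMul ℝ F] [PolynormableSpace ℝ F]

theorem IsCk.add {n : ℕ} {U : Set E} (hU : IsOpen U) {f g : E → F} (hf : IsCk n U f)
    (hg : IsCk n U g) : IsCk n U fun x => f x + g x :=
  (hf.pair hg).clm_comp (ContinuousLinearMap.fst ℝ F F + ContinuousLinearMap.snd ℝ F F) hU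

theorem IsCk.neg {n : ℕ} {U : Set E} (hU : IsOpen U) {f : E → F} (hf : IsCk n U f) :
    IsCk n U fun x => -f x :=
  hf.clm_comp (-ContinuousLinearMap.id ℝ F) hU

theorem IsCk.bilin {X : Type u} [AddCommGroup X] [Module ℝ X] [TopologicalSpace X]
    [IsTopologicalAddGroup X] [ContinuousSMul ℝ X]
    {Y : Type w} [AddCommGroup Y] [Module ℝ Y] [TopologicalSpace Y]
    [IsTopologicalAddGroup Y] [ContinuousSMul ℝ Y]
    (β : X →ₗ[ℝ] Y →ₗ[ℝ] F) (hβ : Continuous fun z : X × Y => β z.1 z.2) (n : ℕ) :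
    IsCk n univ fun z : X × Y => β z.1 z.2 := by
  induction n with
  | zero => exact hβ.continuousOn
  | succ n ih =>
    refine ⟨hβ.continuousOn, fun q => β q.1.1 q.2.2 + β q.2.1 q.1.2, fun x _ h => ?_, ?_⟩
    · have h1 : Tendsto (fun t : ℝ => β x.1 h.2 + β h.1 x.2 + t • β h.1 h.2) (𝓝[≠] 0)
          (𝓝 (β x.1 h.2 + β h.1 x.2 + (0 : ℝ) • β h.1 h.2)) :=
        (Continuous.tendsto (by fun_prop) 0).mono_left nhdsWithin_le_nhds
      rw [zero_smul, add_zero] at h1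
      refine h1.congr' ?_
      filter_upwards [self_mem_nhdsWithin] with t ht
      have : β (x + t • h).1 (x + t • h).2 - β x.1 x.2 =
          t • (β x.1 h.2 + β h.1 x.2 + t • β h.1 h.2) := by
        simp only [Prod.fst_add, Prod.snd_add, Prod.smul_fst, Prod.smul_snd, map_add, map_smul,
          LinearMap.add_apply, LinearMap.smul_apply, smul_add]
        abel
      rw [this, smul_smul, inv_mul_cancel₀ ht, one_smul]
    · refine IsCk.add (isOpen_univ.prod isOpen_univ) ?_ ?_
      · refine ih.comp (f := fun q : (X × Y) × (X × Y) => (q.1.1, q.2.2))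
          (isOpen_univ.prod isOpen_univ) isOpen_univ ?_ (mapsTo_univ _ _)
        exact IsCk.clm (((ContinuousLinearMap.fst ℝ X Y).comp (ContinuousLinearMap.fst ℝ _ _)).prod
          ((ContinuousLinearMap.snd ℝ X Y).comp (ContinuousLinearMap.snd ℝ _ _))) n _
      · refine ih.comp (f := fun q : (X × Y) × (X × Y) => (q.2.1, q.1.2))
          (isOpen_univ.prod isOpen_univ) isOpen_univ ?_ (mapsTo_univ _ _)
        exact IsCk.clm (((ContinuousLinearMap.fst ℝ X Y).comp (ContinuousLinearMap.snd ℝ _ _)).prod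
          ((ContinuousLinearMap.snd ℝ X Y).comp (ContinuousLinearMap.fst ℝ _ _))) n _

theorem IsCk.bilin_comp {X : Type u} [AddCommGroup X] [Module ℝ X] [TopologicalSpace X]
    [IsTopologicalAddGroup X] [ContinuousSMul ℝ X]
    {Y : Type*} [AddCommGroup Y] [Module ℝ Y] [TopologicalSpace Y]
    [IsTopologicalAddGroup Y] [ContinuousSMul ℝ Y]
    (β : X →ₗ[ℝ] Y →ₗ[ℝ] F) (hβ : Continuous fun z : X × Y => β z.1 z.2) {n : ℕ}
    {U : Set E} (hU : IsOpen U) {f : E → X} {g : E → Y} (hf : IsCk n U f) (hg : IsCk n U g) :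
    IsCk n U fun x => β (f x) (g x) :=
  (IsCk.bilin β hβ n).comp hU isOpen_univ (hf.pair hg) (mapsTo_univ _ _)

theorem IsCk.smul {n : ℕ} {U : Set E} (hU : IsOpen U) {c : E → ℝ} {f : E → F}
    (hc : IsCk n U c) (hf : IsCk n U f) : IsCk n U fun x => c x • f x :=
  IsCk.bilin_comp (LinearMap.lsmul ℝ F) (by simpa using continuous_smul) hU hc hf

theorem IsCk.of_contDiff {φ : ℝ → ℝ} (hφ : ContDiff ℝ (⊤ : ℕ∞) φ) (n : ℕ) :
    IsCk n univ φ := by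
  induction n generalizing φ with
  | zero => exact hφ.continuous.continuousOn
  | succ n ih =>
    refine ⟨hφ.continuous.continuousOn, fun z => z.2 • deriv φ z.1, fun x _ h => ?_, ?_⟩
    · have hd : HasDerivAt φ (deriv φ x) x := (hφ.differentiable (by simp) x).hasDerivAt
      have hd0 : HasDerivAt (fun t : ℝ => x + t • h) h 0 := by
        simpa using ((hasDerivAt_id (0 : ℝ)).mul_const h).const_add x
      have h2 := HasDerivAt.comp (0 : ℝ) (h₂ := φ) (h := fun t : ℝ => x + t • h)
        (by rw [zero_smul, add_zero]; exact hd) hd0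
      rw [hasDerivAt_iff_tendsto_slope_zero] at h2
      simpa [mul_comm] using h2
    · have hd : ContDiff ℝ (⊤ : ℕ∞) (deriv φ) := by
        have : ContDiff ℝ ((⊤ : ℕ∞) + 1) φ := by simpa using hφ
        exact (contDiff_succ_iff_deriv.1 this).2.2
      refine IsCk.smul (isOpen_univ.prod isOpen_univ)
        (IsCk.clm (ContinuousLinearMap.snd ℝ ℝ ℝ) n _)
        ((ih hd).comp (isOpen_univ.prod isOpen_univ) isOpen_univ
          (IsCk.clm (ContinuousLinearMap.fst ℝ ℝ ℝ) n _) (mapsTo_univ _ _))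

end

end Calculus

/-! ### The space of rapidly decreasing matrices -/

section Bilinear

theorem continuous_finset_sup {X ι : Type*} [AddCommGroup X] [Module ℝ X] [TopologicalSpace X]
    {p : ι → Seminorm ℝ X} (s : Finset ι) (h : ∀ i ∈ s, Continuous (p i)) :
    Continuous (s.sup p : Seminorm ℝ X) := by
  classical
  induction s using Finset.induction_on with
  | empty => rw [Finset.sup_empty, Seminorm.coe_bot]; exact continuous_const
  | insert i s hi ih =>
    rw [Finset.sup_insert, Seminorm.coe_sup]
    exact (h i (Finset.mem_insert_self i s)).sup
      (ih fun j hj => h j (Finset.mem_insert_of_mem hj))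

theorem continuous_linear_of_seminorm {X F : Type*} [AddCommGroup X] [Module ℝ X]
    [TopologicalSpace X] [IsTopologicalAddGroup X]
    [AddCommGroup F] [Module ℝ F] [TopologicalSpace F] {ι : Type*}
    {q : SeminormFamily ℝ F ι} (hq : WithSeminorms q) (f : X →ₗ[ℝ] F)
    (h : ∀ i, ∃ p : Seminorm ℝ X, Continuous p ∧ ∀ x, q i (f x) ≤ p x) : Continuous f := by
  have := hq.topologicalAddGroup
  refine continuous_of_continuousAt_zero f ?_
  unfold ContinuousAt
  rw [map_zero, hq.tendsto_nhds]
  intro i ε hε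
  obtain ⟨p, hp, hle⟩ := h i
  have h0 : Tendsto p (𝓝 0) (𝓝 0) := by simpa using hp.tendsto 0
  filter_upwards [h0.eventually (gt_mem_nhds hε)] with x hx
  rw [sub_zero]
  exact (hle x).trans_lt hx

theorem continuous_bilin_of_seminorm {X Y F : Type*} [AddCommGroup X] [Module ℝ X]
    [TopologicalSpace X] [IsTopologicalAddGroup X] [AddCommGroup Y] [Module ℝ Y]
    [TopologicalSpace Y] [IsTopologicalAddGroup Y] [AddCommGroup F] [Module ℝ F]
    [TopologicalSpace F] {ι : Type*} {q : SeminormFamily ℝ F ι} (hq : WithSeminorms q)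
    (β : X →ₗ[ℝ] Y →ₗ[ℝ] F)
    (h : ∀ i, ∃ (p : Seminorm ℝ X) (r : Seminorm ℝ Y), Continuous p ∧ Continuous r ∧
      ∀ x y, q i (β x y) ≤ p x * r y) : Continuous fun z : X × Y => β z.1 z.2 := by
  rw [continuous_iff_continuousAt]
  rintro ⟨x₀, y₀⟩
  unfold ContinuousAt
  rw [hq.tendsto_nhds]
  intro i ε hε
  obtain ⟨p, r, hp, hr, hle⟩ := h i
  have h1 : Tendsto (fun z : X × Y => p (z.1 - x₀) * r (z.2 - y₀) + p (z.1 - x₀) * r y₀ +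
      p x₀ * r (z.2 - y₀)) (𝓝 (x₀, y₀)) (𝓝 0) := by
    have : Continuous (fun z : X × Y => p (z.1 - x₀) * r (z.2 - y₀) + p (z.1 - x₀) * r y₀ +
      p x₀ * r (z.2 - y₀)) := by fun_prop
    simpa using this.tendsto (x₀, y₀)
  filter_upwards [h1.eventually (gt_mem_nhds hε)] with z hz
  have h2 : β z.1 z.2 - β x₀ y₀ = β (z.1 - x₀) (z.2 - y₀) + β (z.1 - x₀) y₀ +
      β x₀ (z.2 - y₀) := by
    simp only [map_sub, LinearMap.sub_apply]; abel
  refine lt_of_le_of_lt ?_ hz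
  simp only [h2]
  refine (map_add_le_add _ _ _).trans (add_le_add ((map_add_le_add _ _ _).trans
    (add_le_add (hle _ _) (hle _ _))) (hle _ _))

end Bilinear

section Rapid

variable {Ω : Type v} [GrowthIndex Ω] {A : Type u} [AddCommGroup A] [Module ℝ A]
  [TopologicalSpace A]

/-- The growth weight `1 + |x|` of an index. -/
def wt (x : Ω) : ℝ := 1 + (GrowthIndex.size x : ℝ)

theorem one_le_wt (x : Ω) : 1 ≤ wt x := by unfold wt; simp

theorem wt_pos (x : Ω) : 0 < wt x := zero_lt_one.trans_le (one_le_wt x)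

theorem weight_eq (N : ℕ) (i j : Ω) : weight N i j = wt i ^ N * wt j ^ N := rfl

theorem weight_pos (N : ℕ) (i j : Ω) : 0 < weight N i j := by
  rw [weight_eq]; have := wt_pos i; have := wt_pos j; positivity

theorem one_le_wt_pow (x : Ω) (N : ℕ) : 1 ≤ wt x ^ N := one_le_pow₀ (one_le_wt x)

theorem weight_mono {N M : ℕ} (h : N ≤ M) (i j : Ω) : weight N i j ≤ weight M i j := by
  rw [weight_eq, weight_eq]
  have := wt_pos i; have := wt_pos j
  exact mul_le_mul (pow_le_pow_right₀ (one_le_wt i) h) (pow_le_pow_right₀ (one_le_wt j) h)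
    (by positivity) (by positivity)

@[ext]
theorem RapidMatrix.ext {k l : RapidMatrix Ω A} (h : ∀ i j, k.toMatrix i j = l.toMatrix i j) :
    k = l := Subtype.ext (Matrix.ext h)

@[simp] theorem RapidMatrix.toMatrix_add (k l : RapidMatrix Ω A) (i j : Ω) :
    (k + l).toMatrix i j = k.toMatrix i j + l.toMatrix i j := rfl

@[simp] theorem RapidMatrix.toMatrix_sub (k l : RapidMatrix Ω A) (i j : Ω) :
    (k - l).toMatrix i j = k.toMatrix i j - l.toMatrix i j := rfl

@[simp] theorem RapidMatrix.toMatrix_neg (k : RapidMatrix Ω A) (i j : Ω) :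
    (-k).toMatrix i j = -k.toMatrix i j := rfl

@[simp] theorem RapidMatrix.toMatrix_zero (i j : Ω) : (0 : RapidMatrix Ω A).toMatrix i j = 0 := rfl

@[simp] theorem RapidMatrix.toMatrix_smul (c : ℝ) (k : RapidMatrix Ω A) (i j : Ω) :
    (c • k).toMatrix i j = c • k.toMatrix i j := rfl

theorem le_rapidSeminorm (p : {p : Seminorm ℝ A // Continuous p}) (N : ℕ) (k : RapidMatrix Ω A)
    (i j : Ω) : weight N i j * p.1 (k.toMatrix i j) ≤ rapidSeminorm p N k :=
  le_ciSup (k.bddAbove p.2 N) (i, j)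

theorem rapidSeminorm_le (p : {p : Seminorm ℝ A // Continuous p}) (N : ℕ) (k : RapidMatrix Ω A)
    {C : ℝ} (hC : 0 ≤ C) (h : ∀ i j, weight N i j * p.1 (k.toMatrix i j) ≤ C) :
    rapidSeminorm p N k ≤ C :=
  Real.iSup_le (fun x => h x.1 x.2) hC

theorem rapidSeminorm_mono {p q : {p : Seminorm ℝ A // Continuous p}} (hpq : p.1 ≤ q.1) {N M : ℕ}
    (hNM : N ≤ M) (k : RapidMatrix Ω A) : rapidSeminorm p N k ≤ rapidSeminorm q M k :=
  rapidSeminorm_le p N k (apply_nonneg _ _) fun i j =>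
    (mul_le_mul (weight_mono hNM i j) (hpq _) (apply_nonneg _ _) (weight_nonneg _ _ _)).trans
      (le_rapidSeminorm q M k i j)

variable (Ω A) in
theorem rapid_withSeminorms : WithSeminorms
    (fun i : {p : Seminorm ℝ A // Continuous p} × ℕ =>
      rapidSeminorm (Ω := Ω) (A := A) i.1 i.2) := ⟨rfl⟩

instance : IsTopologicalAddGroup (RapidMatrix Ω A) := (rapid_withSeminorms Ω A).topologicalAddGroup
instance : ContinuousSMul ℝ (RapidMatrix Ω A) := (rapid_withSeminorms Ω A).continuousSMul
instance : LocallyConvexSpace ℝ (RapidMatrix Ω A) := (rapid_withSeminorms Ω A).toLocallyConvexSpace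

theorem continuous_rapidSeminorm (p : {p : Seminorm ℝ A // Continuous p}) (N : ℕ) :
    Continuous (rapidSeminorm (Ω := Ω) p N) :=
  (rapid_withSeminorms Ω A).continuous_seminorm (p, N)

/-- Every continuous seminorm is dominated by a multiple of a defining seminorm. -/
theorem exists_le_rapidSeminorm (P : Seminorm ℝ (RapidMatrix Ω A)) (hP : Continuous P) :
    ∃ (p : {p : Seminorm ℝ A // Continuous p}) (N : ℕ) (C : ℝ), 0 ≤ C ∧
      ∀ k, P k ≤ C * rapidSeminorm p N k := by
  obtain ⟨s, C, _, hle⟩ := Seminorm.bound_of_continuous (rapid_withSeminorms Ω A) P hP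
  refine ⟨⟨s.sup fun i => i.1.1, ?_⟩, s.sup fun i => i.2, C, C.2, fun k => ?_⟩
  · exact continuous_finset_sup s fun i _ => i.1.2
  · refine (hle k).trans ?_
    rw [_root_.smul_apply, NNReal.smul_def, smul_eq_mul]
    refine mul_le_mul_of_nonneg_left ?_ C.2
    refine Seminorm.finset_sup_apply_le (apply_nonneg _ _) fun i hi => ?_
    exact rapidSeminorm_mono (Finset.le_sup (f := fun i : {p : Seminorm ℝ A // Continuous p} × ℕ =>
      i.1.1) hi) (Finset.le_sup (f := fun i : {p : Seminorm ℝ A // Continuous p} × ℕ => i.2) hi) k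

theorem seminorm_separating [PolynormableSpace ℝ A] [T2Space A] {a : A}
    (h : ∀ p : Seminorm ℝ A, Continuous p → p a = 0) : a = 0 := by
  have h1 : Tendsto (fun _ : ℕ => a) atTop (𝓝 0) := by
    rw [tendsto_iff_seminorm]
    intro p hp ε hε
    filter_upwards with _
    rwa [sub_zero, h p hp]
  exact tendsto_nhds_unique tendsto_const_nhds h1

instance [PolynormableSpace ℝ A] [T2Space A] : T2Space (RapidMatrix Ω A) := by
  have : T1Space (RapidMatrix Ω A) := by
    refine (rapid_withSeminorms Ω A).T1_of_separating fun k hk => ?_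
    by_contra! hcon
    refine hk (RapidMatrix.ext fun i j => ?_)
    refine seminorm_separating fun p hp => ?_
    have h1 := le_rapidSeminorm ⟨p, hp⟩ 0 k i j
    rw [hcon (⟨p, hp⟩, 0)] at h1
    simp only [weight_eq, pow_zero, one_mul] at h1
    exact le_antisymm h1 (apply_nonneg p _)
  infer_instance

/-- A sequence is Cauchy if it is so for every continuous seminorm. -/
theorem SeqComplete.exists_tendsto [PolynormableSpace ℝ A] (hA : SeqComplete A) (s : ℕ → A)
    (hs : ∀ p : Seminorm ℝ A, Continuous p → ∀ ε > 0, ∃ N, ∀ m ≥ N, ∀ n ≥ N, p (s m - s n) < ε) :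
    ∃ a, Tendsto s atTop (𝓝 a) := by
  refine hA s fun V hV => ?_
  obtain ⟨t, r, hr, hV'⟩ := ((PolynormableSpace.withSeminorms ℝ A).mem_nhds_iff 0 V).1 hV
  obtain ⟨N, hN⟩ := hs (t.sup fun i => i.1) (continuous_finset_sup t fun i _ => i.2) r hr
  refine ⟨N, fun m hm n hn => hV' ?_⟩
  rw [Seminorm.mem_ball, sub_zero]
  exact hN m hm n hn

theorem SeqComplete.cauchy {B : Type*} [AddCommGroup B] [Module ℝ B] [TopologicalSpace B]
    {s : ℕ → B}
    (hs : ∀ V ∈ 𝓝 (0 : B), ∃ N, ∀ m ≥ N, ∀ n ≥ N, s m - s n ∈ V) (p : Seminorm ℝ B)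
    (hp : Continuous p) (ε : ℝ) (hε : 0 < ε) : ∃ N, ∀ m ≥ N, ∀ n ≥ N, p (s m - s n) < ε := by
  have h0 : Tendsto p (𝓝 0) (𝓝 0) := by simpa using hp.tendsto 0
  exact hs _ (h0.eventually (gt_mem_nhds hε))

theorem SeqComplete.rapidMatrix [PolynormableSpace ℝ A] [IsTopologicalAddGroup A]
    (hA : SeqComplete A) : SeqComplete (RapidMatrix Ω A) := by
  intro s hs
  have hs' := fun (p : {p : Seminorm ℝ A // Continuous p}) (N : ℕ) (ε : ℝ) (hε : 0 < ε) =>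
    SeqComplete.cauchy hs (rapidSeminorm p N) (continuous_rapidSeminorm p N) ε hε
  have hent : ∀ (p : {p : Seminorm ℝ A // Continuous p}) (N : ℕ) (k l : RapidMatrix Ω A) (ε : ℝ),
      rapidSeminorm p N (k - l) < ε → ∀ i j, weight N i j * p.1 (k.toMatrix i j - l.toMatrix i j)
        < ε := fun p N k l ε h i j => (le_rapidSeminorm p N (k - l) i j).trans_lt h
  have hlim : ∀ i j, ∃ a, Tendsto (fun n => (s n).toMatrix i j) atTop (𝓝 a) := by
    intro i j
    refine hA.exists_tendsto _ fun p hp ε hε => ?_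
    obtain ⟨N, hN⟩ := hs' ⟨p, hp⟩ 0 ε hε
    refine ⟨N, fun m hm n hn => ?_⟩
    simpa [weight_eq] using hent _ _ _ _ _ (hN m hm n hn) i j
  choose a ha using hlim
  have hunif : ∀ (p : {p : Seminorm ℝ A // Continuous p}) (N : ℕ) (ε : ℝ), 0 < ε → ∃ M, ∀ m ≥ M,
      ∀ i j, weight N i j * p.1 ((s m).toMatrix i j - a i j) ≤ ε := by
    intro p N ε hε
    obtain ⟨M, hM⟩ := hs' p N ε hε
    refine ⟨M, fun m hm i j => ?_⟩
    have h1 : Tendsto (fun n => weight N i j * p.1 ((s m).toMatrix i j - (s n).toMatrix i j)) atTop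
        (𝓝 (weight N i j * p.1 ((s m).toMatrix i j - a i j))) :=
      ((p.2.tendsto _).comp ((ha i j).const_sub _)).const_mul _
    refine le_of_tendsto h1 ?_
    filter_upwards [eventually_ge_atTop M] with n hn
    exact (hent _ _ _ _ _ (hM m hm n hn) i j).le
  have hmem : Matrix.of a ∈ rapidSubmodule Ω A := by
    intro p hp N
    obtain ⟨M, hM⟩ := hunif ⟨p, hp⟩ N 1 one_pos
    refine ⟨rapidSeminorm ⟨p, hp⟩ N (s M) + 1, fun i j => ?_⟩
    have h1 := hM M le_rfl i j
    have h2 := le_rapidSeminorm ⟨p, hp⟩ N (s M) i j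
    have h3 : p (a i j) ≤ p ((s M).toMatrix i j) + p ((s M).toMatrix i j - a i j) := by
      have := map_sub_le_add p ((s M).toMatrix i j) ((s M).toMatrix i j - a i j)
      rwa [sub_sub_cancel] at this
    have h4 := mul_le_mul_of_nonneg_left h3 (weight_nonneg N i j)
    rw [mul_add] at h4
    exact h4.trans (add_le_add h2 h1)
  let a' : RapidMatrix Ω A := ⟨Matrix.of a, hmem⟩
  refine ⟨a', ?_⟩
  rw [(rapid_withSeminorms Ω A).tendsto_nhds]
  rintro ⟨p, N⟩ ε hε
  obtain ⟨M, hM⟩ := hunif p N (ε / 2) (half_pos hε)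
  filter_upwards [eventually_ge_atTop M] with m hm
  exact (rapidSeminorm_le p N (s m - a') (half_pos hε).le fun i j => hM m hm i j).trans_lt (half_lt_self hε)

end Rapid

/-! ### Submultiplicative seminorms -/

/-- The topology is given by submultiplicative seminorms. -/
def MConvex (B : Type*) [NonUnitalRing B] [Module ℝ B] [TopologicalSpace B] : Prop :=
  ∀ p : Seminorm ℝ B, Continuous p → ∃ q : Seminorm ℝ B, Continuous q ∧
    (∀ x y, q (x * y) ≤ q x * q y) ∧ p ≤ q

theorem IsStrong.mconvex {A : Type*} [NonUnitalCommRing A] [Module ℝ A] [IsScalarTower ℝ A A]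
    [SMulCommClass ℝ A A] [TopologicalSpace A] (hA : IsStrong A) [IsTopologicalAddGroup A]
    [ContinuousSMul ℝ A] : MConvex A := by
  intro p hp
  obtain ⟨q, hq, hpq⟩ := hA p hp
  let S : Set A := {x | ∃ a l, q a < 1 ∧ (∀ b ∈ l, q b < 1) ∧ x = List.foldl (· * ·) a l}
  have hfold : ∀ (l : List A) (a b : A), List.foldl (· * ·) (a * b) l =
      a * List.foldl (· * ·) b l := by
    intro l
    induction l with
    | nil => intro a b; rfl
    | cons c l ih => intro a b; simp only [List.foldl_cons, mul_assoc, ih]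
  have hSmul : ∀ x ∈ S, ∀ y ∈ S, x * y ∈ S := by
    rintro _ ⟨a, l, ha, hl, rfl⟩ _ ⟨b, l', hb, hl', rfl⟩
    refine ⟨a, l ++ b :: l', ha, ?_, ?_⟩
    · simp only [List.mem_append, List.mem_cons]
      rintro c (hc | rfl | hc)
      exacts [hl c hc, hb, hl' c hc]
    · rw [List.foldl_append, List.foldl_cons, hfold]
  have hUS : q.ball 0 1 ⊆ S := fun x hx => ⟨x, [], by simpa using hx, by simp, rfl⟩
  have hSp : ∀ x ∈ S, p x ≤ 1 := by
    rintro _ ⟨a, l, ha, hl, rfl⟩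
    refine (hpq a l).trans ?_
    have : ∀ l : List A, (∀ b ∈ l, q b < 1) → 0 ≤ (l.map q).prod ∧ (l.map q).prod ≤ 1 := by
      intro l
      induction l with
      | nil => simp
      | cons c l ih =>
        intro h
        have h1 := ih fun b hb => h b (List.mem_cons_of_mem _ hb)
        have h2 := h c List.mem_cons_self
        simp only [List.map_cons, List.prod_cons]
        exact ⟨mul_nonneg (apply_nonneg _ _) h1.1, mul_le_one₀ h2.le h1.1 h1.2⟩
    exact mul_le_one₀ ha.le (this l hl).1 (this l hl).2
  have hSbal : ∀ c : ℝ, |c| ≤ 1 → ∀ x ∈ S, c • x ∈ S := by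
    rintro c hc _ ⟨a, l, ha, hl, rfl⟩
    refine ⟨c • a, l, ?_, hl, ?_⟩
    · rw [map_smul_eq_mul]
      exact (mul_le_of_le_one_left (apply_nonneg _ _) hc).trans_lt ha
    · clear ha hl
      induction l generalizing a with
      | nil => rfl
      | cons b l ih => simp only [List.foldl_cons, ih, smul_mul_assoc]
  let B : Set A := convexHull ℝ S
  have hBmul : ∀ x ∈ B, ∀ y ∈ B, x * y ∈ B := by
    have h1 : ∀ y ∈ S, ∀ x ∈ B, x * y ∈ B := by
      intro y hy x hx
      have : B ⊆ (LinearMap.mulRight ℝ y) ⁻¹' B :=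
        convexHull_min (fun z hz => subset_convexHull ℝ S (hSmul z hz y hy))
          ((convex_convexHull ℝ S).linear_preimage _)
      exact this hx
    intro x hx y hy
    have : B ⊆ (LinearMap.mulLeft ℝ x) ⁻¹' B :=
      convexHull_min (fun z hz => h1 z hz x hx) ((convex_convexHull ℝ S).linear_preimage _)
    exact this hy
  have hBbal : Balanced ℝ B := by
    refine Balanced.convexHull ?_
    rw [balanced_iff_smul_mem]
    exact fun c hc x hx => hSbal c hc x hx
  have hUB : q.ball 0 1 ⊆ B := hUS.trans (subset_convexHull ℝ S)
  have hBabs : Absorbent ℝ B := (q.absorbent_ball_zero one_pos).mono hUB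
  have hBp : ∀ x ∈ B, p x ≤ 1 := by
    have : B ⊆ p.closedBall 0 1 :=
      convexHull_min (fun x hx => by simpa using hSp x hx) (p.convex_closedBall 0 1)
    exact fun x hx => by simpa using this hx
  let m := gaugeSeminorm hBbal (convex_convexHull ℝ S) hBabs
  have hm : ∀ x, m x = gauge B x := fun x => rfl
  refine ⟨m, ?_, fun x y => ?_, fun x => ?_⟩
  · refine Seminorm.continuous_of_le hq fun x => ?_
    rw [hm, ← q.gauge_ball]
    exact gauge_mono (q.absorbent_ball_zero one_pos) hUB x
  · rw [hm, hm, hm]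
    refine le_of_forall_pos_le_add fun ε hε => ?_
    have hcont : Tendsto (fun δ : ℝ => (gauge B x + δ) * (gauge B y + δ)) (𝓝[>] 0)
        (𝓝 ((gauge B x + 0) * (gauge B y + 0))) :=
      (Continuous.tendsto (by fun_prop) 0).mono_left nhdsWithin_le_nhds
    rw [add_zero, add_zero] at hcont
    obtain ⟨δ, hδ, hδ0⟩ := ((hcont.eventually (gt_mem_nhds (lt_add_of_pos_right _ hε))).and
      self_mem_nhdsWithin).exists
    refine le_trans ?_ hδ.le
    obtain ⟨a, ha0, ha, u, hu, hux⟩ := exists_lt_of_gauge_lt hBabs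
      (lt_add_of_pos_right (gauge B x) hδ0)
    obtain ⟨b, hb0, hb, v, hv, hvy⟩ := exists_lt_of_gauge_lt hBabs
      (lt_add_of_pos_right (gauge B y) hδ0)
    have h3 : gauge B (x * y) ≤ a * b := by
      refine gauge_le_of_mem (mul_pos ha0 hb0).le ⟨u * v, hBmul u hu v hv, ?_⟩
      rw [← hux, ← hvy]
      simp only [smul_mul_smul_comm]
    exact h3.trans (mul_le_mul ha.le hb.le hb0.le (by
      have := gauge_nonneg (s := B) x; have : 0 < δ := hδ0; linarith))
  · rw [hm]
    refine le_of_forall_pos_le_add fun ε hε => ?_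
    obtain ⟨a, ha0, ha, u, hu, hux⟩ := exists_lt_of_gauge_lt hBabs
      (lt_add_of_pos_right (gauge B x) hε)
    rw [← hux, map_smul_eq_mul, Real.norm_eq_abs, abs_of_pos ha0]
    rw [← hux] at ha
    exact (mul_le_of_le_one_right ha0.le (hBp u hu)).trans ha.le

/-! ### The unital extension as a topological algebra -/

/-- The standing assumptions on the algebra of coefficients: sequential completeness, and local
multiplicative convexity. -/
class GoodAlg (A : Type*) [NonUnitalCommRing A] [Module ℝ A] [TopologicalSpace A] : Prop where
  complete : SeqComplete A
  mconvex : MConvex A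

section Coeff

variable {A : Type u} [NonUnitalCommRing A] [Module ℝ A] [TopologicalSpace A]

instance : TopologicalSpace (Unitization ℝ A) :=
  TopologicalSpace.induced Unitization.toProd inferInstance

theorem Unitization.continuous_toProd :
    Continuous (Unitization.toProd : Unitization ℝ A → ℝ × A) := continuous_induced_dom

theorem Unitization.continuous_fst : Continuous fun x : Unitization ℝ A => x.fst :=
  _root_.continuous_fst.comp Unitization.continuous_toProd

theorem Unitization.continuous_snd : Continuous fun x : Unitization ℝ A => x.snd :=
  _root_.continuous_snd.comp Unitization.continuous_toProd

theorem Unitization.continuous_rng {X : Type*} [TopologicalSpace X] {f : X → Unitization ℝ A}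
    (h1 : Continuous fun x => (f x).fst) (h2 : Continuous fun x => (f x).snd) : Continuous f :=
  continuous_induced_rng.2 (h1.prodMk h2)

instance [T2Space A] : T2Space (Unitization ℝ A) :=
  T2Space.of_injective_continuous Unitization.toProd_injective Unitization.continuous_toProd

instance [IsTopologicalRing A] [ContinuousSMul ℝ A] :
    IsTopologicalRing (Unitization ℝ A) where
  continuous_add := by
    have h1 : Continuous fun x : Unitization ℝ A × Unitization ℝ A => x.1.fst :=
      Unitization.continuous_fst.comp _root_.continuous_fst
    have h2 : Continuous fun x : Unitization ℝ A × Unitization ℝ A => x.2.fst :=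
      Unitization.continuous_fst.comp _root_.continuous_snd
    have h3 : Continuous fun x : Unitization ℝ A × Unitization ℝ A => x.1.snd :=
      Unitization.continuous_snd.comp _root_.continuous_fst
    have h4 : Continuous fun x : Unitization ℝ A × Unitization ℝ A => x.2.snd :=
      Unitization.continuous_snd.comp _root_.continuous_snd
    exact Unitization.continuous_rng (h1.add h2) (h3.add h4)
  continuous_mul := by
    have h1 : Continuous fun x : Unitization ℝ A × Unitization ℝ A => x.1.fst :=
      Unitization.continuous_fst.comp _root_.continuous_fst
    have h2 : Continuous fun x : Unitization ℝ A × Unitization ℝ A => x.2.fst :=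
      Unitization.continuous_fst.comp _root_.continuous_snd
    have h3 : Continuous fun x : Unitization ℝ A × Unitization ℝ A => x.1.snd :=
      Unitization.continuous_snd.comp _root_.continuous_fst
    have h4 : Continuous fun x : Unitization ℝ A × Unitization ℝ A => x.2.snd :=
      Unitization.continuous_snd.comp _root_.continuous_snd
    exact Unitization.continuous_rng (h1.mul h2)
      (((h1.smul h4).add (h2.smul h3)).add (h3.mul h4))
  continuous_neg := Unitization.continuous_rng Unitization.continuous_fst.neg
    Unitization.continuous_snd.neg

/-- The extension of a seminorm to the unital extension. -/
def unitSeminorm (p : Seminorm ℝ A) : Seminorm ℝ (Unitization ℝ A) :=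
  Seminorm.of (fun x => |x.fst| + p x.snd)
    (fun x y => by
      simp only [Unitization.fst_add, Unitization.snd_add]
      linarith [abs_add_le x.fst y.fst, map_add_le_add p x.snd y.snd])
    (fun c x => by
      simp only [Unitization.fst_smul, Unitization.snd_smul, smul_eq_mul, abs_mul,
        map_smul_eq_mul, Real.norm_eq_abs]
      ring)

theorem unitSeminorm_apply (p : Seminorm ℝ A) (x : Unitization ℝ A) :
    unitSeminorm p x = |x.fst| + p x.snd := rfl

@[simp] theorem unitSeminorm_inr (p : Seminorm ℝ A) (a : A) :
    unitSeminorm p (a : Unitization ℝ A) = p a := by simp [unitSeminorm_apply]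

@[simp] theorem unitSeminorm_inl (p : Seminorm ℝ A) (c : ℝ) :
    unitSeminorm p (Unitization.inl c) = |c| := by simp [unitSeminorm_apply]

theorem snd_le_unitSeminorm (p : Seminorm ℝ A) (x : Unitization ℝ A) :
    p x.snd ≤ unitSeminorm p x := by
  rw [unitSeminorm_apply]; linarith [abs_nonneg x.fst]

theorem fst_le_unitSeminorm (p : Seminorm ℝ A) (x : Unitization ℝ A) :
    |x.fst| ≤ unitSeminorm p x := by
  rw [unitSeminorm_apply]; linarith [apply_nonneg p x.snd]

theorem unitSeminorm_mono {p q : Seminorm ℝ A} (h : p ≤ q) (x : Unitization ℝ A) :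
    unitSeminorm p x ≤ unitSeminorm q x := by
  rw [unitSeminorm_apply, unitSeminorm_apply]; linarith [h x.snd]

theorem unitSeminorm_mul_le {p : Seminorm ℝ A} (hp : ∀ x y, p (x * y) ≤ p x * p y)
    (x y : Unitization ℝ A) : unitSeminorm p (x * y) ≤ unitSeminorm p x * unitSeminorm p y := by
  simp only [unitSeminorm_apply, Unitization.fst_mul, Unitization.snd_mul, abs_mul]
  have h1 : p (x.fst • y.snd + y.fst • x.snd + x.snd * y.snd) ≤
      |x.fst| * p y.snd + |y.fst| * p x.snd + p x.snd * p y.snd := by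
    refine (map_add_le_add p _ _).trans (add_le_add ((map_add_le_add p _ _).trans ?_) (hp _ _))
    rw [map_smul_eq_mul, map_smul_eq_mul, Real.norm_eq_abs, Real.norm_eq_abs]
  linarith

theorem continuous_unitSeminorm {p : Seminorm ℝ A} (hp : Continuous p) :
    Continuous (unitSeminorm p) :=
  Unitization.continuous_fst.abs.add (hp.comp Unitization.continuous_snd)

theorem Unitization.hasSum {ι : Type*} {f : ι → Unitization ℝ A} {s : Unitization ℝ A}
    (h1 : HasSum (fun i => (f i).fst) s.fst) (h2 : HasSum (fun i => (f i).snd) s.snd) :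
    HasSum f s := by
  have h3 : ∀ F : Finset ι, (∑ i ∈ F, f i).toProd = (∑ i ∈ F, (f i).fst, ∑ i ∈ F, (f i).snd) := by
    intro F
    have := map_sum (Unitization.linearEquiv ℝ ℝ A) f F
    refine this.trans (Prod.ext ?_ ?_)
    · rw [Prod.fst_sum]; rfl
    · rw [Prod.snd_sum]; rfl
  have h4 : Tendsto (fun F : Finset ι => (∑ i ∈ F, f i).toProd) atTop (𝓝 s.toProd) := by
    simp only [h3]
    exact Tendsto.prodMk_nhds h1 h2
  rw [HasSum, SummationFilter.unconditional_filter, nhds_induced, tendsto_comap_iff]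
  exact h4

end Coeff

section Summation

theorem seminorm_sum_le {B ι : Type*} [AddCommGroup B] [Module ℝ B] (p : Seminorm ℝ B) (f : ι → B)
    (F : Finset ι) : p (∑ i ∈ F, f i) ≤ ∑ i ∈ F, p (f i) :=
  Finset.le_sum_of_subadditive p (map_zero p).le (map_add_le_add p) F f

theorem summable_of_seminorm {A : Type*} [AddCommGroup A] [Module ℝ A] [TopologicalSpace A]
    [PolynormableSpace ℝ A] (hA : SeqComplete A)
    {ι : Type*} [Countable ι] (f : ι → A)
    (hf : ∀ p : Seminorm ℝ A, Continuous p → Summable fun i => p (f i)) : Summable f := by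
  obtain ⟨e, he⟩ := exists_injective_nat ι
  let g : ℕ → A := Function.extend e f 0
  have hg : ∀ p : Seminorm ℝ A, Continuous p → Summable fun n => p (g n) := by
    intro p hp
    have h1 : (fun n => p (g n)) ∘ e = fun i => p (f i) := by
      funext i; simp [g, he.extend_apply]
    refine (he.summable_iff (f := fun n => p (g n)) fun n hn => ?_).1 (h1 ▸ hf p hp)
    have : g n = 0 := Function.extend_apply' _ _ _ (by simpa using hn)
    simp [this]
  have hsum : ∀ (p : Seminorm ℝ A) (F : Finset ℕ), p (∑ n ∈ F, g n) ≤ ∑ n ∈ F, p (g n) :=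
    fun p F => seminorm_sum_le p g F
  have htail : ∀ (p : Seminorm ℝ A), Continuous p → ∀ ε > 0, ∃ N, ∀ F : Finset ℕ,
      (∀ n ∈ F, N ≤ n) → p (∑ n ∈ F, g n) < ε := by
    intro p hp ε hε
    obtain ⟨s, hs⟩ := summable_iff_vanishing_norm.1 (hg p hp) ε hε
    refine ⟨s.sup id + 1, fun F hF => (hsum p F).trans_lt ?_⟩
    refine (le_abs_self _).trans_lt (hs F ?_)
    rw [Finset.disjoint_left]
    intro n hn hns
    have := Finset.le_sup (f := id) hns
    have := hF n hn
    simp only [id] at *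
    omega
  obtain ⟨a, ha⟩ := hA.exists_tendsto (fun N => ∑ n ∈ Finset.range N, g n) (by
    intro p hp ε hε
    obtain ⟨N, hN⟩ := htail p hp ε hε
    have key : ∀ m n, N ≤ n → n ≤ m →
        p (∑ k ∈ Finset.range m, g k - ∑ k ∈ Finset.range n, g k) < ε := by
      intro m n hn hnm
      rw [← Finset.sum_Ico_eq_sub _ hnm]
      exact hN _ fun k hk => hn.trans (Finset.mem_Ico.1 hk).1
    refine ⟨N, fun m hm n hn => ?_⟩
    rcases le_total n m with h | h
    · exact key m n hn h
    · rw [← map_neg_eq_map, neg_sub]; exact key n m hm h)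
  have hga : HasSum g a := by
    rw [HasSum, SummationFilter.unconditional_filter, tendsto_iff_seminorm]
    intro p hp ε hε
    obtain ⟨N, hN⟩ := htail p hp (ε / 2) (half_pos hε)
    have h1 := (tendsto_iff_seminorm.1 ha) p hp (ε / 2) (half_pos hε)
    obtain ⟨M, hM1, hM2⟩ := (h1.and (eventually_ge_atTop N)).exists
    filter_upwards [eventually_ge_atTop (Finset.range M)] with F hF
    have h2 := Finset.sum_sdiff hF (f := g)
    have h3 : ∑ n ∈ F, g n - a = ∑ n ∈ F \ Finset.range M, g n +
        (∑ n ∈ Finset.range M, g n - a) := by rw [← h2]; abel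
    rw [h3]
    have h4 := hN (F \ Finset.range M) fun n hn => by
      simp only [Finset.mem_sdiff, Finset.mem_range, not_lt] at hn
      exact hM2.trans hn.2
    linarith [map_add_le_add p (∑ n ∈ F \ Finset.range M, g n) (∑ n ∈ Finset.range M, g n - a)]
  refine ⟨a, ?_⟩
  have h5 : f = g ∘ e := by funext i; simp [g, he.extend_apply]
  rw [h5]
  refine (he.hasSum_iff fun n hn => ?_).2 hga
  exact Function.extend_apply' _ _ _ (by simpa using hn)

theorem seminorm_tsum_le {B : Type*} [AddCommGroup B] [Module ℝ B] [TopologicalSpace B]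
    {ι : Type*} {f : ι → B} (p : Seminorm ℝ B) (hp : Continuous p) (hf : Summable f) {g : ι → ℝ}
    (hg : Summable g) (h : ∀ i, p (f i) ≤ g i) : p (∑' i, f i) ≤ ∑' i, g i := by
  refine le_of_tendsto ((hp.tendsto _).comp hf.hasSum) ?_
  filter_upwards with F
  refine (seminorm_sum_le p f F).trans ((Finset.sum_le_sum fun i _ => h i).trans ?_)
  exact hg.sum_le_tsum F fun i _ => (apply_nonneg p _).trans (h i)

variable {A : Type u} [NonUnitalCommRing A] [Module ℝ A] [TopologicalSpace A]

theorem Unitization.summable [PolynormableSpace ℝ A] [GoodAlg A] {ι : Type*} [Countable ι]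
    (f : ι → Unitization ℝ A)
    (hf : ∀ p : Seminorm ℝ A, Continuous p → Summable fun i => unitSeminorm p (f i)) :
    Summable f := by
  have h1 : Summable fun i => (f i).fst :=
    Summable.of_norm_bounded (hf 0 continuous_const) fun i => fst_le_unitSeminorm 0 (f i)
  have h2 : Summable fun i => (f i).snd :=
    summable_of_seminorm GoodAlg.complete _ fun p hp =>
      Summable.of_nonneg_of_le (fun i => apply_nonneg p _)
        (fun i => snd_le_unitSeminorm p (f i)) (hf p hp)
  exact ⟨Unitization.mk (∑' i, (f i).fst, ∑' i, (f i).snd),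
    Unitization.hasSum h1.hasSum h2.hasSum⟩

theorem Unitization.tsum_eq {ι : Type*} [T2Space A] {f : ι → Unitization ℝ A} (hf : Summable f) :
    ∑' i, f i = Unitization.inl (∑' i, (f i).fst) + Unitization.inr (∑' i, (f i).snd) := by
  obtain ⟨s, hs⟩ := hf
  have h1 : HasSum (fun i => (f i).fst) s.fst :=
    hs.map (AddMonoidHom.mk' (fun x : Unitization ℝ A => x.fst) fun _ _ => rfl) Unitization.continuous_fst
  have h2 : HasSum (fun i => (f i).snd) s.snd :=
    hs.map (AddMonoidHom.mk' (fun x : Unitization ℝ A => x.snd) fun _ _ => rfl) Unitization.continuous_snd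
  rw [hs.tsum_eq, h1.tsum_eq, h2.tsum_eq, Unitization.inl_fst_add_inr_snd_eq]

end Summation

/-! ### Polynomially bounded embeddings -/

/-- An injection which changes the sizes polynomially. -/
structure PolyEmb {Ω Ω' : Type*} [GrowthIndex Ω] [GrowthIndex Ω'] (j : Ω → Ω') : Prop where
  injective : Function.Injective j
  upper : ∃ (C : ℝ) (N : ℕ), 0 ≤ C ∧ ∀ x, wt (j x) ≤ C * wt x ^ N
  lower : ∃ (C : ℝ) (N : ℕ), 0 ≤ C ∧ ∀ x, wt x ≤ C * wt (j x) ^ N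

/-- The index set embeds into the natural numbers with polynomial change of sizes. -/
class PolyIdx (Ω : Type*) [GrowthIndex Ω] : Prop where
  exists_emb : ∃ e : Ω → ℕ, PolyEmb e

theorem PolyEmb.comp {Ω Ω' Ω'' : Type*} [GrowthIndex Ω] [GrowthIndex Ω'] [GrowthIndex Ω'']
    {j : Ω' → Ω''} {j' : Ω → Ω'} (hj : PolyEmb j) (hj' : PolyEmb j') : PolyEmb (j ∘ j') := by
  obtain ⟨C, N, hC, h⟩ := hj.upper
  obtain ⟨C', N', hC', h'⟩ := hj'.upper
  obtain ⟨D, M, hD, g⟩ := hj.lower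
  obtain ⟨D', M', hD', g'⟩ := hj'.lower
  refine ⟨hj.injective.comp hj'.injective, ⟨C * C' ^ N, N' * N, by positivity, fun x => ?_⟩,
    ⟨D' * D ^ M', M * M', by positivity, fun x => ?_⟩⟩
  · refine (h (j' x)).trans ?_
    rw [pow_mul, mul_assoc, ← mul_pow]
    exact mul_le_mul_of_nonneg_left (pow_le_pow_left₀ (wt_pos _).le (h' x) _) hC
  · refine (g' x).trans ?_
    rw [pow_mul, mul_assoc, ← mul_pow]
    exact mul_le_mul_of_nonneg_left (pow_le_pow_left₀ (wt_pos _).le (g (j' x)) _) hD'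

theorem PolyEmb.of_le {Ω Ω' : Type*} [GrowthIndex Ω] [GrowthIndex Ω'] {j : Ω → Ω'}
    (hj : Function.Injective j) (C N : ℕ)
    (h1 : ∀ x, 1 + GrowthIndex.size (j x) ≤ C * (1 + GrowthIndex.size x) ^ N)
    (h2 : ∀ x, 1 + GrowthIndex.size x ≤ C * (1 + GrowthIndex.size (j x)) ^ N) : PolyEmb j :=
  ⟨hj, ⟨C, N, by positivity, fun x => by unfold wt; exact_mod_cast h1 x⟩,
    ⟨C, N, by positivity, fun x => by unfold wt; exact_mod_cast h2 x⟩⟩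

theorem PolyEmb.of_size {Ω Ω' : Type*} [GrowthIndex Ω] [GrowthIndex Ω'] {j : Ω → Ω'}
    (hj : Function.Injective j) (h : ∀ x, GrowthIndex.size (j x) = GrowthIndex.size x) :
    PolyEmb j :=
  PolyEmb.of_le hj 1 1 (fun x => by simp [h]) (fun x => by simp [h])

theorem PolyEmb.id (Ω : Type*) [GrowthIndex Ω] : PolyEmb (id : Ω → Ω) :=
  PolyEmb.of_size Function.injective_id fun _ => rfl

@[simp] theorem size_prod {Ω Ξ : Type*} [GrowthIndex Ω] [GrowthIndex Ξ] (x : Ω × Ξ) :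
    GrowthIndex.size x = GrowthIndex.size x.1 + GrowthIndex.size x.2 := rfl

@[simp] theorem size_fin {n : ℕ} (i : Fin n) : GrowthIndex.size i = 0 := rfl

@[simp] theorem size_unit (i : Unit) : GrowthIndex.size i = 0 := rfl

@[simp] theorem size_nat (n : ℕ) : GrowthIndex.size n = n := rfl

theorem wt_prod_le {Ω Ξ : Type*} [GrowthIndex Ω] [GrowthIndex Ξ] (x : Ω × Ξ) :
    wt x ≤ wt x.1 * wt x.2 := by
  simp only [wt, size_prod, Nat.cast_add]
  nlinarith [mul_nonneg (Nat.cast_nonneg (α := ℝ) (GrowthIndex.size x.1))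
    (Nat.cast_nonneg (α := ℝ) (GrowthIndex.size x.2))]

theorem wt_fst_le {Ω Ξ : Type*} [GrowthIndex Ω] [GrowthIndex Ξ] (x : Ω × Ξ) :
    wt x.1 ≤ wt x := by simp [wt]

theorem wt_snd_le {Ω Ξ : Type*} [GrowthIndex Ω] [GrowthIndex Ξ] (x : Ω × Ξ) :
    wt x.2 ≤ wt x := by simp [wt]

theorem PolyEmb.prodMap {Ω Ω' Ξ Ξ' : Type*} [GrowthIndex Ω] [GrowthIndex Ω'] [GrowthIndex Ξ]
    [GrowthIndex Ξ'] {j : Ω → Ω'} {l : Ξ → Ξ'} (hj : PolyEmb j) (hl : PolyEmb l) :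
    PolyEmb (Prod.map j l) := by
  obtain ⟨C, N, hC, h⟩ := hj.upper
  obtain ⟨C', N', hC', h'⟩ := hl.upper
  obtain ⟨D, M, hD, g⟩ := hj.lower
  obtain ⟨D', M', hD', g'⟩ := hl.lower
  refine ⟨hj.injective.prodMap hl.injective, ⟨C * C', N + N', by positivity, fun x => ?_⟩,
    ⟨D * D', M + M', by positivity, fun x => ?_⟩⟩
  · refine (wt_prod_le _).trans ?_
    calc wt (j x.1) * wt (l x.2) ≤ (C * wt x.1 ^ N) * (C' * wt x.2 ^ N') :=
          mul_le_mul (h _) (h' _) (wt_pos _).le (mul_nonneg hC (pow_nonneg (wt_pos _).le _))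
      _ = C * C' * (wt x.1 ^ N * wt x.2 ^ N') := by ring
      _ ≤ C * C' * (wt x ^ N * wt x ^ N') := by
          have h1 := pow_le_pow_left₀ (wt_pos x.1).le (wt_fst_le x) N
          have h2 := pow_le_pow_left₀ (wt_pos x.2).le (wt_snd_le x) N'
          have := wt_pos x; have := wt_pos x.1; have := wt_pos x.2
          gcongr
      _ = C * C' * wt x ^ (N + N') := by rw [pow_add]
  · refine (wt_prod_le _).trans ?_
    set y := Prod.map j l x with hy
    calc wt x.1 * wt x.2 ≤ (D * wt y.1 ^ M) * (D' * wt y.2 ^ M') :=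
          mul_le_mul (g _) (g' _) (wt_pos _).le (mul_nonneg hD (pow_nonneg (wt_pos _).le _))
      _ = D * D' * (wt y.1 ^ M * wt y.2 ^ M') := by ring
      _ ≤ D * D' * (wt y ^ M * wt y ^ M') := by
          have h1 := pow_le_pow_left₀ (wt_pos y.1).le (wt_fst_le y) M
          have h2 := pow_le_pow_left₀ (wt_pos y.2).le (wt_snd_le y) M'
          have := wt_pos y; have := wt_pos y.1; have := wt_pos y.2
          gcongr
      _ = D * D' * wt y ^ (M + M') := by rw [pow_add]

instance : PolyIdx ℕ := ⟨_root_.id, PolyEmb.id ℕ⟩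
instance (n : ℕ) : PolyIdx (Fin n) :=
  ⟨fun i => i.1, PolyEmb.of_le Fin.val_injective (1 + n) 1
    (fun x => by simp) (fun x => by simp; nlinarith)⟩
instance : PolyIdx Unit := ⟨fun _ => 0, PolyEmb.of_size (fun _ _ _ => rfl) fun _ => rfl⟩

theorem PolyEmb.natPair : PolyEmb fun x : ℕ × ℕ => Nat.pair x.1 x.2 := by
  refine PolyEmb.of_le (fun x y h => ?_) 2 2 (fun x => ?_) (fun x => ?_)
  · have := Nat.pair_eq_pair.1 h; exact Prod.ext this.1 this.2
  · have h1 := Nat.pair_lt_max_add_one_sq x.1 x.2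
    have h2 : max x.1 x.2 + 1 ≤ 1 + (x.1 + x.2) := by omega
    have h3 := Nat.pow_le_pow_left h2 2
    simp only [size_nat, size_prod]
    omega
  · have h1 := Nat.left_le_pair x.1 x.2
    have h2 := Nat.right_le_pair x.1 x.2
    simp only [size_nat, size_prod]
    nlinarith

instance {Ω Ξ : Type*} [GrowthIndex Ω] [GrowthIndex Ξ] [PolyIdx Ω] [PolyIdx Ξ] :
    PolyIdx (Ω × Ξ) := by
  obtain ⟨e, he⟩ := PolyIdx.exists_emb (Ω := Ω)
  obtain ⟨f, hf⟩ := PolyIdx.exists_emb (Ω := Ξ)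
  exact ⟨_, PolyEmb.natPair.comp (he.prodMap hf)⟩

instance (priority := low) {Ω : Type*} [GrowthIndex Ω] [PolyIdx Ω] : Countable Ω := by
  obtain ⟨e, he⟩ := PolyIdx.exists_emb (Ω := Ω)
  exact he.injective.countable

theorem PolyIdx.exists_summable (Ω : Type*) [GrowthIndex Ω] [PolyIdx Ω] :
    ∃ r : ℕ, Summable fun x : Ω => (wt x ^ r)⁻¹ := by
  obtain ⟨e, he⟩ := PolyIdx.exists_emb (Ω := Ω)
  obtain ⟨C, N, hC, h⟩ := he.upper
  refine ⟨N * 2, ?_⟩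
  have h1 : Summable fun n : ℕ => (((n : ℝ) + 1) ^ 2)⁻¹ := by
    have := (summable_nat_add_iff 1).2 (Real.summable_nat_pow_inv.2 (one_lt_two))
    simpa using this
  refine Summable.of_nonneg_of_le (fun x => by have := wt_pos x; positivity) (fun x => ?_)
    ((h1.comp_injective he.injective).mul_left (C ^ 2))
  have h2 := h x
  have h3 := wt_pos x
  have h4 : (wt (e x)) ^ 2 ≤ (C * wt x ^ N) ^ 2 := pow_le_pow_left₀ (wt_pos _).le h2 2
  have h5 : wt (e x) = (e x : ℝ) + 1 := by simp [wt, add_comm]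
  simp only [Function.comp_apply]
  rw [← h5, ← div_eq_mul_inv, inv_eq_one_div, div_le_div_iff₀ (by positivity)
    (by have := wt_pos (e x); positivity), one_mul, pow_mul, ← mul_pow]
  exact h4

/-- An exponent for which the inverse powers of the weight are summable. -/
noncomputable def sumExp (Ω : Type*) [GrowthIndex Ω] [PolyIdx Ω] : ℕ :=
  (PolyIdx.exists_summable Ω).choose

theorem summable_wt (Ω : Type*) [GrowthIndex Ω] [PolyIdx Ω] :
    Summable fun x : Ω => (wt x ^ sumExp Ω)⁻¹ := (PolyIdx.exists_summable Ω).choose_spec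

/-- The sum of the inverse powers of the weight. -/
noncomputable def sumWt (Ω : Type*) [GrowthIndex Ω] [PolyIdx Ω] : ℝ :=
  ∑' x : Ω, (wt x ^ sumExp Ω)⁻¹

theorem sumWt_nonneg (Ω : Type*) [GrowthIndex Ω] [PolyIdx Ω] : 0 ≤ sumWt Ω :=
  tsum_nonneg fun x => by have := wt_pos x; positivity

/-! ### Tempered matrices -/

section Tempered

variable {Ω : Type v} [GrowthIndex Ω] {A : Type u} [NonUnitalCommRing A] [Module ℝ A]
  [TopologicalSpace A]

/-- The matrices whose columns are rapidly decreasing, with polynomial control. -/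
def colSubmodule (Ω : Type v) [GrowthIndex Ω] (A : Type u) [NonUnitalCommRing A] [Module ℝ A]
    [TopologicalSpace A] : Submodule ℝ (Matrix Ω Ω (Unitization ℝ A)) where
  carrier := {a | ∀ p : Seminorm ℝ A, Continuous p → ∀ N : ℕ, ∃ (M : ℕ) (C : ℝ), 0 ≤ C ∧
    ∀ i j, wt i ^ N * unitSeminorm p (a i j) ≤ C * wt j ^ M}
  zero_mem' := fun p _ N => ⟨0, 0, le_rfl, fun i j => by simp⟩
  add_mem' := by
    intro a b ha hb p hp N
    obtain ⟨M, C, hC, h⟩ := ha p hp N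
    obtain ⟨M', C', hC', h'⟩ := hb p hp N
    refine ⟨max M M', C + C', by positivity, fun i j => ?_⟩
    have h1 := pow_le_pow_right₀ (one_le_wt j) (le_max_left M M')
    have h2 := pow_le_pow_right₀ (one_le_wt j) (le_max_right M M')
    have h3 := mul_le_mul_of_nonneg_left (map_add_le_add (unitSeminorm p) (a i j) (b i j))
      (pow_nonneg (wt_pos i).le N)
    rw [mul_add] at h3
    rw [add_mul]
    exact h3.trans (add_le_add ((h i j).trans (mul_le_mul_of_nonneg_left h1 hC))
      ((h' i j).trans (mul_le_mul_of_nonneg_left h2 hC')))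
  smul_mem' := by
    intro c a ha p hp N
    obtain ⟨M, C, hC, h⟩ := ha p hp N
    refine ⟨M, ‖c‖ * C, by positivity, fun i j => ?_⟩
    rw [Matrix.smul_apply, map_smul_eq_mul, mul_left_comm, mul_assoc]
    exact mul_le_mul_of_nonneg_left (h i j) (norm_nonneg c)

/-- Matrices with rapidly decreasing rows and columns, with polynomial control. -/
def temperedSubmodule (Ω : Type v) [GrowthIndex Ω] (A : Type u) [NonUnitalCommRing A] [Module ℝ A]
    [TopologicalSpace A] : Submodule ℝ (Matrix Ω Ω (Unitization ℝ A)) where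
  carrier := {a | a ∈ colSubmodule Ω A ∧ a.transpose ∈ colSubmodule Ω A}
  zero_mem' := ⟨zero_mem _, zero_mem _⟩
  add_mem' := fun ha hb => ⟨add_mem ha.1 hb.1, add_mem ha.2 hb.2⟩
  smul_mem' := fun c _ ha => ⟨Submodule.smul_mem _ c ha.1, Submodule.smul_mem _ c ha.2⟩

/-- The product of matrices over the unital extension. -/
noncomputable def matMul {I J L : Type*} (a : Matrix I J (Unitization ℝ A))
    (b : Matrix J L (Unitization ℝ A)) :
    Matrix I L (Unitization ℝ A) := fun i l => ∑' j, a i j * b j l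

variable [IsScalarTower ℝ A A] [SMulCommClass ℝ A A] [IsTopologicalRing A] [ContinuousSMul ℝ A]
  [PolynormableSpace ℝ A] [T2Space A] [GoodAlg A] [PolyIdx Ω]

theorem exists_mul_bound {a b : Matrix Ω Ω (Unitization ℝ A)} (ha : a ∈ colSubmodule Ω A)
    (hb : b ∈ colSubmodule Ω A) (p : Seminorm ℝ A) (hp : Continuous p) (N K : ℕ) :
    ∃ (M : ℕ) (C : ℝ), 0 ≤ C ∧ ∀ i j l, wt i ^ N * unitSeminorm p (a i j * b j l) ≤
      C * wt l ^ M * (wt j ^ (K + sumExp Ω))⁻¹ := by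
  obtain ⟨q, hq, hqm, hpq⟩ := GoodAlg.mconvex p hp
  obtain ⟨M, C, hC, h⟩ := ha q hq N
  obtain ⟨M', C', hC', h'⟩ := hb q hq (M + (K + sumExp Ω))
  refine ⟨M', C * C', by positivity, fun i j l => ?_⟩
  have h1 := h i j
  have h2 := h' j l
  have hj : 0 < wt j ^ (K + sumExp Ω) := pow_pos (wt_pos j) _
  rw [← div_eq_mul_inv, le_div_iff₀ hj]
  have h3 : unitSeminorm p (a i j * b j l) ≤ unitSeminorm q (a i j) * unitSeminorm q (b j l) :=
    (unitSeminorm_mono hpq _).trans (unitSeminorm_mul_le hqm _ _)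
  have hi : 0 ≤ wt i ^ N := pow_nonneg (wt_pos i).le _
  calc wt i ^ N * unitSeminorm p (a i j * b j l) * wt j ^ (K + sumExp Ω)
      ≤ wt i ^ N * (unitSeminorm q (a i j) * unitSeminorm q (b j l)) * wt j ^ (K + sumExp Ω) := by
        gcongr
    _ = (wt i ^ N * unitSeminorm q (a i j)) * (unitSeminorm q (b j l) * wt j ^ (K + sumExp Ω)) := by
        ring
    _ ≤ (C * wt j ^ M) * (unitSeminorm q (b j l) * wt j ^ (K + sumExp Ω)) := by
        gcongr
    _ = C * (wt j ^ (M + (K + sumExp Ω)) * unitSeminorm q (b j l)) := by rw [pow_add]; ring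
    _ ≤ C * (C' * wt l ^ M') := by gcongr
    _ = C * C' * wt l ^ M' := by ring

theorem summable_mul {a b : Matrix Ω Ω (Unitization ℝ A)} (ha : a ∈ colSubmodule Ω A)
    (hb : b ∈ colSubmodule Ω A) (i l : Ω) : Summable fun j => a i j * b j l := by
  refine Unitization.summable _ fun p hp => ?_
  obtain ⟨M, C, hC, h⟩ := exists_mul_bound ha hb p hp 0 0
  refine Summable.of_nonneg_of_le (fun j => apply_nonneg _ _) (fun j => ?_)
    ((summable_wt Ω).mul_left (C * wt l ^ M))
  simpa using h i j l

theorem matMul_mem_col {a b : Matrix Ω Ω (Unitization ℝ A)} (ha : a ∈ colSubmodule Ω A)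
    (hb : b ∈ colSubmodule Ω A) : matMul a b ∈ colSubmodule Ω A := by
  intro p hp N
  obtain ⟨M, C, hC, h⟩ := exists_mul_bound ha hb p hp N 0
  refine ⟨M, C * sumWt Ω, mul_nonneg hC (sumWt_nonneg Ω), fun i l => ?_⟩
  have hi : 0 < wt i ^ N := pow_pos (wt_pos i) _
  have h1 : unitSeminorm p (matMul a b i l) ≤
      ∑' j : Ω, (wt i ^ N)⁻¹ * (C * wt l ^ M) * (wt j ^ sumExp Ω)⁻¹ := by
    refine seminorm_tsum_le _ (continuous_unitSeminorm hp) (summable_mul ha hb i l)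
      ((summable_wt Ω).mul_left _) fun j => ?_
    have := h i j l
    rw [zero_add] at this
    rw [mul_assoc, ← div_eq_inv_mul, le_div_iff₀ hi, mul_comm]
    exact this
  rw [tsum_mul_left] at h1
  calc wt i ^ N * unitSeminorm p (matMul a b i l)
      ≤ wt i ^ N * ((wt i ^ N)⁻¹ * (C * wt l ^ M) * sumWt Ω) :=
        mul_le_mul_of_nonneg_left h1 hi.le
    _ = C * sumWt Ω * wt l ^ M := by field_simp

theorem matMul_transpose {I J L : Type*} (a : Matrix I J (Unitization ℝ A))
    (b : Matrix J L (Unitization ℝ A)) :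
    (matMul a b).transpose = matMul b.transpose a.transpose := by
  refine Matrix.ext fun i l => ?_
  exact tsum_congr fun j => mul_comm _ _

theorem matMul_assoc {a b c : Matrix Ω Ω (Unitization ℝ A)} (ha : a ∈ colSubmodule Ω A)
    (hb : b ∈ colSubmodule Ω A) (hc : c ∈ colSubmodule Ω A) :
    matMul (matMul a b) c = matMul a (matMul b c) := by
  refine Matrix.ext fun i l => ?_
  have hsum : Summable (Function.uncurry fun j m => a i j * b j m * c m l) := by
    refine Unitization.summable _ fun p hp => ?_
    obtain ⟨q, hq, hqm, hpq⟩ := GoodAlg.mconvex p hp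
    obtain ⟨M, C, hC, h⟩ := exists_mul_bound ha hb q hq 0 0
    obtain ⟨K, D, hD, g⟩ := hc q hq (M + sumExp Ω)
    refine Summable.of_nonneg_of_le (fun x => apply_nonneg _ _) (fun x => ?_)
      (((summable_wt Ω).mul_of_nonneg (summable_wt Ω)
        (fun x => by have := wt_pos x; positivity) (fun x => by have := wt_pos x; positivity)).mul_left
        (C * D * wt l ^ K))
    obtain ⟨j, m⟩ := x
    have h1 := h i j m
    have h2 := g m l
    simp only [pow_zero, one_mul, zero_add, Function.uncurry_apply_pair] at h1 ⊢
    refine ((unitSeminorm_mono hpq _).trans (unitSeminorm_mul_le hqm _ _)).trans ?_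
    have hm : 0 < wt m ^ sumExp Ω := pow_pos (wt_pos m) _
    have hj : 0 < wt j ^ sumExp Ω := pow_pos (wt_pos j) _
    have hmM : 0 < wt m ^ M := pow_pos (wt_pos m) _
    calc unitSeminorm q (a i j * b j m) * unitSeminorm q (c m l)
        ≤ (C * wt m ^ M * (wt j ^ sumExp Ω)⁻¹) * unitSeminorm q (c m l) := by gcongr
      _ = C * (wt j ^ sumExp Ω)⁻¹ * (wt m ^ sumExp Ω)⁻¹ *
            (wt m ^ (M + sumExp Ω) * unitSeminorm q (c m l)) := by
          rw [pow_add]; field_simp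
      _ ≤ C * (wt j ^ sumExp Ω)⁻¹ * (wt m ^ sumExp Ω)⁻¹ * (D * wt l ^ K) := by gcongr
      _ = C * D * wt l ^ K * ((wt j ^ sumExp Ω)⁻¹ * (wt m ^ sumExp Ω)⁻¹) := by ring
  have h1 : ∀ m, Summable fun j => a i j * b j m * c m l :=
    fun m => (summable_mul ha hb i m).mul_right _
  have h2 : ∀ j, Summable fun m => a i j * b j m * c m l := fun j => by
    simp only [mul_assoc]; exact (summable_mul hb hc j l).mul_left _
  calc ∑' m, (∑' j, a i j * b j m) * c m l = ∑' m, ∑' j, a i j * b j m * c m l :=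
        tsum_congr fun m => ((summable_mul ha hb i m).tsum_mul_right _).symm
    _ = ∑' j, ∑' m, a i j * b j m * c m l := hsum.tsum_comm' h2 h1
    _ = ∑' j, a i j * ∑' m, b j m * c m l := by
        refine tsum_congr fun j => ?_
        simp only [mul_assoc]
        exact (summable_mul hb hc j l).tsum_mul_left _

theorem one_mem_col [DecidableEq Ω] : (1 : Matrix Ω Ω (Unitization ℝ A)) ∈ colSubmodule Ω A := by
  intro p hp N
  refine ⟨N, 1, zero_le_one, fun i j => ?_⟩
  by_cases h : i = j
  · subst h; simp [unitSeminorm_apply]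
  · rw [Matrix.one_apply_ne h, map_zero, mul_zero]
    have := wt_pos j; positivity

/-- The algebra of tempered matrices over the unital extension. -/
def TM (Ω : Type v) [GrowthIndex Ω] (A : Type u) [NonUnitalCommRing A] [Module ℝ A]
    [TopologicalSpace A] : Type (max u v) := ↥(temperedSubmodule Ω A)

instance : AddCommGroup (TM Ω A) := inferInstanceAs (AddCommGroup ↥(temperedSubmodule Ω A))
instance : Module ℝ (TM Ω A) := inferInstanceAs (Module ℝ ↥(temperedSubmodule Ω A))

/-- The underlying matrix. -/
def TM.mat (a : TM Ω A) : Matrix Ω Ω (Unitization ℝ A) := a.1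

theorem TM.mat_injective : Function.Injective (TM.mat : TM Ω A → _) := Subtype.val_injective

@[ext] theorem TM.ext {a b : TM Ω A} (h : ∀ i j, a.mat i j = b.mat i j) : a = b :=
  TM.mat_injective (Matrix.ext h)

theorem TM.col (a : TM Ω A) : a.mat ∈ colSubmodule Ω A := a.2.1
theorem TM.row (a : TM Ω A) : a.mat.transpose ∈ colSubmodule Ω A := a.2.2

@[simp] theorem TM.mat_add (a b : TM Ω A) (i j : Ω) : (a + b).mat i j = a.mat i j + b.mat i j := rfl
@[simp] theorem TM.mat_sub (a b : TM Ω A) (i j : Ω) : (a - b).mat i j = a.mat i j - b.mat i j := rfl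
@[simp] theorem TM.mat_neg (a : TM Ω A) (i j : Ω) : (-a).mat i j = -a.mat i j := rfl
@[simp] theorem TM.mat_zero (i j : Ω) : (0 : TM Ω A).mat i j = 0 := rfl
@[simp] theorem TM.mat_smul (c : ℝ) (a : TM Ω A) (i j : Ω) : (c • a).mat i j = c • a.mat i j := rfl

noncomputable instance : Mul (TM Ω A) := ⟨fun a b => ⟨matMul a.mat b.mat,
  matMul_mem_col a.col b.col, by rw [matMul_transpose]; exact matMul_mem_col b.row a.row⟩⟩

instance [DecidableEq Ω] : One (TM Ω A) :=
  ⟨⟨1, one_mem_col, by rw [Matrix.transpose_one]; exact one_mem_col⟩⟩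

theorem TM.mat_one [DecidableEq Ω] : (1 : TM Ω A).mat = 1 := rfl

theorem TM.mul_apply (a b : TM Ω A) (i l : Ω) : (a * b).mat i l = ∑' j, a.mat i j * b.mat j l := rfl

theorem TM.summable (a b : TM Ω A) (i l : Ω) : Summable fun j => a.mat i j * b.mat j l :=
  summable_mul a.col b.col i l

theorem TM.mmul_eq (a b : TM Ω A) : mmul a.mat b.mat = (a * b).mat := by
  refine Matrix.ext fun i l => ?_
  exact (Unitization.tsum_eq (a.summable b i l)).symm

noncomputable instance [DecidableEq Ω] : Ring (TM Ω A) :=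
  { (inferInstance : AddCommGroup (TM Ω A)) with
    mul := (· * ·)
    one := 1
    left_distrib := fun a b c => by
      ext1 i l
      simp only [TM.mul_apply, TM.mat_add, mul_add]
      exact (a.summable b i l).tsum_add (a.summable c i l)
    right_distrib := fun a b c => by
      ext1 i l
      simp only [TM.mul_apply, TM.mat_add, add_mul]
      exact (a.summable c i l).tsum_add (b.summable c i l)
    zero_mul := fun a => by ext1 i l; simp [TM.mul_apply]
    mul_zero := fun a => by ext1 i l; simp [TM.mul_apply]
    mul_assoc := fun a b c => TM.mat_injective (matMul_assoc a.col b.col c.col)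
    one_mul := fun a => by
      ext1 i l
      rw [TM.mul_apply, TM.mat_one, tsum_eq_single i, Matrix.one_apply_eq, one_mul]
      intro j hj
      rw [Matrix.one_apply_ne' hj, zero_mul]
    mul_one := fun a => by
      ext1 i l
      rw [TM.mul_apply, TM.mat_one, tsum_eq_single l, Matrix.one_apply_eq, mul_one]
      intro j hj
      rw [Matrix.one_apply_ne hj, mul_zero] }

noncomputable instance [DecidableEq Ω] : Algebra ℝ (TM Ω A) :=
  Algebra.ofModule
    (fun c a b => by
      ext1 i l
      simp only [TM.mul_apply, TM.mat_smul, smul_mul_assoc]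
      exact (a.summable b i l).tsum_const_smul c)
    (fun c a b => by
      ext1 i l
      simp only [TM.mul_apply, TM.mat_smul, mul_smul_comm]
      exact (a.summable b i l).tsum_const_smul c)

/-- The transpose of a tempered matrix. -/
def TM.tr (a : TM Ω A) : TM Ω A := ⟨a.mat.transpose, a.row, a.col⟩

@[simp] theorem TM.tr_apply (a : TM Ω A) (i j : Ω) : a.tr.mat i j = a.mat j i := rfl

theorem TM.tr_mul (a b : TM Ω A) : (a * b).tr = b.tr * a.tr :=
  TM.mat_injective (matMul_transpose a.mat b.mat)

@[simp] theorem TM.tr_tr (a : TM Ω A) : a.tr.tr = a := rfl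

end Tempered

theorem exists_mul_seminorm_eq {X : Type*} [AddCommGroup X] [Module ℝ X] [TopologicalSpace X]
    {p : Seminorm ℝ X} (hp : Continuous p) {C : ℝ} (hC : 0 ≤ C) :
    ∃ q : Seminorm ℝ X, Continuous q ∧ ∀ x, q x = C * p x := by
  refine ⟨C.toNNReal • p, ?_, fun x => ?_⟩
  · rw [FunLike.coe_smul]
    exact hp.const_smul _
  · rw [_root_.smul_apply, NNReal.smul_def, Real.coe_toNNReal C hC, smul_eq_mul]

section RapidIdeal

variable {Ω Ω' Ω'' Ω₁ Ω₂ : Type} [GrowthIndex Ω] [GrowthIndex Ω'] [GrowthIndex Ω''] [GrowthIndex Ω₁]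
  [GrowthIndex Ω₂]
variable {A : Type u} [NonUnitalCommRing A] [Module ℝ A] [TopologicalSpace A]
  [IsScalarTower ℝ A A] [SMulCommClass ℝ A A] [IsTopologicalRing A] [ContinuousSMul ℝ A]
  [PolynormableSpace ℝ A] [T2Space A] [GoodAlg A] [PolyIdx Ω] [PolyIdx Ω'] [PolyIdx Ω'']
  [PolyIdx Ω₁] [PolyIdx Ω₂]
  [DecidableEq Ω] [DecidableEq Ω'] [DecidableEq Ω''] [DecidableEq Ω₁] [DecidableEq Ω₂]

/-! ### The ideal of rapidly decreasing matrices -/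

theorem wt_pow_mul_le (k : RapidMatrix Ω A) {p : Seminorm ℝ A} (hp : Continuous p) (N M : ℕ)
    (i j : Ω) : wt i ^ N * p (k.toMatrix i j) * wt j ^ M ≤ rapidSeminorm ⟨p, hp⟩ (max N M) k := by
  refine le_trans ?_ (le_rapidSeminorm ⟨p, hp⟩ (max N M) k i j)
  rw [weight_eq]
  have h1 := pow_le_pow_right₀ (one_le_wt i) (le_max_left N M)
  have h2 := pow_le_pow_right₀ (one_le_wt j) (le_max_right N M)
  have := wt_pos i
  have := wt_pos j
  calc wt i ^ N * p (k.toMatrix i j) * wt j ^ M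
      ≤ wt i ^ max N M * p (k.toMatrix i j) * wt j ^ max N M := by gcongr
    _ = _ := by ring

theorem wt_pow_mul_le' (k : RapidMatrix Ω A) {p : Seminorm ℝ A} (hp : Continuous p) (N : ℕ)
    (i j : Ω) : wt i ^ N * p (k.toMatrix i j) ≤ rapidSeminorm ⟨p, hp⟩ N k := by
  simpa using wt_pow_mul_le k hp N 0 i j

theorem RapidMatrix.map_mem_col (k : RapidMatrix Ω A) :
    k.toMatrix.map (fun a : A => (a : Unitization ℝ A)) ∈ colSubmodule Ω A := by
  intro p hp N
  refine ⟨0, _, apply_nonneg (rapidSeminorm ⟨p, hp⟩ N) k, fun i j => ?_⟩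
  simpa using wt_pow_mul_le' k hp N i j

/-- The transpose of a rapidly decreasing matrix. -/
def RapidMatrix.tr (k : RapidMatrix Ω A) : RapidMatrix Ω A :=
  ⟨k.toMatrix.transpose, fun p hp N => ⟨rapidSeminorm ⟨p, hp⟩ N k, fun i j => by
    have := le_rapidSeminorm ⟨p, hp⟩ N k j i
    rw [weight_eq, mul_comm (wt j ^ N)] at this
    exact this⟩⟩

/-- The transposition as a continuous linear map. -/
def trL : RapidMatrix Ω A →L[ℝ] RapidMatrix Ω A where
  toFun := RapidMatrix.tr
  map_add' _ _ := rfl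
  map_smul' _ _ := rfl
  cont := by
    refine continuous_linear_of_seminorm (rapid_withSeminorms Ω A)
      (⟨⟨RapidMatrix.tr, fun _ _ => rfl⟩, fun _ _ => rfl⟩ : RapidMatrix Ω A →ₗ[ℝ] RapidMatrix Ω A)
      fun ⟨p, N⟩ => ⟨rapidSeminorm p N, continuous_rapidSeminorm p N, fun k => ?_⟩
    refine rapidSeminorm_le p N _ (apply_nonneg _ _) fun i j => ?_
    have := le_rapidSeminorm p N k j i
    rw [weight_eq, mul_comm (wt j ^ N)] at this
    exact this

/-- The inclusion of the rapidly decreasing matrices. -/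
def incl : RapidMatrix Ω A →ₗ[ℝ] TM Ω A where
  toFun k := ⟨k.toMatrix.map fun a : A => (a : Unitization ℝ A), k.map_mem_col, k.tr.map_mem_col⟩
  map_add' k l := by
    refine TM.mat_injective (Matrix.ext fun i j => ?_)
    exact Unitization.inr_add ℝ _ _
  map_smul' c k := by
    refine TM.mat_injective (Matrix.ext fun i j => ?_)
    exact Unitization.inr_smul ℝ _ _

@[simp] theorem incl_apply (k : RapidMatrix Ω A) (i j : Ω) :
    (incl k).mat i j = (k.toMatrix i j : Unitization ℝ A) := rfl

theorem incl_injective : Function.Injective (incl : RapidMatrix Ω A →ₗ[ℝ] TM Ω A) := by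
  intro k l h
  refine RapidMatrix.ext fun i j => ?_
  have := congrArg (fun a : TM Ω A => a.mat i j) h
  exact Unitization.inr_injective this

theorem perturb_eq (b : TM Ω A) (k : RapidMatrix Ω A) : perturb b.mat k = (b + incl k).mat := rfl

theorem incl_tr (k : RapidMatrix Ω A) : incl k.tr = (incl k).tr := rfl

theorem TM.mul_incl_fst (t : TM Ω A) (k : RapidMatrix Ω A) (i l : Ω) :
    ((t * incl k).mat i l).fst = 0 := by
  rw [TM.mul_apply, Unitization.tsum_eq (t.summable _ i l)]
  simp

theorem lmul_bound (t : TM Ω A) (k : RapidMatrix Ω A) {p q : Seminorm ℝ A}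
    (hp : Continuous p) (hq : Continuous q) (hqm : ∀ x y, q (x * y) ≤ q x * q y) (hpq : p ≤ q)
    {N M : ℕ} {C : ℝ} (hC : 0 ≤ C)
    (h : ∀ i j, wt i ^ N * unitSeminorm q (t.mat i j) ≤ C * wt j ^ M) (i l : Ω) :
    weight N i l * unitSeminorm p ((t * incl k).mat i l) ≤
      C * sumWt Ω * rapidSeminorm ⟨q, hq⟩ (max (M + sumExp Ω) N) k := by
  set R := rapidSeminorm ⟨q, hq⟩ (max (M + sumExp Ω) N) k
  have hw : 0 < weight N i l := weight_pos N i l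
  have hR : 0 ≤ R := apply_nonneg _ _
  have h1 : unitSeminorm p ((t * incl k).mat i l) ≤
      ∑' j : Ω, (weight N i l)⁻¹ * (C * R) * (wt j ^ sumExp Ω)⁻¹ := by
    refine seminorm_tsum_le _ (continuous_unitSeminorm hp) (t.summable _ i l)
      ((summable_wt Ω).mul_left _) fun j => ?_
    have h3 := (unitSeminorm_mono hpq (t.mat i j * (incl k).mat j l)).trans
      (unitSeminorm_mul_le hqm _ _)
    have h4 := wt_pow_mul_le k hq (M + sumExp Ω) N j l
    have hj : 0 < wt j ^ sumExp Ω := pow_pos (wt_pos j) _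
    have hl : 0 < wt l ^ N := pow_pos (wt_pos l) _
    have hjM : 0 < wt j ^ M := pow_pos (wt_pos j) _
    refine h3.trans ?_
    rw [mul_assoc, ← div_eq_inv_mul, le_div_iff₀ hw, ← div_eq_mul_inv, le_div_iff₀ hj, incl_apply,
      unitSeminorm_inr, weight_eq]
    calc unitSeminorm q (t.mat i j) * q (k.toMatrix j l) * (wt i ^ N * wt l ^ N) * wt j ^ sumExp Ω
        = (wt i ^ N * unitSeminorm q (t.mat i j)) *
          (q (k.toMatrix j l) * wt l ^ N * wt j ^ sumExp Ω) := by ring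
      _ ≤ (C * wt j ^ M) * (q (k.toMatrix j l) * wt l ^ N * wt j ^ sumExp Ω) := by
          have := h i j
          gcongr
      _ = C * (wt j ^ (M + sumExp Ω) * q (k.toMatrix j l) * wt l ^ N) := by rw [pow_add]; ring
      _ ≤ C * R := by gcongr
  rw [tsum_mul_left] at h1
  calc weight N i l * unitSeminorm p ((t * incl k).mat i l)
      ≤ weight N i l * ((weight N i l)⁻¹ * (C * R) * sumWt Ω) :=
        mul_le_mul_of_nonneg_left h1 hw.le
    _ = C * sumWt Ω * R := by field_simp

/-- The product of a tempered matrix and a rapidly decreasing matrix. -/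
noncomputable def lmul (t : TM Ω A) (k : RapidMatrix Ω A) : RapidMatrix Ω A :=
  ⟨fun i l => ((t * incl k).mat i l).snd, fun p hp N => by
    obtain ⟨q, hq, hqm, hpq⟩ := GoodAlg.mconvex p hp
    obtain ⟨M, C, hC, h⟩ := t.col q hq N
    refine ⟨_, fun i l => le_trans ?_ (lmul_bound t k hp hq hqm hpq hC h i l)⟩
    exact mul_le_mul_of_nonneg_left (snd_le_unitSeminorm p _) (weight_nonneg _ _ _)⟩

theorem incl_lmul (t : TM Ω A) (k : RapidMatrix Ω A) : incl (lmul t k) = t * incl k := by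
  refine TM.ext fun i l => ?_
  refine Unitization.ext ?_ ?_
  · rw [TM.mul_incl_fst]; rfl
  · rfl

theorem rapidSeminorm_lmul_le (t : TM Ω A) (k : RapidMatrix Ω A) {p q : Seminorm ℝ A}
    (hp : Continuous p) (hq : Continuous q) (hqm : ∀ x y, q (x * y) ≤ q x * q y) (hpq : p ≤ q)
    {N M : ℕ} {C : ℝ} (hC : 0 ≤ C)
    (h : ∀ i j, wt i ^ N * unitSeminorm q (t.mat i j) ≤ C * wt j ^ M) :
    rapidSeminorm ⟨p, hp⟩ N (lmul t k) ≤
      C * sumWt Ω * rapidSeminorm ⟨q, hq⟩ (max (M + sumExp Ω) N) k := by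
  refine rapidSeminorm_le _ _ _ (mul_nonneg (mul_nonneg hC (sumWt_nonneg Ω)) (apply_nonneg _ _))
    fun i l => le_trans ?_ (lmul_bound t k hp hq hqm hpq hC h i l)
  exact mul_le_mul_of_nonneg_left (snd_le_unitSeminorm p _) (weight_nonneg _ _ _)

/-- Left multiplication by a tempered matrix. -/
noncomputable def lmulL (t : TM Ω A) : RapidMatrix Ω A →L[ℝ] RapidMatrix Ω A :=
  let L : RapidMatrix Ω A →ₗ[ℝ] RapidMatrix Ω A :=
    { toFun := lmul t
      map_add' := fun k l => incl_injective (by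
        rw [map_add, incl_lmul, incl_lmul, incl_lmul, map_add, mul_add])
      map_smul' := fun c k => incl_injective (by
        rw [map_smul, incl_lmul, incl_lmul, RingHom.id_apply, map_smul, mul_smul_comm]) }
  { L with
    cont := by
      refine continuous_linear_of_seminorm (rapid_withSeminorms Ω A) L fun ⟨⟨p, hp⟩, N⟩ => ?_
      obtain ⟨q, hq, hqm, hpq⟩ := GoodAlg.mconvex p hp
      obtain ⟨M, C, hC, h⟩ := t.col q hq N
      obtain ⟨r, hr, hre⟩ := exists_mul_seminorm_eq
        (continuous_rapidSeminorm (Ω := Ω) ⟨q, hq⟩ (max (M + sumExp Ω) N))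
        (mul_nonneg hC (sumWt_nonneg Ω))
      exact ⟨r, hr, fun k => (rapidSeminorm_lmul_le t k hp hq hqm hpq hC h).trans_eq (hre k).symm⟩ }

@[simp] theorem incl_lmulL (t : TM Ω A) (k : RapidMatrix Ω A) : incl (lmulL t k) = t * incl k :=
  incl_lmul t k

/-- Right multiplication by a tempered matrix. -/
noncomputable def rmulL (t : TM Ω A) : RapidMatrix Ω A →L[ℝ] RapidMatrix Ω A :=
  trL.comp ((lmulL t.tr).comp trL)

@[simp] theorem incl_rmulL (t : TM Ω A) (k : RapidMatrix Ω A) : incl (rmulL t k) = incl k * t := by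
  change incl (lmul t.tr k.tr).tr = _
  rw [incl_tr, incl_lmul, TM.tr_mul, incl_tr, TM.tr_tr, TM.tr_tr]

/-! ### Amplification -/

/-- The entries of the amplification. -/
def ampMat (e : Ω'' ≃ Ω × Ω') (a : Matrix Ω Ω (Unitization ℝ A)) :
    Matrix Ω'' Ω'' (Unitization ℝ A) :=
  fun i j => if (e i).2 = (e j).2 then a (e i).1 (e j).1 else 0

theorem exists_ampMat_bound (e : Ω'' ≃ Ω × Ω') (he : PolyEmb e) (N : ℕ) :
    ∃ N' : ℕ, ∀ M : ℕ, ∃ (D : ℝ) (M' : ℕ), 0 ≤ D ∧ ∀ (P : Seminorm ℝ (Unitization ℝ A))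
      (a : Matrix Ω Ω (Unitization ℝ A)) (C : ℝ), 0 ≤ C →
      (∀ i j, wt i ^ N' * P (a i j) ≤ C * wt j ^ M) →
      ∀ i j, wt i ^ N * P (ampMat e a i j) ≤ D * C * wt j ^ M' := by
  obtain ⟨C₁, r, hC₁, h₁⟩ := he.lower
  obtain ⟨C₂, s, hC₂, h₂⟩ := he.upper
  refine ⟨r * N, fun M => ⟨C₁ ^ N * C₂ ^ (r * N + M), s * (r * N + M), by positivity,
    fun P a C hC h i j => ?_⟩⟩
  unfold ampMat
  split_ifs with hij
  · have hx := h (e i).1 (e j).1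
    have h3 : wt i ^ N ≤ C₁ ^ N * (wt (e i).1 ^ (r * N) * wt (e j) ^ (r * N)) := by
      calc wt i ^ N ≤ (C₁ * wt (e i) ^ r) ^ N := pow_le_pow_left₀ (wt_pos i).le (h₁ i) N
        _ = C₁ ^ N * wt (e i) ^ (r * N) := by rw [mul_pow, pow_mul]
        _ ≤ C₁ ^ N * (wt (e i).1 * wt (e i).2) ^ (r * N) := by
            have := wt_prod_le (e i)
            have := wt_pos (e i)
            gcongr
        _ ≤ C₁ ^ N * (wt (e i).1 * wt (e j)) ^ (r * N) := by
            have h5 := wt_snd_le (e j)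
            rw [← hij] at h5
            have := wt_pos (e i).1
            have := wt_pos (e i).2
            gcongr
        _ = _ := by rw [mul_pow]
    have h4 : wt (e j) ^ (r * N + M) ≤ C₂ ^ (r * N + M) * wt j ^ (s * (r * N + M)) := by
      calc wt (e j) ^ (r * N + M) ≤ (C₂ * wt j ^ s) ^ (r * N + M) :=
            pow_le_pow_left₀ (wt_pos _).le (h₂ j) _
        _ = _ := by rw [mul_pow, pow_mul]
    have h6 : wt (e j).1 ^ M ≤ wt (e j) ^ M := pow_le_pow_left₀ (wt_pos _).le (wt_fst_le _) _
    have hj := wt_pos (e j)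
    have hi := wt_pos (e i).1
    calc wt i ^ N * P (a (e i).1 (e j).1)
        ≤ C₁ ^ N * (wt (e i).1 ^ (r * N) * wt (e j) ^ (r * N)) * P (a (e i).1 (e j).1) := by
          gcongr
      _ = C₁ ^ N * wt (e j) ^ (r * N) * (wt (e i).1 ^ (r * N) * P (a (e i).1 (e j).1)) := by ring
      _ ≤ C₁ ^ N * wt (e j) ^ (r * N) * (C * wt (e j) ^ M) := by
          refine mul_le_mul_of_nonneg_left (hx.trans ?_) (by positivity)
          gcongr
      _ = C₁ ^ N * C * wt (e j) ^ (r * N + M) := by rw [pow_add]; ring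
      _ ≤ C₁ ^ N * C * (C₂ ^ (r * N + M) * wt j ^ (s * (r * N + M))) := by gcongr
      _ = _ := by ring
  · have := wt_pos j
    rw [map_zero, mul_zero]
    positivity

theorem ampMat_mem_col (e : Ω'' ≃ Ω × Ω') (he : PolyEmb e) {a : Matrix Ω Ω (Unitization ℝ A)}
    (ha : a ∈ colSubmodule Ω A) : ampMat e a ∈ colSubmodule Ω'' A := by
  intro p hp N
  obtain ⟨N', h⟩ := exists_ampMat_bound (A := A) e he N
  obtain ⟨M, C, hC, h1⟩ := ha p hp N'
  obtain ⟨D, M', hD, h2⟩ := h M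
  exact ⟨M', D * C, by positivity, h2 (unitSeminorm p) a C hC h1⟩

theorem ampMat_transpose (e : Ω'' ≃ Ω × Ω') (a : Matrix Ω Ω (Unitization ℝ A)) :
    (ampMat e a).transpose = ampMat e a.transpose := by
  refine Matrix.ext fun i j => ?_
  simp only [Matrix.transpose_apply, ampMat, eq_comm]

/-- The amplification `a ↦ a ⊗ 1`, along an identification of the index set with a product. -/
noncomputable def amp (e : Ω'' ≃ Ω × Ω') (he : PolyEmb e) : TM Ω A →ₐ[ℝ] TM Ω'' A :=
  AlgHom.ofLinearMap
    { toFun := fun a => ⟨ampMat e a.mat, ampMat_mem_col e he a.col,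
        by rw [ampMat_transpose]; exact ampMat_mem_col e he a.row⟩
      map_add' := fun a b => by
        refine TM.mat_injective (Matrix.ext fun i j => ?_)
        change ampMat e (a + b).mat i j = ampMat e a.mat i j + ampMat e b.mat i j
        unfold ampMat
        split_ifs <;> simp
      map_smul' := fun c a => by
        refine TM.mat_injective (Matrix.ext fun i j => ?_)
        change ampMat e (c • a).mat i j = c • ampMat e a.mat i j
        unfold ampMat
        split_ifs <;> simp }
    (by
      refine TM.mat_injective (Matrix.ext fun i j => ?_)
      change ampMat e 1 i j = (1 : Matrix Ω'' Ω'' (Unitization ℝ A)) i j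
      simp only [ampMat, Matrix.one_apply]
      by_cases h : i = j
      · simp [h]
      · rw [if_neg h]
        split_ifs with h1 h2
        · exact absurd (e.injective (Prod.ext h2 h1)) h
        · rfl
        · rfl)
    (fun a b => by
      refine TM.mat_injective (Matrix.ext fun i l => ?_)
      change ampMat e (a * b).mat i l = ∑' j, ampMat e a.mat i j * ampMat e b.mat j l
      have hinj : Function.Injective fun m : Ω => e.symm (m, (e i).2) := fun m m' h => by
        simpa using h
      rw [← hinj.tsum_eq (f := fun j => ampMat e a.mat i j * ampMat e b.mat j l)]
      · simp only [ampMat, Equiv.apply_symm_apply, if_true]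
        split_ifs with h
        · rw [TM.mul_apply]
        · simp
      · intro j hj
        refine ⟨(e j).1, ?_⟩
        have : (e i).2 = (e j).2 := by
          by_contra hne
          exact hj (by simp [ampMat, hne])
        simp only [this, Prod.mk.eta, Equiv.symm_apply_apply])

theorem amp_apply (e : Ω'' ≃ Ω × Ω') (he : PolyEmb e) (a : TM Ω A) (i j : Ω'') :
    (amp e he a).mat i j = if (e i).2 = (e j).2 then a.mat (e i).1 (e j).1 else 0 := rfl

theorem amp_tr (e : Ω'' ≃ Ω × Ω') (he : PolyEmb e) (a : TM Ω A) :
    (amp e he a).tr = amp e he a.tr := TM.mat_injective (ampMat_transpose e a.mat)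

/-- Multiplication by an amplified rapidly decreasing matrix. -/
noncomputable def ampMul (e : Ω'' ≃ Ω × Ω') (he : PolyEmb e) :
    RapidMatrix Ω A →ₗ[ℝ] RapidMatrix Ω'' A →ₗ[ℝ] RapidMatrix Ω'' A :=
  LinearMap.mk₂ ℝ (fun k l => lmul (amp e he (incl k)) l)
    (fun k k' l => incl_injective (by simp only [map_add, incl_lmul, add_mul]))
    (fun c k l => incl_injective (by simp only [map_smul, incl_lmul, smul_mul_assoc]))
    (fun k l l' => incl_injective (by simp only [map_add, incl_lmul, mul_add]))
    (fun c k l => incl_injective (by simp only [map_smul, incl_lmul, mul_smul_comm]))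

@[simp] theorem incl_ampMul (e : Ω'' ≃ Ω × Ω') (he : PolyEmb e) (k : RapidMatrix Ω A)
    (l : RapidMatrix Ω'' A) : incl (ampMul e he k l) = amp e he (incl k) * incl l := incl_lmul _ _

theorem continuous_ampMul (e : Ω'' ≃ Ω × Ω') (he : PolyEmb e) :
    Continuous fun z : RapidMatrix Ω A × RapidMatrix Ω'' A => ampMul e he z.1 z.2 := by
  refine continuous_bilin_of_seminorm (rapid_withSeminorms Ω'' A) _ fun ⟨⟨p, hp⟩, N⟩ => ?_
  obtain ⟨q, hq, hqm, hpq⟩ := GoodAlg.mconvex p hp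
  obtain ⟨N', h⟩ := exists_ampMat_bound (A := A) e he N
  obtain ⟨D, M', hD, h2⟩ := h 0
  obtain ⟨r, hr, hre⟩ := exists_mul_seminorm_eq (continuous_rapidSeminorm (Ω := Ω) ⟨q, hq⟩ N')
    (mul_nonneg hD (sumWt_nonneg Ω''))
  refine ⟨r, rapidSeminorm ⟨q, hq⟩ (max (M' + sumExp Ω'') N), hr,
    continuous_rapidSeminorm _ _, fun k l => ?_⟩
  have h3 := rapidSeminorm_lmul_le (amp e he (incl k)) l hp hq hqm hpq (N := N) (M := M')
    (C := D * rapidSeminorm ⟨q, hq⟩ N' k) (mul_nonneg hD (apply_nonneg _ _))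
    (h2 (unitSeminorm q) (incl k).mat _ (apply_nonneg _ _) fun i j => by
      simpa using wt_pow_mul_le' k hq N' i j)
  refine h3.trans (le_of_eq ?_)
  rw [hre]
  ring

/-- `x ↦ x ⊗ 1`. -/
noncomputable def ampL : TM Ω₁ A →ₐ[ℝ] TM (Ω₁ × Ω₂) A := amp (Equiv.refl _) (PolyEmb.id _)

theorem PolyEmb.prodComm : PolyEmb (Equiv.prodComm Ω₁ Ω₂) :=
  PolyEmb.of_size (Equiv.prodComm Ω₁ Ω₂).injective fun x => by simp [add_comm]

/-- `y ↦ 1 ⊗ y`. -/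
noncomputable def ampR : TM Ω₂ A →ₐ[ℝ] TM (Ω₁ × Ω₂) A := amp (Equiv.prodComm _ _) PolyEmb.prodComm

theorem ampL_apply (x : TM Ω₁ A) (i j : Ω₁ × Ω₂) :
    (ampL x : TM (Ω₁ × Ω₂) A).mat i j = if i.2 = j.2 then x.mat i.1 j.1 else 0 := rfl

theorem ampR_apply (y : TM Ω₂ A) (i j : Ω₁ × Ω₂) :
    (ampR y : TM (Ω₁ × Ω₂) A).mat i j = if i.1 = j.1 then y.mat i.2 j.2 else 0 := rfl

theorem ampL_mul_ampR_apply (x : TM Ω₁ A) (y : TM Ω₂ A) (i j : Ω₁ × Ω₂) :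
    (ampL x * ampR y : TM (Ω₁ × Ω₂) A).mat i j = x.mat i.1 j.1 * y.mat i.2 j.2 := by
  rw [TM.mul_apply, tsum_eq_single (j.1, i.2)]
  · simp [ampL_apply, ampR_apply]
  · intro m hm
    rw [ampL_apply, ampR_apply]
    split_ifs with h1 h2
    · exact absurd (Prod.ext (by simp_all) (by simp_all)) hm
    · rw [mul_zero]
    · rw [zero_mul]
    · rw [zero_mul]

theorem ampR_mul_ampL (x : TM Ω₁ A) (y : TM Ω₂ A) :
    (ampR y * ampL x : TM (Ω₁ × Ω₂) A) = ampL x * ampR y := by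
  refine TM.ext fun i j => ?_
  rw [ampL_mul_ampR_apply, TM.mul_apply, tsum_eq_single (i.1, j.2)]
  · simp [ampL_apply, ampR_apply, mul_comm]
  · intro m hm
    rw [ampL_apply, ampR_apply]
    split_ifs with h1 h2
    · exact absurd (Prod.ext (by simp_all) (by simp_all)) hm
    · rw [mul_zero]
    · rw [zero_mul]
    · rw [zero_mul]

theorem kronecker_eq (x : TM Ω₁ A) (y : TM Ω₂ A) :
    x.mat ⊗ₖ y.mat = (ampL x * ampR y : TM (Ω₁ × Ω₂) A).mat :=
  Matrix.ext fun i j => (ampL_mul_ampR_apply x y i j).symm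

theorem weight_prod_le (N : ℕ) (i j : Ω₁ × Ω₂) :
    weight N i j ≤ weight N i.1 j.1 * weight N i.2 j.2 := by
  rw [weight_eq, weight_eq, weight_eq]
  have h1 := pow_le_pow_left₀ (wt_pos i).le (wt_prod_le i) N
  have h2 := pow_le_pow_left₀ (wt_pos j).le (wt_prod_le j) N
  refine (mul_le_mul h1 h2 (pow_nonneg (wt_pos j).le _) (h1.trans' (pow_nonneg (wt_pos i).le _))).trans
    (le_of_eq ?_)
  rw [mul_pow, mul_pow]
  ring

/-- The Kronecker product of rapidly decreasing matrices. -/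
noncomputable def kron :
    RapidMatrix Ω₁ A →ₗ[ℝ] RapidMatrix Ω₂ A →ₗ[ℝ] RapidMatrix (Ω₁ × Ω₂) A :=
  have key : ∀ (p : Seminorm ℝ A) (_ : Continuous p) (k : RapidMatrix Ω₁ A) (l : RapidMatrix Ω₂ A)
      (N : ℕ), ∃ C, ∀ i j : Ω₁ × Ω₂,
      weight N i j * p (k.toMatrix i.1 j.1 * l.toMatrix i.2 j.2) ≤ C := by
    intro p hp k l N
    obtain ⟨q, hq, hqm, hpq⟩ := GoodAlg.mconvex p hp
    refine ⟨rapidSeminorm ⟨q, hq⟩ N k * rapidSeminorm ⟨q, hq⟩ N l, fun i j => ?_⟩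
    have h1 := le_rapidSeminorm ⟨q, hq⟩ N k i.1 j.1
    have h2 := le_rapidSeminorm ⟨q, hq⟩ N l i.2 j.2
    have h3 := weight_prod_le N i j
    calc weight N i j * p (k.toMatrix i.1 j.1 * l.toMatrix i.2 j.2)
        ≤ (weight N i.1 j.1 * weight N i.2 j.2) * (q (k.toMatrix i.1 j.1) * q (l.toMatrix i.2 j.2)) :=
          mul_le_mul h3 ((hpq _).trans (hqm _ _)) (apply_nonneg _ _)
            (mul_nonneg (weight_nonneg _ _ _) (weight_nonneg _ _ _))
      _ = (weight N i.1 j.1 * q (k.toMatrix i.1 j.1)) * (weight N i.2 j.2 * q (l.toMatrix i.2 j.2)) := by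
          ring
      _ ≤ _ := mul_le_mul h1 h2 (mul_nonneg (weight_nonneg _ _ _) (apply_nonneg _ _))
            (apply_nonneg _ _)
  LinearMap.mk₂ ℝ (fun k l => (⟨fun i j => k.toMatrix i.1 j.1 * l.toMatrix i.2 j.2,
      fun p hp N => key p hp k l N⟩ : RapidMatrix (Ω₁ × Ω₂) A))
    (fun _ _ _ => RapidMatrix.ext fun _ _ => add_mul _ _ _)
    (fun _ _ _ => RapidMatrix.ext fun _ _ => smul_mul_assoc _ _ _)
    (fun _ _ _ => RapidMatrix.ext fun _ _ => mul_add _ _ _)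
    (fun _ _ _ => RapidMatrix.ext fun _ _ => mul_smul_comm _ _ _)

theorem kron_apply (k : RapidMatrix Ω₁ A) (l : RapidMatrix Ω₂ A) (i j : Ω₁ × Ω₂) :
    (kron k l).toMatrix i j = k.toMatrix i.1 j.1 * l.toMatrix i.2 j.2 := rfl

theorem incl_kron (k : RapidMatrix Ω₁ A) (l : RapidMatrix Ω₂ A) :
    incl (kron k l) = ampL (incl k) * ampR (incl l) := by
  refine TM.ext fun i j => ?_
  rw [ampL_mul_ampR_apply, incl_apply, kron_apply, Unitization.inr_mul]
  rfl

theorem continuous_kron : Continuous fun z : RapidMatrix Ω₁ A × RapidMatrix Ω₂ A =>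
    kron z.1 z.2 := by
  refine continuous_bilin_of_seminorm (rapid_withSeminorms (Ω₁ × Ω₂) A) _ fun ⟨⟨p, hp⟩, N⟩ => ?_
  obtain ⟨q, hq, hqm, hpq⟩ := GoodAlg.mconvex p hp
  refine ⟨rapidSeminorm ⟨q, hq⟩ N, rapidSeminorm ⟨q, hq⟩ N, continuous_rapidSeminorm _ _,
    continuous_rapidSeminorm _ _, fun k l => rapidSeminorm_le _ _ _
      (mul_nonneg (apply_nonneg _ _) (apply_nonneg _ _)) fun i j => ?_⟩
  have h1 := le_rapidSeminorm ⟨q, hq⟩ N k i.1 j.1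
  have h2 := le_rapidSeminorm ⟨q, hq⟩ N l i.2 j.2
  have h3 := weight_prod_le N i j
  rw [kron_apply]
  calc weight N i j * p (k.toMatrix i.1 j.1 * l.toMatrix i.2 j.2)
      ≤ (weight N i.1 j.1 * weight N i.2 j.2) * (q (k.toMatrix i.1 j.1) * q (l.toMatrix i.2 j.2)) :=
        mul_le_mul h3 ((hpq _).trans (hqm _ _)) (apply_nonneg _ _)
          (mul_nonneg (weight_nonneg _ _ _) (weight_nonneg _ _ _))
    _ = (weight N i.1 j.1 * q (k.toMatrix i.1 j.1)) * (weight N i.2 j.2 * q (l.toMatrix i.2 j.2)) := by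
        ring
    _ ≤ _ := mul_le_mul h1 h2 (mul_nonneg (weight_nonneg _ _ _) (apply_nonneg _ _))
          (apply_nonneg _ _)

/-! ### Relabeling of tempered matrices -/

theorem relabel_apply {j : Ω → Ω'} (hj : Function.Injective j) (a : Matrix Ω Ω (Unitization ℝ A))
    (x y : Ω) : relabel j a (j x) (j y) = a x y :=
  (hj.prodMap hj).extend_apply (fun x : Ω × Ω => a x.1 x.2) 0 (x, y)

theorem relabel_apply_of_notMem {j : Ω → Ω'} (a : Matrix Ω Ω (Unitization ℝ A)) {i l : Ω'}
    (h : i ∉ range j ∨ l ∉ range j) : relabel j a i l = 0 := by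
  refine Function.extend_apply' _ _ _ ?_
  rintro ⟨⟨x, y⟩, hxy⟩
  have := Prod.ext_iff.1 hxy
  rcases h with h | h
  · exact h ⟨x, this.1⟩
  · exact h ⟨y, this.2⟩

/-- A matrix identity may be checked on the range of an injection and off the range. -/
theorem forall_range_or {j : Ω → Ω'} {P : Ω' → Ω' → Prop} (h1 : ∀ x y, P (j x) (j y))
    (h2 : ∀ i l, (i ∉ range j ∨ l ∉ range j) → P i l) (i l : Ω') : P i l := by
  by_cases hi : i ∈ range j
  · by_cases hl : l ∈ range j
    · obtain ⟨x, rfl⟩ := hi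
      obtain ⟨y, rfl⟩ := hl
      exact h1 x y
    · exact h2 i l (Or.inr hl)
  · exact h2 i l (Or.inl hi)

theorem relabel_mem_col {j : Ω → Ω'} (hj : PolyEmb j) {a : Matrix Ω Ω (Unitization ℝ A)}
    (ha : a ∈ colSubmodule Ω A) : relabel j a ∈ colSubmodule Ω' A := by
  intro p hp N
  obtain ⟨C₁, r, hC₁, h₁⟩ := hj.upper
  obtain ⟨C₂, s, hC₂, h₂⟩ := hj.lower
  obtain ⟨M, C, hC, h⟩ := ha p hp (r * N)
  refine ⟨s * M, C₁ ^ N * C * C₂ ^ M, by positivity, forall_range_or (j := j) (fun x y => ?_)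
    fun i l hil => ?_⟩
  · rw [relabel_apply hj.injective]
    have hw := wt_pos (j x)
    have hy := wt_pos (j y)
    have hx := wt_pos x
    have hy' := wt_pos y
    calc wt (j x) ^ N * unitSeminorm p (a x y) ≤ (C₁ * wt x ^ r) ^ N * unitSeminorm p (a x y) := by
          have := h₁ x
          gcongr
      _ = C₁ ^ N * (wt x ^ (r * N) * unitSeminorm p (a x y)) := by rw [mul_pow, pow_mul]; ring
      _ ≤ C₁ ^ N * (C * wt y ^ M) := by
          have := h x y
          gcongr
      _ ≤ C₁ ^ N * (C * (C₂ * wt (j y) ^ s) ^ M) := by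
          have := h₂ y
          gcongr
      _ = _ := by rw [mul_pow, pow_mul]; ring
  · rw [relabel_apply_of_notMem a hil, map_zero, mul_zero]
    have := wt_pos l
    positivity

theorem relabel_transpose {j : Ω → Ω'} (hj : Function.Injective j)
    (a : Matrix Ω Ω (Unitization ℝ A)) : (relabel j a).transpose = relabel j a.transpose := by
  refine Matrix.ext (forall_range_or (j := j) (fun x y => ?_) fun i l h => ?_)
  · rw [Matrix.transpose_apply, relabel_apply hj, relabel_apply hj, Matrix.transpose_apply]
  · rw [Matrix.transpose_apply, relabel_apply_of_notMem _ h.symm, relabel_apply_of_notMem _ h]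

/-- The relabeling of tempered matrices. -/
noncomputable def push (j : Ω → Ω') (hj : PolyEmb j) : TM Ω A →ₗ[ℝ] TM Ω' A where
  toFun a := ⟨relabel j a.mat, relabel_mem_col hj a.col, by
    rw [relabel_transpose hj.injective]; exact relabel_mem_col hj a.row⟩
  map_add' a b := by
    refine TM.ext (forall_range_or (j := j) (fun x y => ?_) fun i l h => ?_)
    · change relabel j (a + b).mat _ _ = relabel j a.mat _ _ + relabel j b.mat _ _
      simp only [relabel_apply hj.injective, TM.mat_add]
    · change relabel j (a + b).mat _ _ = relabel j a.mat _ _ + relabel j b.mat _ _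
      simp only [relabel_apply_of_notMem _ h, add_zero]
  map_smul' c a := by
    refine TM.ext (forall_range_or (j := j) (fun x y => ?_) fun i l h => ?_)
    · change relabel j (c • a).mat _ _ = c • relabel j a.mat _ _
      simp only [relabel_apply hj.injective, TM.mat_smul]
    · change relabel j (c • a).mat _ _ = c • relabel j a.mat _ _
      simp only [relabel_apply_of_notMem _ h, smul_zero]

theorem push_mat (j : Ω → Ω') (hj : PolyEmb j) (a : TM Ω A) :
    (push j hj a).mat = relabel j a.mat := rfl

theorem push_apply (j : Ω → Ω') (hj : PolyEmb j) (a : TM Ω A) (x y : Ω) :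
    (push j hj a).mat (j x) (j y) = a.mat x y := relabel_apply hj.injective _ _ _

theorem push_apply_of_notMem (j : Ω → Ω') (hj : PolyEmb j) (a : TM Ω A) {i l : Ω'}
    (h : i ∉ range j ∨ l ∉ range j) : (push j hj a).mat i l = 0 := relabel_apply_of_notMem _ h

theorem push_tr (j : Ω → Ω') (hj : PolyEmb j) (a : TM Ω A) :
    (push j hj a).tr = push j hj a.tr := TM.mat_injective (relabel_transpose hj.injective a.mat)

theorem push_push (j : Ω' → Ω'') (hj : PolyEmb j) (j' : Ω → Ω') (hj' : PolyEmb j') (a : TM Ω A) :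
    push j hj (push j' hj' a) = push (j ∘ j') (hj.comp hj') a := by
  refine TM.ext (forall_range_or (j := j) (fun x y => ?_) fun i l h => ?_)
  · rw [push_apply]
    revert x y
    refine forall_range_or (j := j') (fun x y => ?_) fun i l h => ?_
    · rw [push_apply]
      exact (push_apply (j ∘ j') (hj.comp hj') a x y).symm
    · rw [push_apply_of_notMem _ _ _ h, push_apply_of_notMem]
      refine h.imp ?_ ?_
      all_goals
        rintro h1 ⟨z, hz⟩
        exact h1 ⟨z, hj.injective hz⟩
  · rw [push_apply_of_notMem _ _ _ h, push_apply_of_notMem]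
    refine h.imp ?_ ?_
    all_goals
      rintro h1 ⟨z, hz⟩
      exact h1 ⟨j' z, hz⟩

theorem push_id (a : TM Ω A) : push id (PolyEmb.id Ω) a = a :=
  TM.ext fun i l => push_apply id (PolyEmb.id Ω) a i l

theorem mul_push {j : Ω → Ω'} (hj : PolyEmb j) {t : TM Ω' A} {q : TM Ω A}
    (h1 : ∀ x y, t.mat (j x) (j y) = q.mat x y) (h2 : ∀ i ∉ range j, ∀ y, t.mat i (j y) = 0)
    (a : TM Ω A) : t * push j hj a = push j hj (q * a) := by
  have key : ∀ i y, (t * push j hj a).mat i (j y) = ∑' x, t.mat i (j x) * a.mat x y := by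
    intro i y
    rw [TM.mul_apply, ← hj.injective.tsum_eq]
    · simp only [push_apply]
    · intro m hm
      by_contra hne
      exact hm (by beta_reduce; rw [push_apply_of_notMem _ _ _ (Or.inl hne), mul_zero])
  refine TM.ext (forall_range_or (j := j) (fun x y => ?_) fun i l h => ?_)
  · rw [key, push_apply, TM.mul_apply]
    simp only [h1]
  · rw [push_apply_of_notMem _ _ _ h]
    by_cases hl : l ∈ range j
    · obtain ⟨y, rfl⟩ := hl
      have hi : i ∉ range j := h.resolve_right (not_not.2 ⟨y, rfl⟩)
      rw [key]
      simp [h2 i hi]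
    · rw [TM.mul_apply]
      simp [push_apply_of_notMem j hj a (Or.inr hl)]

theorem push_mul {j : Ω → Ω'} (hj : PolyEmb j) {t : TM Ω' A} {q : TM Ω A}
    (h1 : ∀ x y, t.mat (j x) (j y) = q.mat x y) (h2 : ∀ i ∉ range j, ∀ y, t.mat (j y) i = 0)
    (a : TM Ω A) : push j hj a * t = push j hj (a * q) := by
  have := mul_push hj (t := t.tr) (q := q.tr) (fun x y => h1 y x) h2 a.tr
  rw [← push_tr, ← TM.tr_mul, ← TM.tr_mul, ← push_tr] at this
  exact congrArg TM.tr this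

theorem push_mul_push {j : Ω → Ω'} (hj : PolyEmb j) (a b : TM Ω A) :
    push j hj a * push j hj b = push j hj (a * b) :=
  mul_push hj (push_apply j hj a) (fun _ hi _ => push_apply_of_notMem _ _ _ (Or.inl hi)) b

theorem push_mul_push_of_disjoint {j : Ω → Ω'} (hj : PolyEmb j) {l : Ω'' → Ω'} (hl : PolyEmb l)
    (h : ∀ x y, j x ≠ l y) (a : TM Ω A) (b : TM Ω'' A) : push j hj a * push l hl b = 0 := by
  have h1 : ∀ y, l y ∉ range j := by rintro y ⟨z, hz⟩; exact h z y hz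
  rw [mul_push hl (q := 0) (fun x y => push_apply_of_notMem _ _ _ (Or.inr (h1 y)))
    (fun i _ y => push_apply_of_notMem _ _ _ (Or.inr (h1 y))), zero_mul, map_zero]

/-- The relabeling of rapidly decreasing matrices. -/
noncomputable def pushJ (j : Ω → Ω') (hj : PolyEmb j) : RapidMatrix Ω A →L[ℝ] RapidMatrix Ω' A :=
  have key : ∀ (p : {p : Seminorm ℝ A // Continuous p}) (N : ℕ), ∃ (C : ℝ) (M : ℕ), 0 ≤ C ∧
      ∀ (k : RapidMatrix Ω A) (i l : Ω'),
      weight N i l * p.1 ((push j hj (incl k)).mat i l).snd ≤ C * rapidSeminorm p M k := by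
    intro p N
    obtain ⟨C₁, r, hC₁, h₁⟩ := hj.upper
    refine ⟨C₁ ^ N * C₁ ^ N, r * N, by positivity, fun k => forall_range_or (j := j)
      (fun x y => ?_) fun i l h => ?_⟩
    · rw [push_apply, incl_apply, Unitization.snd_inr]
      have h3 := le_rapidSeminorm p (r * N) k x y
      rw [weight_eq] at h3 ⊢
      have hw := wt_pos (j x)
      have hy := wt_pos (j y)
      have hx := wt_pos x
      have hy' := wt_pos y
      calc wt (j x) ^ N * wt (j y) ^ N * p.1 (k.toMatrix x y)
          ≤ (C₁ * wt x ^ r) ^ N * (C₁ * wt y ^ r) ^ N * p.1 (k.toMatrix x y) := by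
            have := h₁ x
            have := h₁ y
            gcongr
        _ = C₁ ^ N * C₁ ^ N * (wt x ^ (r * N) * wt y ^ (r * N) * p.1 (k.toMatrix x y)) := by
            rw [mul_pow, mul_pow, pow_mul, pow_mul]; ring
        _ ≤ _ := by gcongr
    · rw [push_apply_of_notMem _ _ _ h, Unitization.snd_zero, map_zero, mul_zero]
      have := apply_nonneg (rapidSeminorm p (r * N)) k
      positivity
  let L : RapidMatrix Ω A →ₗ[ℝ] RapidMatrix Ω' A :=
    { toFun := fun k => ⟨fun i l => ((push j hj (incl k)).mat i l).snd, fun p hp N => by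
        obtain ⟨C, M, _, h⟩ := key ⟨p, hp⟩ N
        exact ⟨_, h k⟩⟩
      map_add' := fun k l => RapidMatrix.ext fun i m => by
        change ((push j hj (incl (k + l))).mat i m).snd = _
        rw [map_add, map_add]; rfl
      map_smul' := fun c k => RapidMatrix.ext fun i m => by
        change ((push j hj (incl (c • k))).mat i m).snd = _
        rw [map_smul, map_smul]; rfl }
  { L with
    cont := by
      refine continuous_linear_of_seminorm (rapid_withSeminorms Ω' A) L fun ⟨p, N⟩ => ?_
      obtain ⟨C, M, hC, h⟩ := key p N
      obtain ⟨r, hr, hre⟩ := exists_mul_seminorm_eq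
        (continuous_rapidSeminorm (Ω := Ω) p M) hC
      exact ⟨r, hr, fun k => (rapidSeminorm_le p N _ (mul_nonneg hC (apply_nonneg _ _))
        (h k)).trans_eq (hre k).symm⟩ }

@[simp] theorem incl_pushJ (j : Ω → Ω') (hj : PolyEmb j) (k : RapidMatrix Ω A) :
    incl (pushJ j hj k) = push j hj (incl k) := by
  refine TM.ext fun i l => Unitization.ext ?_ rfl
  revert i l
  refine forall_range_or (j := j) (fun x y => ?_) fun i l h => ?_
  · rw [push_apply]; rfl
  · rw [push_apply_of_notMem _ _ _ h]; rfl

/-! ### Tensor products with finite real matrices -/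

/-- The tensor product of a real matrix and a tempered matrix. -/
noncomputable def ten {n : ℕ} : Matrix (Fin n) (Fin n) ℝ →ₗ[ℝ] TM Ω A →ₗ[ℝ] TM (Fin n × Ω) A :=
  have key : ∀ (m : Matrix (Fin n) (Fin n) ℝ) (a : Matrix Ω Ω (Unitization ℝ A)),
      a ∈ colSubmodule Ω A →
      (fun i j : Fin n × Ω => m i.1 j.1 • a i.2 j.2) ∈ colSubmodule (Fin n × Ω) A := by
    intro m a ha p hp N
    obtain ⟨M, C, hC, h⟩ := ha p hp N
    refine ⟨M, (∑ i, ∑ j, |m i j|) * C, by positivity, fun i j => ?_⟩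
    have h1 : |m i.1 j.1| ≤ ∑ i, ∑ j, |m i j| :=
      (Finset.single_le_sum (f := fun l => |m i.1 l|) (fun l _ => abs_nonneg _)
        (Finset.mem_univ j.1)).trans
        (Finset.single_le_sum (f := fun k => ∑ l, |m k l|)
          (fun l _ => Finset.sum_nonneg fun _ _ => abs_nonneg _) (Finset.mem_univ i.1))
    have h2 : wt i = wt i.2 := by simp [wt]
    have h3 : wt j = wt j.2 := by simp [wt]
    have hj := wt_pos j.2
    rw [map_smul_eq_mul, h2, h3, Real.norm_eq_abs, mul_left_comm, mul_assoc]
    exact mul_le_mul h1 (h i.2 j.2) (mul_nonneg (pow_nonneg (wt_pos _).le _) (apply_nonneg _ _))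
      ((abs_nonneg _).trans h1)
  LinearMap.mk₂ ℝ (fun m a => (⟨fun i j => m i.1 j.1 • a.mat i.2 j.2, key m _ a.col,
      key m.transpose _ a.row⟩ : TM (Fin n × Ω) A))
    (fun _ _ _ => TM.ext fun _ _ => add_smul _ _ _)
    (fun _ _ _ => TM.ext fun _ _ => mul_smul _ _ _)
    (fun _ _ _ => TM.ext fun _ _ => smul_add _ _ _)
    (fun c m a => TM.ext fun i j => by
      change m i.1 j.1 • (c • a.mat i.2 j.2) = c • (m i.1 j.1 • a.mat i.2 j.2)
      exact smul_comm _ _ _)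

theorem ten_apply {n : ℕ} (m : Matrix (Fin n) (Fin n) ℝ) (a : TM Ω A) (i j : Fin n × Ω) :
    (ten m a).mat i j = m i.1 j.1 • a.mat i.2 j.2 := rfl

theorem ten_mul_ten {n : ℕ} (m m' : Matrix (Fin n) (Fin n) ℝ) (a b : TM Ω A) :
    ten m a * ten m' b = ten (m * m') (a * b) := by
  refine TM.ext fun i l => ?_
  rw [TM.mul_apply, ten_apply, Matrix.mul_apply, TM.mul_apply]
  have hs := a.summable b i.2 l.2
  have h1 : ∀ j : Fin n × Ω, (ten m a).mat i j * (ten m' b).mat j l =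
      (m i.1 j.1 * m' j.1 l.1) • (a.mat i.2 j.2 * b.mat j.2 l.2) := fun j => by
    rw [ten_apply, ten_apply, smul_mul_smul_comm]
  have h2 : ∀ c : Fin n, HasSum (fun x : Ω => (m i.1 c * m' c l.1) • (a.mat i.2 x * b.mat x l.2))
      ((m i.1 c * m' c l.1) • ∑' x, a.mat i.2 x * b.mat x l.2) :=
    fun c => hs.hasSum.const_smul _
  simp only [h1]
  rw [Finset.sum_smul]
  have h3 := ((ten m a).summable (ten m' b) i l)
  simp only [h1] at h3
  rw [h3.tsum_prod' (fun c => (h2 c).summable), tsum_fintype]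
  exact Finset.sum_congr rfl fun c _ => (h2 c).tsum_eq

theorem ten_one {n : ℕ} (a : TM Ω A) : ten (1 : Matrix (Fin n) (Fin n) ℝ) a = ampR a := by
  refine TM.ext fun i j => ?_
  rw [ten_apply, ampR_apply, Matrix.one_apply]
  split_ifs <;> simp

theorem ten_one_one {n : ℕ} : ten (1 : Matrix (Fin n) (Fin n) ℝ) (1 : TM Ω A) = 1 := by
  rw [ten_one, map_one]

theorem push_ten {n : ℕ} {j : Ω → Ω'} (hj : PolyEmb j) (m : Matrix (Fin n) (Fin n) ℝ) (a : TM Ω A) :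
    push (Prod.map id j) ((PolyEmb.id (Fin n)).prodMap hj) (ten m a) = ten m (push j hj a) := by
  refine TM.ext (forall_range_or (j := Prod.map id j) (fun x y => ?_) fun i l h => ?_)
  · rw [push_apply, ten_apply, ten_apply]
    exact congrArg _ (push_apply j hj a x.2 y.2).symm
  · rw [push_apply_of_notMem _ _ _ h, ten_apply, push_apply_of_notMem, smul_zero]
    refine h.imp ?_ ?_
    · rintro h1 ⟨z, hz⟩
      exact h1 ⟨(i.1, z), Prod.ext rfl hz⟩
    · rintro h1 ⟨z, hz⟩
      exact h1 ⟨(l.1, z), Prod.ext rfl hz⟩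

theorem PolyEmb.prodMk {n : ℕ} (c : Fin n) : PolyEmb fun x : Ω => (c, x) :=
  PolyEmb.of_size (fun x y h => (Prod.ext_iff.1 h).2) fun x => by simp

theorem ten_single {n : ℕ} (c : Fin n) (a : TM Ω A) :
    ten (Matrix.single c c 1) a = push (fun x : Ω => (c, x)) (PolyEmb.prodMk c) a := by
  refine TM.ext (forall_range_or (j := fun x : Ω => (c, x)) (fun x y => ?_) fun i l h => ?_)
  · rw [push_apply, ten_apply]
    simp
  · rw [push_apply_of_notMem _ _ _ h, ten_apply, Matrix.single_apply_of_ne, zero_smul]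
    rintro ⟨h1, h2⟩
    rcases h with h | h
    · exact h ⟨i.2, Prod.ext h1 rfl⟩
    · exact h ⟨l.2, Prod.ext h2 rfl⟩

/-- The tensor product of a real matrix and a rapidly decreasing matrix. -/
noncomputable def tenJ {n : ℕ} (m : Matrix (Fin n) (Fin n) ℝ) :
    RapidMatrix Ω A →L[ℝ] RapidMatrix (Fin n × Ω) A :=
  (lmulL (ten m 1)).comp (∑ c : Fin n, pushJ (fun x : Ω => (c, x)) (PolyEmb.prodMk c))

@[simp] theorem incl_tenJ {n : ℕ} (m : Matrix (Fin n) (Fin n) ℝ) (k : RapidMatrix Ω A) :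
    incl (tenJ m k) = ten m (incl k) := by
  change incl (lmulL (ten m 1) ((∑ c : Fin n, pushJ (fun x : Ω => (c, x)) (PolyEmb.prodMk c)) k)) = _
  rw [incl_lmulL, _root_.sum_apply, map_sum]
  simp only [incl_pushJ, ← ten_single]
  rw [← LinearMap.sum_apply, ← map_sum, ten_mul_ten, one_mul]
  congr 2
  have : (∑ c : Fin n, Matrix.single c c (1 : ℝ)) = 1 := by
    ext i j
    rw [Matrix.sum_apply, Finset.sum_eq_single i, Matrix.one_apply]
    · simp [Matrix.single_apply]
    · intro c _ hc
      rw [Matrix.single_apply_of_row_ne hc]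
    · simp
  rw [this, mul_one]

/-! ### Diagonal matrices -/

theorem inl_mul_eq_smul (c : ℝ) (x : Unitization ℝ A) : Unitization.inl c * x = c • x :=
  Unitization.ext (by simp) (by simp)

/-- The real functions of polynomial growth give diagonal matrices. -/
def diagT (f : Ω → ℝ) (hf : ∃ (C : ℝ) (M : ℕ), 0 ≤ C ∧ ∀ x, |f x| ≤ C * wt x ^ M) : TM Ω A :=
  have key : Matrix.diagonal (fun x => (Unitization.inl (f x) : Unitization ℝ A)) ∈
      colSubmodule Ω A := by
    intro p hp N
    obtain ⟨C, M, hC, h⟩ := hf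
    refine ⟨N + M, C, hC, fun i j => ?_⟩
    have hj := wt_pos j
    by_cases hij : i = j
    · subst hij
      rw [Matrix.diagonal_apply_eq, unitSeminorm_inl, pow_add, mul_left_comm]
      exact mul_le_mul_of_nonneg_left (h i) (by positivity)
    · rw [Matrix.diagonal_apply_ne _ hij, map_zero, mul_zero]
      positivity
  ⟨_, key, by rw [Matrix.diagonal_transpose]; exact key⟩

theorem diagT_mat (f : Ω → ℝ) (hf) : (diagT f hf : TM Ω A).mat =
    Matrix.diagonal (fun x => (Unitization.inl (f x) : Unitization ℝ A)) := rfl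

theorem diagT_mul_apply (f : Ω → ℝ) (hf) (a : TM Ω A) (i j : Ω) :
    (diagT f hf * a).mat i j = f i • a.mat i j := by
  rw [TM.mul_apply, tsum_eq_single i, diagT_mat, Matrix.diagonal_apply_eq]
  · exact inl_mul_eq_smul _ _
  · intro m hm
    rw [diagT_mat, Matrix.diagonal_apply_ne' _ hm, zero_mul]

theorem mul_diagT_apply (f : Ω → ℝ) (hf) (a : TM Ω A) (i j : Ω) :
    (a * diagT f hf).mat i j = f j • a.mat i j := by
  rw [TM.mul_apply, tsum_eq_single j, diagT_mat, Matrix.diagonal_apply_eq, mul_comm]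
  · exact inl_mul_eq_smul _ _
  · intro m hm
    rw [diagT_mat, Matrix.diagonal_apply_ne _ hm, mul_zero]

/-! ### Smooth families -/

variable {E : Type w} [AddCommGroup E] [Module ℝ E] [TopologicalSpace E]
  [IsTopologicalAddGroup E] [ContinuousSMul ℝ E]
variable {E' : Type v} [AddCommGroup E'] [Module ℝ E'] [TopologicalSpace E']
  [IsTopologicalAddGroup E'] [ContinuousSMul ℝ E']

/-- Smooth families of rapidly decreasing matrices. -/
def SJ (S : Set E) (f : E → TM Ω A) : Prop :=
  ∃ U : Set E, IsOpen U ∧ S ⊆ U ∧ ∃ κ : E → RapidMatrix Ω A, (∀ n, IsCk n U κ) ∧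
    ∀ x ∈ S, f x = incl (κ x)

/-- Families which are smooth multipliers of the smooth families of rapidly decreasing matrices. -/
def SM (S : Set E) (f : E → TM Ω A) : Prop :=
  ∀ ⦃Ω' Ω'' : Type⦄ [GrowthIndex Ω'] [GrowthIndex Ω''] [PolyIdx Ω'] [PolyIdx Ω''] [DecidableEq Ω']
    [DecidableEq Ω''] (e : Ω'' ≃ Ω × Ω') (he : PolyEmb e) ⦃g : E → TM Ω'' A⦄, SJ S g →
    SJ S (fun x => amp e he (f x) * g x) ∧ SJ S (fun x => g x * amp e he (f x))

variable {S : Set E}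

theorem SJ.congr {f g : E → TM Ω A} (hf : SJ S f) (h : ∀ x ∈ S, g x = f x) : SJ S g := by
  obtain ⟨U, hU, hSU, κ, hκ, hf⟩ := hf
  exact ⟨U, hU, hSU, κ, hκ, fun x hx => (h x hx).trans (hf x hx)⟩

theorem SJ.const (k : RapidMatrix Ω A) : SJ S fun _ => incl k :=
  ⟨univ, isOpen_univ, subset_univ _, fun _ => k, fun n => IsCk.const k n univ, fun _ _ => rfl⟩

theorem SJ.zero : SJ S fun _ => (0 : TM Ω A) := (SJ.const 0).congr fun _ _ => (map_zero incl).symm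

theorem SJ.clm (L : RapidMatrix Ω A →L[ℝ] RapidMatrix Ω' A) {T : TM Ω A → TM Ω' A}
    (hT : ∀ k, incl (L k) = T (incl k)) {f : E → TM Ω A} (hf : SJ S f) : SJ S fun x => T (f x) := by
  obtain ⟨U, hU, hSU, κ, hκ, hf⟩ := hf
  exact ⟨U, hU, hSU, _, fun n => (hκ n).clm_comp L hU, fun x hx => (congrArg T (hf x hx)).trans (hT _).symm⟩

theorem SJ.bilin (β : RapidMatrix Ω A →ₗ[ℝ] RapidMatrix Ω' A →ₗ[ℝ] RapidMatrix Ω'' A)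
    (hβ : Continuous fun z : RapidMatrix Ω A × RapidMatrix Ω' A => β z.1 z.2)
    {T : TM Ω A → TM Ω' A → TM Ω'' A} (hT : ∀ k l, incl (β k l) = T (incl k) (incl l))
    {f : E → TM Ω A} {g : E → TM Ω' A} (hf : SJ S f) (hg : SJ S g) :
    SJ S fun x => T (f x) (g x) := by
  obtain ⟨U, hU, hSU, κ, hκ, hf⟩ := hf
  obtain ⟨V, hV, hSV, l, hl, hg⟩ := hg
  have hUV := hU.inter hV
  exact ⟨U ∩ V, hUV, subset_inter hSU hSV, _, fun n => IsCk.bilin_comp β hβ hUV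
    ((hκ n).mono inter_subset_left) ((hl n).mono inter_subset_right), fun x hx => by
      beta_reduce; rw [hf x hx, hg x hx, hT]⟩

theorem SJ.add {f g : E → TM Ω A} (hf : SJ S f) (hg : SJ S g) : SJ S fun x => f x + g x := by
  obtain ⟨U, hU, hSU, κ, hκ, hf⟩ := hf
  obtain ⟨V, hV, hSV, l, hl, hg⟩ := hg
  have hUV := hU.inter hV
  exact ⟨U ∩ V, hUV, subset_inter hSU hSV, _, fun n => IsCk.add hUV
    ((hκ n).mono inter_subset_left) ((hl n).mono inter_subset_right), fun x hx => by
      beta_reduce; rw [hf x hx, hg x hx, map_add]⟩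

theorem SJ.smul {c : E → ℝ} (hc : ∀ n, IsCk n univ c) {f : E → TM Ω A} (hf : SJ S f) :
    SJ S fun x => c x • f x := by
  obtain ⟨U, hU, hSU, κ, hκ, hf⟩ := hf
  exact ⟨U, hU, hSU, _, fun n => IsCk.smul hU ((hc n).mono (subset_univ _)) (hκ n), fun x hx => by
    beta_reduce; rw [hf x hx, map_smul]⟩

theorem SJ.neg {f : E → TM Ω A} (hf : SJ S f) : SJ S fun x => -f x :=
  (hf.smul (c := fun _ => -1) fun n => IsCk.const _ n _).congr fun _ _ => by simp

theorem SJ.sub {f g : E → TM Ω A} (hf : SJ S f) (hg : SJ S g) : SJ S fun x => f x - g x :=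
  (hf.add hg.neg).congr fun x _ => sub_eq_add_neg _ _

theorem SJ.sum {ι : Type*} (s : Finset ι) {f : ι → E → TM Ω A} (hf : ∀ i ∈ s, SJ S (f i)) :
    SJ S fun x => ∑ i ∈ s, f i x := by
  classical
  induction s using Finset.induction_on with
  | empty => simpa using SJ.zero
  | insert a s ha ih =>
    refine ((hf a (Finset.mem_insert_self _ _)).add
      (ih fun i hi => hf i (Finset.mem_insert_of_mem hi))).congr fun x _ => ?_
    rw [Finset.sum_insert ha]

protected theorem SJ.push {j : Ω → Ω'} (hj : PolyEmb j) {f : E → TM Ω A} (hf : SJ S f) :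
    SJ S fun x => push j hj (f x) := hf.clm (pushJ j hj) (incl_pushJ j hj)

protected theorem SJ.ten {n : ℕ} (m : Matrix (Fin n) (Fin n) ℝ) {f : E → TM Ω A} (hf : SJ S f) :
    SJ S fun x => ten m (f x) := hf.clm (tenJ m) (incl_tenJ m)

protected theorem SJ.kron {f : E → TM Ω₁ A} {g : E → TM Ω₂ A} (hf : SJ S f) (hg : SJ S g) :
    SJ S fun x => (ampL (f x) * ampR (g x) : TM (Ω₁ × Ω₂) A) :=
  hf.bilin (T := fun a b => ampL a * ampR b) kron continuous_kron incl_kron hg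

theorem SJ.const_mul (t : TM Ω A) {f : E → TM Ω A} (hf : SJ S f) : SJ S fun x => t * f x :=
  hf.clm (lmulL t) (incl_lmulL t)

theorem SJ.mul_const (t : TM Ω A) {f : E → TM Ω A} (hf : SJ S f) : SJ S fun x => f x * t :=
  hf.clm (T := fun k => k * t) (rmulL t) (incl_rmulL t)

theorem SJ.tr {f : E → TM Ω A} (hf : SJ S f) : SJ S fun x => (f x).tr :=
  hf.clm trL incl_tr

theorem SJ.comp {f : E' → TM Ω A} {T : Set E'} (hf : SJ T f) {φ : E → E'} {V : Set E} (hV : IsOpen V)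
    (hφ : ∀ n, IsCk n V φ) (hSV : S ⊆ V) (hm : MapsTo φ S T) :
    SJ S fun x => f (φ x) := by
  obtain ⟨U, hU, hTU, κ, hκ, hf⟩ := hf
  refine ⟨V ∩ φ ⁻¹' U, (hφ 0).continuousOn.isOpen_inter_preimage hV hU, fun x hx =>
    ⟨hSV hx, hTU (hm hx)⟩, fun x => κ (φ x), fun n => ?_, fun x hx => hf _ (hm hx)⟩
  exact (hκ n).comp ((hφ 0).continuousOn.isOpen_inter_preimage hV hU) hU
    ((hφ n).mono inter_subset_left) fun x hx => hx.2

theorem SM.congr {f g : E → TM Ω A} (hf : SM S f) (h : ∀ x ∈ S, g x = f x) : SM S g := by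
  intro Ω' Ω'' _ _ _ _ _ _ e he k hk
  exact ⟨(hf e he hk).1.congr fun x hx => by rw [h x hx],
    (hf e he hk).2.congr fun x hx => by rw [h x hx]⟩

theorem SM.const (t : TM Ω A) : SM S fun _ => t := fun _ _ _ _ _ _ _ _ _ _ _ hg =>
  ⟨hg.const_mul _, hg.mul_const _⟩

theorem SM.add {f g : E → TM Ω A} (hf : SM S f) (hg : SM S g) : SM S fun x => f x + g x := by
  intro Ω' Ω'' _ _ _ _ _ _ e he k hk
  exact ⟨((hf e he hk).1.add (hg e he hk).1).congr fun x _ => by rw [map_add, add_mul],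
    ((hf e he hk).2.add (hg e he hk).2).congr fun x _ => by rw [map_add, mul_add]⟩

theorem SM.mul {f g : E → TM Ω A} (hf : SM S f) (hg : SM S g) : SM S fun x => f x * g x := by
  intro Ω' Ω'' _ _ _ _ _ _ e he k hk
  exact ⟨(hf e he (hg e he hk).1).1.congr fun x _ => by rw [map_mul, mul_assoc],
    (hg e he (hf e he hk).2).2.congr fun x _ => by rw [map_mul, mul_assoc]⟩

theorem SM.smul {c : E → ℝ} (hc : ∀ n, IsCk n univ c) {f : E → TM Ω A} (hf : SM S f) :
    SM S fun x => c x • f x := by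
  intro Ω' Ω'' _ _ _ _ _ _ e he k hk
  exact ⟨((hf e he hk).1.smul hc).congr fun x _ => by rw [map_smul, smul_mul_assoc],
    ((hf e he hk).2.smul hc).congr fun x _ => by rw [map_smul, mul_smul_comm]⟩

theorem SM.sub {f g : E → TM Ω A} (hf : SM S f) (hg : SM S g) : SM S fun x => f x - g x :=
  (hf.add (hg.smul (c := fun _ => -1) fun n => IsCk.const _ n _)).congr fun x _ => by
    rw [neg_smul, one_smul, sub_eq_add_neg]

theorem SM.sum {ι : Type*} (s : Finset ι) {f : ι → E → TM Ω A} (hf : ∀ i ∈ s, SM S (f i)) :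
    SM S fun x => ∑ i ∈ s, f i x := by
  classical
  induction s using Finset.induction_on with
  | empty => simpa using SM.const 0
  | insert a s ha ih =>
    refine ((hf a (Finset.mem_insert_self _ _)).add
      (ih fun i hi => hf i (Finset.mem_insert_of_mem hi))).congr fun x _ => ?_
    rw [Finset.sum_insert ha]

theorem SM.mul_left {f g : E → TM Ω A} (hf : SM S f) (hg : SJ S g) : SJ S fun x => f x * g x := by
  refine (hf (Ω' := Unit) (Equiv.prodUnique Ω Unit).symm
    (PolyEmb.of_size (Equiv.injective _) fun _ => rfl) hg).1.congr fun x _ => ?_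
  congr 1

theorem SM.mul_right {f g : E → TM Ω A} (hf : SM S f) (hg : SJ S g) : SJ S fun x => g x * f x := by
  refine (hf (Ω' := Unit) (Equiv.prodUnique Ω Unit).symm
    (PolyEmb.of_size (Equiv.injective _) fun _ => rfl) hg).2.congr fun x _ => ?_
  congr 1

theorem SJ.sm {f : E → TM Ω A} (hf : SJ S f) : SM S f := by
  intro Ω' Ω'' _ _ _ _ _ _ e he k hk
  have key : ∀ {f : E → TM Ω A} {k : E → TM Ω'' A}, SJ S f → SJ S k →
      SJ S fun x => amp e he (f x) * k x := fun hf hk =>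
    hf.bilin (T := fun a b => amp e he a * b) (ampMul e he) (continuous_ampMul e he)
      (incl_ampMul e he) hk
  refine ⟨key hf hk, (key hf.tr hk.tr).tr.congr fun x _ => ?_⟩
  rw [TM.tr_mul, ← amp_tr, TM.tr_tr, TM.tr_tr]

theorem amp_amp (e : Ω'' ≃ Ω × Ω') (he : PolyEmb e) (e' : Ω₂ ≃ Ω'' × Ω₁) (he' : PolyEmb e')
    (e'' : Ω₂ ≃ Ω × Ω' × Ω₁) (he'' : PolyEmb e'')
    (h : ∀ i, e'' i = ((e (e' i).1).1, (e (e' i).1).2, (e' i).2)) (a : TM Ω A) :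
    amp e' he' (amp e he a) = amp e'' he'' a := by
  refine TM.ext fun i j => ?_
  rw [amp_apply, amp_apply, amp_apply]
  by_cases h1 : (e' i).2 = (e' j).2
  · by_cases h2 : (e (e' i).1).2 = (e (e' j).1).2
    · have h3 : (e'' i).2 = (e'' j).2 := by rw [h, h]; exact Prod.ext h2 h1
      rw [if_pos h1, if_pos h2, if_pos h3, h, h]
    · have h3 : (e'' i).2 ≠ (e'' j).2 := by
        rw [h, h]; exact fun h4 => h2 (Prod.ext_iff.1 h4).1
      rw [if_pos h1, if_neg h2, if_neg h3]
  · have h3 : (e'' i).2 ≠ (e'' j).2 := by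
      rw [h, h]; exact fun h4 => h1 (Prod.ext_iff.1 h4).2
    rw [if_neg h1, if_neg h3]

theorem SM.amp (e : Ω'' ≃ Ω × Ω') (he : PolyEmb e) {f : E → TM Ω A} (hf : SM S f) :
    SM S fun x => amp e he (f x) := by
  intro Ω₃ Ω₄ _ _ _ _ _ _ e' he' k hk
  let e'' := (e'.trans (Equiv.prodCongr e (Equiv.refl _))).trans (Equiv.prodAssoc Ω Ω' Ω₃)
  have he'' : PolyEmb e'' := ((PolyEmb.of_size (Equiv.injective (Equiv.prodAssoc Ω Ω' Ω₃))
    fun x => by simp [add_assoc]).comp (he.prodMap (PolyEmb.id _))).comp he'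
  have heq := amp_amp (A := A) e he e' he' e'' he'' fun i => rfl
  exact ⟨(hf e'' he'' hk).1.congr fun x _ => by rw [heq],
    (hf e'' he'' hk).2.congr fun x _ => by rw [heq]⟩

theorem SM.ampL {f : E → TM Ω₁ A} (hf : SM S f) :
    SM S fun x => (ampL (f x) : TM (Ω₁ × Ω₂) A) := hf.amp _ _

theorem SM.ampR {f : E → TM Ω₂ A} (hf : SM S f) :
    SM S fun x => (ampR (f x) : TM (Ω₁ × Ω₂) A) := hf.amp _ _

theorem ten_eq {n : ℕ} (m : Matrix (Fin n) (Fin n) ℝ) (a : TM Ω A) :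
    ten m a = ∑ i, ∑ j, m i j • ten (Matrix.single i j 1) a := by
  have h := Matrix.matrix_eq_sum_single m
  have h1 : ∀ i j, Matrix.single i j (m i j) = m i j • Matrix.single i j (1 : ℝ) := fun i j => by
    rw [Matrix.smul_single, smul_eq_mul, mul_one]
  simp only [h1] at h
  conv_lhs => rw [h]
  simp only [map_sum, map_smul, LinearMap.sum_apply, LinearMap.smul_apply]

protected theorem SM.ten {n : ℕ} {m : E → Matrix (Fin n) (Fin n) ℝ} (hm : ∀ i j k, IsCk k univ fun x => m x i j)
    {f : E → TM Ω A} (hf : SM S f) : SM S fun x => ten (m x) (f x) :=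
  (SM.sum Finset.univ fun i _ => SM.sum Finset.univ fun j _ =>
    ((SM.const (ten (Matrix.single i j 1) 1)).mul hf.ampR).smul (hm i j)).congr
      fun x _ => by
        rw [ten_eq]
        simp_rw [← ten_one, ten_mul_ten, mul_one, one_mul]

theorem SJ.ten_smooth {n : ℕ} {m : E → Matrix (Fin n) (Fin n) ℝ}
    (hm : ∀ i j k, IsCk k univ fun x => m x i j)
    {f : E → TM Ω A} (hf : SJ S f) : SJ S fun x => ten (m x) (f x) :=
  (SJ.sum Finset.univ fun i _ => SJ.sum Finset.univ fun j _ =>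
    (hf.ten (Matrix.single i j 1)).smul (hm i j)).congr fun _ _ => ten_eq _ _

end RapidIdeal

/-! ### Integrals of continuous curves -/

section Integral

variable {F : Type u} [AddCommGroup F] [Module ℝ F] [TopologicalSpace F] [IsTopologicalAddGroup F]
  [ContinuousSMul ℝ F] [PolynormableSpace ℝ F]
variable {G : Type v} [AddCommGroup G] [Module ℝ G] [TopologicalSpace G] [IsTopologicalAddGroup G]
  [ContinuousSMul ℝ G] [PolynormableSpace ℝ G]

theorem exists_clm_le_seminorm {p : Seminorm ℝ F} (hp : Continuous p) (y : F) :
    ∃ l : F →L[ℝ] ℝ, (∀ x, |l x| ≤ p x) ∧ l y = p y := by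
  obtain ⟨l, hl, hy⟩ := exists_linear_le_seminorm p y
  have hc : Continuous l := by
    refine continuous_of_continuousAt_zero l ?_
    rw [ContinuousAt, map_zero]
    exact squeeze_zero_norm hl (by simpa using hp.tendsto 0)
  exact ⟨⟨l, hc⟩, hl, hy⟩

theorem eq_of_forall_clm [T2Space F] {x y : F} (h : ∀ l : F →L[ℝ] ℝ, l x = l y) : x = y := by
  rw [← sub_eq_zero]
  refine seminorm_separating fun p hp => ?_
  obtain ⟨l, _, hy⟩ := exists_clm_le_seminorm hp (x - y)
  rw [← hy, map_sub, h, sub_self]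

theorem exists_riemann_sum_bound {f : ℝ → F} (hf : ContinuousOn f (Icc 0 1)) {p : Seminorm ℝ F}
    (hp : Continuous p) {ε : ℝ} (hε : 0 < ε) : ∃ N : ℕ, ∀ n ≥ N, ∀ l : F →L[ℝ] ℝ,
      (∀ x, |l x| ≤ p x) →
      |l (((n : ℝ) + 1)⁻¹ • ∑ k ∈ Finset.range (n + 1), f ((k : ℝ) / (n + 1))) -
        ∫ s in (0 : ℝ)..1, l (f s)| ≤ ε := by
  have hφ : ContinuousOn (fun z : ℝ × ℝ => p (f z.1 - f z.2)) (Icc 0 1 ×ˢ Icc 0 1) :=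
    hp.comp_continuousOn ((hf.comp continuousOn_fst fun z hz => hz.1).sub
      (hf.comp continuousOn_snd fun z hz => hz.2))
  have hu := (isCompact_Icc.prod isCompact_Icc).uniformContinuousOn_of_continuous hφ
  rw [Metric.uniformContinuousOn_iff] at hu
  obtain ⟨δ, hδ, hu⟩ := hu ε hε
  obtain ⟨N, hN⟩ := exists_nat_one_div_lt hδ
  refine ⟨N, fun n hn l hl => ?_⟩
  have hn0 : (0 : ℝ) < n + 1 := by positivity
  have hsmall : 1 / ((n : ℝ) + 1) < δ := by
    refine lt_of_le_of_lt ?_ hN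
    have : (N : ℝ) ≤ n := by exact_mod_cast hn
    gcongr
  have hlf : ContinuousOn (fun s => l (f s)) (Icc 0 1) := l.continuous.comp_continuousOn hf
  let a : ℕ → ℝ := fun k => (k : ℝ) / (n + 1)
  have ha : ∀ k ≤ n + 1, a k ∈ 𝕀 := by
    intro k hk
    refine ⟨by positivity, ?_⟩
    rw [div_le_one hn0]
    exact_mod_cast hk
  have hstep : ∀ k, a (k + 1) - a k = 1 / ((n : ℝ) + 1) := by
    intro k; simp only [a]; push_cast; ring
  have hle : ∀ k, a k ≤ a (k + 1) := by
    intro k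
    have := hstep k
    have : 0 < 1 / ((n : ℝ) + 1) := by positivity
    linarith
  have hint : ∀ k < n + 1, IntervalIntegrable (fun s => l (f s)) MeasureTheory.volume (a k)
      (a (k + 1)) := by
    intro k hk
    refine (hlf.mono ?_).intervalIntegrable
    rw [uIcc_of_le (hle k)]
    exact Icc_subset_Icc (ha k hk.le).1 (ha (k + 1) hk).2
  have hsum := intervalIntegral.sum_integral_adjacent_intervals hint
  have ha0 : a 0 = 0 := by simp [a]
  have ha1 : a (n + 1) = 1 := by simp only [a]; push_cast; exact div_self hn0.ne'
  rw [ha0, ha1] at hsum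
  rw [← hsum, map_smul, map_sum, smul_eq_mul, Finset.mul_sum, ← Finset.sum_sub_distrib]
  have hterm : ∀ k ∈ Finset.range (n + 1),
      |((n : ℝ) + 1)⁻¹ * l (f ((k : ℝ) / (n + 1))) - ∫ s in a k..a (k + 1), l (f s)| ≤
        ε * (1 / ((n : ℝ) + 1)) := by
    intro k hk
    have hk' := Finset.mem_range.1 hk
    have h1 : ∫ s in a k..a (k + 1), (l (f s) - l (f (a k))) =
        (∫ s in a k..a (k + 1), l (f s)) - ((n : ℝ) + 1)⁻¹ * l (f (a k)) := by
      rw [intervalIntegral.integral_sub (hint k hk') intervalIntegrable_const,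
        intervalIntegral.integral_const, hstep, smul_eq_mul, one_div]
    rw [abs_sub_comm]
    change |(∫ s in a k..a (k + 1), l (f s)) - ((n : ℝ) + 1)⁻¹ * l (f (a k))| ≤ _
    rw [← h1]
    have h2 := intervalIntegral.norm_integral_le_of_norm_le_const (a := a k) (b := a (k + 1))
      (f := fun s => l (f s) - l (f (a k))) (C := ε) (by
        intro s hs
        rw [uIoc_of_le (hle k)] at hs
        have hs1 : s ∈ 𝕀 :=
          ⟨(ha k hk'.le).1.trans hs.1.le, hs.2.trans (ha (k + 1) hk').2⟩
        have h3 := hu (s, a k) ⟨hs1, ha k hk'.le⟩ (a k, a k) ⟨ha k hk'.le, ha k hk'.le⟩ (by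
          rw [Prod.dist_eq, max_lt_iff]
          refine ⟨?_, by simpa using hδ⟩
          rw [Real.dist_eq, abs_of_pos (sub_pos.2 hs.1)]
          have := hstep k
          linarith [hs.2])
        simp only [sub_self, map_zero, dist_zero_right] at h3
        rw [Real.norm_eq_abs, ← map_sub]
        exact (hl _).trans ((le_abs_self _).trans h3.le))
    rw [hstep, abs_of_pos (by positivity : 0 < 1 / ((n : ℝ) + 1))] at h2
    exact h2
  refine (Finset.abs_sum_le_sum_abs _ _).trans ((Finset.sum_le_sum hterm).trans ?_)
  rw [Finset.sum_const, Finset.card_range, nsmul_eq_mul]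
  push_cast
  apply le_of_eq
  field_simp

theorem exists_integral (hF : SeqComplete F) {f : ℝ → F} (hf : ContinuousOn f (Icc 0 1)) :
    ∃ v : F, ∀ l : F →L[ℝ] ℝ, l v = ∫ s in (0 : ℝ)..1, l (f s) := by
  obtain ⟨v, hv⟩ := hF.exists_tendsto
    (fun n : ℕ => ((n : ℝ) + 1)⁻¹ • ∑ k ∈ Finset.range (n + 1), f ((k : ℝ) / (n + 1))) (by
      intro p hp ε hε
      obtain ⟨N, hN⟩ := exists_riemann_sum_bound hf hp (ε := ε / 3) (by positivity)
      refine ⟨N, fun m hm n hn => ?_⟩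
      obtain ⟨l, hl, hy⟩ := exists_clm_le_seminorm hp
        (((m : ℝ) + 1)⁻¹ • ∑ k ∈ Finset.range (m + 1), f ((k : ℝ) / (m + 1)) -
          ((n : ℝ) + 1)⁻¹ • ∑ k ∈ Finset.range (n + 1), f ((k : ℝ) / (n + 1)))
      rw [← hy, map_sub]
      have h1 := abs_le.1 (hN m hm l hl)
      have h2 := abs_le.1 (hN n hn l hl)
      linarith [h1.1, h1.2, h2.1, h2.2])
  refine ⟨v, fun l => ?_⟩
  have h1 := (l.continuous.tendsto v).comp hv
  refine tendsto_nhds_unique h1 ?_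
  have hp : Continuous ((normSeminorm ℝ ℝ).comp (l : F →ₗ[ℝ] ℝ)) := by
    exact (continuous_norm.comp l.continuous)
  rw [Metric.tendsto_nhds]
  intro ε hε
  obtain ⟨N, hN⟩ := exists_riemann_sum_bound hf hp (half_pos hε)
  filter_upwards [eventually_ge_atTop N] with n hn
  rw [Real.dist_eq]
  exact (hN n hn l fun x => le_rfl).trans_lt (half_lt_self hε)

/-- The integral of a continuous curve over the unit interval. -/
noncomputable def wint (f : ℝ → F) : F :=
  Classical.epsilon fun v : F => ∀ l : F →L[ℝ] ℝ, l v = ∫ s in (0 : ℝ)..1, l (f s)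

theorem clm_wint (hF : SeqComplete F) {f : ℝ → F} (hf : ContinuousOn f (Icc 0 1))
    (l : F →L[ℝ] ℝ) : l (wint f) = ∫ s in (0 : ℝ)..1, l (f s) :=
  Classical.epsilon_spec (exists_integral hF hf) l

theorem clm_intervalIntegrable {f : ℝ → F} (hf : ContinuousOn f (Icc 0 1)) (l : F →L[ℝ] ℝ) {a b : ℝ}
    (ha : a ∈ 𝕀) (hb : b ∈ 𝕀) :
    IntervalIntegrable (fun s => l (f s)) MeasureTheory.volume a b :=
  ((l.continuous.comp_continuousOn hf).mono (ordConnected_Icc.uIcc_subset ha hb)).intervalIntegrable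

theorem zero_mem_I : (0 : ℝ) ∈ 𝕀 := ⟨le_rfl, zero_le_one⟩
theorem one_mem_I : (1 : ℝ) ∈ 𝕀 := ⟨zero_le_one, le_rfl⟩

theorem wint_le (hF : SeqComplete F) {f : ℝ → F} (hf : ContinuousOn f (Icc 0 1))
    {p : Seminorm ℝ F} (hp : Continuous p) {C : ℝ} (h : ∀ s ∈ 𝕀, p (f s) ≤ C) :
    p (wint f) ≤ C := by
  obtain ⟨l, hl, hy⟩ := exists_clm_le_seminorm hp (wint f)
  rw [← hy, clm_wint hF hf]
  have h2 := intervalIntegral.norm_integral_le_of_norm_le_const (a := (0 : ℝ)) (b := 1)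
    (f := fun s => l (f s)) (C := C) (by
      intro s hs
      rw [uIoc_of_le zero_le_one] at hs
      exact (hl _).trans (h s ⟨hs.1.le, hs.2⟩))
  simp only [sub_zero, abs_one, mul_one] at h2
  exact (le_abs_self _).trans h2

variable [T2Space F] [T2Space G]

theorem wint_sub (hF : SeqComplete F) {f g : ℝ → F} (hf : ContinuousOn f (Icc 0 1))
    (hg : ContinuousOn g (Icc 0 1)) : wint (fun s => f s - g s) = wint f - wint g := by
  refine eq_of_forall_clm fun l => ?_
  rw [map_sub, clm_wint hF (f := fun s => f s - g s) (hf.sub hg), clm_wint hF hf, clm_wint hF hg,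
    ← intervalIntegral.integral_sub (clm_intervalIntegrable hf l zero_mem_I one_mem_I)
      (clm_intervalIntegrable hg l zero_mem_I one_mem_I)]
  simp only [map_sub]

theorem wint_smul (hF : SeqComplete F) {f : ℝ → F} (hf : ContinuousOn f (Icc 0 1)) (c : ℝ) :
    wint (fun s => c • f s) = c • wint f := by
  refine eq_of_forall_clm fun l => ?_
  rw [map_smul, clm_wint hF (f := fun s => c • f s) (hf.const_smul c), clm_wint hF hf, smul_eq_mul,
    ← intervalIntegral.integral_const_mul]
  simp only [map_smul, smul_eq_mul]

/-- Integrals converge if the integrands converge jointly. -/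
theorem tendsto_wint (hF : SeqComplete F) {X : Type*} {L : Filter X} {f : X → ℝ → F} {d : ℝ → F}
    (hd : ContinuousOn d (Icc 0 1)) (hf : ∀ᶠ x in L, ContinuousOn (f x) (Icc 0 1))
    (h : ∀ s ∈ 𝕀,
      Tendsto (fun z : X × ℝ => f z.1 z.2) (L ×ˢ 𝓝[Icc 0 1] s) (𝓝 (d s))) :
    Tendsto (fun x => wint (f x)) L (𝓝 (wint d)) := by
  rw [tendsto_iff_seminorm]
  intro p hp ε hε
  have key : ∀ᶠ z in L ×ˢ 𝓝ˢ (𝕀), z.2 ∈ 𝕀 →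
      p (f z.1 z.2 - d z.2) < ε / 2 := by
    rw [isCompact_Icc.prod_nhdsSet_eq_biSup]
    simp only [eventually_iSup]
    intro s hs
    have h1 := (h s hs).sub ((hd s hs).tendsto.comp tendsto_snd)
    rw [sub_self] at h1
    have h2 := (tendsto_iff_seminorm.1 h1) p hp (ε / 2) (half_pos hε)
    simp only [sub_zero] at h2
    obtain ⟨t₁, ht₁, t₂, ht₂, h3⟩ := mem_prod_iff.1 h2
    obtain ⟨u, hu, hut⟩ := mem_nhdsWithin_iff_exists_mem_nhds_inter.1 ht₂
    exact Filter.mem_of_superset (prod_mem_prod ht₁ hu) fun z hz hzI =>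
      h3 ⟨hz.1, hut ⟨hz.2, hzI⟩⟩
  filter_upwards [hf, key.curry] with x hx hx2
  rw [← wint_sub hF hx hd]
  refine (wint_le hF (hx.sub hd) hp (C := ε / 2) fun s hs => ?_).trans_lt (half_lt_self hε)
  have h3 : ∀ᶠ y in 𝓟 (𝕀), y ∈ 𝕀 → p (f x y - d y) < ε / 2 :=
    hx2.filter_mono principal_le_nhdsSet
  exact (eventually_principal.1 h3 s hs hs).le

/-! ### Antiderivatives -/

/-- The antiderivative which vanishes at zero. -/
noncomputable def anti (f : ℝ → F) (t : ℝ) : F := wint fun s => t • f (t * s)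

theorem mul_mem_I {s t : ℝ} (hs : s ∈ 𝕀) (ht : t ∈ 𝕀) :
    s * t ∈ 𝕀 := ⟨mul_nonneg hs.1 ht.1, mul_le_one₀ hs.2 ht.1 ht.2⟩

theorem continuousOn_anti_integrand {f : ℝ → F} (hf : ContinuousOn f (Icc 0 1)) {t : ℝ}
    (ht : t ∈ 𝕀) : ContinuousOn (fun s => t • f (t * s)) (Icc 0 1) :=
  (hf.comp (by fun_prop) fun _ hs => mul_mem_I ht hs).const_smul t

theorem clm_anti (hF : SeqComplete F) {f : ℝ → F} (hf : ContinuousOn f (Icc 0 1))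
    (l : F →L[ℝ] ℝ) {t : ℝ} (ht : t ∈ 𝕀) :
    l (anti f t) = ∫ s in (0 : ℝ)..t, l (f s) := by
  rw [anti, clm_wint hF (continuousOn_anti_integrand hf ht)]
  simp only [map_smul, smul_eq_mul]
  rw [intervalIntegral.integral_const_mul,
    intervalIntegral.mul_integral_comp_mul_left (f := fun s => l (f s))]
  simp

theorem anti_zero (hF : SeqComplete F) {f : ℝ → F} (hf : ContinuousOn f (Icc 0 1)) :
    anti f 0 = 0 := by
  refine eq_of_forall_clm fun l => ?_
  rw [clm_anti hF hf l zero_mem_I]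
  simp

theorem anti_sub (hF : SeqComplete F) {f g : ℝ → F} (hf : ContinuousOn f (Icc 0 1))
    (hg : ContinuousOn g (Icc 0 1)) {t : ℝ} (ht : t ∈ 𝕀) :
    anti (fun s => f s - g s) t = anti f t - anti g t := by
  rw [anti, anti, anti, ← wint_sub hF (continuousOn_anti_integrand hf ht)
    (continuousOn_anti_integrand hg ht)]
  simp only [smul_sub]

theorem anti_le (hF : SeqComplete F) {f : ℝ → F} (hf : ContinuousOn f (Icc 0 1))
    {p : Seminorm ℝ F} (hp : Continuous p) {C : ℝ} (h : ∀ s ∈ 𝕀, p (f s) ≤ C)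
    {t : ℝ} (ht : t ∈ 𝕀) : p (anti f t) ≤ C := by
  have hC : 0 ≤ C := (apply_nonneg p _).trans (h 0 zero_mem_I)
  refine wint_le hF (continuousOn_anti_integrand hf ht) hp fun s hs => ?_
  rw [map_smul_eq_mul, Real.norm_eq_abs, abs_of_nonneg ht.1]
  exact (mul_le_mul ht.2 (h _ (mul_mem_I ht hs)) (apply_nonneg _ _) zero_le_one).trans_eq
    (one_mul C)

theorem hasCurveDeriv_anti (hF : SeqComplete F) {f : ℝ → F} (hf : ContinuousOn f (Icc 0 1)) {t : ℝ}
    (ht : t ∈ 𝕀) : HasCurveDeriv (anti f) (f t) (Icc 0 1) t := by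
  rw [HasCurveDeriv, tendsto_iff_seminorm]
  intro p hp ε hε
  have h1 := (tendsto_iff_seminorm.1 (hf t ht).tendsto) p hp (ε / 2) (half_pos hε)
  obtain ⟨δ, hδ, h1⟩ := Metric.mem_nhdsWithin_iff.1 h1
  filter_upwards [self_mem_nhdsWithin, mem_nhdsWithin_of_mem_nhds (Metric.ball_mem_nhds t hδ)]
    with s hs hsδ
  obtain ⟨l, hl, hy⟩ := exists_clm_le_seminorm hp ((s - t)⁻¹ • (anti f s - anti f t) - f t)
  have hst : s - t ≠ 0 := sub_ne_zero.2 hs.2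
  rw [← hy, map_sub, map_smul, map_sub, clm_anti hF hf l hs.1, clm_anti hF hf l ht, smul_eq_mul,
    intervalIntegral.integral_interval_sub_left
      (clm_intervalIntegrable hf l zero_mem_I hs.1) (clm_intervalIntegrable hf l zero_mem_I ht)]
  have h2 : ∫ u in t..s, (l (f u) - l (f t)) = (∫ u in t..s, l (f u)) - (s - t) * l (f t) := by
    rw [intervalIntegral.integral_sub (clm_intervalIntegrable hf l ht hs.1)
      intervalIntegrable_const, intervalIntegral.integral_const, smul_eq_mul]
  have h3 : (s - t)⁻¹ * (∫ u in t..s, l (f u)) - l (f t) =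
      (s - t)⁻¹ * ∫ u in t..s, (l (f u) - l (f t)) := by
    rw [h2]; field_simp
  rw [h3]
  have h4 := intervalIntegral.norm_integral_le_of_norm_le_const (a := t) (b := s)
    (f := fun u => l (f u) - l (f t)) (C := ε / 2) (by
      intro u hu
      have hu1 : u ∈ 𝕀 := ordConnected_Icc.uIcc_subset ht hs.1 (uIoc_subset_uIcc hu)
      have hu2 : u ∈ Metric.ball t δ := by
        rw [Metric.mem_ball, Real.dist_eq] at hsδ ⊢
        exact (abs_sub_left_of_mem_uIcc (uIoc_subset_uIcc hu)).trans_lt hsδ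
      rw [Real.norm_eq_abs, ← map_sub]
      exact (hl _).trans (h1 ⟨hu2, hu1⟩).le)
  refine (le_abs_self _).trans_lt ?_
  rw [abs_mul, abs_inv]
  have h5 : 0 < |s - t| := abs_pos.2 hst
  rw [Real.norm_eq_abs] at h4
  calc |s - t|⁻¹ * |∫ u in t..s, (l (f u) - l (f t))| ≤ |s - t|⁻¹ * (ε / 2 * |s - t|) := by gcongr
    _ = ε / 2 := by field_simp
    _ < ε := half_lt_self hε

theorem HasCurveDeriv.continuousWithinAt {γ : ℝ → F} {v : F} {S : Set ℝ} {t : ℝ}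
    (h : HasCurveDeriv γ v S t) : ContinuousWithinAt γ S t := by
  have h1 : Tendsto (fun s : ℝ => (s - t) • ((s - t)⁻¹ • (γ s - γ t)) + γ t) (𝓝[S \ {t}] t)
      (𝓝 ((t - t) • v + γ t)) := by
    refine ((Tendsto.smul ?_ h).add tendsto_const_nhds)
    exact ((tendsto_id.sub_const t).mono_left nhdsWithin_le_nhds)
  rw [sub_self, zero_smul, zero_add] at h1
  have h2 : ContinuousWithinAt γ (S \ {t}) t := by
    refine h1.congr' ?_
    filter_upwards [self_mem_nhdsWithin] with s hs
    rw [smul_smul, mul_inv_cancel₀ (sub_ne_zero.2 hs.2), one_smul, sub_add_cancel]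
  exact continuousWithinAt_sdiff_self.1 h2

theorem seminorm_le_gronwallBound {p : Seminorm ℝ F} (hp : Continuous p) {γ γ' : ℝ → F}
    (hγ : ∀ t ∈ 𝕀, HasCurveDeriv γ (γ' t) (Icc 0 1) t) {δ K ε : ℝ} (h0 : p (γ 0) ≤ δ)
    (hle : ∀ t ∈ 𝕀, p (γ' t) ≤ K * p (γ t) + ε) {t : ℝ} (ht : t ∈ 𝕀) :
    p (γ t) ≤ gronwallBound δ K ε t := by
  have := le_gronwallBound_of_liminf_deriv_right_le (f := fun t => p (γ t)) (f' := fun t => p (γ' t))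
    (a := 0) (b := 1) (δ := δ) (K := K) (ε := ε)
    (hp.comp_continuousOn fun t ht => (hγ t ht).continuousWithinAt) (by
      intro x hx r hr
      have h1 : Tendsto (fun z => p ((z - x)⁻¹ • (γ z - γ x))) (𝓝[Icc 0 1 \ {x}] x)
          (𝓝 (p (γ' x))) := (hp.tendsto _).comp (hγ x ⟨hx.1, hx.2.le⟩)
      have h2 : 𝓝[Ioo x 1] x ≤ 𝓝[Icc 0 1 \ {x}] x :=
        nhdsWithin_mono _ fun z hz => ⟨⟨hx.1.trans hz.1.le, hz.2.le⟩, hz.1.ne'⟩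
      rw [nhdsWithin_Ioo_eq_nhdsGT hx.2] at h2
      refine Eventually.frequently ?_
      filter_upwards [(h1.mono_left h2).eventually (gt_mem_nhds hr), self_mem_nhdsWithin]
        with z hz hzx
      refine lt_of_le_of_lt ?_ hz
      have hzx' : 0 < z - x := sub_pos.2 hzx
      rw [map_smul_eq_mul, Real.norm_eq_abs, abs_of_pos (inv_pos.2 hzx')]
      refine mul_le_mul_of_nonneg_left ?_ (inv_pos.2 hzx').le
      have := map_sub_le_add p (γ z) (γ x)
      have h5 := map_add_le_add p (γ z - γ x) (γ x)
      rw [sub_add_cancel] at h5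
      linarith) h0 (fun x hx => hle x ⟨hx.1, hx.2.le⟩) t ht
  simpa using this

theorem eq_of_hasCurveDeriv {γ η γ' : ℝ → F}
    (hγ : ∀ t ∈ 𝕀, HasCurveDeriv γ (γ' t) (Icc 0 1) t)
    (hη : ∀ t ∈ 𝕀, HasCurveDeriv η (γ' t) (Icc 0 1) t) (h0 : γ 0 = η 0) {t : ℝ}
    (ht : t ∈ 𝕀) : γ t = η t := by
  rw [← sub_eq_zero]
  refine seminorm_separating fun p hp => le_antisymm ?_ (apply_nonneg p _)
  have := seminorm_le_gronwallBound hp (γ := fun t => γ t - η t) (γ' := fun t => γ' t - γ' t)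
    (δ := 0) (K := 0) (ε := 0) (fun t ht => by
      refine ((hγ t ht).sub (hη t ht)).congr fun s => ?_
      rw [← smul_sub, sub_sub_sub_comm]) (by simp [h0]) (fun t _ => by simp) ht
  rwa [gronwallBound_ε0_δ0] at this

/-! ### Parametric integrals -/

theorem continuousOn_slice {Y : Type w} [TopologicalSpace Y] {V : Set Y} {W : Set (Y × ℝ)}
    (hVW : V ×ˢ 𝕀 ⊆ W) {f : Y × ℝ → F} (hf : ContinuousOn f W) {y : Y} (hy : y ∈ V) :
    ContinuousOn (fun s => f (y, s)) (Icc 0 1) :=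
  hf.comp (by fun_prop) fun _ hs => hVW ⟨hy, hs⟩

protected theorem IsCk.wint (hF : SeqComplete F) (n : ℕ) {Y : Type w} [AddCommGroup Y] [Module ℝ Y]
    [TopologicalSpace Y] [IsTopologicalAddGroup Y] [ContinuousSMul ℝ Y] {V : Set Y} (hV : IsOpen V)
    {W : Set (Y × ℝ)} (hW : IsOpen W) (hVW : V ×ˢ 𝕀 ⊆ W) {f : Y × ℝ → F}
    (hf : IsCk n W f) : IsCk n V fun y => wint fun s => f (y, s) := by
  have hcont : ∀ {Y : Type w} [TopologicalSpace Y] {V : Set Y} {W : Set (Y × ℝ)}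
      (_ : V ×ˢ 𝕀 ⊆ W) {f : Y × ℝ → F} (_ : ContinuousOn f W),
      ContinuousOn (fun y => wint fun s => f (y, s)) V := by
    intro Y _ V W hVW f hf y hy
    refine tendsto_wint hF (continuousOn_slice hVW hf hy) ?_ fun s hs => ?_
    · filter_upwards [self_mem_nhdsWithin] with z hz
      exact continuousOn_slice hVW hf hz
    · rw [← nhdsWithin_prod_eq]
      exact (hf (y, s) (hVW ⟨hy, hs⟩)).tendsto.mono_left (nhdsWithin_mono _ hVW)
  induction n generalizing Y with
  | zero => exact hcont hVW hf.continuousOn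
  | succ n ih =>
    obtain ⟨hfc, df, hd, hdf⟩ := hf
    refine ⟨hcont hVW hfc, fun z => wint fun s => df ((z.1, s), (z.2, 0)),
      fun y hy h => ?_, ?_⟩
    · have h1 : Tendsto (fun t : ℝ => wint fun s =>
          t⁻¹ • (f (y + t • h, s) - f (y, s))) (𝓝[≠] 0)
          (𝓝 (wint fun s => df ((y, s), (h, 0)))) := by
        refine tendsto_wint hF ?_ ?_ fun s hs => ?_
        · exact hdf.continuousOn.comp (by fun_prop) fun s hs => ⟨hVW ⟨hy, hs⟩, mem_univ _⟩
        · filter_upwards [eventually_add_smul_mem hV hy h] with t ht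
          exact ((continuousOn_slice hVW hfc ht).sub (continuousOn_slice hVW hfc hy)).const_smul _
        · have h2 := tendsto_diffQuot hW hd hdf.continuousOn (hVW ⟨hy, hs⟩ : (y, s) ∈ W) (h, 0)
          have h3 : Tendsto (fun z : ℝ × ℝ => (((y, z.2), ((h, 0) : Y × ℝ)), z.1))
              (𝓝[≠] 0 ×ˢ 𝓝[Icc 0 1] s) (𝓝 (((y, s), (h, 0)) : (Y × ℝ) × (Y × ℝ)) ×ˢ 𝓝[≠] 0) := by
            refine Tendsto.prodMk ?_ tendsto_fst
            have : Tendsto (fun r : ℝ => (((y, r), (h, 0)) : (Y × ℝ) × (Y × ℝ))) (𝓝 s)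
                (𝓝 ((y, s), (h, 0))) := Continuous.tendsto (by fun_prop) s
            exact (this.mono_left nhdsWithin_le_nhds).comp tendsto_snd
          refine (h2.comp h3).congr fun z => ?_
          simp
      refine h1.congr' ?_
      filter_upwards [eventually_add_smul_mem hV hy h] with t ht
      rw [wint_smul hF (f := fun s => f (y + t • h, s) - f (y, s))
        ((continuousOn_slice hVW hfc ht).sub (continuousOn_slice hVW hfc hy)),
        wint_sub hF (continuousOn_slice hVW hfc ht) (continuousOn_slice hVW hfc hy)]
    · let L : (Y × Y) × ℝ →L[ℝ] (Y × ℝ) × (Y × ℝ) :=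
        (((ContinuousLinearMap.fst ℝ Y Y).comp (ContinuousLinearMap.fst ℝ _ _)).prod
          (ContinuousLinearMap.snd ℝ (Y × Y) ℝ)).prod
        (((ContinuousLinearMap.snd ℝ Y Y).comp (ContinuousLinearMap.fst ℝ _ _)).prod 0)
      have hW' : IsOpen (L ⁻¹' (W ×ˢ univ)) := (hW.prod isOpen_univ).preimage L.continuous
      refine ih (Y := Y × Y) (hV.prod isOpen_univ) hW' ?_
        (f := fun z => df (L z)) ?_
      · rintro ⟨⟨y, h⟩, s⟩ ⟨⟨hy, _⟩, hs⟩
        exact ⟨hVW ⟨hy, hs⟩, mem_univ _⟩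
      · exact hdf.comp hW' (hW.prod isOpen_univ) (IsCk.clm L n _) (mapsTo_preimage _ _)

/-! ### Linear differential equations -/

theorem HasCurveDeriv.add {γ η : ℝ → F} {v w : F} {S : Set ℝ} {t : ℝ} (hγ : HasCurveDeriv γ v S t)
    (hη : HasCurveDeriv η w S t) : HasCurveDeriv (fun s => γ s + η s) (v + w) S t := by
  refine (Tendsto.add hγ hη).congr fun s => ?_
  rw [← smul_add, add_sub_add_comm]

theorem HasCurveDeriv.sub {γ η : ℝ → F} {v w : F} {S : Set ℝ} {t : ℝ} (hγ : HasCurveDeriv γ v S t)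
    (hη : HasCurveDeriv η w S t) : HasCurveDeriv (fun s => γ s - η s) (v - w) S t := by
  refine (Tendsto.sub hγ hη).congr fun s => ?_
  rw [← smul_sub, sub_sub_sub_comm]

theorem exists_linear_ode (hF : SeqComplete F) {c : ℝ → F} (hc : ContinuousOn c (Icc 0 1))
    (Λ : ℝ → F →ₗ[ℝ] F)
    (hΛ : ∀ u : ℝ → F, ContinuousOn u (Icc 0 1) → ContinuousOn (fun t => Λ t (u t)) (Icc 0 1))
    (hb : ∀ p : Seminorm ℝ F, Continuous p → ∃ q : Seminorm ℝ F, Continuous q ∧ p ≤ q ∧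
      ∃ K : ℝ, 0 ≤ K ∧ ∀ t ∈ 𝕀, ∀ u, q (Λ t u) ≤ K * q u) :
    ∃ u : ℝ → F, u 0 = 0 ∧ ∀ t ∈ 𝕀, HasCurveDeriv u (c t + Λ t (u t)) (Icc 0 1) t := by
  let S : ℕ → ℝ → F := fun n => Nat.rec (fun _ => 0) (fun _ f => anti fun s => c s + Λ s (f s)) n
  have hS : ∀ n, S (n + 1) = anti fun s => c s + Λ s (S n s) := fun n => rfl
  have hI : ∀ u : ℝ → F, ContinuousOn u (Icc 0 1) →
      ContinuousOn (fun s => c s + Λ s (u s)) (Icc 0 1) := fun u hu => hc.add (hΛ u hu)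
  have hanti : ∀ u : ℝ → F, ContinuousOn u (Icc 0 1) → ContinuousOn (anti u) (Icc 0 1) :=
    fun u hu t ht => (hasCurveDeriv_anti hF hu ht).continuousWithinAt
  have hSc : ∀ n, ContinuousOn (S n) (Icc 0 1) := by
    intro n
    induction n with
    | zero => exact continuousOn_const
    | succ n ih => rw [hS]; exact hanti _ (hI _ ih)
  have hSd : ∀ n, ∀ t ∈ 𝕀, HasCurveDeriv (S (n + 1)) (c t + Λ t (S n t)) (Icc 0 1) t :=
    fun n t ht => hasCurveDeriv_anti hF (hI _ (hSc n)) ht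
  have hS0 : ∀ n, S n 0 = 0 := by
    intro n
    cases n with
    | zero => rfl
    | succ n => rw [hS]; exact anti_zero hF (hI _ (hSc n))
  have hdiff : ∀ q : Seminorm ℝ F, Continuous q → ∀ K : ℝ, 0 ≤ K →
      (∀ t ∈ 𝕀, ∀ u, q (Λ t u) ≤ K * q u) → ∃ M : ℝ, 0 ≤ M ∧ ∀ n, ∀ t ∈ 𝕀,
      q (S (n + 1) t - S n t) ≤ M * (K * t) ^ n / n.factorial := by
    intro q hq K hK hqK
    obtain ⟨M, hM⟩ := isCompact_Icc.exists_bound_of_continuousOn (hq.comp_continuousOn (hSc 1))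
    have hM' : ∀ t ∈ 𝕀, q (S 1 t) ≤ M := fun t ht => (le_abs_self _).trans (hM t ht)
    refine ⟨M, (apply_nonneg q _).trans (hM' 0 zero_mem_I), fun n => ?_⟩
    induction n with
    | zero =>
      intro t ht
      have : S 0 t = 0 := rfl
      simpa [this] using hM' t ht
    | succ n ih =>
      intro t ht
      have h1 := seminorm_sub_le_of_hasCurveDeriv hq (γ := fun s => S (n + 2) s - S (n + 1) s)
        (γ' := fun s => (c s + Λ s (S (n + 1) s)) - (c s + Λ s (S n s)))
        (B := fun s => M * (K * s) ^ (n + 1) / (n + 1).factorial)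
        (B' := fun s => K * (M * (K * s) ^ n / n.factorial)) ht.1
        (fun s hs => (((hSd (n + 1) s ⟨hs.1, hs.2.trans ht.2⟩).sub
          (hSd n s ⟨hs.1, hs.2.trans ht.2⟩)).mono_left (nhdsWithin_mono _ fun r hr =>
            ⟨⟨hr.1.1, hr.1.2.trans ht.2⟩, hr.2⟩)))
        (fun s hs => by
          have h2 : HasDerivAt (fun s : ℝ => M * (K * s) ^ (n + 1) / (n + 1).factorial)
              (M * (((n + 1 : ℕ) : ℝ) * (K * s) ^ n * (K * 1)) / (n + 1).factorial) s :=
            ((((hasDerivAt_id s).const_mul K).pow (n + 1)).const_mul M).div_const _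
          have h3 : K * (M * (K * s) ^ n / n.factorial) =
              M * (((n + 1 : ℕ) : ℝ) * (K * s) ^ n * (K * 1)) / (n + 1).factorial := by
            rw [Nat.factorial_succ]
            push_cast
            field_simp
          rw [h3]
          exact h2.hasDerivWithinAt)
        (fun s hs => by
          have hs' : s ∈ 𝕀 := ⟨hs.1, hs.2.trans ht.2⟩
          rw [add_sub_add_left_eq_sub, ← map_sub]
          exact (hqK s hs' _).trans (mul_le_mul_of_nonneg_left (ih s hs') hK))
      simpa [hS0] using h1
  have htail : ∀ q : Seminorm ℝ F, Continuous q → ∀ K : ℝ, 0 ≤ K →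
      (∀ t ∈ 𝕀, ∀ u, q (Λ t u) ≤ K * q u) → ∀ ε > 0, ∃ N, ∀ n ≥ N, ∀ m ≥ n,
      ∀ t ∈ 𝕀, q (S m t - S n t) < ε := by
    intro q hq K hK hqK ε hε
    obtain ⟨M, hM, h⟩ := hdiff q hq K hK hqK
    have hsum : Summable fun n : ℕ => M * (K ^ n / n.factorial) :=
      (Real.summable_pow_div_factorial K).mul_left M
    obtain ⟨s, hs⟩ := summable_iff_vanishing_norm.1 hsum ε hε
    refine ⟨s.sup id + 1, fun n hn m hm t ht => ?_⟩
    have h1 : S m t - S n t = ∑ k ∈ Finset.Ico n m, (S (k + 1) t - S k t) :=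
      (Finset.sum_Ico_sub (fun k => S k t) hm).symm
    rw [h1]
    refine (seminorm_sum_le q _ _).trans_lt ?_
    refine (Finset.sum_le_sum fun k _ => h k t ht).trans_lt ?_
    have h2 := hs (Finset.Ico n m) (by
      rw [Finset.disjoint_left]
      intro k hk hks
      have := Finset.le_sup (f := id) hks
      have := (Finset.mem_Ico.1 hk).1
      simp only [id] at *
      omega)
    refine lt_of_le_of_lt (Finset.sum_le_sum fun k _ => ?_) ((le_abs_self _).trans_lt h2)
    rw [mul_div_assoc]
    have : K * t ≤ K := mul_le_of_le_one_right hK ht.2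
    have h0 : 0 ≤ K * t := mul_nonneg hK ht.1
    gcongr
  have hcauchy : ∀ p : Seminorm ℝ F, Continuous p → ∀ ε > 0, ∃ N, ∀ n ≥ N, ∀ m ≥ n,
      ∀ t ∈ 𝕀, p (S m t - S n t) < ε := by
    intro p hp ε hε
    obtain ⟨q, hq, hpq, K, hK, hqK⟩ := hb p hp
    obtain ⟨N, hN⟩ := htail q hq K hK hqK ε hε
    exact ⟨N, fun n hn m hm t ht => (hpq _).trans_lt (hN n hn m hm t ht)⟩
  have hlim : ∀ t, ∃ a, t ∈ 𝕀 → Tendsto (fun n => S n t) atTop (𝓝 a) := by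
    intro t
    by_cases ht : t ∈ 𝕀
    · obtain ⟨a, ha⟩ := hF.exists_tendsto (fun n => S n t) (by
        intro p hp ε hε
        obtain ⟨N, hN⟩ := hcauchy p hp ε hε
        refine ⟨N, fun m hm n hn => ?_⟩
        rcases le_total n m with h | h
        · exact hN n hn m h t ht
        · rw [← map_neg_eq_map, neg_sub]; exact hN m hm n h t ht)
      exact ⟨a, fun _ => ha⟩
    · exact ⟨0, fun h => absurd h ht⟩
  choose u hu using hlim
  have hunif : ∀ p : Seminorm ℝ F, Continuous p → ∀ ε > 0, ∃ N, ∀ n ≥ N, ∀ t ∈ 𝕀,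
      p (u t - S n t) ≤ ε := by
    intro p hp ε hε
    obtain ⟨N, hN⟩ := hcauchy p hp ε hε
    refine ⟨N, fun n hn t ht => ?_⟩
    refine le_of_tendsto ((hp.tendsto _).comp ((hu t ht).sub_const (S n t))) ?_
    filter_upwards [eventually_ge_atTop n] with m hm
    exact (hN n hn m hm t ht).le
  have huc : ContinuousOn u (Icc 0 1) := by
    intro t ht
    rw [ContinuousWithinAt, tendsto_iff_seminorm]
    intro p hp ε hε
    obtain ⟨N, hN⟩ := hunif p hp (ε / 3) (by positivity)
    have h1 := (tendsto_iff_seminorm.1 (hSc N t ht).tendsto) p hp (ε / 4) (by positivity)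
    filter_upwards [h1, self_mem_nhdsWithin] with s hs hsI
    have h2 : u s - u t = (u s - S N s) + (S N s - S N t) - (u t - S N t) := by abel
    rw [h2]
    have h3 := map_sub_le_add p ((u s - S N s) + (S N s - S N t)) (u t - S N t)
    have h4 := map_add_le_add p (u s - S N s) (S N s - S N t)
    linarith [hN N le_rfl s hsI, hN N le_rfl t ht]
  have hfix : ∀ t ∈ 𝕀, u t = anti (fun s => c s + Λ s (u s)) t := by
    intro t ht
    refine tendsto_nhds_unique ((hu t ht).comp (tendsto_add_atTop_nat 1)) ?_
    rw [tendsto_iff_seminorm]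
    intro p hp ε hε
    obtain ⟨q, hq, hpq, K, hK, hqK⟩ := hb p hp
    obtain ⟨N, hN⟩ := hunif q hq (ε / (2 * (K + 1))) (by positivity)
    filter_upwards [eventually_ge_atTop N] with n hn
    refine (hpq _).trans_lt ?_
    rw [Function.comp_apply, hS, ← anti_sub hF (hI _ (hSc n)) (hI _ huc) ht]
    refine (anti_le hF ((hI _ (hSc n)).sub (hI _ huc)) hq (C := ε / 2) (fun s hs => ?_) ht).trans_lt
      (half_lt_self hε)
    change q ((c s + Λ s (S n s)) - (c s + Λ s (u s))) ≤ _
    rw [add_sub_add_left_eq_sub, ← map_sub]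
    refine (hqK s hs _).trans ?_
    rw [← map_neg_eq_map, neg_sub]
    calc K * q (u s - S n s) ≤ K * (ε / (2 * (K + 1))) :=
          mul_le_mul_of_nonneg_left (hN n hn s hs) hK
      _ ≤ (K + 1) * (ε / (2 * (K + 1))) := by gcongr; linarith
      _ = ε / 2 := by field_simp
  refine ⟨u, ?_, fun t ht => ?_⟩
  · rw [hfix 0 zero_mem_I, anti_zero hF (hI _ huc)]
  · refine (hasCurveDeriv_anti hF (hI _ huc) ht).congr' ?_
    filter_upwards [self_mem_nhdsWithin] with s hs
    rw [hfix s hs.1, hfix t ht]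

end Integral

/-! ### Multiplicative integrals -/

section MulIntegral

variable {B : Type u} [NonUnitalRing B] [Module ℝ B] [IsScalarTower ℝ B B] [SMulCommClass ℝ B B]
  [TopologicalSpace B] [IsTopologicalRing B] [ContinuousSMul ℝ B] [PolynormableSpace ℝ B] [T2Space B]

theorem HasCurveDeriv.mul {γ η : ℝ → B} {v w : B} {S : Set ℝ} {t : ℝ} (hγ : HasCurveDeriv γ v S t)
    (hη : HasCurveDeriv η w S t) :
    HasCurveDeriv (fun s => γ s * η s) (v * η t + γ t * w) S t := by
  have h1 : Tendsto η (𝓝[S \ {t}] t) (𝓝 (η t)) :=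
    hη.continuousWithinAt.tendsto.mono_left (nhdsWithin_mono _ sdiff_subset)
  refine ((Tendsto.mul hγ h1).add (Tendsto.mul (tendsto_const_nhds (x := γ t)) hη)).congr
    fun s => ?_
  rw [smul_mul_assoc, mul_smul_comm, ← smul_add, sub_mul, mul_sub]
  congr 1
  abel

/-- The differential equation `u' = c (1 + u)`, `u(0) = 0`. -/
def IsSol (c u : ℝ → B) : Prop :=
  u 0 = 0 ∧ ∀ t ∈ 𝕀, HasCurveDeriv u (c t + c t * u t) (Icc 0 1) t

/-- The differential equation `v' = -(1 + v) c`, `v(0) = 0`. -/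
def IsSolInv (c v : ℝ → B) : Prop :=
  v 0 = 0 ∧ ∀ t ∈ 𝕀, HasCurveDeriv v (-c t + -(v t * c t)) (Icc 0 1) t

theorem IsSol.continuousOn {c u : ℝ → B} (h : IsSol c u) : ContinuousOn u (Icc 0 1) :=
  fun t ht => (h.2 t ht).continuousWithinAt

theorem IsSolInv.continuousOn {c u : ℝ → B} (h : IsSolInv c u) : ContinuousOn u (Icc 0 1) :=
  fun t ht => (h.2 t ht).continuousWithinAt

theorem exists_bound {c : ℝ → B} (hc : ContinuousOn c (Icc 0 1)) {q : Seminorm ℝ B}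
    (hq : Continuous q) : ∃ K : ℝ, 0 ≤ K ∧ ∀ t ∈ 𝕀, q (c t) ≤ K := by
  obtain ⟨K, hK⟩ := isCompact_Icc.exists_bound_of_continuousOn (hq.comp_continuousOn hc)
  have hK' : ∀ t ∈ 𝕀, q (c t) ≤ K := fun t ht => (le_abs_self _).trans (hK t ht)
  exact ⟨K, (apply_nonneg q _).trans (hK' 0 zero_mem_I), hK'⟩

theorem exists_isSol (hB : SeqComplete B) (hM : MConvex B) {c : ℝ → B}
    (hc : ContinuousOn c (Icc 0 1)) : ∃ u, IsSol c u := by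
  refine exists_linear_ode hB hc (fun t => LinearMap.mul ℝ B (c t)) (fun u hu => hc.mul hu)
    fun p hp => ?_
  obtain ⟨q, hq, hqm, hpq⟩ := hM p hp
  obtain ⟨K, hK, hqK⟩ := exists_bound hc hq
  exact ⟨q, hq, hpq, K, hK, fun t ht u => (hqm _ _).trans
    (mul_le_mul_of_nonneg_right (hqK t ht) (apply_nonneg q u))⟩

theorem exists_isSolInv (hB : SeqComplete B) (hM : MConvex B) {c : ℝ → B}
    (hc : ContinuousOn c (Icc 0 1)) : ∃ u, IsSolInv c u := by
  refine exists_linear_ode hB (c := fun t => -c t) hc.neg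
    (fun t => -(LinearMap.mul ℝ B).flip (c t)) (fun u hu => (hu.mul hc).neg) fun p hp => ?_
  obtain ⟨q, hq, hqm, hpq⟩ := hM p hp
  obtain ⟨K, hK, hqK⟩ := exists_bound hc hq
  refine ⟨q, hq, hpq, K, hK, fun t ht u => ?_⟩
  change q (-(u * c t)) ≤ _
  rw [map_neg_eq_map, mul_comm K]
  exact (hqm _ _).trans (mul_le_mul_of_nonneg_left (hqK t ht) (apply_nonneg q u))

/-- A curve whose derivative is bounded by a multiple of it vanishes if it vanishes at zero. -/
theorem eq_zero_of_hasCurveDeriv {γ γ' : ℝ → B} (hγ : ∀ t ∈ 𝕀, HasCurveDeriv γ (γ' t)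
    (Icc 0 1) t) (h0 : γ 0 = 0) (hb : ∀ p : Seminorm ℝ B, Continuous p → ∃ q : Seminorm ℝ B,
      Continuous q ∧ p ≤ q ∧ ∃ K : ℝ, ∀ t ∈ 𝕀, q (γ' t) ≤ K * q (γ t)) {t : ℝ}
    (ht : t ∈ 𝕀) : γ t = 0 := by
  refine seminorm_separating fun p hp => le_antisymm ?_ (apply_nonneg p _)
  obtain ⟨q, hq, hpq, K, hK⟩ := hb p hp
  have := seminorm_le_gronwallBound hq hγ (δ := 0) (K := K) (ε := 0) (by simp [h0])
    (fun t ht => by simpa using hK t ht) ht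
  rw [gronwallBound_ε0_δ0] at this
  exact (hpq _).trans this

theorem IsSol.eq (hM : MConvex B) {c u u' : ℝ → B} (hc : ContinuousOn c (Icc 0 1)) (hu : IsSol c u)
    (hu' : IsSol c u') {t : ℝ} (ht : t ∈ 𝕀) : u t = u' t := by
  rw [← sub_eq_zero]
  refine eq_zero_of_hasCurveDeriv (γ := fun t => u t - u' t) (γ' := fun t => c t * (u t - u' t))
    (fun t ht => ?_) (by simp [hu.1, hu'.1]) (fun p hp => ?_) ht
  · have := (hu.2 t ht).sub (hu'.2 t ht)
    rwa [add_sub_add_left_eq_sub, ← mul_sub] at this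
  · obtain ⟨q, hq, hqm, hpq⟩ := hM p hp
    obtain ⟨K, hK, hqK⟩ := exists_bound hc hq
    exact ⟨q, hq, hpq, K, fun t ht => (hqm _ _).trans
      (mul_le_mul_of_nonneg_right (hqK t ht) (apply_nonneg q _))⟩

theorem IsSolInv.eq (hM : MConvex B) {c u u' : ℝ → B} (hc : ContinuousOn c (Icc 0 1))
    (hu : IsSolInv c u) (hu' : IsSolInv c u') {t : ℝ} (ht : t ∈ 𝕀) : u t = u' t := by
  rw [← sub_eq_zero]
  refine eq_zero_of_hasCurveDeriv (γ := fun t => u t - u' t) (γ' := fun t => -((u t - u' t) * c t))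
    (fun t ht => ?_) (by simp [hu.1, hu'.1]) (fun p hp => ?_) ht
  · have := (hu.2 t ht).sub (hu'.2 t ht)
    rw [add_sub_add_left_eq_sub] at this
    convert this using 1
    rw [sub_mul]; abel
  · obtain ⟨q, hq, hqm, hpq⟩ := hM p hp
    obtain ⟨K, hK, hqK⟩ := exists_bound hc hq
    refine ⟨q, hq, hpq, K, fun t ht => ?_⟩
    rw [map_neg_eq_map, mul_comm K]
    exact (hqm _ _).trans (mul_le_mul_of_nonneg_left (hqK t ht) (apply_nonneg q _))

theorem IsSol.inv_mul {c u v : ℝ → B} (hu : IsSol c u) (hv : IsSolInv c v) {t : ℝ}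
    (ht : t ∈ 𝕀) : v t + u t + v t * u t = 0 := by
  refine eq_of_hasCurveDeriv (γ := fun t => v t + u t + v t * u t) (η := fun _ => 0)
    (γ' := fun _ => 0) (fun t ht => ?_) (fun t _ => ?_) (by simp [hu.1, hv.1]) ht
  · convert ((hv.2 t ht).add (hu.2 t ht)).add ((hv.2 t ht).mul (hu.2 t ht)) using 1
    noncomm_ring
  · simpa [HasCurveDeriv] using tendsto_const_nhds

theorem IsSol.mul_inv (hM : MConvex B) {c u v : ℝ → B} (hc : ContinuousOn c (Icc 0 1))
    (hu : IsSol c u) (hv : IsSolInv c v) {t : ℝ}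
    (ht : t ∈ 𝕀) : u t + v t + u t * v t = 0 := by
  refine eq_zero_of_hasCurveDeriv (γ := fun t => u t + v t + u t * v t)
    (γ' := fun t => c t * (u t + v t + u t * v t) - (u t + v t + u t * v t) * c t)
    (fun t ht => ?_) (by simp [hu.1, hv.1]) (fun p hp => ?_) ht
  · convert ((hu.2 t ht).add (hv.2 t ht)).add ((hu.2 t ht).mul (hv.2 t ht)) using 1
    noncomm_ring
  · obtain ⟨q, hq, hqm, hpq⟩ := hM p hp
    obtain ⟨K, hK, hqK⟩ := exists_bound hc hq
    refine ⟨q, hq, hpq, K + K, fun t ht => (map_sub_le_add q _ _).trans ?_⟩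
    have h1 : ∀ e, q (c t * e) + q (e * c t) ≤ (K + K) * q e := fun e => by
      have h2 := hqm (c t) e
      have h3 := hqm e (c t)
      nlinarith [apply_nonneg q e, hqK t ht]
    exact h1 _

theorem HasCurveDeriv.comp_mul {u : ℝ → B} {v : B} {r s : ℝ} (hr : r ∈ 𝕀)
    (h : HasCurveDeriv u v (Icc 0 1) (r * s)) :
    HasCurveDeriv (fun s => u (r * s)) (r • v) (Icc 0 1) s := by
  by_cases hr0 : r = 0
  · subst hr0
    simpa [HasCurveDeriv] using tendsto_const_nhds
  have h1 : Tendsto (fun s' => r * s') (𝓝[Icc 0 1 \ {s}] s) (𝓝[Icc 0 1 \ {r * s}] (r * s)) := by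
    refine tendsto_nhdsWithin_iff.2 ⟨?_, ?_⟩
    · exact (Continuous.tendsto (by fun_prop) s).mono_left nhdsWithin_le_nhds
    · filter_upwards [self_mem_nhdsWithin] with s' hs'
      exact ⟨mul_mem_I hr hs'.1, fun h => hs'.2 (mul_left_cancel₀ hr0 h)⟩
  refine ((Tendsto.comp h h1).const_smul r).congr fun s' => ?_
  rw [Function.comp_apply, smul_smul, ← mul_sub, mul_inv, mul_inv_cancel_left₀ hr0]

theorem IsSol.comp_mul {c u : ℝ → B} (hu : IsSol c u) {r : ℝ} (hr : r ∈ 𝕀) :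
    IsSol (fun s => r • c (r * s)) (fun s => u (r * s)) := by
  refine ⟨by simpa using hu.1, fun s hs => ?_⟩
  have := (hu.2 _ (mul_mem_I hr hs)).comp_mul hr
  rwa [smul_add, ← smul_mul_assoc] at this

theorem IsSolInv.comp_mul {c u : ℝ → B} (hu : IsSolInv c u) {r : ℝ} (hr : r ∈ 𝕀) :
    IsSolInv (fun s => r • c (r * s)) (fun s => u (r * s)) := by
  refine ⟨by simpa using hu.1, fun s hs => ?_⟩
  have := (hu.2 _ (mul_mem_I hr hs)).comp_mul hr
  rwa [smul_add, smul_neg, smul_neg, ← mul_smul_comm] at this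

theorem exists_gronwallBound (K : ℝ) : ∃ C : ℝ, ∀ t ∈ 𝕀, gronwallBound 0 K K t ≤ C := by
  have : ContinuousOn (gronwallBound 0 K K) (Icc 0 1) := fun t _ =>
    (hasDerivAt_gronwallBound 0 K K t).continuousAt.continuousWithinAt
  obtain ⟨C, hC⟩ := isCompact_Icc.exists_bound_of_continuousOn this
  exact ⟨C, fun t ht => (le_abs_self _).trans (hC t ht)⟩

theorem IsSol.le {c u : ℝ → B} (hu : IsSol c u) {q : Seminorm ℝ B} (hq : Continuous q)
    (hqm : ∀ x y, q (x * y) ≤ q x * q y) {K : ℝ} (hK : ∀ t ∈ 𝕀, q (c t) ≤ K) {t : ℝ}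
    (ht : t ∈ 𝕀) : q (u t) ≤ gronwallBound 0 K K t := by
  refine seminorm_le_gronwallBound hq hu.2 (by simp [hu.1]) (fun t ht => ?_) ht
  have h1 := map_add_le_add q (c t) (c t * u t)
  have h2 := (hqm (c t) (u t)).trans (mul_le_mul_of_nonneg_right (hK t ht) (apply_nonneg q _))
  linarith [hK t ht]

theorem IsSolInv.le {c u : ℝ → B} (hu : IsSolInv c u) {q : Seminorm ℝ B} (hq : Continuous q)
    (hqm : ∀ x y, q (x * y) ≤ q x * q y) {K : ℝ} (hK : ∀ t ∈ 𝕀, q (c t) ≤ K) {t : ℝ}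
    (ht : t ∈ 𝕀) : q (u t) ≤ gronwallBound 0 K K t := by
  refine seminorm_le_gronwallBound hq hu.2 (by simp [hu.1]) (fun t ht => ?_) ht
  have h1 := map_add_le_add q (-c t) (-(u t * c t))
  rw [map_neg_eq_map, map_neg_eq_map] at h1
  have h2 := (hqm (u t) (c t)).trans (mul_le_mul_of_nonneg_left (hK t ht) (apply_nonneg q _))
  linarith [hK t ht]

/-- `(1 + a) x (1 + b)`. -/
def sandwich (a x b : B) : B := x + a * x + (x * b + a * x * b)

theorem Filter.Tendsto.sandwich {X : Type*} {L : Filter X} {f g h : X → B} {a x b : B}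
    (hf : Tendsto f L (𝓝 a)) (hg : Tendsto g L (𝓝 x)) (hh : Tendsto h L (𝓝 b)) :
    Tendsto (fun z => sandwich (f z) (g z) (h z)) L (𝓝 (sandwich a x b)) :=
  (hg.add (hf.mul hg)).add ((hg.mul hh).add ((hf.mul hg).mul hh))

theorem ContinuousOn.sandwich {X : Type*} [TopologicalSpace X] {S : Set X} {f g h : X → B}
    (hf : ContinuousOn f S) (hg : ContinuousOn g S) (hh : ContinuousOn h S) :
    ContinuousOn (fun z => sandwich (f z) (g z) (h z)) S :=
  (hg.add (hf.mul hg)).add ((hg.mul hh).add ((hf.mul hg).mul hh))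

theorem IsCk.mul {X : Type w} [AddCommGroup X] [Module ℝ X] [TopologicalSpace X]
    [IsTopologicalAddGroup X] [ContinuousSMul ℝ X] {n : ℕ} {U : Set X} (hU : IsOpen U) {f g : X → B}
    (hf : IsCk n U f) (hg : IsCk n U g) : IsCk n U fun x => f x * g x :=
  IsCk.bilin_comp (LinearMap.mul ℝ B) (by simpa using continuous_mul) hU hf hg

theorem IsCk.sandwich {X : Type w} [AddCommGroup X] [Module ℝ X] [TopologicalSpace X]
    [IsTopologicalAddGroup X] [ContinuousSMul ℝ X] {n : ℕ} {U : Set X} (hU : IsOpen U)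
    {f g h : X → B} (hf : IsCk n U f) (hg : IsCk n U g) (hh : IsCk n U h) :
    IsCk n U fun z => sandwich (f z) (g z) (h z) :=
  IsCk.add hU (IsCk.add hU hg (IsCk.mul hU hf hg))
    (IsCk.add hU (IsCk.mul hU hg hh) (IsCk.mul hU (IsCk.mul hU hf hg) hh))

theorem seminorm_sandwich_le {q : Seminorm ℝ B} (hqm : ∀ x y, q (x * y) ≤ q x * q y) (a x b : B) :
    q (sandwich a x b) ≤ (1 + q a) * q x * (1 + q b) := by
  have h1 := map_add_le_add q (x + a * x) (x * b + a * x * b)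
  have h2 := map_add_le_add q x (a * x)
  have h3 := map_add_le_add q (x * b) (a * x * b)
  have h4 := hqm a x
  have h5 := hqm x b
  have h6 := (hqm (a * x) b).trans (mul_le_mul_of_nonneg_right (hqm a x) (apply_nonneg q b))
  change q (x + a * x + (x * b + a * x * b)) ≤ _
  nlinarith

/-- The variation of the solutions. -/
theorem IsSol.sub_eq (hB : SeqComplete B) (hM : MConvex B) {c c₂ u v u₂ : ℝ → B}
    (hc : ContinuousOn c (Icc 0 1)) (hc₂ : ContinuousOn c₂ (Icc 0 1)) (hu : IsSol c u)
    (hv : IsSolInv c v) (hu₂ : IsSol c₂ u₂) :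
    u₂ 1 - u 1 = wint (fun s => sandwich (v s) (c₂ s - c s) (u₂ s)) +
      u 1 * wint (fun s => sandwich (v s) (c₂ s - c s) (u₂ s)) := by
  have hcont : ContinuousOn (fun s => sandwich (v s) (c₂ s - c s) (u₂ s)) (Icc 0 1) :=
    ContinuousOn.sandwich hv.continuousOn (hc₂.sub hc) hu₂.continuousOn
  have key : (u₂ 1 - u 1) + v 1 * (u₂ 1 - u 1) = anti (fun s => sandwich (v s) (c₂ s - c s) (u₂ s)) 1 :=
    eq_of_hasCurveDeriv (γ := fun t => (u₂ t - u t) + v t * (u₂ t - u t)) (fun t ht => by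
      convert (((hu₂.2 t ht).sub (hu.2 t ht)).add ((hv.2 t ht).mul
        ((hu₂.2 t ht).sub (hu.2 t ht)))) using 1
      unfold sandwich
      noncomm_ring) (fun t ht => hasCurveDeriv_anti hB hcont ht)
      (by rw [anti_zero hB hcont]; simp [hu₂.1, hu.1]) one_mem_I
  have h1 : anti (fun s => sandwich (v s) (c₂ s - c s) (u₂ s)) 1 =
      wint (fun s => sandwich (v s) (c₂ s - c s) (u₂ s)) := by
    simp only [anti, one_smul, one_mul]
  rw [← h1, ← key]
  have h2 := hu.mul_inv hM hc hv one_mem_I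
  have h3 : u₂ 1 - u 1 + v 1 * (u₂ 1 - u 1) + u 1 * (u₂ 1 - u 1 + v 1 * (u₂ 1 - u 1)) =
      (u₂ 1 - u 1) + (u 1 + v 1 + u 1 * v 1) * (u₂ 1 - u 1) := by noncomm_ring
  rw [h3, h2, zero_mul, add_zero]

theorem IsSol.inv_sub_eq (hM : MConvex B) {c c₂ u v u₂ v₂ : ℝ → B} (hc : ContinuousOn c (Icc 0 1))
    (hu : IsSol c u) (hv : IsSolInv c v) (hu₂ : IsSol c₂ u₂) (hv₂ : IsSolInv c₂ v₂) :
    v₂ 1 - v 1 = -sandwich (v₂ 1) (u₂ 1 - u 1) (v 1) := by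
  have h2 := hu.mul_inv hM hc hv one_mem_I
  have h3 := hu₂.inv_mul hv₂ one_mem_I
  have h4 : -sandwich (v₂ 1) (u₂ 1 - u 1) (v 1) = v₂ 1 - v 1 -
      (v₂ 1 + u₂ 1 + v₂ 1 * u₂ 1) - (v₂ 1 + u₂ 1 + v₂ 1 * u₂ 1) * v 1 + (u 1 + v 1 + u 1 * v 1) +
        v₂ 1 * (u 1 + v 1 + u 1 * v 1) := by
    unfold sandwich
    noncomm_ring
  rw [h4, h2, h3]
  simp

/-! ### Smooth dependence of multiplicative integrals on parameters -/

variable {E : Type w} [AddCommGroup E] [Module ℝ E] [TopologicalSpace E]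
  [IsTopologicalAddGroup E] [ContinuousSMul ℝ E]

/-- Rescaling of the second variable. -/
def rescale (z : (E × ℝ) × ℝ) : E × ℝ := (z.1.1, z.2 * z.1.2)

theorem continuous_rescale : Continuous (rescale : (E × ℝ) × ℝ → E × ℝ) := by
  unfold rescale; fun_prop

protected theorem IsCk.rescale (n : ℕ) (U : Set ((E × ℝ) × ℝ)) (hU : IsOpen U) :
    IsCk n U (rescale : (E × ℝ) × ℝ → E × ℝ) := by
  refine IsCk.pair (IsCk.clm ((ContinuousLinearMap.fst ℝ E ℝ).comp
    (ContinuousLinearMap.fst ℝ (E × ℝ) ℝ)) n U) ?_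
  exact IsCk.smul hU (IsCk.clm (ContinuousLinearMap.snd ℝ (E × ℝ) ℝ) n U)
    (IsCk.clm ((ContinuousLinearMap.snd ℝ E ℝ).comp (ContinuousLinearMap.fst ℝ (E × ℝ) ℝ)) n U)

/-- The points whose segment to the initial time is contained in `W`. -/
def segmentDomain (W : Set (E × ℝ)) : Set (E × ℝ) := {z | ∀ s ∈ 𝕀, rescale (z, s) ∈ W}

theorem isOpen_segmentDomain {W : Set (E × ℝ)} (hW : IsOpen W) : IsOpen (segmentDomain W) := by
  rw [isOpen_iff_mem_nhds]
  intro z hz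
  refine isCompact_Icc.eventually_forall_of_forall_eventually fun s hs => ?_
  exact continuous_rescale.continuousAt.preimage_mem_nhds (hW.mem_nhds (hz s hs))

theorem rescale_mem_segmentDomain {W : Set (E × ℝ)} {z : E × ℝ} (hz : z ∈ segmentDomain W) {s : ℝ}
    (hs : s ∈ 𝕀) : rescale (z, s) ∈ segmentDomain W := by
  intro r hr
  have := hz (r * s) (mul_mem_I hr hs)
  simpa [rescale, mul_assoc] using this

/-- The rescaled equation. -/
def rescaled (ω : E × ℝ → B) (z : (E × ℝ) × ℝ) : B := z.1.2 • ω (rescale z)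

theorem continuousOn_rescaled {W : Set (E × ℝ)} {ω : E × ℝ → B} (hω : ContinuousOn ω W) :
    ContinuousOn (rescaled ω) (rescale ⁻¹' W) :=
  ContinuousOn.smul (by fun_prop) (hω.comp continuous_rescale.continuousOn fun _ h => h)

theorem IsCk.rescaled {n : ℕ} {W : Set (E × ℝ)} (hW : IsOpen W) {ω : E × ℝ → B}
    (hω : IsCk n W ω) : IsCk n (rescale ⁻¹' W) (rescaled ω) := by
  have hW' := hW.preimage continuous_rescale
  exact IsCk.smul hW' (IsCk.clm ((ContinuousLinearMap.snd ℝ E ℝ).comp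
    (ContinuousLinearMap.fst ℝ (E × ℝ) ℝ)) n _) (hω.comp hW' hW (IsCk.rescale n _ hW') fun _ h => h)

theorem continuousOn_rescaled_slice {W : Set (E × ℝ)} {ω : E × ℝ → B} (hω : ContinuousOn ω W)
    {z : E × ℝ} (hz : z ∈ segmentDomain W) :
    ContinuousOn (fun s => rescaled ω (z, s)) (Icc 0 1) :=
  (continuousOn_rescaled hω).comp (by fun_prop) fun s hs => hz s hs

/-- A family of solutions of the rescaled equations, and of their inverses. -/
structure IsSolFamily (W : Set (E × ℝ)) (ω : E × ℝ → B) (u v : E × ℝ → ℝ → B) : Prop where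
  sol : ∀ z ∈ segmentDomain W, IsSol (fun s => rescaled ω (z, s)) (u z)
  inv : ∀ z ∈ segmentDomain W, IsSolInv (fun s => rescaled ω (z, s)) (v z)

theorem exists_isSolFamily (hB : SeqComplete B) (hM : MConvex B) {W : Set (E × ℝ)} {ω : E × ℝ → B}
    (hω : ContinuousOn ω W) : ∃ u v, IsSolFamily W ω u v := by
  have h1 : ∀ z, ∃ u, z ∈ segmentDomain W → IsSol (fun s => rescaled ω (z, s)) u := by
    intro z
    by_cases hz : z ∈ segmentDomain W
    · obtain ⟨u, hu⟩ := exists_isSol hB hM (continuousOn_rescaled_slice hω hz)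
      exact ⟨u, fun _ => hu⟩
    · exact ⟨0, fun h => absurd h hz⟩
  have h2 : ∀ z, ∃ u, z ∈ segmentDomain W → IsSolInv (fun s => rescaled ω (z, s)) u := by
    intro z
    by_cases hz : z ∈ segmentDomain W
    · obtain ⟨u, hu⟩ := exists_isSolInv hB hM (continuousOn_rescaled_slice hω hz)
      exact ⟨u, fun _ => hu⟩
    · exact ⟨0, fun h => absurd h hz⟩
  choose u hu using h1
  choose v hv using h2
  exact ⟨u, v, hu, hv⟩

theorem rescaled_rescale (ω : E × ℝ → B) (z : E × ℝ) (r s : ℝ) :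
    rescaled ω (rescale (z, r), s) = r • rescaled ω (z, r * s) := by
  simp only [rescaled, rescale, smul_smul]
  congr 3
  ring

theorem IsSolFamily.apply_eq (hM : MConvex B) {W : Set (E × ℝ)} {ω : E × ℝ → B}
    (hω : ContinuousOn ω W) {u v : E × ℝ → ℝ → B} (h : IsSolFamily W ω u v) {z : E × ℝ}
    (hz : z ∈ segmentDomain W) {r : ℝ} (hr : r ∈ 𝕀) :
    u z r = u (rescale (z, r)) 1 ∧ v z r = v (rescale (z, r)) 1 := by
  have hz' := rescale_mem_segmentDomain hz hr
  have hc := continuousOn_rescaled_slice hω hz'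
  have h1 := (h.sol z hz).comp_mul hr
  have h2 := (h.inv z hz).comp_mul hr
  simp only [← rescaled_rescale] at h1 h2
  have h3 := h1.eq hM hc (h.sol _ hz') one_mem_I
  have h4 := h2.eq hM hc (h.inv _ hz') one_mem_I
  simp only [mul_one] at h3 h4
  exact ⟨h3, h4⟩

theorem IsSolFamily.eventually_le {W : Set (E × ℝ)} (hW : IsOpen W) {ω : E × ℝ → B}
    (hω : ContinuousOn ω W) {u v : E × ℝ → ℝ → B} (h : IsSolFamily W ω u v) {z : E × ℝ}
    (hz : z ∈ segmentDomain W) {q : Seminorm ℝ B} (hq : Continuous q)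
    (hqm : ∀ x y, q (x * y) ≤ q x * q y) : ∃ C : ℝ, ∀ᶠ z' in 𝓝[segmentDomain W] z,
      ∀ s ∈ 𝕀, q (u z' s) ≤ C ∧ q (v z' s) ≤ C := by
  obtain ⟨K, hK, hb⟩ := exists_bound (continuousOn_rescaled_slice hω hz) hq
  obtain ⟨C, hC⟩ := exists_gronwallBound (K + 1)
  refine ⟨C, ?_⟩
  have h1 : ∀ᶠ z' in 𝓝 z, ∀ s ∈ 𝕀, q (rescaled ω (z', s)) < K + 1 := by
    refine isCompact_Icc.eventually_forall_of_forall_eventually fun s hs => ?_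
    have hc : ContinuousAt (fun z => q (rescaled ω z)) (z, s) :=
      hq.continuousAt.comp ((continuousOn_rescaled hω).continuousAt
        ((hW.preimage continuous_rescale).mem_nhds (hz s hs)))
    exact hc.eventually (gt_mem_nhds ((hb s hs).trans_lt (lt_add_one K)))
  filter_upwards [nhdsWithin_le_nhds h1, self_mem_nhdsWithin] with z' h2 hz' s hs
  exact ⟨((h.sol z' hz').le hq hqm (fun t ht => (h2 t ht).le) hs).trans (hC s hs),
    ((h.inv z' hz').le hq hqm (fun t ht => (h2 t ht).le) hs).trans (hC s hs)⟩

theorem IsSolFamily.continuousOn (hB : SeqComplete B) (hM : MConvex B) {W : Set (E × ℝ)}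
    (hW : IsOpen W) {ω : E × ℝ → B} (hω : ContinuousOn ω W) {u v : E × ℝ → ℝ → B}
    (h : IsSolFamily W ω u v) : ContinuousOn (fun z => u z 1) (segmentDomain W) ∧
      ContinuousOn (fun z => v z 1) (segmentDomain W) := by
  have hu : ContinuousOn (fun z => u z 1) (segmentDomain W) := by
    intro z hz
    have hc := continuousOn_rescaled_slice hω hz
    have hR : Tendsto (fun z' => wint fun s => sandwich (v z s)
        (rescaled ω (z', s) - rescaled ω (z, s)) (u z' s)) (𝓝[segmentDomain W] z) (𝓝 0) := by
      have h0 : wint (fun _ : ℝ => (0 : B)) = 0 := by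
        simpa using wint_smul hB (f := fun _ : ℝ => (0 : B)) continuousOn_const 0
      rw [← h0]
      refine tendsto_wint hB continuousOn_const ?_ fun s hs => ?_
      · filter_upwards [self_mem_nhdsWithin] with z' hz'
        exact ContinuousOn.sandwich (h.inv z hz).continuousOn
          ((continuousOn_rescaled_slice hω hz').sub hc) (h.sol z' hz').continuousOn
      · rw [tendsto_iff_seminorm]
        intro p hp ε hε
        obtain ⟨q, hq, hqm, hpq⟩ := hM p hp
        obtain ⟨C, hC⟩ := h.eventually_le hW hω hz hq hqm
        obtain ⟨D, hD, hvD⟩ := exists_bound (h.inv z hz).continuousOn hq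
        have h1 : Tendsto (fun y : (E × ℝ) × ℝ => q (rescaled ω (y.1, y.2) - rescaled ω (z, y.2)))
            (𝓝[segmentDomain W] z ×ˢ 𝓝[Icc 0 1] s) (𝓝 0) := by
          have h2 : Tendsto (fun y : (E × ℝ) × ℝ => rescaled ω (y.1, y.2))
              (𝓝[segmentDomain W] z ×ˢ 𝓝[Icc 0 1] s) (𝓝 (rescaled ω (z, s))) := by
            rw [← nhdsWithin_prod_eq]
            exact ((continuousOn_rescaled hω) (z, s) (hz s hs)).tendsto.mono_left
              (nhdsWithin_mono _ fun y hy => hy.1 y.2 hy.2)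
          have h3 : Tendsto (fun y : (E × ℝ) × ℝ => rescaled ω (z, y.2))
              (𝓝[segmentDomain W] z ×ˢ 𝓝[Icc 0 1] s) (𝓝 (rescaled ω (z, s))) :=
            (hc s hs).tendsto.comp tendsto_snd
          have h4 := (hq.tendsto _).comp (h2.sub h3)
          rwa [sub_self, map_zero] at h4
        have h4 : Tendsto (fun y : (E × ℝ) × ℝ =>
            (1 + D) * q (rescaled ω (y.1, y.2) - rescaled ω (z, y.2)) * (1 + C))
            (𝓝[segmentDomain W] z ×ˢ 𝓝[Icc 0 1] s) (𝓝 0) := by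
          simpa using (h1.const_mul (1 + D)).mul_const (1 + C)
        have h5 := (hC.prod_mk (eventually_mem_nhdsWithin (a := s) (s := 𝕀)))
        filter_upwards [h4.eventually (gt_mem_nhds hε), h5] with y hy hy'
        rw [sub_zero]
        refine (hpq _).trans_lt ((seminorm_sandwich_le hqm _ _ _).trans_lt (lt_of_le_of_lt ?_ hy))
        have h6 := hvD y.2 hy'.2
        have h7 := (hy'.1 y.2 hy'.2).1
        have h8 := apply_nonneg q (rescaled ω (y.1, y.2) - rescaled ω (z, y.2))
        have h9 := apply_nonneg q (u y.1 y.2)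
        gcongr
    have h2 : Tendsto (fun z' => u z' 1 - u z 1) (𝓝[segmentDomain W] z) (𝓝 (0 + u z 1 * 0)) := by
      refine (hR.add (hR.const_mul (u z 1))).congr' ?_
      filter_upwards [self_mem_nhdsWithin] with z' hz'
      exact (IsSol.sub_eq hB hM hc (continuousOn_rescaled_slice hω hz') (h.sol z hz) (h.inv z hz)
        (h.sol z' hz')).symm
    rw [mul_zero, add_zero] at h2
    have h3 := h2.add_const (u z 1)
    simp only [sub_add_cancel, zero_add] at h3
    exact h3
  refine ⟨hu, fun z hz => ?_⟩
  have hc := continuousOn_rescaled_slice hω hz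
  rw [ContinuousWithinAt, tendsto_iff_seminorm]
  intro p hp ε hε
  obtain ⟨q, hq, hqm, hpq⟩ := hM p hp
  obtain ⟨C, hC⟩ := h.eventually_le hW hω hz hq hqm
  have h1 : Tendsto (fun z' => (1 + C) * q (u z' 1 - u z 1) * (1 + q (v z 1)))
      (𝓝[segmentDomain W] z) (𝓝 0) := by
    have h2 := (hq.tendsto _).comp ((hu z hz).tendsto.sub_const (u z 1))
    simp only [sub_self, map_zero] at h2
    simpa using (h2.const_mul (1 + C)).mul_const (1 + q (v z 1))
  filter_upwards [h1.eventually (gt_mem_nhds hε), hC, self_mem_nhdsWithin] with z' h2 h3 hz'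
  rw [IsSol.inv_sub_eq hM hc (h.sol z hz) (h.inv z hz) (h.sol z' hz') (h.inv z' hz'), map_neg_eq_map]
  refine (hpq _).trans_lt ((seminorm_sandwich_le hqm _ _ _).trans_lt (lt_of_le_of_lt ?_ h2))
  have h4 := (h3 1 one_mem_I).2
  have h5 := apply_nonneg q (v z 1)
  have h6 := apply_nonneg q (u z' 1 - u z 1)
  gcongr

theorem sandwich_smul (a x b : B) (c : ℝ) : sandwich a (c • x) b = c • sandwich a x b := by
  simp only [sandwich, smul_add, mul_smul_comm, smul_mul_assoc]

theorem IsSolFamily.isCk (hB : SeqComplete B) (hM : MConvex B) {W : Set (E × ℝ)}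
    (hW : IsOpen W) {ω : E × ℝ → B} (hω : ∀ n, IsCk n W ω) {u v : E × ℝ → ℝ → B}
    (h : IsSolFamily W ω u v) (n : ℕ) : IsCk n (segmentDomain W) (fun z => u z 1) ∧
      IsCk n (segmentDomain W) (fun z => v z 1) := by
  have hω0 : ContinuousOn ω W := hω 0
  obtain ⟨hu, hv⟩ := h.continuousOn hB hM hW hω0
  have hV := isOpen_segmentDomain hW
  have hW' := hW.preimage (continuous_rescale (E := E))
  induction n with
  | zero => exact ⟨hu, hv⟩
  | succ n ih =>
    obtain ⟨hωc, dω, hd, hdω⟩ := IsCk.rescaled hW (hω (n + 1))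
    let X : (E × ℝ) × (E × ℝ) → B := fun y => wint fun s =>
      sandwich (v (rescale (y.1, s)) 1) (dω ((y.1, s), (y.2, 0))) (u (rescale (y.1, s)) 1)
    let L : ((E × ℝ) × (E × ℝ)) × ℝ →L[ℝ] ((E × ℝ) × ℝ) × ((E × ℝ) × ℝ) :=
      (((ContinuousLinearMap.fst ℝ (E × ℝ) (E × ℝ)).comp (ContinuousLinearMap.fst ℝ _ _)).prod
        (ContinuousLinearMap.snd ℝ _ ℝ)).prod
      (((ContinuousLinearMap.snd ℝ (E × ℝ) (E × ℝ)).comp (ContinuousLinearMap.fst ℝ _ _)).prod 0)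
    let W₂ : Set (((E × ℝ) × (E × ℝ)) × ℝ) := L ⁻¹' ((rescale ⁻¹' W ∩ rescale ⁻¹' segmentDomain W) ×ˢ univ)
    have hopen := hW'.inter (hV.preimage (continuous_rescale (E := E)))
    have hW₂ : IsOpen W₂ := (hopen.prod isOpen_univ).preimage L.continuous
    have hmem : ∀ z ∈ segmentDomain W, ∀ η, ∀ s ∈ 𝕀, ((z, η), s) ∈ W₂ :=
      fun z hz η s hs => ⟨⟨hz s hs, rescale_mem_segmentDomain hz hs⟩, mem_univ _⟩
    have hφ : IsCk n W₂ fun y => rescale (L y).1 :=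
      IsCk.pair (IsCk.clm ((ContinuousLinearMap.fst ℝ E ℝ).comp
        ((ContinuousLinearMap.fst ℝ (E × ℝ) (E × ℝ)).comp (ContinuousLinearMap.fst ℝ _ ℝ))) n W₂)
        (IsCk.smul hW₂ (IsCk.clm (ContinuousLinearMap.snd ℝ _ ℝ) n W₂)
          (IsCk.clm ((ContinuousLinearMap.snd ℝ E ℝ).comp
            ((ContinuousLinearMap.fst ℝ (E × ℝ) (E × ℝ)).comp (ContinuousLinearMap.fst ℝ _ ℝ))) n W₂))
    have hf : IsCk n W₂ fun y => sandwich (v (rescale (L y).1) 1) (dω (L y)) (u (rescale (L y).1) 1) := by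
      refine IsCk.sandwich hW₂ ?_ ?_ ?_
      · exact ih.2.comp hW₂ hV hφ fun y hy => hy.1.2
      · exact hdω.comp hW₂ (hW'.prod isOpen_univ) (IsCk.clm L n W₂) fun y hy => ⟨hy.1.1, mem_univ _⟩
      · exact ih.1.comp hW₂ hV hφ fun y hy => hy.1.2
    have hX : IsCk n (segmentDomain W ×ˢ univ) X :=
      IsCk.wint hB n (hV.prod isOpen_univ) hW₂ (fun y hy => hmem _ hy.1.1 _ _ hy.2) hf
    have hfst : ∀ {g : E × ℝ → B}, IsCk n (segmentDomain W) g →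
        IsCk n (segmentDomain W ×ˢ (univ : Set (E × ℝ))) fun y => g y.1 := fun hg =>
      hg.comp (hV.prod isOpen_univ) hV
        (IsCk.clm (ContinuousLinearMap.fst ℝ (E × ℝ) (E × ℝ)) n _) fun y hy => hy.1
    let dG : (E × ℝ) × (E × ℝ) → B := fun y => X y + u y.1 1 * X y
    have hdG : IsCk n (segmentDomain W ×ˢ univ) dG := IsCk.add (hV.prod isOpen_univ) hX
      (IsCk.mul (hV.prod isOpen_univ) (hfst ih.1) hX)
    have hder : ∀ z ∈ segmentDomain W, ∀ η, Tendsto (fun t : ℝ => t⁻¹ • (u (z + t • η) 1 - u z 1))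
        (𝓝[≠] 0) (𝓝 (dG (z, η))) := by
      intro z hz η
      have hc := continuousOn_rescaled_slice hω0 hz
      have hev := eventually_add_smul_mem hV hz η
      have h1 : Tendsto (fun t : ℝ => wint fun s => sandwich (v z s)
          (t⁻¹ • (rescaled ω (z + t • η, s) - rescaled ω (z, s))) (u (z + t • η) s)) (𝓝[≠] 0)
          (𝓝 (X (z, η))) := by
        refine tendsto_wint hB ?_ ?_ fun s hs => ?_
        · exact hf.continuousOn.comp (f := fun s => ((z, η), s)) (by fun_prop)
            fun s hs => hmem z hz η s hs
        · filter_upwards [hev] with t ht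
          exact ContinuousOn.sandwich (h.inv z hz).continuousOn
            (((continuousOn_rescaled_slice hω0 ht).sub hc).const_smul _)
            (h.sol _ ht).continuousOn
        · have hz' := rescale_mem_segmentDomain hz hs
          refine Filter.Tendsto.sandwich ?_ ?_ ?_
          · have := ((h.inv z hz).continuousOn s hs).tendsto
            rw [(h.apply_eq hM hω0 hz hs).2] at this
            exact this.comp tendsto_snd
          · have h2 := tendsto_diffQuot hW' hd hdω.continuousOn (hz s hs : (z, s) ∈ rescale ⁻¹' W) (η, 0)
            have h3 : Tendsto (fun y : ℝ × ℝ => (((z, y.2), ((η, 0) : (E × ℝ) × ℝ)), y.1))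
                (𝓝[≠] 0 ×ˢ 𝓝[Icc 0 1] s)
                (𝓝 (((z, s), (η, 0)) : ((E × ℝ) × ℝ) × ((E × ℝ) × ℝ)) ×ˢ 𝓝[≠] 0) := by
              refine Tendsto.prodMk ?_ tendsto_fst
              have : Tendsto (fun r : ℝ => (((z, r), (η, 0)) : ((E × ℝ) × ℝ) × ((E × ℝ) × ℝ))) (𝓝 s)
                  (𝓝 ((z, s), (η, 0))) := Continuous.tendsto (by fun_prop) s
              exact (this.mono_left nhdsWithin_le_nhds).comp tendsto_snd
            refine (h2.comp h3).congr fun y => ?_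
            simp
          · have h2 : Tendsto (fun y : ℝ × ℝ => rescale (z + y.1 • η, y.2))
                (𝓝[≠] 0 ×ˢ 𝓝[Icc 0 1] s) (𝓝 (rescale (z, s))) := by
              have h3 : Continuous fun y : ℝ × ℝ => rescale (z + y.1 • η, y.2) :=
                continuous_rescale.comp (by fun_prop)
              have h4 := h3.tendsto (0, s)
              simp only [zero_smul, add_zero] at h4
              refine h4.mono_left ?_
              rw [nhds_prod_eq]
              exact Filter.prod_mono nhdsWithin_le_nhds nhdsWithin_le_nhds
            have h5 := (hu.continuousAt (hV.mem_nhds hz')).tendsto.comp h2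
            refine h5.congr' ?_
            have h6 := hev.prod_mk (eventually_mem_nhdsWithin (a := s) (s := 𝕀))
            filter_upwards [h6] with y hy
            exact (h.apply_eq hM hω0 hy.1 hy.2).1.symm
      have h2 := h1.add (h1.const_mul (u z 1))
      refine h2.congr' ?_
      filter_upwards [hev] with t ht
      rw [IsSol.sub_eq hB hM hc (continuousOn_rescaled_slice hω0 ht) (h.sol z hz) (h.inv z hz)
        (h.sol _ ht)]
      simp_rw [sandwich_smul]
      rw [wint_smul hB (f := fun s => sandwich (v z s)
        (rescaled ω (z + t • η, s) - rescaled ω (z, s)) (u (z + t • η) s))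
        (ContinuousOn.sandwich (h.inv z hz).continuousOn
            ((continuousOn_rescaled_slice hω0 ht).sub hc) (h.sol _ ht).continuousOn),
        mul_smul_comm, ← smul_add]
    refine ⟨⟨hu, dG, hder, hdG⟩, hv, fun y => -sandwich (v y.1 1) (dG y) (v y.1 1),
      fun z hz η => ?_, IsCk.neg (hV.prod isOpen_univ)
        (IsCk.sandwich (hV.prod isOpen_univ) (hfst ih.2) hdG (hfst ih.2))⟩
    have hc := continuousOn_rescaled_slice hω0 hz
    have hev := eventually_add_smul_mem hV hz η
    have h0 : Tendsto (fun t : ℝ => z + t • η) (𝓝[≠] 0) (𝓝 z) := by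
      have : Continuous fun t : ℝ => z + t • η := by fun_prop
      simpa using (this.tendsto 0).mono_left nhdsWithin_le_nhds
    have h1 : Tendsto (fun t : ℝ => v (z + t • η) 1) (𝓝[≠] 0) (𝓝 (v z 1)) :=
      (hv.continuousAt (hV.mem_nhds hz)).tendsto.comp h0
    refine (Tendsto.neg (Filter.Tendsto.sandwich h1 (hder z hz η)
      (tendsto_const_nhds (x := v z 1)))).congr' ?_
    filter_upwards [hev] with t ht
    rw [IsSol.inv_sub_eq hM hc (h.sol z hz) (h.inv z hz) (h.sol _ ht) (h.inv _ ht), sandwich_smul,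
      smul_neg]

/-- Smooth linear evolution equations have smooth solutions, with smooth inverses. -/
theorem exists_smooth_sol (hB : SeqComplete B) (hM : MConvex B) {W : Set (E × ℝ)}
    (hW : IsOpen W) {ω : E × ℝ → B} (hω : ∀ n, IsCk n W ω) {X : Set E}
    (hX : X ×ˢ 𝕀 ⊆ W) : ∃ V : Set (E × ℝ), IsOpen V ∧ X ×ˢ 𝕀 ⊆ V ∧
      ∃ G G' : E × ℝ → B, (∀ n, IsCk n V G) ∧ (∀ n, IsCk n V G') ∧
        ∀ x ∈ X, IsSol (fun t => ω (x, t)) (fun t => G (x, t)) ∧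
          IsSolInv (fun t => ω (x, t)) (fun t => G' (x, t)) := by
  have hω0 : ContinuousOn ω W := hω 0
  obtain ⟨u, v, h⟩ := exists_isSolFamily hB hM hω0
  have hXV : X ×ˢ 𝕀 ⊆ segmentDomain W := fun z hz s hs =>
    hX ⟨hz.1, mul_mem_I hs hz.2⟩
  refine ⟨segmentDomain W, isOpen_segmentDomain hW, hXV, fun z => u z 1, fun z => v z 1,
    fun n => (h.isCk hB hM hW hω n).1, fun n => (h.isCk hB hM hW hω n).2, fun x hx => ?_⟩
  have hx1 : (x, (1 : ℝ)) ∈ segmentDomain W := hXV ⟨hx, one_mem_I⟩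
  have hc : (fun s => rescaled ω ((x, (1 : ℝ)), s)) = fun t => ω (x, t) := by
    funext s; simp [rescaled, rescale]
  have key : ∀ t ∈ 𝕀, u (x, t) 1 = u (x, 1) t ∧ v (x, t) 1 = v (x, 1) t := by
    intro t ht
    have h1 := h.apply_eq hM hω0 hx1 ht
    simp only [rescale, mul_one] at h1
    exact ⟨h1.1.symm, h1.2.symm⟩
  have h1 := h.sol _ hx1
  have h2 := h.inv _ hx1
  rw [hc] at h1 h2
  have hcongr : ∀ {f g : ℝ → B} {a : B} {t : ℝ}, t ∈ 𝕀 → (∀ s ∈ 𝕀, g s = f s) →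
      HasCurveDeriv f a (Icc 0 1) t → HasCurveDeriv g a (Icc 0 1) t := by
    intro f g a t ht hfg hd
    refine Tendsto.congr' ?_ hd
    filter_upwards [self_mem_nhdsWithin] with s hs
    rw [hfg s hs.1, hfg t ht]
  refine ⟨⟨(key 0 zero_mem_I).1.trans h1.1, fun t ht => hcongr ht (fun s hs => (key s hs).1) ?_⟩,
    (key 0 zero_mem_I).2.trans h2.1, fun t ht => hcongr ht (fun s hs => (key s hs).2) ?_⟩
  · beta_reduce; rw [(key t ht).1]; exact h1.2 t ht
  · beta_reduce; rw [(key t ht).2]; exact h2.2 t ht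

end MulIntegral

/-! ### The algebra of rapidly decreasing matrices -/

section RapidAlgebra

variable {Ω Ω' Ω'' Ξ Ξ' : Type} [GrowthIndex Ω] [PolyIdx Ω] [DecidableEq Ω] [GrowthIndex Ω'] [PolyIdx Ω']
  [DecidableEq Ω'] [GrowthIndex Ω''] [PolyIdx Ω''] [DecidableEq Ω''] [GrowthIndex Ξ] [PolyIdx Ξ]
  [DecidableEq Ξ] [GrowthIndex Ξ'] [PolyIdx Ξ'] [DecidableEq Ξ']
variable {A : Type u} [NonUnitalCommRing A] [Module ℝ A] [TopologicalSpace A]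
  [IsScalarTower ℝ A A] [SMulCommClass ℝ A A] [IsTopologicalRing A] [ContinuousSMul ℝ A]
  [PolynormableSpace ℝ A] [T2Space A] [GoodAlg A]

noncomputable instance : Mul (RapidMatrix Ω A) := ⟨fun k l => lmul (incl k) l⟩

theorem incl_mul (k l : RapidMatrix Ω A) : incl (k * l) = incl k * incl l := incl_lmul _ _

noncomputable instance : NonUnitalRing (RapidMatrix Ω A) :=
  { (inferInstance : AddCommGroup (RapidMatrix Ω A)), (inferInstance : Mul (RapidMatrix Ω A)) with
    left_distrib := fun a b c => incl_injective (by simp only [incl_mul, map_add, mul_add])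
    right_distrib := fun a b c => incl_injective (by simp only [incl_mul, map_add, add_mul])
    zero_mul := fun a => incl_injective (by simp only [incl_mul, map_zero, zero_mul])
    mul_zero := fun a => incl_injective (by simp only [incl_mul, map_zero, mul_zero])
    mul_assoc := fun a b c => incl_injective (by simp only [incl_mul, mul_assoc]) }

instance : IsScalarTower ℝ (RapidMatrix Ω A) (RapidMatrix Ω A) :=
  ⟨fun c a b => incl_injective (by simp only [smul_eq_mul, incl_mul, map_smul, smul_mul_assoc])⟩

instance : SMulCommClass ℝ (RapidMatrix Ω A) (RapidMatrix Ω A) :=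
  ⟨fun c a b => incl_injective (by simp only [smul_eq_mul, incl_mul, map_smul, mul_smul_comm])⟩

instance : IsTopologicalRing (RapidMatrix Ω A) :=
  { (inferInstance : IsTopologicalAddGroup (RapidMatrix Ω A)) with
    continuous_mul := by
      have h := continuous_ampMul (A := A) (Equiv.prodUnique Ω Unit).symm
        (PolyEmb.of_size (Equiv.injective _) fun _ => rfl)
      refine h.congr fun z => incl_injective ?_
      rw [incl_ampMul, incl_mul]
      congr 1 }

theorem rapid_mconvex : MConvex (RapidMatrix Ω A) := by
  intro P hP
  obtain ⟨⟨p, hp⟩, N, C, hC, hle⟩ := exists_le_rapidSeminorm P hP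
  obtain ⟨q, hq, hqm, hpq⟩ := GoodAlg.mconvex p hp
  let N' := max N (sumExp Ω)
  have hD : 0 ≤ max C (sumWt Ω) := hC.trans (le_max_left _ _)
  obtain ⟨r, hr, hre⟩ := exists_mul_seminorm_eq (continuous_rapidSeminorm (Ω := Ω) ⟨q, hq⟩ N') hD
  have hle' : ∀ k l : RapidMatrix Ω A, rapidSeminorm ⟨q, hq⟩ N' (k * l) ≤
      rapidSeminorm ⟨q, hq⟩ N' k * sumWt Ω * rapidSeminorm ⟨q, hq⟩ N' l := by
    intro k l
    have h := rapidSeminorm_lmul_le (incl k) l hq hq hqm le_rfl (N := N') (M := 0)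
      (C := rapidSeminorm ⟨q, hq⟩ N' k) (apply_nonneg _ _) fun i j => by
        simpa using wt_pow_mul_le' k hq N' i j
    rwa [zero_add, max_eq_right (le_max_right N (sumExp Ω))] at h
  refine ⟨r, hr, fun k l => ?_, fun k => ?_⟩
  · rw [hre, hre, hre]
    refine (mul_le_mul_of_nonneg_left (hle' k l) hD).trans ?_
    have h1 := apply_nonneg (rapidSeminorm (Ω := Ω) ⟨q, hq⟩ N') k
    have h2 := apply_nonneg (rapidSeminorm (Ω := Ω) ⟨q, hq⟩ N') l
    calc max C (sumWt Ω) * (rapidSeminorm ⟨q, hq⟩ N' k * sumWt Ω * rapidSeminorm ⟨q, hq⟩ N' l)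
        ≤ max C (sumWt Ω) * (rapidSeminorm ⟨q, hq⟩ N' k * max C (sumWt Ω) *
          rapidSeminorm ⟨q, hq⟩ N' l) := by
          gcongr; exact le_max_right _ _
      _ = _ := by ring
  · rw [hre]
    have h1 := apply_nonneg (rapidSeminorm (Ω := Ω) ⟨q, hq⟩ N') k
    calc P k ≤ C * rapidSeminorm ⟨p, hp⟩ N k := hle k
      _ ≤ C * rapidSeminorm ⟨q, hq⟩ N' k := by
          gcongr
          exact rapidSeminorm_mono hpq (le_max_left _ _) k
      _ ≤ _ := by gcongr; exact le_max_left _ _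

theorem rapid_complete : SeqComplete (RapidMatrix Ω A) := GoodAlg.complete.rapidMatrix

/-- The diagonal projection to the positive part of a signed index set. -/
noncomputable def sgn (τ : Ω → Fin 2) : TM Ω A :=
  diagT (fun x => ((τ x : ℕ) : ℝ)) ⟨1, 0, zero_le_one, fun x => by
    have : (τ x : ℕ) ≤ 1 := by omega
    have h1 : ((τ x : ℕ) : ℝ) ≤ 1 := by exact_mod_cast this
    simpa [abs_of_nonneg] using h1⟩

theorem sgn_apply (τ : Ω → Fin 2) (i j : Ω) :
    (sgn τ : TM Ω A).mat i j = if i = j ∧ τ i = 1 then 1 else 0 := by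
  change Matrix.diagonal _ i j = _
  rw [Matrix.diagonal_apply]
  by_cases h : i = j
  · rcases h2 : τ i with ⟨_ | _ | n, hn⟩
    · simp [h2]
    · simp [h, ← h2]
      simp [← h, h2]
    · omega
  · simp [h]

theorem sgn_mul_sgn (τ : Ω → Fin 2) : sgn τ * sgn τ = (sgn τ : TM Ω A) := by
  refine TM.ext fun i j => ?_
  rw [sgn, diagT_mul_apply, diagT_mat, Matrix.diagonal_apply]
  rcases h2 : τ i with ⟨_ | _ | n, hn⟩
  · simp
  · simp
  · omega

/-- The base idempotent. -/
noncomputable def R0T : TM Idx A := sgn Prod.fst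

theorem block_apply {Ω : Type*} (a b c d : Matrix Ω Ω (Unitization ℝ A)) (i j : Fin 2 × Ω) :
    block a b c d i j = (!![a, b; c, d] : Matrix (Fin 2) (Fin 2) (Matrix Ω Ω (Unitization ℝ A)))
      i.1 j.1 i.2 j.2 := rfl

theorem R0T_mat : (R0T : TM Idx A).mat = R0 := by
  refine Matrix.ext fun i j => ?_
  rw [R0T, sgn_apply, R0, block_apply]
  obtain ⟨i1, i2⟩ := i
  obtain ⟨j1, j2⟩ := j
  fin_cases i1 <;> fin_cases j1 <;> simp [Matrix.one_apply, Prod.ext_iff]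

theorem R0T_mul_R0T : R0T * R0T = (R0T : TM Idx A) := sgn_mul_sgn _

variable {E : Type w} [AddCommGroup E] [Module ℝ E] [TopologicalSpace E]
  [IsTopologicalAddGroup E] [ContinuousSMul ℝ E]

/-- Smooth families of idempotents in the Grassmannian. -/
def IsGr (S : Set E) (F : E → TM Idx A) : Prop :=
  SJ S (fun x => F x - R0T) ∧ ∀ x ∈ S, F x * F x = F x

/-- Smooth families of units. -/
structure IsUnits (S : Set E) (g g' : E → TM Idx A) : Prop where
  left : SJ S fun x => g x - 1
  right : SJ S fun x => g' x - 1
  mul_inv : ∀ x ∈ S, g x * g' x = 1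
  inv_mul : ∀ x ∈ S, g' x * g x = 1

/-- Smooth homotopy. -/
def Htpy (S : Set E) (F₀ F₁ : E → TM Idx A) : Prop :=
  ∃ H : E × ℝ → TM Idx A, IsGr (S ×ˢ 𝕀) H ∧
    ∀ x ∈ S, H (x, 0) = F₀ x ∧ H (x, 1) = F₁ x

theorem smoothInto_iff {b : TM Idx A} {S : Set E} {f : E → Mat A} :
    SmoothInto b.mat S f ↔ ∃ F : E → TM Idx A, SJ S (fun x => F x - b) ∧
      ∀ x ∈ S, f x = (F x).mat := by
  constructor
  · rintro ⟨U, hU, hSU, κ, hκ, hf⟩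
    exact ⟨fun x => b + incl (κ x), ⟨U, hU, hSU, κ, hκ, fun x _ => add_sub_cancel_left _ _⟩,
      fun x hx => hf x hx⟩
  · rintro ⟨F, ⟨U, hU, hSU, κ, hκ, hF⟩, hf⟩
    refine ⟨U, hU, hSU, κ, hκ, fun x hx => ?_⟩
    rw [hf x hx, perturb_eq, ← hF x hx, add_sub_cancel]

theorem mat_mem_Gr_iff {F : TM Idx A} : F.mat ∈ Gr A ↔ F * F = F ∧ ∃ k, F = R0T + incl k := by
  rw [Gr, mem_ofPred_eq, TM.mmul_eq, TM.mat_injective.eq_iff, ← R0T_mat]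
  refine and_congr_right fun _ => exists_congr fun k => ?_
  rw [perturb_eq, TM.mat_injective.eq_iff]

theorem smoothToGr_iff {S : Set E} {f : E → Mat A} :
    SmoothToGr S f ↔ ∃ F : E → TM Idx A, IsGr S F ∧ ∀ x ∈ S, f x = (F x).mat := by
  rw [SmoothToGr, ← R0T_mat, smoothInto_iff]
  constructor
  · rintro ⟨⟨F, hF, hf⟩, hG⟩
    refine ⟨F, ⟨hF, fun x hx => ?_⟩, hf⟩
    have := hG x hx
    rw [hf x hx, mat_mem_Gr_iff] at this
    exact this.1
  · rintro ⟨F, ⟨hF, hi⟩, hf⟩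
    refine ⟨⟨F, hF, hf⟩, fun x hx => ?_⟩
    rw [hf x hx, mat_mem_Gr_iff]
    refine ⟨hi x hx, ?_⟩
    obtain ⟨U, hU, hSU, κ, hκ, hF⟩ := hF
    exact ⟨κ x, by rw [← hF x hx, add_sub_cancel]⟩

theorem IsUnits.smoothUnits {S : Set E} {g g' : E → TM Idx A} (h : IsUnits S g g') :
    SmoothUnits S (fun x => (g x).mat) fun x => (g' x).mat := by
  refine ⟨?_, ?_, fun x hx => ?_⟩
  · rw [← TM.mat_one, smoothInto_iff]; exact ⟨g, h.left, fun _ _ => rfl⟩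
  · rw [← TM.mat_one, smoothInto_iff]; exact ⟨g', h.right, fun _ _ => rfl⟩
  · rw [TM.mmul_eq, TM.mmul_eq, h.mul_inv x hx, h.inv_mul x hx]
    exact ⟨rfl, rfl⟩

theorem IsCk.exists_deriv {F : Type v} [AddCommGroup F] [Module ℝ F] [TopologicalSpace F] [T2Space F]
    {U : Set E} (hU : IsOpen U) {f : E → F} (hf : ∀ n, IsCk n U f) : ∃ df : E × E → F,
      (∀ x ∈ U, ∀ h, HasDirDeriv f x h (df (x, h))) ∧ ∀ n, IsCk n (U ×ˢ univ) df := by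
  obtain ⟨_, df, hd, _⟩ := hf 1
  refine ⟨df, hd, fun n => ?_⟩
  obtain ⟨_, df', hd', hdf'⟩ := hf (n + 1)
  refine hdf'.congr (hU.prod isOpen_univ) fun z hz => ?_
  exact tendsto_nhds_unique (hd z.1 hz.1 z.2) (hd' z.1 hz.1 z.2)

theorem HasCurveDeriv.clm {F G : Type*} [AddCommGroup F] [Module ℝ F] [TopologicalSpace F]
    [AddCommGroup G] [Module ℝ G] [TopologicalSpace G] (L : F →L[ℝ] G) {γ : ℝ → F} {v : F} {S : Set ℝ}
    {t : ℝ} (h : HasCurveDeriv γ v S t) : HasCurveDeriv (fun s => L (γ s)) (L v) S t := by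
  refine ((L.continuous.tendsto v).comp h).congr fun s => ?_
  rw [Function.comp_apply, map_smul, map_sub]

theorem HasCurveDeriv.unique {F : Type*} [AddCommGroup F] [Module ℝ F] [TopologicalSpace F] [T2Space F]
    {γ η : ℝ → F} {v w : F} {t : ℝ} (h : HasCurveDeriv γ v (Icc 0 1) t)
    (h' : HasCurveDeriv η w (Icc 0 1) t) (ht : t ∈ 𝕀) (he : EqOn γ η (Icc 0 1)) : v = w := by
  have hne : (𝓝[𝕀 \ {t}] t).NeBot :=
    uniqueDiffWithinAt_iff_accPt.1 (uniqueDiffOn_Icc zero_lt_one t ht) |>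
      accPt_principal_iff_nhdsWithin.1
  refine tendsto_nhds_unique h (Tendsto.congr' ?_ h')
  filter_upwards [self_mem_nhdsWithin] with s hs
  rw [he hs.1, he ht]

/-- A smooth curve of idempotents is conjugated to its initial value by the solution of the
differential equation with right side `P' P - P P'`. -/
theorem conj_of_isSol {R : TM Idx A} {f d w a b : ℝ → RapidMatrix Idx A}
    (hidem : ∀ t ∈ 𝕀, (R + incl (f t)) * (R + incl (f t)) = R + incl (f t))
    (hd : ∀ t ∈ 𝕀, HasCurveDeriv f (d t) (Icc 0 1) t)
    (hw : ∀ t ∈ 𝕀, incl (w t) =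
      incl (d t) * (R + incl (f t)) - (R + incl (f t)) * incl (d t))
    (hb : IsSol w b) (ha : IsSolInv w a) {t : ℝ} (ht : t ∈ 𝕀) :
    (1 + incl (a t)) * (R + incl (f t)) * (1 + incl (b t)) = R + incl (f 0) := by
  have hd' : ∀ t ∈ 𝕀, incl (d t) * (R + incl (f t)) + (R + incl (f t)) * incl (d t) =
      incl (d t) := by
    intro t ht
    have h1 := (((hd t ht).clm (lmulL R)).add ((hd t ht).clm (rmulL R))).add ((hd t ht).mul (hd t ht))
    have h3 : HasCurveDeriv (fun s => f s - f 0 + (lmulL R (f 0) + rmulL R (f 0) + f 0 * f 0)) (d t)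
        (Icc 0 1) t := by
      refine Tendsto.congr (fun s => ?_) (hd t ht)
      congr 1
      exact ((add_sub_add_right_eq_sub _ _ _).trans (sub_sub_sub_cancel_right _ _ _)).symm
    have h2 := h1.unique h3 ht fun s hs => incl_injective ?_
    · have h4 := congrArg incl h2
      simp only [map_add, incl_lmulL, incl_rmulL, incl_mul] at h4
      rw [← h4]
      conv_rhs => rw [← h4]
      noncomm_ring
    · have h5 := hidem s hs
      have h6 := hidem 0 zero_mem_I
      simp only [map_add, map_sub, incl_lmulL, incl_rmulL, incl_mul]
      rw [add_mul, mul_add, mul_add] at h5 h6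
      have h7 : R * incl (f s) + incl (f s) * R + incl (f s) * incl (f s) = R + incl (f s) - R * R := by
        rw [← h5]; abel
      have h8 : R * incl (f 0) + incl (f 0) * R + incl (f 0) * incl (f 0) = R + incl (f 0) - R * R := by
        rw [← h6]; abel
      rw [h7, h8]; abel
  let K : ℝ → RapidMatrix Idx A := fun t => f t + rmulL R (a t) + lmulL R (b t) + a t * f t +
    f t * b t + rmulL R (a t) * b t + a t * f t * b t
  have hK : ∀ t, incl (K t) = (1 + incl (a t)) * (R + incl (f t)) * (1 + incl (b t)) - R := by
    intro t
    simp only [K, map_add, incl_lmulL, incl_rmulL, incl_mul]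
    noncomm_ring
  have hconst : K t = K 0 := by
    refine eq_of_hasCurveDeriv (γ := K) (η := fun _ => K 0) (γ' := fun _ => 0) (fun t ht => ?_)
      (fun t _ => by simpa [HasCurveDeriv] using tendsto_const_nhds) rfl ht
    have hft := hd t ht
    have hat := ha.2 t ht
    have hbt := hb.2 t ht
    have h1 := (((((hft.add (hat.clm (rmulL R))).add (hbt.clm (lmulL R))).add (hat.mul hft)).add
      (hft.mul hbt)).add ((hat.clm (rmulL R)).mul hbt)).add ((hat.mul hft).mul hbt)
    convert h1 using 1
    refine incl_injective ?_
    simp only [map_add, map_neg, map_zero, incl_lmulL, incl_rmulL, incl_mul]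
    have h2 := hw t ht
    have h3 := hd' t ht
    have h4 := hidem t ht
    set p := R + incl (f t) with hp
    have h5 : incl (f t) = p - R := by rw [hp]; abel
    rw [h5]
    set D := incl (d t)
    set W := incl (w t)
    set x := incl (a t)
    set y := incl (b t)
    have h6 : p * D * p = 0 := by
      have : p * (D * p + p * D) * p = p * D * p := by rw [h3]
      have h7 : p * (D * p + p * D) * p = p * D * (p * p) + (p * p) * D * p := by noncomm_ring
      rw [h7, h4] at this
      simpa using this
    have h7 : D - W * p + p * W = 0 := by
      rw [h2]
      have : D - (D * p - p * D) * p + p * (D * p - p * D) =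
          D - (D * (p * p) + (p * p) * D) + 2 * (p * D * p) := by noncomm_ring
      rw [this, h4, h3, h6]
      simp
    have h8 : (1 + x) * (D - W * p + p * W) * (1 + y) = 0 := by rw [h7]; simp
    rw [← h8]
    noncomm_ring
  have h1 := hK t
  rw [hconst, hK 0, ha.1, hb.1] at h1
  simp only [map_zero, add_zero, one_mul, mul_one, sub_left_inj] at h1
  exact h1.symm

theorem SJ.exists {Ω : Type} [GrowthIndex Ω] [PolyIdx Ω] [DecidableEq Ω] {S : Set E} {f : E → TM Ω A}
    (hf : SJ S f) {x : E} (hx : x ∈ S) : ∃ k, f x = incl k := by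
  obtain ⟨U, hU, hSU, κ, hκ, hF⟩ := hf
  exact ⟨κ x, hF x hx⟩

/-- Every smooth homotopy is induced by conjugation. -/
theorem IsGr.exists_conj {X : Set E} {H : E × ℝ → TM Idx A} (hH : IsGr (X ×ˢ 𝕀) H) :
    ∃ g g' : E × ℝ → TM Idx A, IsUnits (X ×ˢ 𝕀) g g' ∧ (∀ x ∈ X, g (x, 0) = 1) ∧
      ∀ x ∈ X, ∀ t ∈ 𝕀, H (x, t) = g (x, t) * H (x, 0) * g' (x, t) := by
  obtain ⟨⟨U, hU, hXU, κ, hκ, hF⟩, hidem⟩ := hH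
  have hF' : ∀ z ∈ X ×ˢ 𝕀, H z = R0T + incl (κ z) := fun z hz => by
    rw [← hF z hz, add_sub_cancel]
  obtain ⟨dκ, hd, hdκ⟩ := IsCk.exists_deriv hU hκ
  let d : E × ℝ → RapidMatrix Idx A := fun z => dκ (z, (0, 1))
  have hdC : ∀ n, IsCk n U d := fun n => (hdκ n).comp hU (hU.prod isOpen_univ)
    (IsCk.pair (IsCk.clm (ContinuousLinearMap.id ℝ (E × ℝ)) n U) (IsCk.const (0, 1) n U))
    fun z hz => ⟨hz, mem_univ _⟩
  let w : E × ℝ → RapidMatrix Idx A := fun z =>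
    (rmulL R0T (d z) + d z * κ z) + -(lmulL R0T (d z) + κ z * d z)
  have hw : ∀ z, incl (w z) = incl (d z) * (R0T + incl (κ z)) - (R0T + incl (κ z)) * incl (d z) := by
    intro z
    simp only [w, map_add, map_neg, incl_rmulL, incl_lmulL, incl_mul]
    noncomm_ring
  have hwC : ∀ n, IsCk n U w := fun n => IsCk.add hU
    (IsCk.add hU ((hdC n).clm_comp _ hU) (IsCk.mul hU (hdC n) (hκ n)))
    (IsCk.neg hU (IsCk.add hU ((hdC n).clm_comp _ hU) (IsCk.mul hU (hκ n) (hdC n))))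
  obtain ⟨V, hV, hXV, G, G', hG, hG', hsol⟩ := exists_smooth_sol rapid_complete rapid_mconvex hU hwC hXU
  have hinv : ∀ z ∈ X ×ˢ 𝕀, (1 + incl (G z)) * (1 + incl (G' z)) = 1 ∧
      (1 + incl (G' z)) * (1 + incl (G z)) = 1 := by
    rintro ⟨x, t⟩ ⟨hx, ht⟩
    have hc : ContinuousOn (fun t => w (x, t)) (Icc 0 1) :=
      (hwC 0).continuousOn.comp (by fun_prop) fun s hs => hXU ⟨hx, hs⟩
    have h1 := congrArg incl ((hsol x hx).1.mul_inv rapid_mconvex hc (hsol x hx).2 ht)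
    have h2 := congrArg incl ((hsol x hx).1.inv_mul (hsol x hx).2 ht)
    simp only [map_add, map_zero, incl_mul] at h1 h2
    constructor
    · rw [show (1 + incl (G (x, t))) * (1 + incl (G' (x, t))) = 1 + (incl (G (x, t)) +
        incl (G' (x, t)) + incl (G (x, t)) * incl (G' (x, t))) by noncomm_ring, h1, add_zero]
    · rw [show (1 + incl (G' (x, t))) * (1 + incl (G (x, t))) = 1 + (incl (G' (x, t)) +
        incl (G (x, t)) + incl (G' (x, t)) * incl (G (x, t))) by noncomm_ring, h2, add_zero]
  refine ⟨fun z => 1 + incl (G z), fun z => 1 + incl (G' z), ⟨?_, ?_, fun z hz => (hinv z hz).1,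
    fun z hz => (hinv z hz).2⟩, fun x hx => ?_, fun x hx t ht => ?_⟩
  · exact ⟨V, hV, hXV, G, hG, fun z _ => add_sub_cancel_left _ _⟩
  · exact ⟨V, hV, hXV, G', hG', fun z _ => add_sub_cancel_left _ _⟩
  · have := (hsol x hx).1.1
    beta_reduce at this ⊢
    rw [this, map_zero, add_zero]
  · have hcurve : ∀ t ∈ 𝕀, HasCurveDeriv (fun t => κ (x, t)) (d (x, t)) (Icc 0 1) t := by
      intro t ht
      have h1 := (hd (x, t) (hXU ⟨hx, ht⟩) (0, 1)).hasCurveDeriv (y := (x, 0)) (t := t) (by simp)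
        (Icc 0 1)
      simpa using h1
    have h1 := conj_of_isSol (R := R0T) (f := fun t => κ (x, t)) (d := fun t => d (x, t))
      (w := fun t => w (x, t)) (a := fun t => G' (x, t)) (b := fun t => G (x, t))
      (fun t ht => by
        have := hidem (x, t) ⟨hx, ht⟩
        rwa [hF' _ ⟨hx, ht⟩] at this) hcurve (fun t _ => hw _) (hsol x hx).1 (hsol x hx).2 ht
    have h2 := hinv (x, t) ⟨hx, ht⟩
    rw [hF' _ ⟨hx, ht⟩, hF' (x, 0) ⟨hx, zero_mem_I⟩, ← h1]
    rw [show (1 + incl (G (x, t))) * ((1 + incl (G' (x, t))) * (R0T + incl (κ (x, t))) *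
      (1 + incl (G (x, t)))) * (1 + incl (G' (x, t))) = ((1 + incl (G (x, t))) *
      (1 + incl (G' (x, t)))) * (R0T + incl (κ (x, t))) * ((1 + incl (G (x, t))) *
      (1 + incl (G' (x, t)))) by simp only [mul_assoc], h2.1, one_mul, mul_one]

theorem inducedByConj {X : Set E} {H : E × ℝ → Mat A} (hH : SmoothToGr (X ×ˢ 𝕀) H) :
    InducedByConj X H := by
  obtain ⟨F, hF, hHF⟩ := smoothToGr_iff.1 hH
  obtain ⟨g, g', hg, h0, h1⟩ := hF.exists_conj
  refine ⟨_, _, hg.smoothUnits, fun x hx => ?_, fun x hx t ht => ?_⟩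
  · rw [h0 x hx, TM.mat_one]
  · rw [hHF _ ⟨hx, ht⟩, hHF _ ⟨hx, zero_mem_I⟩, h1 x hx t ht, TM.mmul_eq, TM.mmul_eq]

theorem Htpy.conjHomotopic {S : Set E} {F₀ F₁ : E → TM Idx A} (h : Htpy S F₀ F₁) {f₀ f₁ : E → Mat A}
    (h₀ : ∀ x ∈ S, f₀ x = (F₀ x).mat) (h₁ : ∀ x ∈ S, f₁ x = (F₁ x).mat) : ConjHomotopic S f₀ f₁ := by
  obtain ⟨H, hH, he⟩ := h
  have : SmoothToGr (S ×ˢ 𝕀) fun z => (H z).mat := smoothToGr_iff.2 ⟨H, hH, fun _ _ => rfl⟩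
  refine ⟨_, this, fun x hx => ?_, inducedByConj this⟩
  rw [(he x hx).1, (he x hx).2, h₀ x hx, h₁ x hx]
  exact ⟨rfl, rfl⟩

theorem ConjHomotopic.exists_htpy {S : Set E} {f₀ f₁ : E → Mat A} (h : ConjHomotopic S f₀ f₁) :
    ∃ H : E × ℝ → TM Idx A, IsGr (S ×ˢ 𝕀) H ∧
      ∀ x ∈ S, f₀ x = (H (x, 0)).mat ∧ f₁ x = (H (x, 1)).mat := by
  obtain ⟨H, hH, he, _⟩ := h
  obtain ⟨F, hF, hHF⟩ := smoothToGr_iff.1 hH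
  refine ⟨F, hF, fun x hx => ?_⟩
  rw [← (he x hx).1, ← (he x hx).2]
  exact ⟨hHF _ ⟨hx, zero_mem_I⟩, hHF _ ⟨hx, one_mem_I⟩⟩

section Htpy

variable {S : Set E}

theorem IsGr.congr {F F' : E → TM Idx A} (hF : IsGr S F) (h : ∀ x ∈ S, F' x = F x) : IsGr S F' :=
  ⟨hF.1.congr fun x hx => by rw [h x hx], fun x hx => by rw [h x hx]; exact hF.2 x hx⟩

theorem IsGr.sm {F : E → TM Idx A} (hF : IsGr S F) : SM S F :=
  ((SM.const R0T).add hF.1.sm).congr fun x _ => (add_sub_cancel _ _).symm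

theorem IsGr.fst {F : E → TM Idx A} (hF : IsGr S F) (T : Set ℝ) :
    IsGr (S ×ˢ T) fun z : E × ℝ => F z.1 := by
  refine ⟨?_, fun z hz => hF.2 z.1 hz.1⟩
  exact hF.1.comp (φ := Prod.fst) isOpen_univ (fun n => IsCk.clm (ContinuousLinearMap.fst ℝ E ℝ) n _)
    (subset_univ _) fun z hz => hz.1

theorem SJ.fst {Ω : Type} [GrowthIndex Ω] [PolyIdx Ω] [DecidableEq Ω] {F : E → TM Ω A} (hF : SJ S F)
    (T : Set ℝ) : SJ (S ×ˢ T) fun z : E × ℝ => F z.1 :=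
  hF.comp (φ := Prod.fst) isOpen_univ (fun n => IsCk.clm (ContinuousLinearMap.fst ℝ E ℝ) n _)
    (subset_univ _) fun z hz => hz.1

theorem IsUnits.sm {g g' : E → TM Idx A} (h : IsUnits S g g') : SM S g ∧ SM S g' :=
  ⟨((SM.const 1).add h.left.sm).congr fun x _ => (add_sub_cancel _ _).symm,
    ((SM.const 1).add h.right.sm).congr fun x _ => (add_sub_cancel _ _).symm⟩

theorem IsUnits.isGr_conj {g g' F : E → TM Idx A} (h : IsUnits S g g') (hF : IsGr S F) :
    IsGr S fun x => g x * F x * g' x := by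
  refine ⟨?_, fun x hx => ?_⟩
  · refine (((h.sm.2.mul_right (hF.sm.mul_right h.left)).add (hF.sm.mul_left h.right)).add hF.1).congr
      fun x _ => ?_
    noncomm_ring
  · rw [show g x * F x * g' x * (g x * F x * g' x) = g x * F x * (g' x * g x) * F x * g' x by
      simp only [mul_assoc], h.inv_mul x hx, mul_one, mul_assoc (g x), hF.2 x hx]

theorem Htpy.congr {F₀ F₁ F₀' F₁' : E → TM Idx A} (h : Htpy S F₀ F₁) (h₀ : ∀ x ∈ S, F₀' x = F₀ x)
    (h₁ : ∀ x ∈ S, F₁' x = F₁ x) : Htpy S F₀' F₁' := by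
  obtain ⟨H, hH, he⟩ := h
  exact ⟨H, hH, fun x hx => by rw [h₀ x hx, h₁ x hx]; exact he x hx⟩

theorem Htpy.symm {F₀ F₁ : E → TM Idx A} (h : Htpy S F₀ F₁) : Htpy S F₁ F₀ := by
  obtain ⟨H, hH, he⟩ := h
  have hm : MapsTo (fun z : E × ℝ => (z.1, 1 + -z.2)) (S ×ˢ 𝕀) (S ×ˢ 𝕀) :=
    fun z hz => ⟨hz.1, by have := hz.2.1; have := hz.2.2; constructor <;> dsimp only <;> linarith⟩
  refine ⟨fun z => H (z.1, 1 + -z.2), ⟨?_, fun z hz => hH.2 _ (hm hz)⟩, fun x hx => ?_⟩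
  · refine hH.1.comp (φ := fun z : E × ℝ => (z.1, 1 + -z.2)) isOpen_univ (fun n => ?_)
      (subset_univ _) hm
    exact IsCk.pair (IsCk.clm (ContinuousLinearMap.fst ℝ E ℝ) n _) (IsCk.add isOpen_univ
      (IsCk.const 1 n _) (IsCk.neg isOpen_univ (IsCk.clm (ContinuousLinearMap.snd ℝ E ℝ) n _)))
  · have h1 : (1 : ℝ) + -0 = 1 := by norm_num
    have h2 : (1 : ℝ) + -1 = 0 := by norm_num
    beta_reduce
    rw [h1, h2]
    exact (he x hx).symm

theorem Htpy.isGr_left {F₀ F₁ : E → TM Idx A} (h : Htpy S F₀ F₁) : IsGr S F₀ := by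
  obtain ⟨H, hH, he⟩ := h
  refine IsGr.congr (F := fun x => H (x, 0)) ⟨?_, fun x hx => hH.2 _ ⟨hx, zero_mem_I⟩⟩
    fun x hx => (he x hx).1.symm
  exact hH.1.comp (φ := fun x => (x, 0)) isOpen_univ
    (fun n => IsCk.pair (IsCk.clm (ContinuousLinearMap.id ℝ E) n _) (IsCk.const 0 n _))
    (subset_univ _) fun x hx => ⟨hx, zero_mem_I⟩

theorem IsUnits.mul {g g' h h' : E → TM Idx A} (hg : IsUnits S g g') (hh : IsUnits S h h') :
    IsUnits S (fun x => g x * h x) fun x => h' x * g' x where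
  left := ((hg.sm.1.mul_left hh.left).add hg.left).congr fun x _ => by noncomm_ring
  right := ((hh.sm.2.mul_left hg.right).add hh.right).congr fun x _ => by noncomm_ring
  mul_inv x hx := by
    rw [mul_assoc, ← mul_assoc (h x), hh.mul_inv x hx, one_mul, hg.mul_inv x hx]
  inv_mul x hx := by
    rw [mul_assoc, ← mul_assoc (g' x), hg.inv_mul x hx, one_mul, hh.inv_mul x hx]

theorem Htpy.trans {F₀ F₁ F₂ : E → TM Idx A} (h : Htpy S F₀ F₁) (h' : Htpy S F₁ F₂) : Htpy S F₀ F₂ := by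
  have hF := h.isGr_left
  obtain ⟨H, hH, he⟩ := h
  obtain ⟨K, hK, he'⟩ := h'
  obtain ⟨g, g', hg, hg0, hgc⟩ := hH.exists_conj
  obtain ⟨k, k', hk, hk0, hkc⟩ := hK.exists_conj
  refine ⟨fun z => (k z * g z) * F₀ z.1 * (g' z * k' z), (hk.mul hg).isGr_conj (hF.fst _), fun x hx => ?_⟩
  have e : ∀ t ∈ 𝕀, k (x, t) * g (x, t) * F₀ x * (g' (x, t) * k' (x, t)) =
      k (x, t) * H (x, t) * k' (x, t) := by
    intro t ht
    rw [hgc x hx t ht, (he x hx).1]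
    simp only [mul_assoc]
  constructor
  · have h1 := hkc x hx 0 zero_mem_I
    have h2 := hk.mul_inv (x, 0) ⟨hx, zero_mem_I⟩
    beta_reduce
    rw [e 0 zero_mem_I, hk0 x hx, one_mul]
    rw [hk0 x hx, one_mul] at h2
    rw [h2, mul_one, (he x hx).1]
  · beta_reduce
    rw [e 1 one_mem_I, (he x hx).2, ← (he' x hx).1, ← hkc x hx 1 one_mem_I, (he' x hx).2]

end Htpy

/-! ### Diagonal families with scaled parameters -/

/-- Smooth functions which are constant before `0` and after `1`. -/
structure Transit (φ : ℝ → ℝ) : Prop where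
  contDiff : ContDiff ℝ (⊤ : ℕ∞) φ
  left : ∃ a, ∀ x < 0, φ x = a
  right : ∃ b, ∀ x > 1, φ x = b

theorem Transit.exists_bound {φ : ℝ → ℝ} (h : Transit φ) : ∃ C, 0 ≤ C ∧ ∀ x, |φ x| ≤ C := by
  obtain ⟨a, ha⟩ := h.left
  obtain ⟨b, hb⟩ := h.right
  obtain ⟨C, hC⟩ := (isCompact_Icc (a := (0 : ℝ)) (b := 1)).exists_bound_of_continuousOn
    h.contDiff.continuous.continuousOn
  refine ⟨max C (max |a| |b|), (abs_nonneg a).trans ((le_max_left _ _).trans (le_max_right _ _)),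
    fun x => ?_⟩
  rcases lt_or_ge x 0 with hx | hx
  · rw [ha x hx]; exact (le_max_left _ _).trans (le_max_right _ _)
  rcases lt_or_ge 1 x with hx' | hx'
  · rw [hb x hx']; exact (le_max_right _ _).trans (le_max_right _ _)
  · exact (hC x ⟨hx, hx'⟩).trans (le_max_left _ _)

theorem Transit.deriv {φ : ℝ → ℝ} (h : Transit φ) : Transit (deriv φ) := by
  obtain ⟨a, ha⟩ := h.left
  obtain ⟨b, hb⟩ := h.right
  refine ⟨(contDiff_infty_iff_deriv.1 h.contDiff).2, ⟨0, fun x hx => ?_⟩, ⟨0, fun x hx => ?_⟩⟩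
  · have : φ =ᶠ[𝓝 x] fun _ => a := by filter_upwards [gt_mem_nhds hx] with y hy using ha y hy
    rw [this.deriv_eq, deriv_const]
  · have : φ =ᶠ[𝓝 x] fun _ => b := by filter_upwards [lt_mem_nhds hx] with y hy using hb y hy
    rw [this.deriv_eq, deriv_const]

theorem Transit.hasDerivAt {φ : ℝ → ℝ} (h : Transit φ) (x : ℝ) : HasDerivAt φ (_root_.deriv φ x) x :=
  (h.contDiff.differentiable (by simp) x).hasDerivAt

theorem Transit.exists_lipschitz {φ : ℝ → ℝ} (h : Transit φ) :
    ∃ C, 0 ≤ C ∧ ∀ x y, |φ y - φ x| ≤ C * |y - x| := by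
  obtain ⟨C, hC, hb⟩ := h.deriv.exists_bound
  exact ⟨C, hC, fun x y => convex_univ.norm_image_sub_le_of_norm_hasDerivWithin_le
    (fun z _ => (h.hasDerivAt z).hasDerivWithinAt) (fun z _ => hb z) (mem_univ x) (mem_univ y)⟩

theorem Transit.exists_taylor {φ : ℝ → ℝ} (h : Transit φ) :
    ∃ C, 0 ≤ C ∧ ∀ x y, |φ y - φ x - (y - x) * _root_.deriv φ x| ≤ C * |y - x| ^ 2 := by
  obtain ⟨C, hC, hb⟩ := h.deriv.exists_lipschitz
  refine ⟨C, hC, fun x y => ?_⟩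
  have h1 := (convex_uIcc x y).norm_image_sub_le_of_norm_hasDerivWithin_le
    (f := fun z => φ z - z * _root_.deriv φ x) (C := C * |y - x|)
    (fun z _ => ((h.hasDerivAt z).sub ((hasDerivAt_id z).mul_const _)).hasDerivWithinAt)
    (fun z hz => by
      rw [one_mul]
      refine (hb x z).trans (mul_le_mul_of_nonneg_left ?_ hC)
      exact abs_sub_left_of_mem_uIcc hz) left_mem_uIcc right_mem_uIcc
  rw [Real.norm_eq_abs, Real.norm_eq_abs, mul_assoc, ← sq] at h1
  convert h1 using 2
  ring

theorem rapidSeminorm_diag_le {k l : RapidMatrix Ω A} {c : Ω → ℝ}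
    (h : ∀ i j, l.toMatrix i j = c i • k.toMatrix i j) {C : ℝ} (hC : 0 ≤ C) {M : ℕ}
    (hc : ∀ i, |c i| ≤ C * wt i ^ M) (p : {p : Seminorm ℝ A // Continuous p}) (N : ℕ) :
    rapidSeminorm p N l ≤ C * rapidSeminorm p (N + M) k := by
  refine rapidSeminorm_le _ _ _ (mul_nonneg hC (apply_nonneg _ _)) fun i j => ?_
  have h1 := le_rapidSeminorm p (N + M) k i j
  rw [weight_eq, pow_add, pow_add] at h1
  have hi := wt_pos i
  have hj := wt_pos j
  have h2 := one_le_wt_pow j M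
  have hp := apply_nonneg p.1 (k.toMatrix i j)
  rw [h, map_smul_eq_mul, Real.norm_eq_abs, weight_eq]
  calc wt i ^ N * wt j ^ N * (|c i| * p.1 (k.toMatrix i j))
      ≤ wt i ^ N * (wt j ^ N * 1) * ((C * wt i ^ M) * p.1 (k.toMatrix i j)) := by
        have := hc i
        rw [mul_one]
        gcongr
    _ ≤ wt i ^ N * (wt j ^ N * wt j ^ M) * ((C * wt i ^ M) * p.1 (k.toMatrix i j)) := by gcongr
    _ = C * (wt i ^ N * wt i ^ M * (wt j ^ N * wt j ^ M) * p.1 (k.toMatrix i j)) := by ring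
    _ ≤ _ := by gcongr

theorem rapid_tendsto {X : Type*} {L : Filter X} {f : X → RapidMatrix Ω A} {k : RapidMatrix Ω A}
    (h : ∀ p N, ∃ g : X → ℝ, Tendsto g L (𝓝 0) ∧ ∀ᶠ x in L, rapidSeminorm p N (f x - k) ≤ g x) :
    Tendsto f L (𝓝 k) := by
  rw [(rapid_withSeminorms Ω A).tendsto_nhds]
  rintro ⟨p, N⟩ ε hε
  obtain ⟨g, hg, hle⟩ := h p N
  filter_upwards [hle, hg.eventually (gt_mem_nhds hε)] with x h1 h2 using h1.trans_lt h2

theorem lmulL_diagT_apply (f : Ω → ℝ) (hf) (k : RapidMatrix Ω A) (i j : Ω) :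
    (lmulL (diagT f hf) k).toMatrix i j = f i • k.toMatrix i j := by
  have := diagT_mul_apply f hf (incl k) i j
  rw [← incl_lmulL, incl_apply, incl_apply, ← Unitization.inr_smul] at this
  exact Unitization.inr_injective this

/-- The diagonal matrix of the values `φ (2 wt(x) t - 1)`. -/
noncomputable def dl {φ : ℝ → ℝ} (hφ : Transit φ) (t : ℝ) : TM Ω A :=
  diagT (fun x => φ (2 * wt x * t - 1)) (by
    obtain ⟨C, hC, h⟩ := hφ.exists_bound
    exact ⟨C, 0, hC, fun x => by simpa using h _⟩)

/-- The diagonal matrix of the weights. -/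
noncomputable def wtT : TM Ω A := diagT (fun x => 2 * wt x) ⟨2, 1, zero_le_two, fun x => by
  rw [abs_of_nonneg (by have := wt_pos x; positivity), pow_one]⟩

theorem dl_apply {φ : ℝ → ℝ} (hφ : Transit φ) (t : ℝ) (k : RapidMatrix Ω A) (i j : Ω) :
    (lmulL (dl hφ t) k).toMatrix i j = φ (2 * wt i * t - 1) • k.toMatrix i j := lmulL_diagT_apply _ _ _ _ _

theorem rapidSeminorm_dl_le {φ : ℝ → ℝ} (hφ : Transit φ) : ∃ C, 0 ≤ C ∧ ∀ t (k : RapidMatrix Ω A) p N,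
    rapidSeminorm p N (lmulL (dl hφ t) k) ≤ C * rapidSeminorm p N k := by
  obtain ⟨C, hC, h⟩ := hφ.exists_bound
  exact ⟨C, hC, fun t k p N => rapidSeminorm_diag_le (dl_apply hφ t k) hC (M := 0)
    (fun i => by simpa using h _) p N⟩

theorem rapidSeminorm_dl_sub_le {φ : ℝ → ℝ} (hφ : Transit φ) : ∃ C, 0 ≤ C ∧
    ∀ t s (k : RapidMatrix Ω A) p N, rapidSeminorm p N (lmulL (dl hφ t) k - lmulL (dl hφ s) k) ≤
      C * |t - s| * rapidSeminorm p (N + 1) k := by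
  obtain ⟨C, hC, h⟩ := hφ.exists_lipschitz
  refine ⟨C * 2, by positivity, fun t s k p N => rapidSeminorm_diag_le
    (c := fun i => φ (2 * wt i * t - 1) - φ (2 * wt i * s - 1)) (fun i j => ?_) (by positivity)
    (fun i => ?_) p N⟩
  · rw [RapidMatrix.toMatrix_sub, dl_apply, dl_apply, sub_smul]
  · refine (h _ _).trans (le_of_eq ?_)
    have hi := wt_pos i
    rw [show 2 * wt i * t - 1 - (2 * wt i * s - 1) = 2 * wt i * (t - s) by ring, abs_mul,
      abs_of_pos (by positivity : 0 < 2 * wt i)]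
    ring

theorem rapidSeminorm_dl_taylor_le {φ : ℝ → ℝ} (hφ : Transit φ) : ∃ C, 0 ≤ C ∧
    ∀ t s (k : RapidMatrix Ω A) p N, rapidSeminorm p N (lmulL (dl hφ t) k - lmulL (dl hφ s) k -
      (t - s) • lmulL (dl hφ.deriv s) (lmulL wtT k)) ≤ C * |t - s| ^ 2 * rapidSeminorm p (N + 2) k := by
  obtain ⟨C, hC, h⟩ := hφ.exists_taylor
  refine ⟨C * 4, by positivity, fun t s k p N => rapidSeminorm_diag_le
    (c := fun i => φ (2 * wt i * t - 1) - φ (2 * wt i * s - 1) -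
      (2 * wt i * (t - s)) * deriv φ (2 * wt i * s - 1)) (fun i j => ?_) (by positivity)
    (fun i => ?_) p N⟩
  · rw [RapidMatrix.toMatrix_sub, RapidMatrix.toMatrix_sub, RapidMatrix.toMatrix_smul, dl_apply,
      dl_apply, dl_apply, wtT, lmulL_diagT_apply]
    module
  · have hi := wt_pos i
    have h1 := h (2 * wt i * s - 1) (2 * wt i * t - 1)
    rw [show 2 * wt i * t - 1 - (2 * wt i * s - 1) = 2 * wt i * (t - s) by ring] at h1
    refine h1.trans (le_of_eq ?_)
    rw [abs_mul, abs_of_pos (by positivity : 0 < 2 * wt i)]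
    ring

protected theorem IsCk.dl {φ : ℝ → ℝ} (hφ : Transit φ) (n : ℕ) :
    IsCk n univ fun z : ℝ × RapidMatrix Ω A => lmulL (dl hφ z.1) z.2 := by
  have hcont : ∀ {φ : ℝ → ℝ} (hφ : Transit φ),
      Continuous fun z : ℝ × RapidMatrix Ω A => lmulL (dl hφ z.1) z.2 := by
    intro φ hφ
    rw [continuous_iff_continuousAt]
    rintro ⟨t₀, k₀⟩
    refine rapid_tendsto fun p N => ?_
    obtain ⟨C, hC, h1⟩ := rapidSeminorm_dl_le (Ω := Ω) (A := A) hφ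
    obtain ⟨D, hD, h2⟩ := rapidSeminorm_dl_sub_le (Ω := Ω) (A := A) hφ
    refine ⟨fun z => C * rapidSeminorm p N (z.2 - k₀) + D * |z.1 - t₀| * rapidSeminorm p (N + 1) k₀,
      ?_, Eventually.of_forall fun z => ?_⟩
    · have := continuous_rapidSeminorm (Ω := Ω) p N
      have h3 : Continuous fun z : ℝ × RapidMatrix Ω A => C * rapidSeminorm p N (z.2 - k₀) +
          D * |z.1 - t₀| * rapidSeminorm p (N + 1) k₀ := by fun_prop
      simpa using h3.tendsto (t₀, k₀)
    · have h3 : lmulL (dl hφ z.1) z.2 - lmulL (dl hφ t₀) k₀ =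
          lmulL (dl hφ z.1) (z.2 - k₀) +
          (lmulL (dl hφ z.1) k₀ - lmulL (dl hφ t₀) k₀) := by
        rw [map_sub]; abel
      beta_reduce
      rw [h3]
      exact (map_add_le_add _ _ _).trans (add_le_add (h1 _ _ _ _) (h2 _ _ _ _ _))
  induction n generalizing φ with
  | zero => exact (hcont hφ).continuousOn
  | succ n ih =>
    refine ⟨(hcont hφ).continuousOn, fun z => lmulL (dl hφ z.1.1) z.2.2 +
      z.2.1 • lmulL (dl hφ.deriv z.1.1) (lmulL wtT z.1.2), ?_, ?_⟩
    · rintro ⟨t₀, k₀⟩ - ⟨τ, η⟩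
      refine rapid_tendsto fun p N => ?_
      obtain ⟨D, hD, h2⟩ := rapidSeminorm_dl_sub_le (Ω := Ω) (A := A) hφ
      obtain ⟨B, hB, h3⟩ := rapidSeminorm_dl_taylor_le (Ω := Ω) (A := A) hφ
      refine ⟨fun s => D * |s * τ| * rapidSeminorm p (N + 1) η +
        |s| * (B * |τ| ^ 2 * rapidSeminorm p (N + 2) k₀), ?_, ?_⟩
      · have h4 : Continuous fun s : ℝ => D * |s * τ| * rapidSeminorm p (N + 1) η +
          |s| * (B * |τ| ^ 2 * rapidSeminorm p (N + 2) k₀) := by fun_prop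
        simpa using (h4.tendsto 0).mono_left nhdsWithin_le_nhds
      · filter_upwards [self_mem_nhdsWithin] with s hs
        have hs0 : s ≠ 0 := hs
        have h4 := h2 (t₀ + s * τ) t₀ η p N
        have h5 := h3 (t₀ + s * τ) t₀ k₀ p N
        rw [add_sub_cancel_left] at h4 h5
        have h6 : s⁻¹ • (lmulL (dl hφ (t₀ + s * τ)) (k₀ + s • η) -
            lmulL (dl hφ t₀) k₀) - (lmulL (dl hφ t₀) η +
              τ • lmulL (dl hφ.deriv t₀) (lmulL wtT k₀)) =
            (lmulL (dl hφ (t₀ + s * τ)) η - lmulL (dl hφ t₀) η) +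
            s⁻¹ • (lmulL (dl hφ (t₀ + s * τ)) k₀ - lmulL (dl hφ t₀) k₀ -
              (s * τ) • lmulL (dl hφ.deriv t₀) (lmulL wtT k₀)) := by
          rw [map_add, map_smul]
          simp only [smul_sub, smul_add, smul_smul, inv_mul_cancel₀ hs0, inv_mul_cancel_left₀ hs0,
            one_smul]
          abel
        change rapidSeminorm p N (s⁻¹ • (lmulL (dl hφ (t₀ + s * τ)) (k₀ + s • η) -
            lmulL (dl hφ t₀) k₀) - (lmulL (dl hφ t₀) η +
              τ • lmulL (dl hφ.deriv t₀) (lmulL wtT k₀))) ≤ _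
        rw [h6]
        refine (map_add_le_add _ _ _).trans (add_le_add h4 ?_)
        rw [map_smul_eq_mul, norm_inv, Real.norm_eq_abs]
        have hs1 : 0 < |s| := abs_pos.2 hs0
        calc |s|⁻¹ * _ ≤ |s|⁻¹ * (B * |s * τ| ^ 2 * rapidSeminorm p (N + 2) k₀) := by gcongr
          _ = _ := by rw [abs_mul]; field_simp
    · have hU : IsOpen ((univ : Set (ℝ × RapidMatrix Ω A)) ×ˢ (univ : Set (ℝ × RapidMatrix Ω A))) :=
        isOpen_univ.prod isOpen_univ
      let f1 := ContinuousLinearMap.fst ℝ (ℝ × RapidMatrix Ω A) (ℝ × RapidMatrix Ω A)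
      let f2 := ContinuousLinearMap.snd ℝ (ℝ × RapidMatrix Ω A) (ℝ × RapidMatrix Ω A)
      let g1 := ContinuousLinearMap.fst ℝ ℝ (RapidMatrix Ω A)
      let g2 := ContinuousLinearMap.snd ℝ ℝ (RapidMatrix Ω A)
      refine IsCk.add hU ?_ (IsCk.smul hU (IsCk.clm (g1.comp f2) n _) ?_)
      · exact (ih hφ).comp hU isOpen_univ (IsCk.clm ((g1.comp f1).prod (g2.comp f2)) n _)
          (mapsTo_univ _ _)
      · exact (ih hφ.deriv).comp hU isOpen_univ
          (IsCk.clm ((g1.comp f1).prod ((lmulL wtT).comp (g2.comp f1))) n _) (mapsTo_univ _ _)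

variable {S : Set E}

theorem IsCk.dl_comp {φ : ℝ → ℝ} (hφ : Transit φ) {U : Set E} (hU : IsOpen U)
    {κ : E → RapidMatrix Ω A} {t : E → ℝ} (n : ℕ) (ht : IsCk n U t) (hκ : IsCk n U κ) :
    IsCk n U fun x => lmulL (dl hφ (t x)) (κ x) := by
  have h1 : IsCk n U fun x => (t x, κ x) := ht.pair hκ
  have h2 := IsCk.dl (Ω := Ω) (A := A) hφ n
  have h3 := IsCk.comp hU isOpen_univ h2 h1 (fun _ _ => mem_univ _)
  exact h3

theorem SJ.dl_mul {φ : ℝ → ℝ} (hφ : Transit φ) {f : E → TM Ω A} (hf : SJ S f) {t : E → ℝ}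
    (ht : ∀ n, IsCk n univ t) : SJ S fun x => dl hφ (t x) * f x := by
  obtain ⟨U, hU, hSU, κ, hκ, hf⟩ := hf
  refine ⟨U, hU, hSU, fun x => lmulL (dl hφ (t x)) (κ x), fun n => ?_,
    fun x hx => by beta_reduce; rw [hf x hx, incl_lmulL]⟩
  have h1 := (ht n).mono (subset_univ U)
  have h2 := hκ n
  exact IsCk.dl_comp hφ hU n h1 h2

theorem diagT_tr (f : Ω → ℝ) (hf) : (diagT f hf : TM Ω A).tr = diagT f hf :=
  TM.mat_injective (Matrix.diagonal_transpose _)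

theorem SJ.mul_dl {φ : ℝ → ℝ} (hφ : Transit φ) {f : E → TM Ω A} (hf : SJ S f) {t : E → ℝ}
    (ht : ∀ n, IsCk n univ t) : SJ S fun x => f x * dl hφ (t x) := by
  refine (hf.tr.dl_mul hφ ht).tr.congr fun x _ => ?_
  rw [TM.tr_mul, TM.tr_tr, dl, diagT_tr]

/-! ### Embeddings into the standard index set -/

theorem PolyEmb.uncurry {n : ℕ} {Ω Ω' : Type} [GrowthIndex Ω] [GrowthIndex Ω'] {j : Fin n → Ω → Ω'}
    (hj : ∀ i, PolyEmb (j i)) (hd : ∀ i i' x y, j i x = j i' y → i = i') :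
    PolyEmb (fun z : Fin n × Ω => j z.1 z.2) := by
  choose C N hC h using fun i => (hj i).upper
  choose D M hD h' using fun i => (hj i).lower
  have hle : ∀ (f : Fin n → ℝ) (hf : ∀ i, 0 ≤ f i) i, f i ≤ ∑ i, f i := fun f hf i =>
    Finset.single_le_sum (fun i _ => hf i) (Finset.mem_univ i)
  have hwt : ∀ z : Fin n × Ω, wt z = wt z.2 := fun z => by simp [wt]
  refine ⟨fun z z' hz => ?_, ⟨∑ i, C i, ∑ i, N i, Finset.sum_nonneg fun i _ => hC i, fun z => ?_⟩,
    ⟨∑ i, D i, ∑ i, M i, Finset.sum_nonneg fun i _ => hD i, fun z => ?_⟩⟩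
  · obtain ⟨i, x⟩ := z
    obtain ⟨i', y⟩ := z'
    obtain rfl := hd _ _ _ _ hz
    exact Prod.ext rfl ((hj i).injective hz)
  · rw [hwt]
    refine (h z.1 z.2).trans (mul_le_mul (hle C hC _) (pow_le_pow_right₀ (one_le_wt _)
      (Finset.single_le_sum (fun i _ => Nat.zero_le _) (Finset.mem_univ _)))
      (pow_nonneg (wt_pos _).le _) (Finset.sum_nonneg fun i _ => hC i))
  · rw [hwt]
    refine (h' z.1 z.2).trans (mul_le_mul (hle D hD _) (pow_le_pow_right₀ (one_le_wt _)
      (Finset.single_le_sum (fun i _ => Nat.zero_le _) (Finset.mem_univ _)))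
      (pow_nonneg (wt_pos _).le _) (Finset.sum_nonneg fun i _ => hD i))

/-- Sign preserving embeddings of a signed index set. -/
structure SEmb {Ω : Type} [GrowthIndex Ω] (τ : Ω → Fin 2) (j : Ω → Idx) : Prop where
  emb : PolyEmb j
  sign : ∀ x, (j x).1 = τ x

theorem SEmb.uncurry {n : ℕ} {Ω : Type} [GrowthIndex Ω] {τ : Fin n → Ω → Fin 2} {j : Fin n → Ω → Idx}
    (hj : ∀ i, SEmb (τ i) (j i)) (hd : ∀ i i' x y, j i x = j i' y → i = i') :
    SEmb (fun z : Fin n × Ω => τ z.1 z.2) (fun z : Fin n × Ω => j z.1 z.2) :=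
  ⟨PolyEmb.uncurry (fun i => (hj i).emb) hd, fun z => (hj z.1).sign z.2⟩

/-- If `D` is idempotent, then this means that `D + κ` is idempotent. -/
def QI (D κ : TM Ω A) : Prop := D * κ + κ * D + κ * κ = κ

theorem QI.idem {D κ : TM Ω A} (hD : D * D = D) (h : QI D κ) : (D + κ) * (D + κ) = D + κ := by
  have : (D + κ) * (D + κ) = D * D + (D * κ + κ * D + κ * κ) := by noncomm_ring
  rw [this, hD, h]

theorem QI.of_idem {D κ : TM Ω A} (hD : D * D = D) (h : (D + κ) * (D + κ) = D + κ) : QI D κ := by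
  have h1 : (D + κ) * (D + κ) = D * D + (D * κ + κ * D + κ * κ) := by noncomm_ring
  rw [h1, hD] at h
  exact add_left_cancel h

theorem sgn_mul_push {τ : Ω → Fin 2} {τ' : Ω' → Fin 2} {j : Ω → Ω'} (hj : PolyEmb j)
    (hs : ∀ x, τ' (j x) = τ x) (a : TM Ω A) :
    sgn τ' * push j hj a = push j hj (sgn τ * a) ∧ push j hj a * sgn τ' = push j hj (a * sgn τ) := by
  have h1 : ∀ x y, (sgn τ' : TM Ω' A).mat (j x) (j y) = (sgn τ : TM Ω A).mat x y := fun x y => by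
    simp only [sgn_apply, hs, hj.injective.eq_iff]
  refine ⟨mul_push hj h1 (fun i hi y => ?_) a, push_mul hj h1 (fun i hi y => ?_) a⟩
  · rw [sgn_apply, if_neg]; rintro ⟨rfl, _⟩; exact hi ⟨y, rfl⟩
  · rw [sgn_apply, if_neg]; rintro ⟨rfl, _⟩; exact hi ⟨y, rfl⟩

protected theorem QI.push {τ : Ω → Fin 2} {τ' : Ω' → Fin 2} {j : Ω → Ω'} (hj : PolyEmb j)
    (hs : ∀ x, τ' (j x) = τ x) {κ : TM Ω A} (h : QI (sgn τ) κ) : QI (sgn τ') (push j hj κ) := by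
  unfold QI
  rw [(sgn_mul_push hj hs κ).1, (sgn_mul_push hj hs κ).2, push_mul_push, ← map_add, ← map_add, h]

theorem IsGr.of_qi {κ : E → TM Idx A} (hκ : SJ S κ) (hi : ∀ x ∈ S, QI R0T (κ x)) :
    IsGr S fun x => R0T + κ x :=
  ⟨hκ.congr fun _ _ => add_sub_cancel_left _ _, fun x hx => (hi x hx).idem R0T_mul_R0T⟩

theorem IsGr.qi {F : E → TM Idx A} (hF : IsGr S F) {x : E} (hx : x ∈ S) : QI R0T (F x - R0T) :=
  QI.of_idem R0T_mul_R0T (by rw [add_sub_cancel]; exact hF.2 x hx)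

theorem Htpy.of_qi {κ : E × ℝ → TM Idx A} (hκ : SJ (S ×ˢ 𝕀) κ)
    (hi : ∀ x ∈ S, ∀ t ∈ 𝕀, QI R0T (κ (x, t))) :
    Htpy S (fun x => R0T + κ (x, 0)) fun x => R0T + κ (x, 1) :=
  ⟨fun z => R0T + κ z, IsGr.of_qi hκ fun z hz => hi z.1 hz.1 z.2 hz.2, fun _ _ => ⟨rfl, rfl⟩⟩

theorem SEmb.isGr {τ : Ω → Fin 2} {j : Ω → Idx} (hj : SEmb τ j) {κ : E → TM Ω A} (hκ : SJ S κ)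
    (hi : ∀ x ∈ S, QI (sgn τ) (κ x)) : IsGr S fun x => R0T + push j hj.emb (κ x) :=
  IsGr.of_qi (hκ.push hj.emb) fun x hx => (hi x hx).push hj.emb hj.sign

/-- Quasi-idempotent families over a signed index set which are homotopic. -/
theorem SEmb.htpy {τ : Ω → Fin 2} {j : Ω → Idx} (hj : SEmb τ j) {κ : E × ℝ → TM Ω A}
    (hκ : SJ (S ×ˢ 𝕀) κ) (hi : ∀ x ∈ S, ∀ t ∈ 𝕀, QI (sgn τ) (κ (x, t))) :
    Htpy S (fun x => R0T + push j hj.emb (κ (x, 0))) fun x => R0T + push j hj.emb (κ (x, 1)) :=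
  Htpy.of_qi (κ := fun z => push j hj.emb (κ z)) (hκ.push hj.emb) fun x hx t ht =>
    (hi x hx t ht).push hj.emb hj.sign

/-- The planar rotation at time `t`. -/
noncomputable def rot (t : ℝ) : Matrix (Fin 2) (Fin 2) ℝ :=
  !![Real.cos (Real.pi / 2 * t), -Real.sin (Real.pi / 2 * t);
    Real.sin (Real.pi / 2 * t), Real.cos (Real.pi / 2 * t)]

theorem isCk_cos (n : ℕ) : IsCk n univ fun z : E × ℝ => Real.cos (Real.pi / 2 * z.2) :=
  (IsCk.of_contDiff Real.contDiff_cos n).comp isOpen_univ isOpen_univ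
    (IsCk.clm ((Real.pi / 2) • ContinuousLinearMap.snd ℝ E ℝ) n univ) (mapsTo_univ _ _)

theorem isCk_sin (n : ℕ) : IsCk n univ fun z : E × ℝ => Real.sin (Real.pi / 2 * z.2) :=
  (IsCk.of_contDiff Real.contDiff_sin n).comp isOpen_univ isOpen_univ
    (IsCk.clm ((Real.pi / 2) • ContinuousLinearMap.snd ℝ E ℝ) n univ) (mapsTo_univ _ _)

theorem isCk_rot (i j : Fin 2) (n : ℕ) : IsCk n univ fun z : E × ℝ => rot z.2 i j := by
  fin_cases i <;> fin_cases j
  · exact isCk_cos n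
  · exact IsCk.neg isOpen_univ (isCk_sin n)
  · exact isCk_sin n
  · exact isCk_cos n

theorem isCk_matrix_mul {m : ℕ} {a b : E → Matrix (Fin m) (Fin m) ℝ}
    (ha : ∀ i j n, IsCk n univ fun z => a z i j) (hb : ∀ i j n, IsCk n univ fun z => b z i j)
    (i j : Fin m) (n : ℕ) : IsCk n univ fun z => (a z * b z) i j := by
  simp only [Matrix.mul_apply]
  have : ∀ s : Finset (Fin m), IsCk n univ fun z => ∑ l ∈ s, a z i l * b z l j := by
    intro s
    induction s using Finset.induction_on with
    | empty => simpa using IsCk.const (0 : ℝ) n univ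
    | insert c s hc ih =>
      simp only [Finset.sum_insert hc]
      exact IsCk.add isOpen_univ (IsCk.smul isOpen_univ (ha i c n) (hb c j n)) ih
  exact this _

theorem rot_mul_transpose (t : ℝ) : rot t * (rot t).transpose = 1 := by
  have := Real.sin_sq_add_cos_sq (Real.pi / 2 * t)
  ext i j
  fin_cases i <;> fin_cases j <;> simp [rot, Matrix.mul_apply, Fin.sum_univ_two] <;> nlinarith

theorem transpose_mul_rot (t : ℝ) : (rot t).transpose * rot t = 1 :=
  mul_eq_one_comm.1 (rot_mul_transpose t)

theorem rot_zero : rot 0 = 1 := by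
  ext i j
  fin_cases i <;> fin_cases j <;> simp [rot]

theorem rot_one : rot 1 = !![0, -1; 1, 0] := by
  ext i j
  fin_cases i <;> fin_cases j <;> simp [rot]

/-- The rotation of the projection to the first coordinate. -/
noncomputable def rotProj (t : ℝ) : Matrix (Fin 2) (Fin 2) ℝ :=
  rot t * Matrix.single 0 0 1 * (rot t).transpose

theorem rotProj_mul_rotProj (t : ℝ) : rotProj t * rotProj t = rotProj t := by
  have : rotProj t * rotProj t = rot t * Matrix.single 0 0 1 * ((rot t).transpose * rot t) *
      Matrix.single 0 0 1 * (rot t).transpose := by simp only [rotProj, Matrix.mul_assoc]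
  rw [this, transpose_mul_rot, Matrix.mul_one, Matrix.mul_assoc (rot t), Matrix.single_mul_single_same,
    mul_one, rotProj]

theorem rotProj_zero : rotProj 0 = Matrix.single 0 0 1 := by
  rw [rotProj, rot_zero, Matrix.transpose_one, Matrix.one_mul, Matrix.mul_one]

theorem rotProj_one : rotProj 1 = Matrix.single 1 1 1 := by
  have h : (Matrix.single 0 0 1 : Matrix (Fin 2) (Fin 2) ℝ) = !![1, 0; 0, 0] := by
    ext i j
    fin_cases i <;> fin_cases j <;> simp
  rw [rotProj, rot_one, h]
  ext i j
  fin_cases i <;> fin_cases j <;> simp [Matrix.mul_apply, Fin.sum_univ_two]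

theorem isCk_rotProj (i j : Fin 2) (n : ℕ) : IsCk n univ fun z : E × ℝ => rotProj z.2 i j :=
  isCk_matrix_mul (a := fun z : E × ℝ => rot z.2 * Matrix.single 0 0 1)
    (b := fun z : E × ℝ => (rot z.2).transpose)
    (isCk_matrix_mul (a := fun z : E × ℝ => rot z.2) (b := fun _ => Matrix.single 0 0 1) isCk_rot
      fun i j n => IsCk.const _ n _) (fun i j n => isCk_rot j i n) i j n

theorem sgn_snd {n : ℕ} (τ : Ω → Fin 2) :
    (sgn (fun z : Fin n × Ω => τ z.2) : TM (Fin n × Ω) A) = ten 1 (sgn τ) := by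
  refine TM.ext fun i j => ?_
  rw [sgn_apply, ten_apply, sgn_apply, Matrix.one_apply]
  by_cases h : i.1 = j.1
  · simp [h, Prod.ext_iff]
  · simp [h, Prod.ext_iff]

protected theorem QI.ten {n : ℕ} {D κ : TM Ω A} (h : QI D κ) {m : Matrix (Fin n) (Fin n) ℝ} (hm : m * m = m) :
    QI (ten 1 D) (ten m κ) := by
  unfold QI
  rw [ten_mul_ten, ten_mul_ten, ten_mul_ten, Matrix.one_mul, Matrix.mul_one, hm, ← map_add, ← map_add, h]

theorem push_htpy_of_disjoint {τ : Ω → Fin 2} {j₀ j₁ : Ω → Idx} (h₀ : SEmb τ j₀) (h₁ : SEmb τ j₁)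
    (hd : ∀ x y, j₀ x ≠ j₁ y) {κ : E → TM Ω A} (hκ : SJ S κ) (hi : ∀ x ∈ S, QI (sgn τ) (κ x)) :
    Htpy S (fun x => R0T + push j₀ h₀.emb (κ x)) fun x => R0T + push j₁ h₁.emb (κ x) := by
  let j : Fin 2 → Ω → Idx := ![j₀, j₁]
  have hj : SEmb (fun z : Fin 2 × Ω => τ z.2) fun z : Fin 2 × Ω => j z.1 z.2 := by
    refine SEmb.uncurry (τ := fun _ => τ) (fun i => ?_) fun i i' x y h => ?_
    · fin_cases i
      · exact h₀
      · exact h₁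
    · fin_cases i <;> fin_cases i'
      · rfl
      · exact absurd h (hd x y)
      · exact absurd h.symm (hd y x)
      · rfl
  have := hj.htpy (S := S) (κ := fun z : E × ℝ => ten (rotProj z.2) (κ z.1))
    ((hκ.fst _).ten_smooth isCk_rotProj) (fun x hx t _ => by
      rw [sgn_snd]; exact (hi x hx).ten (rotProj_mul_rotProj t))
  refine this.congr (fun x _ => ?_) fun x _ => ?_
  · rw [rotProj_zero, ten_single, push_push]; rfl
  · rw [rotProj_one, ten_single, push_push]; rfl

/-! ### Independence of embeddings -/

/-- The isometry of a self-embedding of the index set. -/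
noncomputable def shiftT (j : Ω → Ω) (hj : PolyEmb j) : TM Ω A :=
  ⟨fun i l => if i = j l then 1 else 0, by
    intro p hp N
    obtain ⟨C, M, hC, h⟩ := hj.upper
    refine ⟨M * N, C ^ N * unitSeminorm p 1, by positivity, fun i l => ?_⟩
    have hi := wt_pos i
    have hl := wt_pos l
    have hp := apply_nonneg (unitSeminorm p) 1
    change wt i ^ N * unitSeminorm p (if i = j l then 1 else 0) ≤ _
    split_ifs with hil
    · rw [mul_right_comm, pow_mul, ← mul_pow, hil]
      have h1 := h l
      have h2 := wt_pos (j l)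
      gcongr
    · rw [map_zero, mul_zero]; positivity, by
    intro p hp N
    obtain ⟨C, M, hC, h⟩ := hj.lower
    refine ⟨M * N, C ^ N * unitSeminorm p 1, by positivity, fun l i => ?_⟩
    have hi := wt_pos i
    have hl := wt_pos l
    have hp := apply_nonneg (unitSeminorm p) 1
    change wt l ^ N * unitSeminorm p (if i = j l then 1 else 0) ≤ _
    split_ifs with hil
    · rw [mul_right_comm, pow_mul, ← mul_pow, hil]
      have h1 := h l
      gcongr
    · rw [map_zero, mul_zero]; positivity⟩

theorem shiftT_apply (j : Ω → Ω) (hj : PolyEmb j) (i l : Ω) :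
    (shiftT j hj : TM Ω A).mat i l = if i = j l then 1 else 0 := rfl

theorem shiftT_mul_apply (j : Ω → Ω) (hj : PolyEmb j) (a : TM Ω A) (x l : Ω) :
    (shiftT j hj * a).mat (j x) l = a.mat x l := by
  rw [TM.mul_apply, tsum_eq_single x]
  · simp [shiftT_apply]
  · intro m hm
    rw [shiftT_apply, if_neg fun h => hm (hj.injective h).symm, zero_mul]

theorem shiftT_mul_apply_of_notMem (j : Ω → Ω) (hj : PolyEmb j) (a : TM Ω A) {i : Ω}
    (hi : i ∉ range j) (l : Ω) : (shiftT j hj * a).mat i l = 0 := by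
  have h : ∀ m, (shiftT j hj : TM Ω A).mat i m = 0 := fun m => by
    rw [shiftT_apply, if_neg]; rintro rfl; exact hi ⟨m, rfl⟩
  rw [TM.mul_apply]
  simp [h]

theorem mul_shiftT_tr_apply (j : Ω → Ω) (hj : PolyEmb j) (a : TM Ω A) (x l : Ω) :
    (a * (shiftT j hj).tr).mat l (j x) = a.mat l x := by
  have := shiftT_mul_apply j hj a.tr x l
  rw [← TM.tr_tr (shiftT j hj), ← TM.tr_mul] at this
  exact this

theorem mul_shiftT_tr_apply_of_notMem (j : Ω → Ω) (hj : PolyEmb j) (a : TM Ω A) {i : Ω}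
    (hi : i ∉ range j) (l : Ω) : (a * (shiftT j hj).tr).mat l i = 0 := by
  have := shiftT_mul_apply_of_notMem j hj a.tr hi l
  rw [← TM.tr_tr (shiftT j hj), ← TM.tr_mul] at this
  exact this

theorem shiftT_conj (j : Ω → Ω) (hj : PolyEmb j) (a : TM Ω A) :
    shiftT j hj * a * (shiftT j hj).tr = push j hj a := by
  refine TM.ext (forall_range_or (j := j) (fun x y => ?_) fun i l h => ?_)
  · rw [mul_shiftT_tr_apply, shiftT_mul_apply, push_apply]
  · rw [push_apply_of_notMem _ _ _ h]
    rcases h with h | h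
    · rw [mul_assoc, shiftT_mul_apply_of_notMem j hj _ h]
    · rw [mul_shiftT_tr_apply_of_notMem j hj _ h]

theorem shiftT_tr_mul_shiftT (j : Ω → Ω) (hj : PolyEmb j) :
    (shiftT j hj).tr * shiftT j hj = (1 : TM Ω A) := by
  refine TM.ext fun i l => ?_
  rw [TM.mul_apply, tsum_eq_single (j i), TM.tr_apply, shiftT_apply, shiftT_apply, if_pos rfl, one_mul,
    TM.mat_one, Matrix.one_apply]
  · simp only [hj.injective.eq_iff]
  · intro m hm
    rw [TM.tr_apply, shiftT_apply, if_neg hm, zero_mul]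

theorem sgn_mul_shiftT {τ : Ω → Fin 2} (j : Ω → Ω) (hj : PolyEmb j) (hs : ∀ x, τ (j x) = τ x) :
    sgn τ * shiftT j hj = (shiftT j hj * sgn τ : TM Ω A) := by
  refine TM.ext fun i l => ?_
  rw [sgn, diagT_mul_apply, mul_diagT_apply, shiftT_apply]
  split_ifs with h
  · rw [h, hs]
  · simp

theorem sgn_mul_diagT (τ : Ω → Fin 2) (f : Ω → ℝ) (hf) :
    sgn τ * diagT f hf = (diagT f hf * sgn τ : TM Ω A) := by
  refine TM.ext fun i l => ?_
  rw [sgn, diagT_mul_apply, diagT_mul_apply, diagT_mat, diagT_mat, Matrix.diagonal_apply,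
    Matrix.diagonal_apply]
  split_ifs with h
  · rw [← inl_mul_eq_smul, ← inl_mul_eq_smul, mul_comm]
  · simp

theorem TM.tr_one : (1 : TM Ω A).tr = 1 := TM.mat_injective Matrix.transpose_one

theorem sgn_tr (τ : Ω → Fin 2) : (sgn τ : TM Ω A).tr = sgn τ := diagT_tr _ _

theorem transit_of_comp {f : ℝ → ℝ} (hf : ContDiff ℝ (⊤ : ℕ∞) f) :
    Transit fun x => f (Real.smoothTransition x) where
  contDiff := hf.comp Real.smoothTransition.contDiff
  left := ⟨f 0, fun x hx => by rw [Real.smoothTransition.zero_of_nonpos hx.le]⟩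
  right := ⟨f 1, fun x hx => by rw [Real.smoothTransition.one_of_one_le (le_of_lt hx)]⟩

theorem transit_cos : Transit fun x => Real.cos (Real.pi / 2 * Real.smoothTransition x) :=
  transit_of_comp (f := fun x => Real.cos (Real.pi / 2 * x))
    (Real.contDiff_cos.comp (contDiff_const.mul contDiff_id))

theorem transit_sin : Transit fun x => Real.sin (Real.pi / 2 * Real.smoothTransition x) :=
  transit_of_comp (f := fun x => Real.sin (Real.pi / 2 * x))
    (Real.contDiff_sin.comp (contDiff_const.mul contDiff_id))

/-- A path of isometries from the identity to the isometry of an expanding self-embedding. -/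
noncomputable def shiftPath (j : Ω → Ω) (hj : PolyEmb j) (t : ℝ) : TM Ω A :=
  dl transit_cos t + shiftT j hj * dl transit_sin t

theorem dl_tr {φ : ℝ → ℝ} (hφ : Transit φ) (t : ℝ) : (dl hφ t : TM Ω A).tr = dl hφ t := diagT_tr _ _

theorem shiftPath_tr (j : Ω → Ω) (hj : PolyEmb j) (t : ℝ) : (shiftPath j hj t : TM Ω A).tr =
    dl transit_cos t + dl transit_sin t * (shiftT j hj).tr := by
  have h : ∀ a b : TM Ω A, (a + b).tr = a.tr + b.tr := fun _ _ => rfl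
  rw [shiftPath, h, TM.tr_mul, dl_tr, dl_tr]

theorem shiftPath_tr_mul {j : Ω → Ω} (hj : PolyEmb j) (hw : ∀ x, 2 * wt x ≤ wt (j x)) (t : ℝ) :
    (shiftPath j hj t).tr * shiftPath j hj t = (1 : TM Ω A) := by
  have h0 : dl transit_cos t * shiftT j hj * dl transit_sin t = (0 : TM Ω A) := by
    refine TM.ext fun i l => ?_
    rw [dl, dl, mul_diagT_apply, diagT_mul_apply, shiftT_apply]
    split_ifs with h
    · rcases le_or_gt (2 * wt l * t) 1 with h1 | h1
      · have h3 : Real.sin (Real.pi / 2 * Real.smoothTransition (2 * wt l * t - 1)) = 0 := by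
          rw [Real.smoothTransition.zero_of_nonpos (by linarith), mul_zero, Real.sin_zero]
        rw [h3, zero_smul]; rfl
      · have ht : 0 < t := by
          by_contra ht
          have := wt_pos l
          nlinarith
        have h2 := mul_le_mul_of_nonneg_right (hw l) ht.le
        have h3 : Real.cos (Real.pi / 2 * Real.smoothTransition (2 * wt i * t - 1)) = 0 := by
          rw [h, Real.smoothTransition.one_of_one_le (by linarith), mul_one, Real.cos_pi_div_two]
        rw [h3, zero_smul, smul_zero]; rfl
    · simp
  have h0' : dl transit_sin t * (shiftT j hj).tr * dl transit_cos t = (0 : TM Ω A) := by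
    have := congrArg TM.tr h0
    rw [TM.tr_mul, TM.tr_mul, dl_tr, dl_tr, ← mul_assoc] at this
    exact this
  have h1 : dl transit_cos t * dl transit_cos t + dl transit_sin t * dl transit_sin t = (1 : TM Ω A) := by
    refine TM.ext fun i l => ?_
    rw [TM.mat_add, dl, dl, diagT_mul_apply, diagT_mul_apply, diagT_mat, diagT_mat, TM.mat_one,
      Matrix.diagonal_apply, Matrix.diagonal_apply, Matrix.one_apply]
    split_ifs with h
    · have := Real.cos_sq_add_sin_sq (Real.pi / 2 * Real.smoothTransition (2 * wt i * t - 1))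
      rw [← Unitization.inl_smul, ← Unitization.inl_smul, ← Unitization.inl_add, smul_eq_mul,
        smul_eq_mul, ← sq, ← sq, this, Unitization.inl_one]
    · simp
  rw [shiftPath_tr, shiftPath]
  have e : ∀ c s h h' : TM Ω A, (c + s * h') * (c + h * s) =
      c * c + c * h * s + s * h' * c + s * (h' * h) * s := fun c s h h' => by noncomm_ring
  rw [e, h0, h0', shiftT_tr_mul_shiftT, mul_one, add_zero, add_zero, h1]

theorem sgn_mul_shiftPath {τ : Ω → Fin 2} (j : Ω → Ω) (hj : PolyEmb j) (hs : ∀ x, τ (j x) = τ x)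
    (t : ℝ) : sgn τ * shiftPath j hj t = (shiftPath j hj t * sgn τ : TM Ω A) := by
  rw [shiftPath, mul_add, add_mul, dl, sgn_mul_diagT, ← mul_assoc, sgn_mul_shiftT j hj hs, mul_assoc,
    dl, sgn_mul_diagT, mul_assoc]

theorem shiftPath_zero (j : Ω → Ω) (hj : PolyEmb j) : shiftPath j hj 0 = (1 : TM Ω A) := by
  have h1 : dl transit_cos 0 = (1 : TM Ω A) := by
    refine TM.ext fun i l => ?_
    rw [dl, diagT_mat, TM.mat_one, Matrix.diagonal_apply, Matrix.one_apply, mul_zero,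
      Real.smoothTransition.zero_of_nonpos (by norm_num), mul_zero, Real.cos_zero, Unitization.inl_one]
  have h2 : dl transit_sin 0 = (0 : TM Ω A) := by
    refine TM.ext fun i l => ?_
    rw [dl, diagT_mat, Matrix.diagonal_apply, mul_zero,
      Real.smoothTransition.zero_of_nonpos (by norm_num), mul_zero, Real.sin_zero, Unitization.inl_zero,
      ite_self]; rfl
  rw [shiftPath, h1, h2, mul_zero, add_zero]

theorem shiftPath_one (j : Ω → Ω) (hj : PolyEmb j) : shiftPath j hj 1 = (shiftT j hj : TM Ω A) := by
  have h : ∀ i : Ω, Real.smoothTransition (2 * wt i * 1 - 1) = 1 := fun i =>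
    Real.smoothTransition.one_of_one_le (by have := one_le_wt i; linarith)
  have h1 : dl transit_cos 1 = (0 : TM Ω A) := by
    refine TM.ext fun i l => ?_
    rw [dl, diagT_mat, Matrix.diagonal_apply, h, mul_one, Real.cos_pi_div_two, Unitization.inl_zero,
      ite_self]; rfl
  have h2 : dl transit_sin 1 = (1 : TM Ω A) := by
    refine TM.ext fun i l => ?_
    rw [dl, diagT_mat, TM.mat_one, Matrix.diagonal_apply, Matrix.one_apply, h, mul_one,
      Real.sin_pi_div_two, Unitization.inl_one]
  rw [shiftPath, h1, h2, mul_one, zero_add]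

theorem SJ.shiftPath_conj {κ : E × ℝ → TM Ω A} {T : Set (E × ℝ)} (hκ : SJ T κ) {j : Ω → Ω}
    (hj : PolyEmb j) : SJ T fun z => shiftPath j hj z.2 * κ z * (shiftPath j hj z.2).tr := by
  have ht : ∀ n, IsCk n univ fun z : E × ℝ => z.2 := fun n =>
    IsCk.clm (ContinuousLinearMap.snd ℝ E ℝ) n univ
  refine (((hκ.dl_mul transit_cos ht).mul_dl transit_cos ht).add
    ((((hκ.dl_mul transit_sin ht).mul_dl transit_cos ht).const_mul (shiftT j hj)).add
    ((((hκ.dl_mul transit_cos ht).mul_dl transit_sin ht).mul_const (shiftT j hj).tr).add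
    ((((hκ.dl_mul transit_sin ht).mul_dl transit_sin ht).const_mul (shiftT j hj)).mul_const
      (shiftT j hj).tr)))).congr fun z _ => ?_
  rw [shiftPath_tr, shiftPath]
  noncomm_ring

theorem QI.conj {D κ g g' : TM Ω A} (h : QI D κ) (hg : g' * g = 1) (h1 : D * g = g * D)
    (h2 : D * g' = g' * D) : QI D (g * κ * g') := by
  unfold QI
  have e1 : D * (g * κ * g') = g * (D * κ) * g' := by
    rw [← mul_assoc, ← mul_assoc, h1, mul_assoc g]
  have e2 : g * κ * g' * D = g * (κ * D) * g' := by
    rw [mul_assoc _ g', ← h2, ← mul_assoc, mul_assoc g]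
  have e3 : g * κ * g' * (g * κ * g') = g * (κ * κ) * g' := by
    rw [show g * κ * g' * (g * κ * g') = g * κ * (g' * g) * κ * g' by simp only [mul_assoc], hg, mul_one,
      mul_assoc g]
  rw [e1, e2, e3, ← add_mul, ← add_mul, ← mul_add, ← mul_add, h]

/-- An expanding sign preserving self-embedding acts trivially up to homotopy. -/
theorem push_htpy_self {j : Idx → Idx} (hj : SEmb Prod.fst j) (hw : ∀ x, 2 * wt x ≤ wt (j x))
    {κ : E → TM Idx A} (hκ : SJ S κ) (hi : ∀ x ∈ S, QI R0T (κ x)) :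
    Htpy S (fun x => R0T + κ x) fun x => R0T + push j hj.emb (κ x) := by
  have h1 : ∀ t, R0T * shiftPath j hj.emb t = (shiftPath j hj.emb t * R0T : TM Idx A) :=
    fun t => sgn_mul_shiftPath j hj.emb hj.sign t
  have := Htpy.of_qi (S := S) (κ := fun z : E × ℝ => shiftPath j hj.emb z.2 * κ z.1 *
    (shiftPath j hj.emb z.2).tr) ((hκ.fst _).shiftPath_conj hj.emb)
    (fun x hx t _ => (hi x hx).conj (shiftPath_tr_mul hj.emb hw t) (h1 t) (by
      have := congrArg TM.tr (h1 t)
      rw [TM.tr_mul, TM.tr_mul, R0T, sgn_tr] at this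
      exact this.symm))
  refine this.congr (fun x _ => ?_) fun x _ => ?_
  · rw [shiftPath_zero, one_mul]
    exact congrArg _ ((congrArg _ TM.tr_one).trans (mul_one _)).symm
  · rw [shiftPath_one, shiftT_conj]

theorem wt_idx (x : Idx) : wt x = 1 + (x.2 : ℝ) := by simp [wt]

/-- The embedding onto the odd (or even) indices. -/
theorem sEmb_double (c : ℕ) : SEmb Prod.fst fun x : Idx => ((x.1, 2 * x.2 + c) : Idx) := by
  refine ⟨PolyEmb.of_le (fun x y h => ?_) (2 + c) 1 (fun x => ?_) fun x => ?_, fun _ => rfl⟩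
  · have := Prod.ext_iff.1 h
    refine Prod.ext this.1 ?_
    have := this.2
    simp only at this
    omega
  · simp only [size_prod, size_fin, size_nat]
    nlinarith
  · simp only [size_prod, size_fin, size_nat]
    nlinarith

/-- Any two sign preserving embeddings give homotopic families. -/
theorem push_htpy {τ : Ω → Fin 2} {j₀ j₁ : Ω → Idx} (h₀ : SEmb τ j₀) (h₁ : SEmb τ j₁)
    {κ : E → TM Ω A} (hκ : SJ S κ) (hi : ∀ x ∈ S, QI (sgn τ) (κ x)) :
    Htpy S (fun x => R0T + push j₀ h₀.emb (κ x)) fun x => R0T + push j₁ h₁.emb (κ x) := by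
  have hcomp : ∀ {j : Ω → Idx} (h : SEmb τ j) (c : ℕ),
      SEmb τ fun x => (((j x).1, 2 * (j x).2 + c) : Idx) := fun h c =>
    ⟨(sEmb_double c).emb.comp h.emb, h.sign⟩
  have hodd : ∀ {j : Ω → Idx} (h : SEmb τ j), Htpy S (fun x => R0T + push j h.emb (κ x))
      fun x => R0T + push _ (hcomp h 1).emb (κ x) := by
    intro j h
    refine (push_htpy_self (sEmb_double 1) (fun x => ?_) (hκ.push h.emb)
      fun x hx => (hi x hx).push h.emb h.sign).congr (fun _ _ => rfl) fun x _ => ?_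
    · rw [wt_idx, wt_idx]; push_cast; linarith
    · rw [push_push]; rfl
  have hne : ∀ x y, (((j₀ x).1, 2 * (j₀ x).2 + 1) : Idx) ≠ ((j₁ y).1, 2 * (j₁ y).2 + 0) := by
    intro x y h
    have := (Prod.ext_iff.1 h).2
    simp only at this
    omega
  have hne' : ∀ x y, (((j₁ x).1, 2 * (j₁ x).2 + 0) : Idx) ≠ ((j₁ y).1, 2 * (j₁ y).2 + 1) := by
    intro x y h
    have := (Prod.ext_iff.1 h).2
    simp only at this
    omega
  exact ((hodd h₀).trans (push_htpy_of_disjoint (hcomp h₀ 1) (hcomp h₁ 0) hne hκ hi)).trans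
    ((push_htpy_of_disjoint (hcomp h₁ 0) (hcomp h₁ 1) hne' hκ hi).trans (hodd h₁).symm)

theorem push_uncurry {n : ℕ} {j : Fin n → Ω → Ω'} (hj : ∀ i, PolyEmb (j i))
    (hd : ∀ i i' x y, j i x = j i' y → i = i') (κ : Fin n → TM Ω A) :
    push (fun z : Fin n × Ω => j z.1 z.2) (PolyEmb.uncurry hj hd)
      (∑ i, ten (Matrix.single i i 1) (κ i)) = ∑ i, push (j i) (hj i) (κ i) := by
  rw [map_sum]
  refine Finset.sum_congr rfl fun i _ => ?_
  rw [ten_single, push_push]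
  rfl

theorem QI.sum_ten {n : ℕ} {D : TM Ω A} {κ : Fin n → TM Ω A} (h : ∀ i, QI D (κ i)) :
    QI (ten 1 D) (∑ i, ten (Matrix.single i i 1) (κ i)) := by
  unfold QI
  rw [Finset.mul_sum, Finset.sum_mul, Finset.sum_mul, ← Finset.sum_add_distrib, ← Finset.sum_add_distrib]
  refine Finset.sum_congr rfl fun i _ => ?_
  rw [Finset.mul_sum, Finset.sum_eq_single i]
  · rw [ten_mul_ten, ten_mul_ten, ten_mul_ten, Matrix.one_mul, Matrix.mul_one,
      Matrix.single_mul_single_same, mul_one, ← map_add, ← map_add, h i]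
  · intro l _ hl
    rw [ten_mul_ten, Matrix.single_mul_single_of_ne _ _ _ _ hl.symm, map_zero, LinearMap.zero_apply]
  · intro hi; exact absurd (Finset.mem_univ i) hi

/-- Sums over disjoint sign preserving embeddings are independent of the embeddings. -/
theorem push_sum_htpy {n : ℕ} {τ : Ω → Fin 2} {j₀ j₁ : Fin n → Ω → Idx} (h₀ : ∀ i, SEmb τ (j₀ i))
    (h₁ : ∀ i, SEmb τ (j₁ i)) (hd₀ : ∀ i i' x y, j₀ i x = j₀ i' y → i = i')
    (hd₁ : ∀ i i' x y, j₁ i x = j₁ i' y → i = i') {κ : Fin n → E → TM Ω A} (hκ : ∀ i, SJ S (κ i))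
    (hi : ∀ i, ∀ x ∈ S, QI (sgn τ) (κ i x)) :
    Htpy S (fun x => R0T + ∑ i, push (j₀ i) (h₀ i).emb (κ i x))
      fun x => R0T + ∑ i, push (j₁ i) (h₁ i).emb (κ i x) := by
  have := push_htpy (SEmb.uncurry (τ := fun _ => τ) h₀ hd₀) (SEmb.uncurry (τ := fun _ => τ) h₁ hd₁)
    (κ := fun x => ∑ i, ten (Matrix.single i i 1) (κ i x))
    (SJ.sum Finset.univ fun i _ => (hκ i).ten _)
    (fun x hx => by rw [sgn_snd]; exact QI.sum_ten fun i => hi i x hx)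
  refine this.congr (fun x _ => ?_) fun x _ => ?_
  · exact congrArg _ (push_uncurry (fun i => (h₀ i).emb) hd₀ fun i => κ i x).symm
  · exact congrArg _ (push_uncurry (fun i => (h₁ i).emb) hd₁ fun i => κ i x).symm

/-! ### Regularization of pairs of idempotents -/

theorem single_mul_single {n : ℕ} (i j k l : Fin n) :
    (Matrix.single i j 1 * Matrix.single k l 1 : Matrix (Fin n) (Fin n) ℝ) =
      if j = k then Matrix.single i l 1 else 0 := by
  split_ifs with h
  · rw [h, Matrix.single_mul_single_same, mul_one]
  · rw [Matrix.single_mul_single_of_ne _ _ _ _ h]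

theorem ten_zero_left {n : ℕ} (a : TM Ω A) : ten (0 : Matrix (Fin n) (Fin n) ℝ) a = 0 := by
  rw [map_zero, LinearMap.zero_apply]

theorem one_sub_mul_self {R : Type*} [Ring R] {q : R} (h : q * q = q) : (1 - q) * q = 0 := by
  rw [sub_mul, one_mul, h, sub_self]

theorem mul_one_sub_self {R : Type*} [Ring R] {q : R} (h : q * q = q) : q * (1 - q) = 0 := by
  rw [mul_sub, mul_one, h, sub_self]

theorem one_sub_mul_one_sub {R : Type*} [Ring R] {q : R} (h : q * q = q) :
    (1 - q) * (1 - q) = 1 - q := by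
  rw [mul_sub, mul_one, one_sub_mul_self h, sub_zero]

/-- A matrix of four blocks. -/
noncomputable def blockT (a b c d : TM Ω A) : TM (Fin 2 × Ω) A :=
  ten (Matrix.single 0 0 1) a + ten (Matrix.single 0 1 1) b + ten (Matrix.single 1 0 1) c +
    ten (Matrix.single 1 1 1) d

theorem blockT_mat (a b c d : TM Ω A) : (blockT a b c d).mat = block a.mat b.mat c.mat d.mat := by
  refine Matrix.ext fun i j => ?_
  rw [block_apply, blockT, TM.mat_add, TM.mat_add, TM.mat_add, ten_apply, ten_apply, ten_apply,
    ten_apply]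
  obtain ⟨i1, i2⟩ := i
  obtain ⟨j1, j2⟩ := j
  fin_cases i1 <;> fin_cases j1 <;> simp

theorem blockT_mul_blockT (a b c d a' b' c' d' : TM Ω A) :
    blockT a b c d * blockT a' b' c' d' =
      blockT (a * a' + b * c') (a * b' + b * d') (c * a' + d * c') (c * b' + d * d') := by
  simp only [blockT, add_mul, mul_add, ten_mul_ten, single_mul_single, map_add]
  simp only [if_true, Fin.isValue, zero_ne_one, one_ne_zero, if_false, ten_zero_left]
  abel

theorem blockT_one : blockT 1 0 0 1 = (1 : TM (Fin 2 × Ω) A) := by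
  rw [blockT, map_zero, map_zero, add_zero, add_zero, ← LinearMap.add_apply, ← map_add, ← ten_one_one]
  congr 2
  ext i j
  fin_cases i <;> fin_cases j <;> simp

theorem blockT_add (a b c d a' b' c' d' : TM Ω A) :
    blockT a b c d + blockT a' b' c' d' = blockT (a + a') (b + b') (c + c') (d + d') := by
  simp only [blockT, map_add]
  abel

theorem sgn_fst : (sgn Prod.fst : TM (Fin 2 × Ω) A) = blockT 0 0 0 1 := by
  refine TM.ext fun i j => ?_
  rw [sgn_apply, blockT_mat, block_apply]
  obtain ⟨i1, i2⟩ := i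
  obtain ⟨j1, j2⟩ := j
  fin_cases i1 <;> fin_cases j1 <;> simp [TM.mat_one, Matrix.one_apply, Prod.ext_iff]

/-- The difference of the regularization of the pair `⟨Q + X, Q⟩` and the base idempotent. -/
noncomputable def kap (Q X : TM Ω A) : TM (Fin 2 × Ω) A :=
  blockT ((1 - Q) * X * (1 - Q)) ((1 - Q) * X * Q) (Q * X * (1 - Q)) (Q * X * Q)

/-- The partial switch. -/
noncomputable def swT (Q : TM Ω A) : TM (Fin 2 × Ω) A := blockT (1 - Q) Q Q (1 - Q)

theorem swT_conj (Q P R : TM Ω A) : swT Q * blockT P 0 0 R * swT Q =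
    kap Q P + blockT (Q * R * Q) (Q * R * (1 - Q)) ((1 - Q) * R * Q) ((1 - Q) * R * (1 - Q)) := by
  rw [swT, blockT_mul_blockT, blockT_mul_blockT, kap, blockT_add]
  simp only [mul_zero, add_zero, zero_add]

theorem kap_add (Q X Y : TM Ω A) : kap Q (X + Y) = kap Q X + kap Q Y := by
  simp only [kap, blockT_add, mul_add, add_mul]

theorem kap_neg (Q X : TM Ω A) : kap Q (-X) = -kap Q X := by
  have := kap_add Q X (-X)
  rw [add_neg_cancel] at this
  have h0 : kap Q (0 : TM Ω A) = 0 := by simp [kap, blockT]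
  rw [h0] at this
  exact (neg_eq_of_add_eq_zero_right this.symm).symm

theorem swT_base {Q : TM Ω A} (hQ : Q * Q = Q) :
    swT Q * blockT Q 0 0 (1 - Q) * swT Q = sgn Prod.fst := by
  rw [swT_conj, kap, blockT_add, sgn_fst]
  simp only [one_sub_mul_self hQ, mul_one_sub_self hQ, one_sub_mul_one_sub hQ, hQ, zero_mul, add_zero,
    add_sub_cancel]

theorem swT_mul_swT {Q : TM Ω A} (hQ : Q * Q = Q) : swT Q * swT Q = 1 := by
  rw [swT, blockT_mul_blockT]
  simp only [one_sub_mul_self hQ, mul_one_sub_self hQ, one_sub_mul_one_sub hQ, hQ, add_zero,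
    add_sub_cancel, sub_add_cancel, blockT_one]

theorem sgn_fst_add_kap {Q : TM Ω A} (hQ : Q * Q = Q) (X : TM Ω A) :
    sgn Prod.fst + kap Q X = swT Q * blockT (Q + X) 0 0 (1 - Q) * swT Q := by
  rw [swT_conj, kap_add, ← swT_base hQ, swT_conj]
  abel

theorem TM.mat_one_sub (Q : TM Ω A) : (1 - Q).mat = 1 - Q.mat := by
  rw [← TM.mat_one]; rfl

theorem sw_mat (Q : TM Ω A) : sw Q.mat = (swT Q).mat := by
  rw [swT, blockT_mat, TM.mat_one_sub, sw]

/-- Regularization in terms of tempered matrices. -/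
theorem regularize_mat {P Q : TM Ω A} (hQ : Q * Q = Q) :
    regularize P.mat Q.mat = (sgn Prod.fst + kap Q (P - Q)).mat := by
  rw [sgn_fst_add_kap hQ, add_sub_cancel, regularize, sw_mat, ← TM.mat_one_sub,
    show (0 : Matrix Ω Ω (Unitization ℝ A)) = (0 : TM Ω A).mat from rfl, ← blockT_mat, TM.mmul_eq,
    TM.mmul_eq]

protected theorem QI.kap {Q X : TM Ω A} (hQ : Q * Q = Q) (h : QI Q X) :
    QI (sgn Prod.fst) (kap Q X) := by
  refine QI.of_idem (sgn_mul_sgn _) ?_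
  rw [sgn_fst_add_kap hQ]
  have h1 : ∀ s b : TM (Fin 2 × Ω) A, s * s = 1 → b * b = b → s * b * s * (s * b * s) = s * b * s := by
    intro s b hs hb
    rw [show s * b * s * (s * b * s) = s * b * (s * s) * b * s by noncomm_ring, hs, mul_one, mul_assoc s,
      hb]
  refine h1 _ _ (swT_mul_swT hQ) ?_
  rw [blockT_mul_blockT, h.idem hQ, one_sub_mul_one_sub hQ]
  simp

protected theorem SJ.blockT {a b c d : E → TM Ω A} (ha : SJ S a) (hb : SJ S b) (hc : SJ S c) (hd : SJ S d) :
    SJ S fun x => blockT (a x) (b x) (c x) (d x) :=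
  (((ha.ten _).add (hb.ten _)).add (hc.ten _)).add (hd.ten _)

protected theorem SJ.kap {Q X : E → TM Ω A} (hQ : SM S Q) (hX : SJ S X) : SJ S fun x => kap (Q x) (X x) := by
  have hQ' : SM S fun x => 1 - Q x := (SM.const 1).sub hQ
  exact SJ.blockT (hQ'.mul_right (hQ'.mul_left hX)) (hQ.mul_right (hQ'.mul_left hX))
    (hQ'.mul_right (hQ.mul_left hX)) (hQ.mul_right (hQ.mul_left hX))

theorem push_blockT {j : Ω → Ω'} (hj : PolyEmb j) (a b c d : TM Ω A) :
    push (Prod.map id j) ((PolyEmb.id (Fin 2)).prodMap hj) (blockT a b c d) =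
      blockT (push j hj a) (push j hj b) (push j hj c) (push j hj d) := by
  simp only [blockT, map_add]
  rw [push_ten, push_ten, push_ten, push_ten]

/-- Regularization is compatible with relabelings. -/
theorem kap_push {j : Ω → Ω'} (hj : PolyEmb j) {Q : TM Ω A} {Q' : TM Ω' A} {X : TM Ω A}
    (h : ∀ Y : TM Ω A, Q' * push j hj Y = push j hj (Q * Y) ∧ push j hj Y * Q' = push j hj (Y * Q)) :
    kap Q' (push j hj X) = push (Prod.map id j) ((PolyEmb.id (Fin 2)).prodMap hj) (kap Q X) := by
  have h1 : ∀ Y, (1 - Q') * push j hj Y = push j hj ((1 - Q) * Y) := fun Y => by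
    rw [sub_mul, one_mul, (h Y).1, ← map_sub, sub_mul, one_mul]
  have h2 : ∀ Y, push j hj Y * (1 - Q') = push j hj (Y * (1 - Q)) := fun Y => by
    rw [mul_sub, mul_one, (h Y).2, ← map_sub, mul_sub, mul_one]
  rw [kap, kap, push_blockT hj]
  simp only [h1, h2, fun Y => (h Y).1, fun Y => (h Y).2]

/-- The relation of `kap_push` from the entries. -/
theorem mul_push_and_push_mul {j : Ω → Ω'} (hj : PolyEmb j) {Q : TM Ω A} {Q' : TM Ω' A}
    (h1 : ∀ x y, Q'.mat (j x) (j y) = Q.mat x y)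
    (h2 : ∀ i ∉ range j, ∀ y, Q'.mat i (j y) = 0 ∧ Q'.mat (j y) i = 0) (Y : TM Ω A) :
    Q' * push j hj Y = push j hj (Q * Y) ∧ push j hj Y * Q' = push j hj (Y * Q) :=
  ⟨mul_push hj h1 (fun i hi y => (h2 i hi y).1) Y, push_mul hj h1 (fun i hi y => (h2 i hi y).2) Y⟩

theorem PolyEmb.sign_graph (τ : Ω → Fin 2) : PolyEmb fun n : Ω => (τ n, n) :=
  PolyEmb.of_size (fun x y h => (Prod.ext_iff.1 h).2) fun x => by simp

theorem sgn_mul_apply (τ : Ω → Fin 2) (X : TM Ω A) (i j : Ω) :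
    (sgn τ * X).mat i j = if τ i = 1 then X.mat i j else 0 := by
  rw [sgn, diagT_mul_apply]
  rcases h : τ i with ⟨_ | _ | n, hn⟩
  · simp
  · simp
  · omega

theorem mul_sgn_apply (τ : Ω → Fin 2) (X : TM Ω A) (i j : Ω) :
    (X * sgn τ).mat i j = if τ j = 1 then X.mat i j else 0 := by
  rw [sgn, mul_diagT_apply]
  rcases h : τ j with ⟨_ | _ | n, hn⟩
  · simp
  · simp
  · omega

/-- Regularization with respect to a diagonal idempotent. -/
theorem kap_sgn (τ : Ω → Fin 2) (X : TM Ω A) :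
    kap (sgn τ) X = push (fun n => (τ n, n)) (PolyEmb.sign_graph τ) X := by
  have h0 : ∀ i j, ((1 - sgn τ) * X).mat i j = if τ i = 1 then 0 else X.mat i j := fun i j => by
    rw [sub_mul, one_mul, TM.mat_sub, sgn_mul_apply]
    split_ifs <;> simp
  have h1 : ∀ (Y : TM Ω A) i j, (Y * (1 - sgn τ)).mat i j = if τ j = 1 then 0 else Y.mat i j :=
    fun Y i j => by
    rw [mul_sub, mul_one, TM.mat_sub, mul_sgn_apply]
    split_ifs <;> simp
  have hkap : ∀ i j : Fin 2 × Ω, (kap (sgn τ) X).mat i j =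
      if i.1 = τ i.2 ∧ j.1 = τ j.2 then X.mat i.2 j.2 else 0 := by
    rintro ⟨i1, i2⟩ ⟨j1, j2⟩
    rw [kap, blockT_mat, block_apply]
    have hc : ∀ c : Fin 2, c = 0 ∨ c = 1 := by decide
    rcases hc i1 with rfl | rfl <;> rcases hc j1 with rfl | rfl <;> rcases hc (τ i2) with hi | hi <;>
      rcases hc (τ j2) with hj | hj <;> simp [h0, h1, sgn_mul_apply, mul_sgn_apply, hi, hj]
  refine TM.ext (forall_range_or (j := fun n => (τ n, n)) (fun x y => ?_) fun i l h => ?_)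
  · rw [push_apply, hkap, if_pos ⟨rfl, rfl⟩]
  · rw [push_apply_of_notMem _ _ _ h, hkap, if_neg]
    rintro ⟨hi, hl⟩
    rcases h with h | h
    · exact h ⟨i.2, Prod.ext hi.symm rfl⟩
    · exact h ⟨l.2, Prod.ext hl.symm rfl⟩

/-- Paths of pairs of idempotents give homotopies. -/
theorem kap_htpy {j : Fin 2 × Ω → Idx} (hj : SEmb Prod.fst j) {Q X : E × ℝ → TM Ω A}
    (hQ : SM (S ×ˢ 𝕀) Q) (hX : SJ (S ×ˢ 𝕀) X)
    (hi : ∀ x ∈ S, ∀ t ∈ 𝕀, Q (x, t) * Q (x, t) = Q (x, t))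
    (hq : ∀ x ∈ S, ∀ t ∈ 𝕀, QI (Q (x, t)) (X (x, t))) :
    Htpy S (fun x => R0T + push j hj.emb (kap (Q (x, 0)) (X (x, 0))))
      fun x => R0T + push j hj.emb (kap (Q (x, 1)) (X (x, 1))) :=
  hj.htpy (κ := fun z => kap (Q z) (X z)) (SJ.kap hQ hX) fun x hx t ht =>
    (hq x hx t ht).kap (hi x hx t ht)

/-! ### Relabelings -/

theorem IsRelabeling.polyEmb {Ω Ω' : Type} [GrowthIndex Ω] [GrowthIndex Ω'] {r : Ω → Ω'}
    (h : IsRelabeling r) : PolyEmb r := by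
  have hwt : ∀ {Ξ : Type} [GrowthIndex Ξ], (wt : Ξ → ℝ) ∈ slow Ξ := fun {Ξ} _ =>
    ⟨1, 1, fun x => by rw [abs_of_pos (wt_pos x), one_mul, pow_one]; rfl⟩
  have hle : ∀ {a C d : ℝ} {N : ℕ}, 0 ≤ d → a ≤ C * d ^ N → a ≤ |C| * d ^ N := fun hd h1 =>
    h1.trans (mul_le_mul_of_nonneg_right (le_abs_self _) (pow_nonneg hd _))
  refine ⟨h.injective, ?_, ?_⟩
  · have h1 : (wt ∘ r : Ω → ℝ) ∈ slow Ω := by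
      rw [h.slow_iff]; exact ⟨wt, hwt, rfl⟩
    obtain ⟨C, N, h1⟩ := h1
    exact ⟨|C|, N, abs_nonneg C, fun x => hle (wt_pos x).le ((le_abs_self _).trans (h1 x))⟩
  · have h1 : (wt : Ω → ℝ) ∈ slow Ω := hwt
    rw [h.slow_iff] at h1
    obtain ⟨F, ⟨C, N, hF⟩, h1⟩ := h1
    refine ⟨|C|, N, abs_nonneg C, fun x => hle (wt_pos _).le ?_⟩
    rw [h1]
    exact (le_abs_self _).trans (hF (r x))

/-! ### The additive structure -/

theorem QI.add {D κ l : TM Ω A} (hκ : QI D κ) (hl : QI D l) (h1 : κ * l = 0) (h2 : l * κ = 0) :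
    QI D (κ + l) := by
  unfold QI at *
  have : D * (κ + l) + (κ + l) * D + (κ + l) * (κ + l) =
      (D * κ + κ * D + κ * κ) + (D * l + l * D + l * l) + κ * l + l * κ := by noncomm_ring
  rw [this, hκ, hl, h1, h2, add_zero, add_zero]

theorem SEmb.disjoint_two {j₀ j₁ : Ω → Ω'} (h : ∀ x y, j₀ x ≠ j₁ y) (i i' : Fin 2) (x y : Ω)
    (e : (![j₀, j₁] : Fin 2 → Ω → Ω') i x = (![j₀, j₁] : Fin 2 → Ω → Ω') i' y) : i = i' := by
  fin_cases i <;> fin_cases i'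
  · rfl
  · exact absurd e (h x y)
  · exact absurd e.symm (h y x)
  · rfl

theorem SEmb.disjoint_three {j₀ j₁ j₂ : Ω → Ω'} (h : ∀ x y, j₀ x ≠ j₁ y) (h' : ∀ x y, j₀ x ≠ j₂ y)
    (h'' : ∀ x y, j₁ x ≠ j₂ y) (i i' : Fin 3) (x y : Ω)
    (e : (![j₀, j₁, j₂] : Fin 3 → Ω → Ω') i x = (![j₀, j₁, j₂] : Fin 3 → Ω → Ω') i' y) : i = i' := by
  fin_cases i <;> fin_cases i'
  · rfl
  · exact absurd e (h x y)
  · exact absurd e (h' x y)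
  · exact absurd e.symm (h y x)
  · rfl
  · exact absurd e (h'' x y)
  · exact absurd e.symm (h' y x)
  · exact absurd e.symm (h'' y x)
  · rfl

theorem push_add_htpy {τ : Ω → Fin 2} {α β α' β' : Ω → Idx} (hα : SEmb τ α) (hβ : SEmb τ β)
    (hα' : SEmb τ α') (hβ' : SEmb τ β') (hd : ∀ x y, α x ≠ β y) (hd' : ∀ x y, α' x ≠ β' y)
    {κ l : E → TM Ω A} (hκ : SJ S κ) (hl : SJ S l) (hκi : ∀ x ∈ S, QI (sgn τ) (κ x))
    (hli : ∀ x ∈ S, QI (sgn τ) (l x)) :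
    Htpy S (fun x => R0T + (push α hα.emb (κ x) + push β hβ.emb (l x)))
      fun x => R0T + (push α' hα'.emb (κ x) + push β' hβ'.emb (l x)) := by
  have := push_sum_htpy (S := S) (τ := τ) (j₀ := ![α, β]) (j₁ := ![α', β']) (κ := ![κ, l])
    (Fin.forall_fin_two.2 ⟨hα, hβ⟩) (Fin.forall_fin_two.2 ⟨hα', hβ'⟩)
    (SEmb.disjoint_two hd) (SEmb.disjoint_two hd') (Fin.forall_fin_two.2 ⟨hκ, hl⟩)
    (Fin.forall_fin_two.2 ⟨hκi, hli⟩)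
  refine this.congr (fun x _ => ?_) fun x _ => ?_
  · rw [Fin.sum_univ_two]; rfl
  · rw [Fin.sum_univ_two]; rfl

theorem push_add_add_htpy {τ : Ω → Fin 2} {α β γ α' β' γ' : Ω → Idx} (hα : SEmb τ α) (hβ : SEmb τ β)
    (hγ : SEmb τ γ) (hα' : SEmb τ α') (hβ' : SEmb τ β') (hγ' : SEmb τ γ') (hd : ∀ x y, α x ≠ β y)
    (hd1 : ∀ x y, α x ≠ γ y) (hd2 : ∀ x y, β x ≠ γ y) (hd' : ∀ x y, α' x ≠ β' y)
    (hd1' : ∀ x y, α' x ≠ γ' y) (hd2' : ∀ x y, β' x ≠ γ' y)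
    {κ l m : E → TM Ω A} (hκ : SJ S κ) (hl : SJ S l) (hm : SJ S m) (hκi : ∀ x ∈ S, QI (sgn τ) (κ x))
    (hli : ∀ x ∈ S, QI (sgn τ) (l x)) (hmi : ∀ x ∈ S, QI (sgn τ) (m x)) :
    Htpy S (fun x => R0T + (push α hα.emb (κ x) + push β hβ.emb (l x) + push γ hγ.emb (m x)))
      fun x => R0T + (push α' hα'.emb (κ x) + push β' hβ'.emb (l x) + push γ' hγ'.emb (m x)) := by
  have h3 : ∀ {P : Fin 3 → Prop}, P 0 → P 1 → P 2 → ∀ i, P i := fun h0 h1 h2 i => by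
    fin_cases i
    · exact h0
    · exact h1
    · exact h2
  have := push_sum_htpy (S := S) (τ := τ) (j₀ := ![α, β, γ]) (j₁ := ![α', β', γ']) (κ := ![κ, l, m])
    (h3 hα hβ hγ) (h3 hα' hβ' hγ') (SEmb.disjoint_three hd hd1 hd2) (SEmb.disjoint_three hd' hd1' hd2')
    (h3 hκ hl hm) (h3 hκi hli hmi)
  refine this.congr (fun x _ => ?_) fun x _ => ?_
  · rw [Fin.sum_univ_three]; rfl
  · rw [Fin.sum_univ_three]; rfl

/-- Embeddings which define the sum. -/
structure AddEmb (α β : Idx → Idx) : Prop where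
  left : SEmb Prod.fst α
  right : SEmb Prod.fst β
  disjoint : ∀ x y, α x ≠ β y

/-- The sum of idempotents. -/
noncomputable def addT {α β : Idx → Idx} (h : AddEmb α β) (b d : TM Idx A) : TM Idx A :=
  R0T + (push α h.left.emb (b - R0T) + push β h.right.emb (d - R0T))

theorem addT_sub {α β : Idx → Idx} (h : AddEmb α β) (b d : TM Idx A) : addT h b d - R0T =
    push α h.left.emb (b - R0T) + push β h.right.emb (d - R0T) := add_sub_cancel_left _ _

theorem SEmb.comp {τ : Ω → Fin 2} {j : Ω → Idx} {α : Idx → Idx} (hα : SEmb Prod.fst α) (hj : SEmb τ j) :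
    SEmb τ (α ∘ j) :=
  ⟨hα.emb.comp hj.emb, fun x => (hα.sign _).trans (hj.sign x)⟩

theorem SEmb.id : SEmb Prod.fst (id : Idx → Idx) := ⟨PolyEmb.id _, fun _ => rfl⟩

section Laws

variable {α β : Idx → Idx} (h : AddEmb α β) {F D G : E → TM Idx A}

include h in
theorem AddEmb.symm : AddEmb β α := ⟨h.right, h.left, fun x y e => h.disjoint y x e.symm⟩

theorem IsGr.addT (hF : IsGr S F) (hD : IsGr S D) : IsGr S fun x => addT h (F x) (D x) :=
  IsGr.of_qi ((hF.1.push h.left.emb).add (hD.1.push h.right.emb)) fun x hx =>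
    ((hF.qi hx).push h.left.emb h.left.sign).add ((hD.qi hx).push h.right.emb h.right.sign)
      (push_mul_push_of_disjoint _ _ h.disjoint _ _) (push_mul_push_of_disjoint _ _ h.symm.disjoint _ _)

/-- Maps which preserve smooth families of idempotents are compatible with homotopies. -/
theorem Htpy.map₂ {op : TM Idx A → TM Idx A → TM Idx A}
    (hop : ∀ {T : Set (E × ℝ)} {F D : E × ℝ → TM Idx A}, IsGr T F → IsGr T D →
      IsGr T fun z => op (F z) (D z)) {F₀ F₁ D₀ D₁ : E → TM Idx A} (hF : Htpy S F₀ F₁)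
    (hD : Htpy S D₀ D₁) : Htpy S (fun x => op (F₀ x) (D₀ x)) fun x => op (F₁ x) (D₁ x) := by
  obtain ⟨H, hH, he⟩ := hF
  obtain ⟨K, hK, he'⟩ := hD
  refine ⟨_, hop hH hK, fun x hx => ?_⟩
  rw [(he x hx).1, (he x hx).2, (he' x hx).1, (he' x hx).2]
  exact ⟨rfl, rfl⟩

theorem addT_htpy_assoc (hF : IsGr S F) (hD : IsGr S D) (hG : IsGr S G) :
    Htpy S (fun x => addT h (addT h (F x) (D x)) (G x)) fun x => addT h (F x) (addT h (D x) (G x)) := by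
  refine (push_add_add_htpy (h.left.comp h.left) (h.left.comp h.right) h.right h.left
    (h.right.comp h.left) (h.right.comp h.right)
    (fun x y e => h.disjoint _ _ (h.left.emb.injective e))
    (fun x y => h.disjoint _ _) (fun x y => h.disjoint _ _)
    (fun x y => h.disjoint _ _) (fun x y => h.disjoint _ _)
    (fun x y e => h.disjoint _ _ (h.right.emb.injective e)) hF.1 hD.1 hG.1
    (fun x hx => hF.qi hx) (fun x hx => hD.qi hx) fun x hx => hG.qi hx).congr
    (fun x _ => ?_) fun x _ => ?_
  · rw [addT, addT_sub, map_add, push_push, push_push]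
  · rw [addT, addT_sub, map_add, push_push, push_push, add_assoc (push α _ _)]

theorem addT_htpy_comm (hF : IsGr S F) (hD : IsGr S D) :
    Htpy S (fun x => addT h (F x) (D x)) fun x => addT h (D x) (F x) := by
  refine (push_add_htpy h.left h.right h.right h.left h.disjoint h.symm.disjoint hF.1 hD.1
    (fun x hx => hF.qi hx) fun x hx => hD.qi hx).congr (fun x _ => rfl) fun x _ => ?_
  rw [addT, add_comm (push α _ _)]

theorem addT_htpy_zero (hF : IsGr S F) : Htpy S (fun x => addT h (F x) R0T) F := by
  refine (push_htpy h.left SEmb.id hF.1 fun x hx => hF.qi hx).congr (fun x _ => ?_) fun x _ => ?_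
  · rw [addT, sub_self, map_zero, add_zero]
  · rw [push_id, add_sub_cancel]

/-- Embeddings which define the additive inverse. -/
structure NegEmb (ν : Idx → Idx) : Prop where
  emb : PolyEmb ν
  sign : ∀ x, (ν x).1 = 1 - x.1

/-- The additive inverse. -/
noncomputable def negT {ν : Idx → Idx} (hν : NegEmb ν) (b : TM Idx A) : TM Idx A :=
  R0T - push ν hν.emb (b - R0T)

theorem one_sub_sgn (τ : Ω → Fin 2) : 1 - sgn τ = (sgn (fun x => 1 - τ x) : TM Ω A) := by
  refine TM.ext fun i j => ?_
  rw [TM.mat_sub, TM.mat_one, Matrix.one_apply, sgn_apply, sgn_apply]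
  have hc : ∀ c : Fin 2, c = 0 ∨ c = 1 := by decide
  rcases hc (τ i) with hi | hi <;> by_cases hij : i = j
  · subst hij; simp [hi]
  · simp [hij]
  · subst hij; simp [hi]
  · simp [hij]

theorem QI.neg {D κ : TM Ω A} (hκ : QI D κ) : QI (1 - D) (-κ) := by
  unfold QI at *
  have : (1 - D) * -κ + -κ * (1 - D) + -κ * -κ = (D * κ + κ * D + κ * κ) - κ - κ := by noncomm_ring
  rw [this, hκ]
  abel

protected theorem IsGr.negT {ν : Idx → Idx} (hν : NegEmb ν) (hF : IsGr S F) : IsGr S fun x => negT hν (F x) := by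
  refine (IsGr.of_qi (κ := fun x => push ν hν.emb (-(F x - R0T))) (hF.1.neg.push hν.emb)
    fun x hx => ?_).congr fun x _ => ?_
  · refine QI.push (τ := fun x => 1 - x.1) hν.emb hν.sign ?_
    have := (hF.qi hx).neg
    rw [R0T, one_sub_sgn] at this
    exact this
  · rw [negT, map_neg, sub_eq_add_neg]

end Laws

/-! ### Partial rotations -/

/-- The matrix `m` acting on the range of the idempotent `Q`. -/
noncomputable def rho {n : ℕ} (m : Matrix (Fin n) (Fin n) ℝ) (Q : TM Ω A) : TM (Fin n × Ω) A :=
  ten m Q + ten 1 (1 - Q)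

theorem rho_one {n : ℕ} (Q : TM Ω A) : rho (1 : Matrix (Fin n) (Fin n) ℝ) Q = 1 := by
  rw [rho, ← map_add, add_sub_cancel, ten_one_one]

theorem rho_mul_rho {n : ℕ} (m m' : Matrix (Fin n) (Fin n) ℝ) {Q : TM Ω A} (hQ : Q * Q = Q) :
    rho m Q * rho m' Q = rho (m * m') Q := by
  simp only [rho, add_mul, mul_add, ten_mul_ten, hQ, one_sub_mul_self hQ, mul_one_sub_self hQ,
    one_sub_mul_one_sub hQ, map_zero, Matrix.one_mul, add_zero, zero_add]

theorem rho_mul_rho_inv {n : ℕ} {m m' : Matrix (Fin n) (Fin n) ℝ} (h : m * m' = 1) {Q : TM Ω A}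
    (hQ : Q * Q = Q) : rho m Q * rho m' Q = 1 := by rw [rho_mul_rho _ _ hQ, h, rho_one]

protected theorem SM.rho {n : ℕ} {m : E → Matrix (Fin n) (Fin n) ℝ} (hm : ∀ i j k, IsCk k univ fun x => m x i j)
    {Q : E → TM Ω A} (hQ : SM S Q) : SM S fun x => rho (m x) (Q x) := by
  have h1 := SM.ten hm hQ
  have h2 : SM S fun x => 1 - Q x := (SM.const 1).sub hQ
  have h3 : SM S fun x => ten (1 : Matrix (Fin n) (Fin n) ℝ) (1 - Q x) :=
    h2.ampR.congr fun x _ => ten_one _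
  exact h1.add h3

theorem QI.conj_both {D κ g g' : TM Ω A} (h : QI D κ) (hg : g * g' = 1) :
    QI (g' * D * g) (g' * κ * g) := by
  unfold QI at *
  have e : ∀ a b : TM Ω A, g' * a * g * (g' * b * g) = g' * (a * b) * g := fun a b => by
    rw [show g' * a * g * (g' * b * g) = g' * a * (g * g') * b * g by simp only [mul_assoc], hg, mul_one,
      mul_assoc g']
  rw [e, e, e, ← add_mul, ← add_mul, ← mul_add, ← mul_add, h]

theorem idem_conj {R : Type*} [Ring R] {D g g' : R} (h : D * D = D) (hg : g * g' = 1) :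
    g' * D * g * (g' * D * g) = g' * D * g := by
  rw [show g' * D * g * (g' * D * g) = g' * D * (g * g') * D * g by simp only [mul_assoc], hg, mul_one,
    mul_assoc g', h]

/-- The mixture of two idempotents along `Q`. -/
theorem QI.ten_sub {n : ℕ} {Q k : TM Ω A} (hQ : Q * Q = Q) (hk : QI Q k)
    {e e' : Matrix (Fin n) (Fin n) ℝ} (he : e * e = e) (he' : e' * e' = e') :
    QI (ten e Q + ten e' (1 - Q)) (ten (e - e') k) := by
  have h1 : ∀ P : TM Ω A, P * P = P → (ten e P + ten e' (1 - P)) *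
      (ten e P + ten e' (1 - P)) =
      ten e P + ten e' (1 - P) := fun P hP => by
    simp only [add_mul, mul_add, ten_mul_ten, he, he', hP, one_sub_mul_self hP, mul_one_sub_self hP,
      one_sub_mul_one_sub hP, map_zero, add_zero, zero_add]
  refine QI.of_idem (h1 Q hQ) ?_
  have h2 : ten e Q + ten e' (1 - Q) + ten (e - e') k =
      ten e (Q + k) + ten e' (1 - (Q + k)) := by
    simp only [map_sub, map_add, LinearMap.sub_apply]
    abel
  rw [h2]
  exact h1 _ (hk.idem hQ)

theorem rot_conj_rotProj (t : ℝ) :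
    (rot t).transpose * rotProj t * rot t = Matrix.single 0 0 1 := by
  have : (rot t).transpose * rotProj t * rot t = ((rot t).transpose * rot t) * Matrix.single 0 0 1 *
      ((rot t).transpose * rot t) := by simp only [rotProj, Matrix.mul_assoc]
  rw [this, transpose_mul_rot, Matrix.one_mul, Matrix.mul_one]

theorem single_idem {n : ℕ} (i : Fin n) :
    (Matrix.single i i 1 * Matrix.single i i 1 : Matrix (Fin n) (Fin n) ℝ) = Matrix.single i i 1 := by
  rw [single_mul_single, if_pos rfl]

theorem sgn_two (τ₀ τ₁ : Ω → Fin 2) :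
    (sgn (fun z : Fin 2 × Ω => (![τ₀, τ₁] : Fin 2 → Ω → Fin 2) z.1 z.2) : TM (Fin 2 × Ω) A) =
      ten (Matrix.single 0 0 1) (sgn τ₀) + ten (Matrix.single 1 1 1) (sgn τ₁) := by
  refine TM.ext fun i j => ?_
  rw [sgn_apply, TM.mat_add, ten_apply, ten_apply, sgn_apply, sgn_apply]
  obtain ⟨i1, i2⟩ := i
  obtain ⟨j1, j2⟩ := j
  fin_cases i1 <;> fin_cases j1 <;> simp

/-- The cancellation of an idempotent and its complement. -/
theorem push_sub_htpy {τ : Ω → Fin 2} {α β : Ω → Idx} (hα : SEmb τ α) (hβ : SEmb (fun x => 1 - τ x) β)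
    (hd : ∀ x y, α x ≠ β y) {k : E → TM Ω A} (hk : SJ S k) (hi : ∀ x ∈ S, QI (sgn τ) (k x)) :
    Htpy S (fun x => R0T + (push α hα.emb (k x) - push β hβ.emb (k x))) fun _ => R0T := by
  have hj : SEmb (fun z : Fin 2 × Ω => (![τ, fun x => 1 - τ x] : Fin 2 → Ω → Fin 2) z.1 z.2)
      fun z : Fin 2 × Ω => (![α, β] : Fin 2 → Ω → Idx) z.1 z.2 :=
    SEmb.uncurry (Fin.forall_fin_two.2 ⟨hα, hβ⟩) (SEmb.disjoint_two hd)
  have hs := sgn_mul_sgn (A := A) τ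
  have hm : ∀ i j n, IsCk n univ fun z : E × ℝ =>
      (rotProj z.2 - Matrix.single 1 1 1 : Matrix (Fin 2) (Fin 2) ℝ) i j :=
    fun i j n => IsCk.add isOpen_univ (isCk_rotProj i j n)
      (IsCk.neg isOpen_univ (IsCk.const _ n _))
  have := hj.htpy (S := S) (κ := fun z : E × ℝ => rho (rot z.2).transpose (sgn τ) *
      ten (rotProj z.2 - Matrix.single 1 1 1) (k z.1) * rho (rot z.2) (sgn τ))
    ((SM.rho isCk_rot (SM.const _)).mul_right ((SM.rho (fun i j n => isCk_rot j i n)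
      (SM.const _)).mul_left ((hk.fst _).ten_smooth hm)))
    (fun x hx t _ => by
      have h1 := (QI.ten_sub hs (hi x hx) (rotProj_mul_rotProj t) (single_idem 1)).conj_both
        (rho_mul_rho_inv (rot_mul_transpose t) hs)
      have h2 : rho (rot t).transpose (sgn τ) * (ten (rotProj t) (sgn τ) +
          ten (Matrix.single 1 1 1) (1 - sgn τ)) * rho (rot t) (sgn τ) =
          (sgn (fun z : Fin 2 × Ω => (![τ, fun x => 1 - τ x] : Fin 2 → Ω → Fin 2) z.1 z.2) :
            TM (Fin 2 × Ω) A) := by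
        rw [sgn_two, ← one_sub_sgn]
        simp only [rho, add_mul, mul_add, ten_mul_ten, hs, one_sub_mul_self hs, mul_one_sub_self hs,
          one_sub_mul_one_sub hs, map_zero, Matrix.one_mul, Matrix.mul_one, add_zero, zero_add,
          rot_conj_rotProj]
      rw [h2] at h1
      exact h1)
  refine this.congr (fun x _ => ?_) fun x _ => ?_
  · rw [rot_zero, Matrix.transpose_one, rho_one, one_mul, mul_one, rotProj_zero, map_sub,
      LinearMap.sub_apply, ten_single, ten_single, map_sub, push_push, push_push]
    rfl
  · rw [rotProj_one, sub_self, ten_zero_left, mul_zero, zero_mul, map_zero, add_zero]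

theorem addT_htpy_neg {α β ν : Idx → Idx} (h : AddEmb α β) (hν : NegEmb ν) {F : E → TM Idx A}
    (hF : IsGr S F) : Htpy S (fun x => addT h (F x) (negT hν (F x))) fun _ => R0T := by
  have hβ : SEmb (fun x : Idx => 1 - x.1) (β ∘ ν) :=
    ⟨h.right.emb.comp hν.emb, fun x => (h.right.sign _).trans (hν.sign x)⟩
  refine (push_sub_htpy h.left hβ (fun x y => h.disjoint _ _) hF.1 fun x hx => hF.qi hx).congr
    (fun x _ => ?_) fun _ _ => rfl
  rw [addT, negT, sub_sub_cancel_left, map_neg, push_push, sub_eq_add_neg (push α _ _)]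

/-! ### Tensor products and restrictions -/

/-- The tensor product of tempered matrices. -/
noncomputable def kr : TM Ω A →ₗ[ℝ] TM Ξ A →ₗ[ℝ] TM (Ω × Ξ) A :=
  LinearMap.mk₂ ℝ (fun x y => ampL x * ampR y) (fun _ _ _ => by rw [map_add, add_mul])
    (fun _ _ _ => by rw [map_smul, smul_mul_assoc]) (fun _ _ _ => by rw [map_add, mul_add])
    (fun _ _ _ => by rw [map_smul, mul_smul_comm])

theorem kr_def (x : TM Ω A) (y : TM Ξ A) : kr x y = ampL x * ampR y := rfl

theorem kr_apply (x : TM Ω A) (y : TM Ξ A) (i j : Ω × Ξ) :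
    (kr x y).mat i j = x.mat i.1 j.1 * y.mat i.2 j.2 := ampL_mul_ampR_apply x y i j

theorem kr_mul_kr (x x' : TM Ω A) (y y' : TM Ξ A) : kr x y * kr x' y' = kr (x * x') (y * y') := by
  rw [kr_def, kr_def, kr_def, map_mul, map_mul, mul_assoc, ← mul_assoc (ampR y), ampR_mul_ampL]
  simp only [mul_assoc]

theorem kr_one_one : kr (1 : TM Ω A) (1 : TM Ξ A) = 1 := by rw [kr_def, map_one, map_one, one_mul]

theorem kr_zero_left (y : TM Ξ A) : kr (0 : TM Ω A) y = 0 := by rw [map_zero, LinearMap.zero_apply]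

protected theorem SJ.kr {f : E → TM Ω A} {g : E → TM Ξ A} (hf : SJ S f) (hg : SJ S g) :
    SJ S fun x => kr (f x) (g x) := hf.kron hg

protected theorem SM.kr {f : E → TM Ω A} {g : E → TM Ξ A} (hf : SM S f) (hg : SM S g) :
    SM S fun x => kr (f x) (g x) := hf.ampL.mul hg.ampR

theorem kr_push {j : Ω → Ω'} (hj : PolyEmb j) {l : Ξ → Ξ'} (hl : PolyEmb l) (x : TM Ω A) (y : TM Ξ A) :
    kr (push j hj x) (push l hl y) = push (Prod.map j l) (hj.prodMap hl) (kr x y) := by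
  refine TM.ext (forall_range_or (j := Prod.map j l) (fun a b => ?_) fun a b h => ?_)
  · rw [push_apply, kr_apply, kr_apply]
    exact congrArg₂ _ (push_apply _ _ _ _ _) (push_apply _ _ _ _ _)
  · rw [push_apply_of_notMem _ _ _ h, kr_apply]
    have key : ∀ c : Ω' × Ξ', c ∉ range (Prod.map j l) → c.1 ∉ range j ∨ c.2 ∉ range l := by
      intro c hc
      by_contra! hcon
      obtain ⟨⟨u, hu⟩, ⟨v, hv⟩⟩ := hcon
      exact hc ⟨(u, v), Prod.ext hu hv⟩
    rcases h with h | h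
    · rcases key _ h with h | h
      · rw [push_apply_of_notMem _ _ _ (Or.inl h), zero_mul]
      · rw [push_apply_of_notMem _ _ _ (Or.inl h), mul_zero]
    · rcases key _ h with h | h
      · rw [push_apply_of_notMem _ _ _ (Or.inr h), zero_mul]
      · rw [push_apply_of_notMem _ _ _ (Or.inr h), mul_zero]

theorem kr_push_left {j : Ω → Ω'} (hj : PolyEmb j) (x : TM Ω A) (y : TM Ξ A) :
    kr (push j hj x) y = push (Prod.map j id) (hj.prodMap (PolyEmb.id Ξ)) (kr x y) := by
  rw [← kr_push hj (PolyEmb.id Ξ), push_id]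

theorem kr_push_right {l : Ξ → Ξ'} (hl : PolyEmb l) (x : TM Ω A) (y : TM Ξ A) :
    kr x (push l hl y) = push (Prod.map id l) ((PolyEmb.id Ω).prodMap hl) (kr x y) := by
  rw [← kr_push (PolyEmb.id Ω) hl, push_id]

/-- The range of `j` is invariant under `Q'`, and `Q` is the restriction. -/
structure Restr (j : Ω → Ω') (Q' : TM Ω' A) (Q : TM Ω A) : Prop where
  apply : ∀ x y, Q'.mat (j x) (j y) = Q.mat x y
  off : ∀ i ∉ range j, ∀ y, Q'.mat i (j y) = 0 ∧ Q'.mat (j y) i = 0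

protected theorem Restr.kap_push {j : Ω → Ω'} (hj : PolyEmb j) {Q : TM Ω A} {Q' : TM Ω' A} (h : Restr j Q' Q)
    (X : TM Ω A) :
    kap Q' (push j hj X) = push (Prod.map id j) ((PolyEmb.id (Fin 2)).prodMap hj) (kap Q X) :=
  kap_push hj (mul_push_and_push_mul hj h.apply h.off)

theorem Restr.of_surjective {j : Ω → Ω'} (hj : Function.Surjective j) {Q : TM Ω A} {Q' : TM Ω' A}
    (h : ∀ x y, Q'.mat (j x) (j y) = Q.mat x y) : Restr j Q' Q :=
  ⟨h, fun i hi => absurd (hj i) hi⟩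

theorem Restr.add {j : Ω → Ω'} {P Q : TM Ω A} {P' Q' : TM Ω' A} (h : Restr j P' P) (h' : Restr j Q' Q) :
    Restr j (P' + Q') (P + Q) :=
  ⟨fun x y => by rw [TM.mat_add, TM.mat_add, h.apply, h'.apply], fun i hi y => by
    rw [TM.mat_add, TM.mat_add, (h.off i hi y).1, (h.off i hi y).2, (h'.off i hi y).1, (h'.off i hi y).2,
      add_zero]; exact ⟨rfl, rfl⟩⟩

theorem Restr.one {j : Ω → Ω'} (hj : Function.Injective j) : Restr j (1 : TM Ω' A) 1 :=
  ⟨fun x y => by simp only [TM.mat_one, Matrix.one_apply, hj.eq_iff],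
    fun i hi y => by
      have h : i ≠ j y := fun e => hi ⟨y, e.symm⟩
      rw [TM.mat_one, Matrix.one_apply_ne h, Matrix.one_apply_ne h.symm]; exact ⟨rfl, rfl⟩⟩

theorem Restr.sub {j : Ω → Ω'} {P Q : TM Ω A} {P' Q' : TM Ω' A} (h : Restr j P' P) (h' : Restr j Q' Q) :
    Restr j (P' - Q') (P - Q) :=
  ⟨fun x y => by rw [TM.mat_sub, TM.mat_sub, h.apply, h'.apply], fun i hi y => by
    rw [TM.mat_sub, TM.mat_sub, (h.off i hi y).1, (h.off i hi y).2, (h'.off i hi y).1, (h'.off i hi y).2,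
      sub_zero]; exact ⟨rfl, rfl⟩⟩

protected theorem Restr.sgn {j : Ω → Ω'} (hj : Function.Injective j) {τ : Ω → Fin 2} {τ' : Ω' → Fin 2}
    (hs : ∀ x, τ' (j x) = τ x) : Restr j (sgn τ' : TM Ω' A) (sgn τ) :=
  ⟨fun x y => by simp only [sgn_apply, hs, hj.eq_iff], fun i hi y => by
    have h : i ≠ j y := fun e => hi ⟨y, e.symm⟩
    rw [sgn_apply, sgn_apply, if_neg fun e => h e.1, if_neg fun e => h e.1.symm]; exact ⟨rfl, rfl⟩⟩

protected theorem Restr.push {j : Ω → Ω'} (hj : PolyEmb j) (a : TM Ω A) : Restr j (push j hj a) a :=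
  ⟨push_apply j hj a, fun i hi y => ⟨push_apply_of_notMem _ _ _ (Or.inl hi),
    push_apply_of_notMem _ _ _ (Or.inr hi)⟩⟩

theorem Restr.push_of_disjoint {j : Ω → Ω'} {l : Ξ → Ω'} (hl : PolyEmb l) (hd : ∀ x y, j x ≠ l y)
    (a : TM Ξ A) : Restr j (push l hl a) 0 := by
  have h : ∀ x, j x ∉ range l := by rintro x ⟨y, hy⟩; exact hd x y hy.symm
  exact ⟨fun x y => push_apply_of_notMem _ _ _ (Or.inl (h x)), fun i hi y =>
    ⟨push_apply_of_notMem _ _ _ (Or.inr (h y)), push_apply_of_notMem _ _ _ (Or.inl (h y))⟩⟩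

theorem Restr.id (Q : TM Ω A) : Restr id Q Q := Restr.of_surjective Function.surjective_id fun _ _ => rfl

protected theorem Restr.kr {j : Ω → Ω'} {l : Ξ → Ξ'} {P : TM Ω A} {P' : TM Ω' A} {Q : TM Ξ A} {Q' : TM Ξ' A}
    (h : Restr j P' P) (h' : Restr l Q' Q) : Restr (Prod.map j l) (kr P' Q') (kr P Q) := by
  refine ⟨fun x y => ?_, fun i hi y => ?_⟩
  · rw [kr_apply, kr_apply]
    exact congrArg₂ _ (h.apply _ _) (h'.apply _ _)
  · rw [kr_apply, kr_apply]
    by_cases h1 : i.1 ∈ range j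
    · have h2 : i.2 ∉ range l := by
        rintro ⟨v, hv⟩
        obtain ⟨u, hu⟩ := h1
        exact hi ⟨(u, v), Prod.ext hu hv⟩
      rw [show (Prod.map j l y).2 = l y.2 from rfl, (h'.off _ h2 y.2).1, (h'.off _ h2 y.2).2, mul_zero,
        mul_zero]
      exact ⟨rfl, rfl⟩
    · rw [show (Prod.map j l y).1 = j y.1 from rfl, (h.off _ h1 y.1).1, (h.off _ h1 y.1).2, zero_mul,
        zero_mul]
      exact ⟨rfl, rfl⟩

theorem Restr.comp {j : Ω' → Ω''} {l : Ω → Ω'} {Q'' : TM Ω'' A} {Q' : TM Ω' A} {Q : TM Ω A}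
    (h : Restr j Q'' Q') (h' : Restr l Q' Q) : Restr (j ∘ l) Q'' Q := by
  refine ⟨fun x y => (h.apply _ _).trans (h'.apply _ _), fun i hi y => ?_⟩
  by_cases h1 : i ∈ range j
  · obtain ⟨x, rfl⟩ := h1
    have h2 : x ∉ range l := by rintro ⟨z, rfl⟩; exact hi ⟨z, rfl⟩
    simp only [Function.comp_apply, h.apply]
    exact h'.off x h2 y
  · exact h.off i h1 (l y)

protected theorem Restr.blockT (P Q : TM Ω A) : Restr (fun x : Ω => ((0 : Fin 2), x)) (blockT P 0 0 Q) P := by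
  refine ⟨fun x y => ?_, fun i hi y => ?_⟩
  · rw [blockT_mat]; rfl
  · obtain ⟨i1, i2⟩ := i
    have hc : ∀ c : Fin 2, c = 0 ∨ c = 1 := by decide
    rcases hc i1 with rfl | rfl
    · exact absurd ⟨i2, rfl⟩ hi
    · rw [blockT_mat]; exact ⟨rfl, rfl⟩

/-! ### Reassociation of index sets -/

/-- Exchange of the first factor. -/
def assocL (z : Fin 2 × (Ω × Ξ)) : (Fin 2 × Ω) × Ξ := ((z.1, z.2.1), z.2.2)

/-- Exchange of the first factor. -/
def assocR (z : Fin 2 × (Ω × Ξ)) : Ω × (Fin 2 × Ξ) := (z.2.1, (z.1, z.2.2))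

theorem polyEmb_assocL : PolyEmb (assocL : Fin 2 × (Ω × Ξ) → (Fin 2 × Ω) × Ξ) :=
  PolyEmb.of_size (fun x y h => by
    obtain ⟨a, b, c⟩ := x
    obtain ⟨a', b', c'⟩ := y
    simp only [assocL, Prod.mk.injEq] at h
    obtain ⟨⟨rfl, rfl⟩, rfl⟩ := h
    rfl) fun x => by simp [assocL]

theorem polyEmb_assocR : PolyEmb (assocR : Fin 2 × (Ω × Ξ) → Ω × (Fin 2 × Ξ)) :=
  PolyEmb.of_size (fun x y h => by
    obtain ⟨a, b, c⟩ := x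
    obtain ⟨a', b', c'⟩ := y
    simp only [assocR, Prod.mk.injEq] at h
    obtain ⟨rfl, rfl, rfl⟩ := h
    rfl) fun x => by simp [assocR]

theorem assocL_surjective : Function.Surjective (assocL : Fin 2 × (Ω × Ξ) → (Fin 2 × Ω) × Ξ) :=
  fun z => ⟨(z.1.1, (z.1.2, z.2)), rfl⟩

theorem assocR_surjective : Function.Surjective (assocR : Fin 2 × (Ω × Ξ) → Ω × (Fin 2 × Ξ)) :=
  fun z => ⟨(z.2.1, (z.1, z.2.2)), rfl⟩

theorem polyEmb_prodAssoc : PolyEmb (Equiv.prodAssoc Ω Ξ Ω') :=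
  PolyEmb.of_size (Equiv.prodAssoc Ω Ξ Ω').injective fun x => by simp [add_assoc]

theorem push_eq_of_surjective {j : Ω → Ω'} (hj : PolyEmb j) (hs : Function.Surjective j) {a : TM Ω A}
    {b : TM Ω' A} (h : ∀ x y, b.mat (j x) (j y) = a.mat x y) : b = push j hj a := by
  refine TM.ext fun i l => ?_
  obtain ⟨x, rfl⟩ := hs i
  obtain ⟨y, rfl⟩ := hs l
  rw [push_apply, h]

theorem kr_kr (x : TM Ω A) (y : TM Ξ A) (z : TM Ω' A) :
    kr x (kr y z) = push (Equiv.prodAssoc Ω Ξ Ω') polyEmb_prodAssoc (kr (kr x y) z) :=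
  push_eq_of_surjective _ (Equiv.surjective _) fun a b => by
    simp only [kr_apply, mul_assoc]; rfl

theorem Restr.prodAssoc (x : TM Ω A) (y : TM Ξ A) (z : TM Ω' A) :
    Restr (Equiv.prodAssoc Ω Ξ Ω') (kr x (kr y z))
      (kr (kr x y) z) := by
  rw [kr_kr]; exact Restr.push _ _

theorem blockT_apply (a b c d : TM Ω A) (i j : Fin 2 × Ω) : (blockT a b c d).mat i j =
    if i.1 = 0 then if j.1 = 0 then a.mat i.2 j.2 else b.mat i.2 j.2
      else if j.1 = 0 then c.mat i.2 j.2 else d.mat i.2 j.2 := by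
  rw [blockT_mat, block_apply]
  obtain ⟨i1, i2⟩ := i
  obtain ⟨j1, j2⟩ := j
  have hc : ∀ c : Fin 2, c = 0 ∨ c = 1 := by decide
  rcases hc i1 with rfl | rfl <;> rcases hc j1 with rfl | rfl <;> rfl

theorem blockT_kr_left (a b c d : TM Ω A) (y : TM Ξ A) :
    kr (blockT a b c d) y = push assocL polyEmb_assocL (blockT (kr a y) (kr b y) (kr c y) (kr d y)) := by
  refine push_eq_of_surjective _ assocL_surjective fun i j => ?_
  simp only [kr_apply, blockT_apply, assocL, ite_mul]

theorem blockT_kr_right (x : TM Ω A) (a b c d : TM Ξ A) :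
    kr x (blockT a b c d) = push assocR polyEmb_assocR (blockT (kr x a) (kr x b) (kr x c) (kr x d)) := by
  refine push_eq_of_surjective _ assocR_surjective fun i j => ?_
  simp only [kr_apply, blockT_apply, assocR, mul_ite]

/-- The tensor product of the pair `⟨1 - q, q⟩` with `c`, `d`. -/
noncomputable def mix (q : TM Ω A) (d c : TM Ξ A) : TM (Ω × Ξ) A := kr q d + kr (1 - q) c

theorem mix_mul_mix {q : TM Ω A} (hq : q * q = q) (d c d' c' : TM Ξ A) :
    mix q d c * mix q d' c' = mix q (d * d') (c * c') := by
  simp only [mix, add_mul, mul_add, kr_mul_kr, hq, one_sub_mul_self hq, mul_one_sub_self hq,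
    one_sub_mul_one_sub hq, kr_zero_left, add_zero, zero_add]

theorem mix_add_kr (q k : TM Ω A) (c l : TM Ξ A) :
    mix q (c + l) c + kr k l = mix (q + k) (c + l) c := by
  simp only [mix, map_add, map_sub, LinearMap.add_apply, LinearMap.sub_apply]
  abel

protected theorem QI.mix {q k : TM Ω A} {c l : TM Ξ A} (hq : q * q = q) (hk : QI q k) (hc : c * c = c)
    (hl : QI c l) : QI (mix q (c + l) c) (kr k l) := by
  refine QI.of_idem ?_ ?_
  · rw [mix_mul_mix hq, hl.idem hc, hc]
  · rw [mix_add_kr, mix_mul_mix (hk.idem hq), hl.idem hc, hc]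

protected theorem SM.mix {q : E → TM Ω A} {d c : E → TM Ξ A} (hq : SM S q) (hd : SM S d) (hc : SM S c) :
    SM S fun x => mix (q x) (d x) (c x) :=
  (hq.kr hd).add (((SM.const 1).sub hq).kr hc)

protected theorem Restr.mix {j : Ω → Ω'} (hj : Function.Injective j) {l : Ξ → Ξ'} {q : TM Ω A} {q' : TM Ω' A}
    {d c : TM Ξ A} {d' c' : TM Ξ' A}
    (hq : Restr j q' q) (hd : Restr l d' d) (hc : Restr l c' c) :
    Restr (Prod.map j l) (mix q' d' c') (mix q d c) :=
  (hq.kr hd).add (((Restr.one hj).sub hq).kr hc)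

/-! ### The multiplicative structure -/

/-- The product of idempotents. -/
noncomputable def mulT {j : Fin 2 × (Idx × Idx) → Idx} (hj : SEmb Prod.fst j) (b d : TM Idx A) :
    TM Idx A :=
  R0T + push j hj.emb (kap (mix R0T d R0T) (kr (b - R0T) (d - R0T)))

theorem mulT_sub {j : Fin 2 × (Idx × Idx) → Idx} (hj : SEmb Prod.fst j) (b d : TM Idx A) :
    mulT hj b d - R0T = push j hj.emb (kap (mix R0T d R0T) (kr (b - R0T) (d - R0T))) :=
  add_sub_cancel_left _ _

section Laws

variable {j j' : Fin 2 × (Idx × Idx) → Idx} (hj : SEmb Prod.fst j) (hj' : SEmb Prod.fst j')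
  {F D G : E → TM Idx A}

theorem mix_R0T_idem {d : TM Idx A} (hd : d * d = d) :
    mix R0T d R0T * mix R0T d R0T = (mix R0T d R0T : TM (Idx × Idx) A) := by
  rw [mix_mul_mix R0T_mul_R0T, hd, R0T_mul_R0T]

theorem IsGr.sm_mix (hD : IsGr S D) : SM S fun x => (mix R0T (D x) R0T : TM (Idx × Idx) A) :=
  (SM.const _).mix hD.sm (SM.const _)

theorem IsGr.qi_mix {x : E} (hF : IsGr S F) (hD : IsGr S D) (hx : x ∈ S) :
    QI (mix R0T (D x) R0T) (kr (F x - R0T) (D x - R0T)) := by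
  have := QI.mix R0T_mul_R0T (hF.qi hx) R0T_mul_R0T (hD.qi hx)
  rwa [add_sub_cancel] at this

theorem IsGr.qi_kap_mix {x : E} (hF : IsGr S F) (hD : IsGr S D) (hx : x ∈ S) :
    QI (sgn Prod.fst) (kap (mix R0T (D x) R0T) (kr (F x - R0T) (D x - R0T))) :=
  (hF.qi_mix hD hx).kap (mix_R0T_idem (hD.2 x hx))

theorem IsGr.sJ_kap_mix (hF : IsGr S F) (hD : IsGr S D) :
    SJ S fun x => kap (mix R0T (D x) R0T) (kr (F x - R0T) (D x - R0T)) :=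
  SJ.kap hD.sm_mix (hF.1.kr hD.1)

theorem IsGr.mulT (hF : IsGr S F) (hD : IsGr S D) : IsGr S fun x => mulT hj (F x) (D x) :=
  hj.isGr (hF.sJ_kap_mix hD) fun x hx => hF.qi_kap_mix hD hx

theorem Restr.addT_left {α β : Idx → Idx} (h : AddEmb α β) (d f : TM Idx A) :
    Restr α (addT h d f) d := by
  have := (Restr.sgn (A := A) h.left.emb.injective h.left.sign).add
    ((Restr.push h.left.emb (d - R0T)).add
      (Restr.push_of_disjoint h.right.emb h.disjoint (f - R0T)))
  rw [add_zero, ← R0T, add_sub_cancel] at this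
  exact this

theorem addT_comm_eq {α β : Idx → Idx} (h : AddEmb α β) (d f : TM Idx A) :
    addT h d f = addT h.symm f d := by rw [addT, addT, add_comm (push α _ _)]

theorem Restr.addT_right {α β : Idx → Idx} (h : AddEmb α β) (d f : TM Idx A) :
    Restr β (addT h d f) f := by
  rw [addT_comm_eq]; exact Restr.addT_left h.symm f d

theorem mulT_htpy_mul_add {α β : Idx → Idx} (h : AddEmb α β) (hF : IsGr S F) (hD : IsGr S D)
    (hG : IsGr S G) : Htpy S (fun x => mulT hj (F x) (addT h (D x) (G x)))
      fun x => addT h (mulT hj (F x) (D x)) (mulT hj (F x) (G x)) := by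
  have hem : ∀ {γ : Idx → Idx} (hγ : PolyEmb γ), SEmb (Ω := Fin 2 × (Idx × Idx)) Prod.fst
      (j ∘ Prod.map id (Prod.map id γ)) := fun hγ =>
    ⟨hj.emb.comp ((PolyEmb.id _).prodMap ((PolyEmb.id _).prodMap hγ)), fun x => hj.sign _⟩
  refine (push_add_htpy (hem h.left.emb) (hem h.right.emb) (h.left.comp hj) (h.right.comp hj)
    (fun x y e => ?_) (fun x y => h.disjoint _ _) (hF.sJ_kap_mix hD) (hF.sJ_kap_mix hG)
    (fun x hx => hF.qi_kap_mix hD hx) fun x hx => hF.qi_kap_mix hG hx).congr (fun x _ => ?_)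
    fun x _ => ?_
  · have := hj.emb.injective e
    simp only [Prod.map, Prod.mk.injEq] at this
    exact h.disjoint _ _ this.2.2
  · have r1 := (Restr.mix (l := α) Function.injective_id (Restr.id (R0T : TM Idx A))
      (Restr.addT_left h (D x) (G x)) (Restr.sgn (A := A) h.left.emb.injective h.left.sign)).kap_push
      ((PolyEmb.id Idx).prodMap h.left.emb) (kr (F x - R0T) (D x - R0T))
    have r2 := (Restr.mix (l := β) Function.injective_id (Restr.id (R0T : TM Idx A))
      (Restr.addT_right h (D x) (G x)) (Restr.sgn (A := A) h.right.emb.injective h.right.sign)).kap_push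
      ((PolyEmb.id Idx).prodMap h.right.emb) (kr (F x - R0T) (G x - R0T))
    rw [mulT, addT_sub, map_add, kap_add, kr_push_right, kr_push_right]
    refine congrArg (R0T + ·) ?_
    refine (congrArg (push j hj.emb) (congrArg₂ (· + ·) r1 r2)).trans ?_
    rw [map_add, push_push, push_push]
    rfl
  · rw [addT, mulT_sub, mulT_sub, push_push, push_push]

/-! ### The multiplicative unit -/

/-- The single entry `e`. -/
noncomputable def unitT (e : A) : TM Unit A :=
  incl ⟨fun _ _ => e, fun p _ N => ⟨weight N () () * p e, fun _ _ => le_rfl⟩⟩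

theorem unitT_apply (e : A) (i l : Unit) : (unitT e).mat i l = (e : Unitization ℝ A) := rfl

/-- The multiplicative unit. -/
noncomputable def oneT {υ : Unit → Idx} (hυ : SEmb (fun _ => 0) υ) (e : A) : TM Idx A :=
  R0T + push υ hυ.emb (unitT e)

theorem sgn_unit : (sgn fun _ : Unit => (0 : Fin 2)) = (0 : TM Unit A) :=
  TM.ext fun i l => by rw [sgn_apply, if_neg (by simp)]; rfl

theorem isGr_oneT {υ : Unit → Idx} (hυ : SEmb (fun _ => 0) υ) {e : A} (he : e * e = e) :
    IsGr S fun _ => oneT hυ e := by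
  refine hυ.isGr (SJ.const _) fun x _ => ?_
  unfold QI
  rw [sgn_unit, zero_mul, mul_zero, zero_add, zero_add]
  refine TM.ext fun i l => ?_
  rw [TM.mul_apply, tsum_fintype, Finset.univ_unique, Finset.sum_singleton]
  change ((e : Unitization ℝ A) * (e : Unitization ℝ A)) = (e : Unitization ℝ A)
  rw [← Unitization.inr_mul, he]

theorem kr_unitT {e : A} (he : ∀ a, e * a = a) {f : TM Ξ A} (hf : ∃ k, f = incl k) :
    kr (unitT e) f = push (fun y : Ξ => ((), y))
      (PolyEmb.of_size (fun x y h => (Prod.ext_iff.1 h).2) fun x => by simp) f := by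
  obtain ⟨k, rfl⟩ := hf
  refine push_eq_of_surjective _ (fun z => ⟨z.2, rfl⟩) fun a b => ?_
  rw [kr_apply, unitT_apply, incl_apply, ← Unitization.inr_mul, he]

theorem mulT_htpy_one_mul {υ : Unit → Idx} (hυ : SEmb (fun _ => 0) υ) {e : A} (he : ∀ a, e * a = a)
    (hF : IsGr S F) : Htpy S (fun x => mulT hj (oneT hυ e) (F x)) F := by
  have hγ : PolyEmb fun y : Idx => (υ (), y) :=
    (hυ.emb.prodMap (PolyEmb.id Idx)).comp (PolyEmb.of_size (j := fun y : Idx => ((), y))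
      (fun x y h => (Prod.ext_iff.1 h).2) fun x => by simp)
  have hem : SEmb Prod.fst (j ∘ Prod.map id (fun y : Idx => (υ (), y)) ∘ fun n : Idx => (n.1, n)) :=
    ⟨hj.emb.comp (((PolyEmb.id _).prodMap hγ).comp (PolyEmb.sign_graph Prod.fst)), fun x => hj.sign _⟩
  refine (push_htpy hem SEmb.id hF.1 fun x hx => hF.qi hx).congr (fun x hx => ?_) fun x _ => ?_
  · have r : Restr (fun y : Idx => (υ (), y)) (mix R0T (F x) R0T) (R0T : TM Idx A) := by
      have r1 := (Restr.mix hυ.emb.injective (Restr.sgn (A := A) hυ.emb.injective hυ.sign)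
        (Restr.id (F x)) (Restr.id (R0T : TM Idx A)))
      have r2 : Restr (fun y : Idx => ((), y)) (mix (sgn fun _ : Unit => 0) (F x) R0T)
          (R0T : TM Idx A) := by
        refine Restr.of_surjective (fun z => ⟨z.2, rfl⟩) fun a b => ?_
        rw [mix, sgn_unit, kr_zero_left, zero_add, sub_zero, kr_apply, TM.mat_one, Matrix.one_apply_eq,
          one_mul]
      exact r1.comp r2
    rw [mulT, oneT, add_sub_cancel_left, kr_push_left, kr_unitT he (hF.1.exists hx), push_push]
    refine congrArg (R0T + ·) ((congrArg (push j hj.emb) ((r.kap_push hγ _).trans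
      (congrArg _ (kap_sgn _ _)))).trans ?_)
    rw [push_push, push_push]
    rfl
  · rw [push_id, add_sub_cancel]

end Laws

/-! ### Associativity of the multiplication -/

theorem rho_rot_one (Q : TM Ω A) : rho (rot 1) Q = blockT (1 - Q) (-Q) Q (1 - Q) := by
  refine TM.ext fun i l => ?_
  rw [rho, TM.mat_add, ten_apply, ten_apply, blockT_apply, rot_one]
  obtain ⟨i1, i2⟩ := i
  obtain ⟨l1, l2⟩ := l
  have hn : (-Q).mat i2 l2 = -(Q.mat i2 l2) := rfl
  fin_cases i1 <;> fin_cases l1 <;> simp [hn]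

theorem rho_rot_one_transpose (Q : TM Ω A) :
    rho (rot 1).transpose Q = blockT (1 - Q) Q (-Q) (1 - Q) := by
  refine TM.ext fun i l => ?_
  rw [rho, TM.mat_add, ten_apply, ten_apply, blockT_apply, rot_one]
  obtain ⟨i1, i2⟩ := i
  obtain ⟨l1, l2⟩ := l
  have hn : (-Q).mat i2 l2 = -(Q.mat i2 l2) := rfl
  fin_cases i1 <;> fin_cases l1 <;> simp [hn]

theorem rho_conj_blockT (Q P R : TM Ω A) :
    rho (rot 1) Q * blockT P 0 0 R * rho (rot 1).transpose Q =
      blockT ((1 - Q) * P * (1 - Q) + Q * R * Q) ((1 - Q) * P * Q - Q * R * (1 - Q))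
        (Q * P * (1 - Q) - (1 - Q) * R * Q) (Q * P * Q + (1 - Q) * R * (1 - Q)) := by
  rw [rho_rot_one, rho_rot_one_transpose, blockT_mul_blockT, blockT_mul_blockT]
  simp only [mul_zero, add_zero, zero_add, neg_mul, mul_neg, neg_neg, sub_eq_add_neg]

protected theorem SM.blockT {P R : E → TM Ω A} (hP : SM S P) (hR : SM S R) :
    SM S fun x => blockT (P x) 0 0 (R x) := by
  refine ((SM.ten (fun i j k => IsCk.const (Matrix.single (0 : Fin 2) 0 (1 : ℝ) i j) k _) hP).add
    (SM.ten (fun i j k => IsCk.const (Matrix.single (1 : Fin 2) 1 (1 : ℝ) i j) k _) hR)).congr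
    fun x _ => ?_
  rw [blockT, map_zero, map_zero, add_zero, add_zero]

protected theorem QI.blockT {P R X : TM Ω A} (hP : P * P = P) (hR : R * R = R) (h : QI P X) :
    QI (blockT P 0 0 R) (blockT X 0 0 0) := by
  refine QI.of_idem ?_ ?_
  · rw [blockT_mul_blockT, hP, hR]; simp
  · rw [blockT_add, blockT_mul_blockT, add_zero, add_zero, h.idem hP, hR]; simp

theorem blockT_eq_push (X : TM Ω A) :
    blockT X 0 0 0 = push (fun x : Ω => ((0 : Fin 2), x)) (PolyEmb.prodMk 0) X := by
  rw [blockT, map_zero, map_zero, map_zero, add_zero, add_zero, add_zero, ten_single]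

/-- An iterated regularization is homotopic to a simple one. -/
theorem kap_kap_htpy {j : Fin 2 × (Fin 2 × Ω) → Idx} (hj : SEmb Prod.fst j) {j' : Fin 2 × Ω → Idx}
    (hj' : SEmb Prod.fst j') {Q P R X : E → TM Ω A} (hP' : SM S P)
    (hQ : SM (S ×ˢ 𝕀) fun z : E × ℝ => Q z.1)
    (hP : SM (S ×ˢ 𝕀) fun z : E × ℝ => P z.1)
    (hR : SM (S ×ˢ 𝕀) fun z : E × ℝ => R z.1)
    (hX : SJ S X) (hQi : ∀ x ∈ S, Q x * Q x = Q x) (hPi : ∀ x ∈ S, P x * P x = P x)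
    (hRi : ∀ x ∈ S, R x * R x = R x) (hi : ∀ x ∈ S, QI (P x) (X x)) :
    Htpy S (fun x => R0T + push j' hj'.emb (kap (P x) (X x)))
      fun x => R0T + push j hj.emb (kap (rho (rot 1) (Q x) * blockT (P x) 0 0 (R x) *
        rho (rot 1).transpose (Q x)) (kap (Q x) (X x))) := by
  have hr : SM (S ×ˢ 𝕀) fun z : E × ℝ => rho (rot z.2) (Q z.1) :=
    SM.rho isCk_rot hQ
  have hr' : SM (S ×ˢ 𝕀) fun z : E × ℝ => rho (rot z.2).transpose (Q z.1) :=
    SM.rho (fun i j n => isCk_rot j i n) hQ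
  have h1 := kap_htpy hj (Q := fun z : E × ℝ => rho (rot z.2) (Q z.1) * blockT (P z.1) 0 0 (R z.1) *
      rho (rot z.2).transpose (Q z.1)) (X := fun z : E × ℝ => rho (rot z.2) (Q z.1) *
      blockT (X z.1) 0 0 0 * rho (rot z.2).transpose (Q z.1))
    ((hr.mul (SM.blockT hP hR)).mul hr')
    (hr'.mul_right (hr.mul_left (SJ.blockT (hX.fst _) SJ.zero SJ.zero SJ.zero)))
    (fun x hx t _ => idem_conj (by rw [blockT_mul_blockT, hPi x hx, hRi x hx]; simp)
      (rho_mul_rho_inv (transpose_mul_rot t) (hQi x hx)))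
    (fun x hx t _ => (QI.blockT (hPi x hx) (hRi x hx) (hi x hx)).conj_both
      (rho_mul_rho_inv (transpose_mul_rot t) (hQi x hx)))
  have hem : SEmb Prod.fst (j ∘ Prod.map id fun x : Ω => ((0 : Fin 2), x)) :=
    ⟨hj.emb.comp ((PolyEmb.id _).prodMap (PolyEmb.prodMk 0)), fun x => hj.sign _⟩
  refine (push_htpy hj' hem (SJ.kap hP' hX) fun x hx => (hi x hx).kap (hPi x hx)).trans
    (h1.congr (fun x _ => ?_) fun x _ => ?_)
  · rw [rot_zero, Matrix.transpose_one, rho_one, one_mul, mul_one, one_mul, mul_one, blockT_eq_push,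
      (Restr.blockT (P x) (R x)).kap_push (PolyEmb.prodMk 0), push_push]
  · rw [rho_conj_blockT (Q x) (X x) 0]
    simp only [mul_zero, zero_mul, add_zero, sub_zero]
    rfl

theorem mix_assoc (a : TM Ω A) (τ l : TM Ξ A) (φ σ : TM Ω' A) :
    mix (mix a (τ + l) τ) (σ + φ) σ =
      kr (kr 1 τ) φ + kr (kr 1 1) σ + kr (kr a l) φ := by
  simp only [mix, ← kr_one_one, map_add, map_sub, LinearMap.add_apply, LinearMap.sub_apply]
  abel

theorem mix_assoc' (a : TM Ω A) (τ l : TM Ξ A) (φ σ : TM Ω' A) :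
    kr 1 (mix τ (σ + φ) σ) + kr a (kr l φ) =
      kr 1 (kr τ φ) + kr 1 (kr 1 σ) + kr a (kr l φ) := by
  simp only [mix, map_add, map_sub, LinearMap.sub_apply]
  abel

protected theorem Restr.mix_assoc (a : TM Ω A) (τ l : TM Ξ A) (φ σ : TM Ω' A) :
    Restr (Equiv.prodAssoc Ω Ξ Ω')
      (kr 1 (mix τ (σ + φ) σ) + kr a
        (kr l φ)) (mix (mix a (τ + l) τ) (σ + φ) σ) := by
  rw [mix_assoc, mix_assoc']
  exact ((Restr.prodAssoc _ _ _).add (Restr.prodAssoc _ _ _)).add (Restr.prodAssoc _ _ _)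

theorem one_sub_kr_one (Q : TM Ω A) : 1 - kr Q (1 : TM Ξ A) = kr (1 - Q) 1 := by
  rw [map_sub, LinearMap.sub_apply, kr_one_one]

theorem one_sub_one_kr (Q : TM Ξ A) : 1 - kr (1 : TM Ω A) Q = kr 1 (1 - Q) := by
  rw [map_sub, kr_one_one]

theorem kr_kap_left (Q X : TM Ω A) (y : TM Ξ A) :
    kr (kap Q X) y = push assocL polyEmb_assocL (kap (kr Q 1) (kr X y)) := by
  rw [kap, kap, blockT_kr_left, one_sub_kr_one]
  simp only [kr_mul_kr, one_mul, mul_one]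

theorem kr_kap_right (x : TM Ω A) (Q X : TM Ξ A) :
    kr x (kap Q X) = push assocR polyEmb_assocR (kap (kr 1 Q) (kr x X)) := by
  rw [kap, kap, blockT_kr_right, one_sub_one_kr]
  simp only [kr_mul_kr, one_mul, mul_one]

theorem one_sub_sgn_fst : 1 - sgn Prod.fst = (blockT 1 0 0 0 : TM (Fin 2 × Ω) A) := by
  rw [sgn_fst, ← blockT_one, sub_eq_iff_eq_add, blockT_add]
  simp only [add_zero, zero_add]

protected theorem Restr.assocL {Q : TM Ω A} (hQ : Q * Q = Q) (d c : TM Ξ A) :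
    Restr assocL (mix (sgn Prod.fst) d c)
      (rho (rot 1) (kr Q 1) * blockT (mix Q d c) 0 0
        (mix (1 - Q) d c) * rho (rot 1).transpose (kr Q 1)) := by
  have h : mix (sgn Prod.fst) d c =
      push assocL polyEmb_assocL (blockT
        (kr (1 : TM Ω A) c) 0 0 (kr 1 d)) := by
    rw [mix, one_sub_sgn_fst, sgn_fst, blockT_kr_left, blockT_kr_left, ← map_add,
      blockT_add]
    simp only [kr_zero_left, add_zero, zero_add]
  rw [h, rho_conj_blockT, one_sub_kr_one]
  simp only [mix, mul_add, kr_mul_kr, one_mul, mul_one, hQ, one_sub_mul_self hQ,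
    mul_one_sub_self hQ, one_sub_mul_one_sub hQ, kr_zero_left, add_zero, zero_add, sub_self,
    sub_sub_cancel]
  rw [← LinearMap.add_apply, ← map_add, sub_add_cancel, add_comm (kr Q d),
    ← LinearMap.add_apply, ← map_add, sub_add_cancel]
  exact Restr.push _ _

protected theorem Restr.assocR {Q : TM Ξ A} (hQ : Q * Q = Q) (a : TM Ω A) (X : TM Ξ A) :
    Restr assocR (mix a (sgn Prod.fst + kap Q X)
      (sgn Prod.fst))
      (rho (rot 1) (kr 1 Q) * blockT
        (kr 1 Q + kr a X) 0 0 (kr 1 (1 - Q)) *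
        rho (rot 1).transpose (kr 1 Q)) := by
  have h : mix a (sgn Prod.fst + kap Q X) (sgn Prod.fst) =
      push assocR polyEmb_assocR (blockT 0 0 0 1 +
        kap (kr 1 Q) (kr a X)) := by
    rw [map_add, ← kr_kap_right, ← kr_one_one, ← map_zero (kr 1), ← blockT_kr_right,
      sgn_fst, mix, map_sub, map_add, LinearMap.sub_apply]
    abel
  rw [h, rho_conj_blockT, one_sub_one_kr, kap, blockT_add, one_sub_one_kr]
  have h1 : kr (1 : TM Ω A) (1 - Q) + kr 1 Q = 1 := by
    rw [← map_add, sub_add_cancel, kr_one_one]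
  simp only [mul_add, add_mul, kr_mul_kr, one_mul, mul_one, hQ, one_sub_mul_self hQ,
    mul_one_sub_self hQ, one_sub_mul_one_sub hQ, map_zero, zero_mul, add_zero, zero_add, sub_zero]
  rw [add_right_comm, add_comm (kr 1 Q), h1]
  exact Restr.push _ _

section Assoc

variable {j : Fin 2 × (Idx × Idx) → Idx} (hj : SEmb Prod.fst j) {F D G : E → TM Idx A}

set_option synthInstance.maxSize 1000 in
theorem mulT_mulT_htpy_left {j' : Fin 2 × ((Idx × Idx) × Idx) → Idx} (hj' : SEmb Prod.fst j')
    (hF : IsGr S F) (hD : IsGr S D) (hG : IsGr S G) :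
    Htpy S (fun x => R0T + push j' hj'.emb (kap (mix (mix R0T (D x) R0T) (G x) R0T)
        (kr (kr (F x - R0T) (D x - R0T)) (G x - R0T))))
      fun x => mulT hj (mulT hj (F x) (D x)) (G x) := by
  have hγ : PolyEmb (Prod.map j id ∘ assocL : Fin 2 × ((Idx × Idx) × Idx) → Idx × Idx) :=
    (hj.emb.prodMap (PolyEmb.id _)).comp polyEmb_assocL
  have hem : SEmb (Ω := Fin 2 × (Fin 2 × ((Idx × Idx) × Idx))) Prod.fst
      (j ∘ Prod.map id (Prod.map j id ∘ assocL)) :=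
    ⟨hj.emb.comp ((PolyEmb.id _).prodMap hγ), fun x => hj.sign _⟩
  have hD' := hD.fst (𝕀)
  have hG' := hG.fst (𝕀)
  have hQ := fun x hx => mix_R0T_idem (hD.2 x hx)
  refine (kap_kap_htpy hem hj' (Q := fun x => kr (mix R0T (D x) R0T) 1)
    (P := fun x => mix (mix R0T (D x) R0T) (G x) R0T)
    (R := fun x => mix (1 - mix R0T (D x) R0T) (G x) R0T)
    (X := fun x => kr (kr (F x - R0T) (D x - R0T)) (G x - R0T))
    (hD.sm_mix.mix hG.sm (SM.const _)) (hD'.sm_mix.kr (SM.const _))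
    (hD'.sm_mix.mix hG'.sm (SM.const _))
    (((SM.const _).sub hD'.sm_mix).mix hG'.sm (SM.const _))
    ((hF.1.kr hD.1).kr hG.1) (fun x hx => ?_) (fun x hx => ?_) (fun x hx => ?_) fun x hx => ?_).congr
    (fun x _ => rfl) fun x hx => ?_
  · rw [kr_mul_kr, hQ x hx, one_mul]
  · rw [mix_mul_mix (hQ x hx), hG.2 x hx, R0T_mul_R0T]
  · rw [mix_mul_mix (one_sub_mul_one_sub (hQ x hx)), hG.2 x hx, R0T_mul_R0T]
  · have := QI.mix (hQ x hx) (hF.qi_mix hD hx) R0T_mul_R0T (hG.qi hx)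
    rwa [add_sub_cancel] at this
  · have r := ((Restr.mix hj.emb.injective (Restr.sgn (A := A) hj.emb.injective hj.sign)
      (Restr.id (G x)) (Restr.id (R0T : TM Idx A))).comp
      (Restr.assocL (hQ x hx) (G x) R0T)).kap_push hγ
    rw [mulT, mulT_sub, kr_push_left, kr_kap_left, push_push]
    refine congrArg (R0T + ·) ((congrArg (push j hj.emb) (r _)).trans ?_)
    rw [push_push]

theorem mulT_mulT_htpy_right {j' : Fin 2 × (Idx × (Idx × Idx)) → Idx} (hj' : SEmb Prod.fst j')
    (hF : IsGr S F) (hD : IsGr S D) (hG : IsGr S G)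
    (hi : ∀ x ∈ S, (kr 1 (mix R0T (G x) R0T) + kr R0T (kr (D x - R0T) (G x - R0T)) :
      TM (Idx × (Idx × Idx)) A) * (kr 1 (mix R0T (G x) R0T) + kr R0T (kr (D x - R0T) (G x - R0T))) =
      kr 1 (mix R0T (G x) R0T) + kr R0T (kr (D x - R0T) (G x - R0T)))
    (hq : ∀ x ∈ S, QI (kr 1 (mix R0T (G x) R0T) + kr R0T (kr (D x - R0T) (G x - R0T)))
      (kr (F x - R0T) (kr (D x - R0T) (G x - R0T)))) :
    Htpy S (fun x => R0T + push j' hj'.emb (kap (kr 1 (mix R0T (G x) R0T) +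
        kr R0T (kr (D x - R0T) (G x - R0T))) (kr (F x - R0T) (kr (D x - R0T) (G x - R0T)))))
      fun x => mulT hj (F x) (mulT hj (D x) (G x)) := by
  have hγ : PolyEmb (Prod.map id j ∘ assocR : Fin 2 × (Idx × (Idx × Idx)) → Idx × Idx) :=
    ((PolyEmb.id _).prodMap hj.emb).comp polyEmb_assocR
  have hem : SEmb (Ω := Fin 2 × (Fin 2 × (Idx × (Idx × Idx)))) Prod.fst
      (j ∘ Prod.map id (Prod.map id j ∘ assocR)) :=
    ⟨hj.emb.comp ((PolyEmb.id _).prodMap hγ), fun x => hj.sign _⟩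
  have hD' := hD.fst (𝕀)
  have hG' := hG.fst (𝕀)
  have hQ := fun x hx => mix_R0T_idem (hG.2 x hx)
  have hc : SM S fun _ => (1 : TM Idx A) := SM.const 1
  have hc' : SM (S ×ˢ 𝕀) fun _ : E × ℝ => (1 : TM Idx A) := SM.const 1
  have hR : SM S fun _ => (R0T : TM Idx A) := SM.const R0T
  have hR' : SM (S ×ˢ 𝕀) fun _ : E × ℝ => (R0T : TM Idx A) := SM.const R0T
  have h1 := hc.kr hG.sm_mix
  have h1' := hc'.kr hG'.sm_mix
  have h2 := hR.kr (hD.1.kr hG.1).sm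
  have h2' := hR'.kr (hD'.1.kr hG'.1).sm
  have h3 : SM (S ×ˢ 𝕀) fun z : E × ℝ => 1 - (mix R0T (G z.1) R0T : TM (Idx × Idx) A) :=
    (SM.const 1).sub hG'.sm_mix
  have h3' := hc'.kr h3
  refine (kap_kap_htpy hem hj' (Q := fun x => kr 1 (mix R0T (G x) R0T))
    (P := fun x => kr 1 (mix R0T (G x) R0T) + kr R0T (kr (D x - R0T) (G x - R0T)))
    (R := fun x => kr 1 (1 - mix R0T (G x) R0T))
    (X := fun x => kr (F x - R0T) (kr (D x - R0T) (G x - R0T)))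
    (h1.add h2) h1' (h1'.add h2') h3'
    (hF.1.kr (hD.1.kr hG.1)) (fun x hx => ?_) hi (fun x hx => ?_) hq).congr
    (fun x _ => rfl) fun x hx => ?_
  · rw [kr_mul_kr, hQ x hx, one_mul]
  · rw [kr_mul_kr, one_sub_mul_one_sub (hQ x hx), one_mul]
  · have h1 : Restr j (mulT hj (D x) (G x)) (sgn Prod.fst + kap (mix R0T (G x) R0T)
        (kr (D x - R0T) (G x - R0T))) :=
      (Restr.sgn hj.emb.injective hj.sign).add (Restr.push hj.emb _)
    have r := ((Restr.mix Function.injective_id (Restr.id (R0T : TM Idx A)) h1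
      (Restr.sgn (A := A) hj.emb.injective hj.sign)).comp
      (Restr.assocR (hQ x hx) R0T (kr (D x - R0T) (G x - R0T)))).kap_push hγ
    rw [mulT, mulT_sub, kr_push_right, kr_kap_right, push_push]
    refine congrArg (R0T + ·) ((congrArg (push j hj.emb) (r _)).trans ?_)
    rw [push_push]

theorem Restr.eq_push {Ω Ω' : Type} [GrowthIndex Ω] [PolyIdx Ω] [DecidableEq Ω] [GrowthIndex Ω']
    [PolyIdx Ω'] [DecidableEq Ω'] {j : Ω → Ω'} (hj : PolyEmb j) (hs : Function.Surjective j) {P : TM Ω A}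
    {P' : TM Ω' A} (h : Restr j P' P) : P' = push j hj P :=
  push_eq_of_surjective hj hs h.apply

theorem QI.push_self {Ω Ω' : Type} [GrowthIndex Ω] [PolyIdx Ω] [DecidableEq Ω] [GrowthIndex Ω']
    [PolyIdx Ω'] [DecidableEq Ω'] {j : Ω → Ω'} (hj : PolyEmb j) {P X : TM Ω A} (h : QI P X) :
    QI (push j hj P) (push j hj X) := by
  unfold QI at *
  rw [push_mul_push, push_mul_push, push_mul_push, ← map_add, ← map_add, h]

theorem mulT_htpy_assoc (hF : IsGr S F) (hD : IsGr S D) (hG : IsGr S G) :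
    Htpy S (fun x => mulT hj (mulT hj (F x) (D x)) (G x))
      fun x => mulT hj (F x) (mulT hj (D x) (G x)) := by
  have h0 : PolyEmb fun w : Idx × Idx => j (0, w) := hj.emb.comp (PolyEmb.prodMk 0)
  have hL : SEmb (Ω := Fin 2 × ((Idx × Idx) × Idx)) Prod.fst
      (j ∘ Prod.map id (Prod.map (fun w => j (0, w)) id)) :=
    ⟨hj.emb.comp ((PolyEmb.id _).prodMap (h0.prodMap (PolyEmb.id _))), fun x => hj.sign _⟩
  have hR : SEmb (Ω := Fin 2 × (Idx × (Idx × Idx))) Prod.fst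
      (j ∘ Prod.map id (Prod.map id (fun w => j (0, w)))) :=
    ⟨hj.emb.comp ((PolyEmb.id _).prodMap ((PolyEmb.id _).prodMap h0)), fun x => hj.sign _⟩
  have hLR : SEmb (Ω := Fin 2 × ((Idx × Idx) × Idx)) Prod.fst
      ((j ∘ Prod.map id (Prod.map id (fun w => j (0, w)))) ∘
        Prod.map id (Equiv.prodAssoc Idx Idx Idx)) :=
    ⟨hR.emb.comp ((PolyEmb.id _).prodMap polyEmb_prodAssoc), fun x => hR.sign _⟩
  have hr : ∀ x, Restr (Equiv.prodAssoc Idx Idx Idx) (kr 1 (mix R0T (G x) R0T) +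
      kr R0T (kr (D x - R0T) (G x - R0T))) (mix (mix R0T (D x) R0T) (G x) R0T) := fun x => by
    have := Restr.mix_assoc (R0T : TM Idx A) R0T (D x - R0T) (G x - R0T) R0T
    rwa [add_sub_cancel, add_sub_cancel] at this
  have hrp := fun x => (hr x).eq_push polyEmb_prodAssoc (Equiv.surjective _)
  have hi : ∀ x ∈ S, mix (mix R0T (D x) R0T) (G x) R0T * mix (mix R0T (D x) R0T) (G x) R0T =
      mix (mix R0T (D x) R0T) (G x) R0T := fun x hx => by
    rw [mix_mul_mix (mix_R0T_idem (hD.2 x hx)), hG.2 x hx, R0T_mul_R0T]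
  have hq : ∀ x ∈ S, QI (mix (mix R0T (D x) R0T) (G x) R0T)
      (kr (kr (F x - R0T) (D x - R0T)) (G x - R0T)) := fun x hx => by
    have := QI.mix (mix_R0T_idem (hD.2 x hx)) (hF.qi_mix hD hx) R0T_mul_R0T (hG.qi hx)
    rwa [add_sub_cancel] at this
  refine (mulT_mulT_htpy_left hj hL hF hD hG).symm.trans ((push_htpy hL hLR
    (SJ.kap (hD.sm_mix.mix hG.sm (SM.const _)) ((hF.1.kr hD.1).kr hG.1))
    fun x hx => (hq x hx).kap (hi x hx)).trans ((mulT_mulT_htpy_right hj hR hF hD hG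
    (fun x hx => ?_) fun x hx => ?_).congr (fun x _ => ?_) fun x _ => rfl))
  · rw [hrp, push_mul_push, hi x hx]
  · rw [hrp, kr_kr]
    exact (hq x hx).push_self _
  · refine congrArg (R0T + ·) ?_
    rw [kr_kr (F x - R0T), (hr x).kap_push polyEmb_prodAssoc, push_push]

end Assoc

/-! ### Commutativity of the multiplication -/

/-- The rotation in the first two coordinates. -/
noncomputable def rotA (t : ℝ) : Matrix (Fin 3) (Fin 3) ℝ :=
  !![Real.cos (Real.pi / 2 * t), -Real.sin (Real.pi / 2 * t), 0;
    Real.sin (Real.pi / 2 * t), Real.cos (Real.pi / 2 * t), 0; 0, 0, 1]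

/-- The right angle rotation in the first and third coordinates. -/
def rotB : Matrix (Fin 3) (Fin 3) ℝ := !![0, 0, -1; 0, 1, 0; 1, 0, 0]

theorem rotA_mul_transpose (t : ℝ) : rotA t * (rotA t).transpose = 1 := by
  have := Real.sin_sq_add_cos_sq (Real.pi / 2 * t)
  ext i j
  fin_cases i <;> fin_cases j <;> simp [rotA, Matrix.mul_apply, Fin.sum_univ_three] <;> nlinarith

theorem transpose_mul_rotA (t : ℝ) : (rotA t).transpose * rotA t = 1 :=
  mul_eq_one_comm.1 (rotA_mul_transpose t)

theorem rotA_zero : rotA 0 = 1 := by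
  ext i j
  fin_cases i <;> fin_cases j <;> simp [rotA]

theorem rotA_one : rotA 1 = !![0, -1, 0; 1, 0, 0; 0, 0, 1] := by
  ext i j
  fin_cases i <;> fin_cases j <;> simp [rotA]

theorem rotB_mul_transpose : rotB * rotB.transpose = 1 := by
  ext i j
  fin_cases i <;> fin_cases j <;> simp [rotB, Matrix.mul_apply, Fin.sum_univ_three]

theorem transpose_mul_rotB : rotB.transpose * rotB = 1 := mul_eq_one_comm.1 rotB_mul_transpose

theorem single_zero : (Matrix.single 0 0 1 : Matrix (Fin 3) (Fin 3) ℝ) = !![1, 0, 0; 0, 0, 0; 0, 0, 0] := by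
  ext i j; fin_cases i <;> fin_cases j <;> rfl

theorem single_one : (Matrix.single 1 1 1 : Matrix (Fin 3) (Fin 3) ℝ) = !![0, 0, 0; 0, 1, 0; 0, 0, 0] := by
  ext i j; fin_cases i <;> fin_cases j <;> rfl

theorem single_two : (Matrix.single 2 2 1 : Matrix (Fin 3) (Fin 3) ℝ) = !![0, 0, 0; 0, 0, 0; 0, 0, 1] := by
  ext i j; fin_cases i <;> fin_cases j <;> rfl

theorem isCk_rotA (i j : Fin 3) (n : ℕ) : IsCk n univ fun z : E × ℝ => rotA z.2 i j := by
  have h (c : ℝ) : IsCk n univ fun _ : E × ℝ => c := IsCk.const c n _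
  fin_cases i <;> fin_cases j
  exacts [isCk_cos n, IsCk.neg isOpen_univ (isCk_sin n), h 0, isCk_sin n, isCk_cos n, h 0, h 0, h 0, h 1]

theorem rho_conj_of_orthogonal {n : ℕ} (m m' e : Matrix (Fin n) (Fin n) ℝ) {x p : TM Ω A}
    (h : x * p = 0) (h' : p * x = 0) : rho m x * ten e p * rho m' x = ten e p := by
  simp only [rho, add_mul, mul_add, ten_mul_ten, sub_mul, mul_sub, h, h', map_zero, one_mul,
    mul_one, sub_zero, zero_add]

theorem rho_conj_of_le {n : ℕ} (m m' e : Matrix (Fin n) (Fin n) ℝ) {x p : TM Ω A}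
    (h : x * p = p) (h' : p * x = p) : rho m x * ten e p * rho m' x = ten (m * e * m') p := by
  simp only [rho, add_mul, mul_add, ten_mul_ten, sub_mul, mul_sub, h, h', one_mul, mul_one,
    add_zero, sub_self, map_sub]

theorem rho_conj_of_fixed {n : ℕ} {m m' e : Matrix (Fin n) (Fin n) ℝ} (hm : m * e = e) (hm' : e * m' = e)
    (x p : TM Ω A) : rho m x * ten e p * rho m' x = ten e p := by
  have h1 : rho m x * ten e p = ten e p := by
    rw [rho, add_mul, ten_mul_ten, ten_mul_ten, hm, Matrix.one_mul, ← map_add, ← add_mul, add_sub_cancel,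
      one_mul]
  rw [h1, rho, mul_add, ten_mul_ten, ten_mul_ten, hm', Matrix.mul_one, ← map_add, ← mul_add,
    add_sub_cancel, mul_one]

theorem rho_add {n : ℕ} (m : Matrix (Fin n) (Fin n) ℝ) {x y : TM Ω A} (h : x * y = 0) :
    rho m (x + y) = rho m x * rho m y := by
  have h1 : x * (1 - y) = x := by rw [mul_sub, mul_one, h, sub_zero]
  have h2 : (1 - x) * y = y := by rw [sub_mul, one_mul, h, sub_zero]
  have h3 : (1 - x) * (1 - y) = 1 - (x + y) := by rw [mul_sub, mul_one, h2]; abel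
  simp only [rho, add_mul, mul_add, ten_mul_ten, h, h1, h2, h3, map_zero, Matrix.one_mul, Matrix.mul_one,
    map_add, zero_add]
  abel

/-- The diagonal matrix of three blocks. -/
noncomputable def diagB (p q r : TM Ω A) : TM (Fin 3 × Ω) A :=
  ten (Matrix.single 0 0 1) p + ten (Matrix.single 1 1 1) q + ten (Matrix.single 2 2 1) r

theorem diagB_mul_diagB (p q r p' q' r' : TM Ω A) :
    diagB p q r * diagB p' q' r' = diagB (p * p') (q * q') (r * r') := by
  simp only [diagB, add_mul, mul_add, ten_mul_ten, single_mul_single]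
  simp [ten_zero_left]

theorem conj_add {R : Type*} [Ring R] (g g' a b : R) : g * (a + b) * g' = g * a * g' + g * b * g' := by
  rw [mul_add, add_mul]

/-- The conjugating matrix. -/
noncomputable def gam (t : ℝ) (x p q : TM Ω A) : TM (Fin 3 × Ω) A :=
  rho rotB.transpose x * (rho (rotA t) x * (rho (rotA t).transpose q * rho (rotA t) p) *
    rho (rotA t).transpose x) * rho rotB x

theorem gam_mul_gam (t : ℝ) {x p q : TM Ω A} (hx : x * x = x) (hp : p * p = p) (hq : q * q = q) :
    gam t x p q * gam t x q p = 1 := by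
  have h1 : ∀ {R : Type (max 0 u)} [Ring R] (s s' v v' q q' p p' : R), s * s' = 1 → s' * s = 1 →
      v * v' = 1 → v' * v = 1 → q' * q = 1 → p * p' = 1 →
      s' * (v * (q' * p) * v') * s * (s' * (v * (p' * q) * v') * s) = 1 := by
    intro R _ s s' v v' q q' p p' h1 h1' h2 h2' h3 h4
    rw [show s' * (v * (q' * p) * v') * s * (s' * (v * (p' * q) * v') * s) =
      s' * (v * (q' * (p * ((v' * ((s * s') * v)) * p') * q)) * v') * s by simp only [mul_assoc], h1,
      one_mul, h2', one_mul, h4, one_mul, h3, mul_one, h2, mul_one, h1']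
  exact h1 _ _ _ _ _ _ _ _ (rho_mul_rho_inv rotB_mul_transpose hx)
    (rho_mul_rho_inv transpose_mul_rotB hx) (rho_mul_rho_inv (rotA_mul_transpose t) hx)
    (rho_mul_rho_inv (transpose_mul_rotA t) hx) (rho_mul_rho_inv (transpose_mul_rotA t) hq)
    (rho_mul_rho_inv (rotA_mul_transpose t) hp)

theorem rho_sub {n : ℕ} (m : Matrix (Fin n) (Fin n) ℝ) (p q : TM Ω A) :
    rho m p - rho m q = ten (m - 1) (p - q) := by
  simp only [rho, map_sub, LinearMap.sub_apply]
  abel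

theorem gam_sub_one (t : ℝ) {x p q : TM Ω A} (hx : x * x = x) (hp : p * p = p) (hq : q * q = q) :
    gam t x p q - 1 = rho rotB.transpose x * (rho (rotA t) x * (rho (rotA t).transpose q *
      ten (rotA t - 1) (p - q)) * rho (rotA t).transpose x) * rho rotB x := by
  have h1 : gam t x q q = 1 := by
    rw [gam, rho_mul_rho_inv (transpose_mul_rotA t) hq, mul_one,
      rho_mul_rho_inv (rotA_mul_transpose t) hx, mul_one, rho_mul_rho_inv transpose_mul_rotB hx]
  rw [← rho_sub, mul_sub, mul_sub, sub_mul, mul_sub, sub_mul, ← gam, ← gam, h1]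

theorem gam_zero {x p q : TM Ω A} (hx : x * x = x) : gam 0 x p q = 1 := by
  rw [gam, rotA_zero, Matrix.transpose_one, rho_one, rho_one, rho_one, mul_one, mul_one, mul_one, mul_one,
    rho_mul_rho_inv transpose_mul_rotB hx]

/-- The conjugation path of the first block matrix. -/
noncomputable def conjPath (t : ℝ) (x p q F : TM Ω A) : TM (Fin 3 × Ω) A :=
  rho (rotA t).transpose x * (gam t x p q * diagB p F 0 * gam t x q p) * rho (rotA t) x

theorem conjPath_idem (t : ℝ) {x p q F : TM Ω A} (hx : x * x = x) (hp : p * p = p) (hq : q * q = q)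
    (hF : F * F = F) : conjPath t x p q F * conjPath t x p q F = conjPath t x p q F := by
  refine idem_conj (idem_conj ?_ (gam_mul_gam t hx hq hp)) (rho_mul_rho_inv (rotA_mul_transpose t) hx)
  rw [diagB_mul_diagB, hp, hF, mul_zero]

theorem conjPath_zero {x p q F : TM Ω A} (hx : x * x = x) : conjPath 0 x p q F = diagB p F 0 := by
  rw [conjPath, rotA_zero, Matrix.transpose_one, rho_one, gam_zero hx, gam_zero hx]
  simp only [one_mul, mul_one]

theorem conjPath_one {x y q z F : TM Ω A} (hx : x * x = x) (hy : y * y = y) (hq : q * q = q)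
    (hxy : x * y = 0) (hyx : y * x = 0) (hyF : y * F = 0) (hFy : F * y = 0) (hqz : q * z = 0)
    (hzq : z * q = 0) (hxz : x * z = 0) (hzx : z * x = 0) (hF : F + y = q + z) :
    conjPath 1 x (x + y) q F = diagB q (z + x) 0 := by
  have ht : (rotA 1).transpose = !![0, 1, 0; -1, 0, 0; 0, 0, 1] := by
    rw [rotA_one]; ext i j; fin_cases i <;> fin_cases j <;> rfl
  have hB : rotB.transpose = !![0, 0, 1; 0, 1, 0; -1, 0, 0] := by
    rw [rotB]; ext i j; fin_cases i <;> fin_cases j <;> rfl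
  have e1 : rho (rotA 1) (x + y) * rho (rotA 1).transpose x = rho (rotA 1) y := by
    rw [add_comm, rho_add _ hyx, mul_assoc, rho_mul_rho_inv (rotA_mul_transpose 1) hx, mul_one]
  have e2 : rho (rotA 1) x * rho (rotA 1).transpose (x + y) = rho (rotA 1).transpose y := by
    rw [rho_add _ hxy, ← mul_assoc, rho_mul_rho_inv (rotA_mul_transpose 1) hx, one_mul]
  have e3 : conjPath 1 x (x + y) q F = rho ((rotA 1).transpose * rotB.transpose * rotA 1) x *
      (rho (rotA 1).transpose q * (rho (rotA 1) y * (rho rotB x * diagB (x + y) F 0 *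
        rho rotB.transpose x) * rho (rotA 1).transpose y) * rho (rotA 1) q) *
      rho ((rotA 1).transpose * rotB * rotA 1) x := by
    rw [← rho_mul_rho _ _ hx, ← rho_mul_rho _ _ hx, ← rho_mul_rho _ _ hx, ← rho_mul_rho _ _ hx, ← e1, ← e2,
      conjPath, gam, gam]
    simp only [mul_assoc]
  have hsum : ∀ m m' : TM (Fin 3 × Ω) A, ∀ a b c : TM (Fin 3 × Ω) A,
      m * (a + b + c) * m' = m * a * m' + m * b * m' + m * c * m' := fun m m' a b c => by
    rw [conj_add, conj_add]
  have s1 : rho rotB x * diagB (x + y) F 0 * rho rotB.transpose x = diagB y F x := by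
    have : diagB (x + y) F 0 = ten (Matrix.single 0 0 1) x + ten (Matrix.single 0 0 1) y +
      ten (Matrix.single 1 1 1) F := by rw [diagB, map_add, map_zero, add_zero]
    rw [this, hsum, rho_conj_of_le _ _ _ hx hx, rho_conj_of_orthogonal _ _ _ hxy hyx, rho_conj_of_fixed]
    · have : rotB * Matrix.single 0 0 1 * rotB.transpose = Matrix.single 2 2 1 := by
        rw [hB, rotB]
        simp only [single_zero, single_one, single_two, Matrix.mul_fin_three]; norm_num
      rw [this, diagB]
      abel
    · rw [rotB]
      simp only [single_zero, single_one, single_two, Matrix.mul_fin_three]; norm_num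
    · rw [hB]
      simp only [single_zero, single_one, single_two, Matrix.mul_fin_three]; norm_num
  have f2 : rotA 1 * Matrix.single 2 2 1 = Matrix.single 2 2 1 := by
    rw [rotA_one]
    simp only [single_zero, single_one, single_two, Matrix.mul_fin_three]; norm_num
  have f2' : Matrix.single 2 2 1 * (rotA 1).transpose = Matrix.single 2 2 1 := by
    rw [ht]
    simp only [single_zero, single_one, single_two, Matrix.mul_fin_three]; norm_num
  have f3 : (rotA 1).transpose * Matrix.single 2 2 1 = Matrix.single 2 2 1 := by
    conv_lhs => rw [← f2]
    rw [← Matrix.mul_assoc, transpose_mul_rotA, Matrix.one_mul]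
  have f3' : Matrix.single 2 2 1 * rotA 1 = Matrix.single 2 2 1 := by
    conv_lhs => rw [← f2']
    rw [Matrix.mul_assoc, transpose_mul_rotA, Matrix.mul_one]
  have f4 : rotA 1 * Matrix.single 0 0 1 * (rotA 1).transpose = Matrix.single 1 1 1 := by
    rw [ht, rotA_one]
    simp only [single_zero, single_one, single_two, Matrix.mul_fin_three]; norm_num
  have f4' : (rotA 1).transpose * Matrix.single 1 1 1 * rotA 1 = Matrix.single 0 0 1 := by
    rw [← f4, ← Matrix.mul_assoc, ← Matrix.mul_assoc, transpose_mul_rotA, Matrix.one_mul,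
      Matrix.mul_assoc, transpose_mul_rotA, Matrix.mul_one]
  have s2 : rho (rotA 1) y * diagB y F x * rho (rotA 1).transpose y = diagB 0 (q + z) x := by
    rw [diagB, hsum, rho_conj_of_le _ _ _ hy hy, rho_conj_of_orthogonal _ _ _ hyF hFy,
      rho_conj_of_fixed f2 f2', f4, ← hF, diagB, map_zero, map_add, zero_add]
    abel
  have s3 : rho (rotA 1).transpose q * diagB 0 (q + z) x * rho (rotA 1) q = diagB q z x := by
    rw [diagB, map_zero, zero_add, map_add, hsum, rho_conj_of_le _ _ _ hq hq,
      rho_conj_of_orthogonal _ _ _ hqz hzq, rho_conj_of_fixed f3 f3', f4', diagB]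
  have hM : (rotA 1).transpose * rotB.transpose * rotA 1 = !![1, 0, 0; 0, 0, -1; 0, 1, 0] := by
    rw [ht, hB, rotA_one]
    rw [Matrix.mul_fin_three, Matrix.mul_fin_three]; norm_num
  have hM' : (rotA 1).transpose * rotB * rotA 1 = !![1, 0, 0; 0, 0, 1; 0, -1, 0] := by
    rw [ht, rotB, rotA_one]
    rw [Matrix.mul_fin_three, Matrix.mul_fin_three]; norm_num
  rw [e3, s1, s2, s3, hM, hM', diagB, hsum, rho_conj_of_orthogonal _ _ _ hxz hzx,
    rho_conj_of_le _ _ _ hx hx, rho_conj_of_fixed, diagB, map_zero, add_zero, map_add]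
  · have : (!![1, 0, 0; 0, 0, -1; 0, 1, 0] * Matrix.single 2 2 1 * !![1, 0, 0; 0, 0, 1; 0, -1, 0] :
        Matrix (Fin 3) (Fin 3) ℝ) = Matrix.single 1 1 1 := by
      simp only [single_zero, single_one, single_two, Matrix.mul_fin_three]; norm_num
    rw [this, add_assoc]
  · simp only [single_zero, single_one, single_two, Matrix.mul_fin_three]; norm_num
  · simp only [single_zero, single_one, single_two, Matrix.mul_fin_three]; norm_num

theorem exists_sEmb (Ω : Type) [GrowthIndex Ω] [PolyIdx Ω] :
    ∃ j : Fin 2 × Ω → Idx, SEmb Prod.fst j := by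
  obtain ⟨e, he⟩ := PolyIdx.exists_emb (Ω := Ω)
  exact ⟨Prod.map id e, (PolyEmb.id _).prodMap he, fun _ => rfl⟩

theorem rotA_transpose_mul_comm (t : ℝ) :
    (rotA t).transpose * Matrix.single 0 0 1 + (rotA t).transpose * Matrix.single 1 1 1 =
      Matrix.single 0 0 1 * (rotA t).transpose + Matrix.single 1 1 1 * (rotA t).transpose := by
  rw [← Matrix.mul_add, ← Matrix.add_mul, single_zero, single_one, rotA]
  ext i j
  fin_cases i <;> fin_cases j <;> simp [Matrix.mul_apply, Fin.sum_univ_three]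

theorem rho_commutator (t : ℝ) {x p F : TM Ω A} (hx : x * x = x) (hxp : x * p = x) (hpx : p * x = x) :
    rho (rotA t).transpose x * diagB p F 0 - diagB p F 0 * rho (rotA t).transpose x =
      ten ((rotA t).transpose * Matrix.single 1 1 1) (x * (F - x)) -
        ten (Matrix.single 1 1 1 * (rotA t).transpose) ((F - x) * x) -
        (ten (Matrix.single 1 1 1) (x * (F - x)) - ten (Matrix.single 1 1 1) ((F - x) * x)) := by
  have h := congrArg (fun m => ten m x) (rotA_transpose_mul_comm t)
  have hadd : ∀ m m' : Matrix (Fin 3) (Fin 3) ℝ, ten (m + m') x = ten m x + ten m' x := fun m m' => by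
    rw [map_add, LinearMap.add_apply]
  simp only [hadd] at h
  simp only [rho, diagB, map_zero, add_zero, add_mul, mul_add, ten_mul_ten, hxp, hpx, sub_mul, mul_sub,
    one_mul, mul_one, map_sub, hx]
  rw [← sub_eq_zero] at h ⊢
  rw [← h]
  abel

theorem ten_sub_one {n : ℕ} (m : Matrix (Fin n) (Fin n) ℝ) (a : TM Ω A) :
    ten (m - 1) a = ten m a - ten 1 a := by
  rw [map_sub, LinearMap.sub_apply]

theorem sJ_gam_sub_one {x p q : E × ℝ → TM Ω A} {T : Set (E × ℝ)} (hx : SM T x) (hp : SM T p)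
    (hq : SM T q) (hk : SJ T fun z => p z - q z) (hxi : ∀ z ∈ T, x z * x z = x z)
    (hpi : ∀ z ∈ T, p z * p z = p z) (hqi : ∀ z ∈ T, q z * q z = q z) :
    SJ T fun z => gam z.2 (x z) (p z) (q z) - 1 := by
  have w1 : SM T fun z => rho rotB.transpose (x z) :=
    SM.rho (m := fun _ => rotB.transpose) (fun i j n => IsCk.const _ n _) hx
  have w2 : SM T fun z => rho rotB (x z) :=
    SM.rho (m := fun _ => rotB) (fun i j n => IsCk.const _ n _) hx
  have w3 : SM T fun z => rho (rotA z.2) (x z) :=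
    SM.rho (m := fun z : E × ℝ => rotA z.2) isCk_rotA hx
  have w4 : SM T fun z => rho (rotA z.2).transpose (x z) :=
    SM.rho (m := fun z : E × ℝ => (rotA z.2).transpose) (fun i j n => isCk_rotA j i n) hx
  have w5 : SM T fun z => rho (rotA z.2).transpose (q z) :=
    SM.rho (m := fun z : E × ℝ => (rotA z.2).transpose) (fun i j n => isCk_rotA j i n) hq
  have k1 : SJ T fun z => ten (rotA z.2) (p z - q z) := hk.ten_smooth isCk_rotA
  have k2 : SJ T fun z => ten (rotA z.2 - 1) (p z - q z) :=
    (k1.sub (hk.ten 1)).congr fun z _ => ten_sub_one _ _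
  exact (w2.mul_right (w1.mul_left (w4.mul_right (w3.mul_left (w5.mul_left k2))))).congr
    fun z hz => gam_sub_one _ (hxi z hz) (hpi z hz) (hqi z hz)

theorem conjPath_sub (t : ℝ) {x p q F : TM Ω A} (hx : x * x = x) :
    conjPath t x p q F - diagB q F 0 =
      rho (rotA t).transpose x * ((gam t x p q - 1) * diagB p F 0 * ((gam t x q p - 1) + 1) +
        diagB p F 0 * (gam t x q p - 1)) * rho (rotA t) x +
      (rho (rotA t).transpose x * diagB p F 0 - diagB p F 0 * rho (rotA t).transpose x) * rho (rotA t) x +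
      ten (Matrix.single 0 0 1) (p - q) := by
  have h1 : ten (Matrix.single 0 0 1) (p - q) = diagB p F 0 - diagB q F 0 := by
    simp only [diagB, map_sub]; abel
  have h2 : diagB p F 0 * rho (rotA t).transpose x * rho (rotA t) x = diagB p F 0 := by
    rw [mul_assoc, rho_mul_rho_inv (transpose_mul_rotA t) hx, mul_one]
  rw [h1, sub_mul (rho (rotA t).transpose x * diagB p F 0), h2, conjPath]
  noncomm_ring

theorem sJ_conjPath_sub {x p q F : E × ℝ → TM Ω A} {T : Set (E × ℝ)} (hx : SM T x) (hp : SM T p)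
    (hq : SM T q) (hF : SM T F) (hk : SJ T fun z => p z - q z) (hu : SJ T fun z => x z * (F z - x z))
    (hu' : SJ T fun z => (F z - x z) * x z) (hxi : ∀ z ∈ T, x z * x z = x z)
    (hpi : ∀ z ∈ T, p z * p z = p z) (hqi : ∀ z ∈ T, q z * q z = q z)
    (hxp : ∀ z ∈ T, x z * p z = x z) (hpx : ∀ z ∈ T, p z * x z = x z) :
    SJ T fun z => conjPath z.2 (x z) (p z) (q z) (F z) - diagB (q z) (F z) 0 := by
  have cA := fun (i j : Fin 3) n => isCk_rotA (E := E) j i n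
  have cc : ∀ (m : Matrix (Fin 3) (Fin 3) ℝ) (i j : Fin 3) (n : ℕ),
      IsCk n univ fun _ : E × ℝ => m i j := fun m i j n => IsCk.const _ n _
  have w3 : SM T fun z => rho (rotA z.2) (x z) :=
    SM.rho (m := fun z : E × ℝ => rotA z.2) isCk_rotA hx
  have w4 : SM T fun z => rho (rotA z.2).transpose (x z) :=
    SM.rho (m := fun z : E × ℝ => (rotA z.2).transpose) cA hx
  have hD : SM T fun z => diagB (p z) (F z) 0 := by
    have d1 : SM T fun z => ten (Matrix.single (0 : Fin 3) (0 : Fin 3) (1 : ℝ)) (p z) :=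
      SM.ten (m := fun _ => Matrix.single 0 0 1) (cc _) hp
    have d2 : SM T fun z => ten (Matrix.single (1 : Fin 3) (1 : Fin 3) (1 : ℝ)) (F z) :=
      SM.ten (m := fun _ => Matrix.single 1 1 1) (cc _) hF
    have d3 : SM T fun z : E × ℝ => ten (Matrix.single (2 : Fin 3) (2 : Fin 3) (1 : ℝ)) (0 : TM Ω A) :=
      SM.const _
    exact (d1.add d2).add d3
  have y1 := sJ_gam_sub_one hx hp hq hk hxi hpi hqi
  have y2 := sJ_gam_sub_one hx hq hp (hk.neg.congr fun z _ => (neg_sub _ _).symm) hxi hqi hpi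
  have y3 : SM T fun z => (gam z.2 (x z) (q z) (p z) - 1) + 1 := y2.sm.add (SM.const 1)
  have m1 := w3.mul_right (w4.mul_left ((y3.mul_right (hD.mul_right y1)).add (hD.mul_left y2)))
  have t1 : SJ T fun z => ten ((rotA z.2).transpose * Matrix.single 1 1 1) (x z * (F z - x z)) :=
    hu.ten_smooth (isCk_matrix_mul (a := fun z : E × ℝ => (rotA z.2).transpose)
      (b := fun _ => Matrix.single 1 1 1) cA (cc _))
  have t2 : SJ T fun z => ten (Matrix.single 1 1 1 * (rotA z.2).transpose) ((F z - x z) * x z) :=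
    hu'.ten_smooth (isCk_matrix_mul (a := fun _ => Matrix.single 1 1 1)
      (b := fun z : E × ℝ => (rotA z.2).transpose) (cc _) cA)
  have t3 := (t1.sub t2).sub ((hu.ten (Matrix.single (1 : Fin 3) (1 : Fin 3) 1)).sub
    (hu'.ten (Matrix.single (1 : Fin 3) (1 : Fin 3) 1)))
  have t4 : SJ T fun z => rho (rotA z.2).transpose (x z) * diagB (p z) (F z) 0 -
      diagB (p z) (F z) 0 * rho (rotA z.2).transpose (x z) :=
    t3.congr fun z hz => rho_commutator _ (hxi z hz) (hxp z hz) (hpx z hz)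
  exact ((m1.add (w3.mul_right t4)).add (hk.ten _)).congr fun z hz =>
    conjPath_sub _ (hxi z hz)

theorem diagB_eq_push (q F : TM Ω A) : diagB q F 0 =
    push (fun w : Ω => ((0 : Fin 3), w)) (PolyEmb.prodMk 0) q +
      push (fun w : Ω => ((1 : Fin 3), w)) (PolyEmb.prodMk 1) F := by
  rw [diagB, map_zero, add_zero, ten_single, ten_single]

theorem Restr.diagB_zero (q F : TM Ω A) : Restr (fun w : Ω => ((0 : Fin 3), w)) (diagB q F 0) q := by
  have := (Restr.push (PolyEmb.prodMk (0 : Fin 3)) q).add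
    (Restr.push_of_disjoint (PolyEmb.prodMk (1 : Fin 3)) (fun x y e => by simp at e) F)
  rwa [add_zero, ← diagB_eq_push] at this

theorem Restr.diagB_one (q F : TM Ω A) : Restr (fun w : Ω => ((1 : Fin 3), w)) (diagB q F 0) F := by
  have := (Restr.push_of_disjoint (PolyEmb.prodMk (0 : Fin 3)) (fun x y e => by simp at e) q).add
    (Restr.push (PolyEmb.prodMk (1 : Fin 3)) F)
  rwa [zero_add, ← diagB_eq_push] at this

/-- The relations between the two presentations of a product. -/
structure Exchange (x y q z F : TM Ω A) : Prop where
  xx : x * x = x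
  yy : y * y = y
  qq : q * q = q
  FF : F * F = F
  xy : x * y = 0
  yx : y * x = 0
  yF : y * F = 0
  Fy : F * y = 0
  qz : q * z = 0
  zq : z * q = 0
  xz : x * z = 0
  zx : z * x = 0
  zz : z * z = z
  sum : F + y = q + z

theorem Exchange.sub_eq {x y q z F : TM Ω A} (h : Exchange x y q z F) : z + x - F = x + y - q := by
  rw [sub_eq_sub_iff_add_eq_add, show z + x + q = (q + z) + x by abel, ← h.sum]
  abel

theorem exchange_htpy {x y q z F : E → TM Ω A} {j j' : Fin 2 × Ω → Idx} (hj : SEmb Prod.fst j)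
    (hj' : SEmb Prod.fst j') (h : ∀ s ∈ S, Exchange (x s) (y s) (q s) (z s) (F s))
    (hx : SM (S ×ˢ 𝕀) fun s : E × ℝ => x s.1)
    (hy : SM (S ×ˢ 𝕀) fun s : E × ℝ => y s.1)
    (hq : SM (S ×ˢ 𝕀) fun s : E × ℝ => q s.1)
    (hF : SM (S ×ˢ 𝕀) fun s : E × ℝ => F s.1) (hq' : SM S q) (hF' : SM S F)
    (hk : SJ S fun s => x s + y s - q s) (hu : SJ S fun s => x s * (F s - x s))
    (hu' : SJ S fun s => (F s - x s) * x s) :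
    Htpy S (fun s => R0T + push j hj.emb (kap (q s) (x s + y s - q s)))
      fun s => R0T + push j' hj'.emb (kap (F s) (x s + y s - q s)) := by
  obtain ⟨J, hJ⟩ := exists_sEmb (Fin 3 × Ω)
  have hpp : ∀ s ∈ S, (x s + y s) * (x s + y s) = x s + y s := fun s hs => by
    rw [add_mul, mul_add, mul_add, (h s hs).xx, (h s hs).yy, (h s hs).xy, (h s hs).yx, add_zero, zero_add]
  have hQ : SM (S ×ˢ 𝕀) fun s : E × ℝ => diagB (q s.1) (F s.1) 0 := by
    have d1 := SM.ten (m := fun _ : E × ℝ => Matrix.single (0 : Fin 3) (0 : Fin 3) (1 : ℝ))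
      (fun i j n => IsCk.const _ n _) hq
    have d2 := SM.ten (m := fun _ : E × ℝ => Matrix.single (1 : Fin 3) (1 : Fin 3) (1 : ℝ))
      (fun i j n => IsCk.const _ n _) hF
    exact (d1.add d2).congr fun s _ => by rw [diagB, map_zero, add_zero]
  have hX : SJ (S ×ˢ 𝕀) fun s : E × ℝ =>
      conjPath s.2 (x s.1) (x s.1 + y s.1) (q s.1) (F s.1) - diagB (q s.1) (F s.1) 0 :=
    sJ_conjPath_sub hx (hx.add hy) hq hF (hk.fst _) (hu.fst _) (hu'.fst _) (fun s hs => (h s.1 hs.1).xx)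
      (fun s hs => hpp s.1 hs.1) (fun s hs => (h s.1 hs.1).qq)
      (fun s hs => by rw [mul_add, (h s.1 hs.1).xx, (h s.1 hs.1).xy, add_zero])
      (fun s hs => by rw [add_mul, (h s.1 hs.1).xx, (h s.1 hs.1).yx, add_zero])
  have hQi : ∀ s ∈ S, diagB (q s) (F s) 0 * diagB (q s) (F s) 0 = diagB (q s) (F s) 0 := fun s hs => by
    rw [diagB_mul_diagB, (h s hs).qq, (h s hs).FF, mul_zero]
  have key := kap_htpy hJ hQ hX (fun s hs t _ => hQi s hs) fun s hs t _ => QI.of_idem (hQi s hs) (by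
    rw [add_sub_cancel]
    exact conjPath_idem _ (h s hs).xx (hpp s hs) (h s hs).qq (h s hs).FF)
  have e : ∀ c : Fin 3, SEmb (Ω := Fin 2 × Ω) Prod.fst (J ∘ Prod.map id fun w : Ω => (c, w)) := fun c =>
    ⟨hJ.emb.comp ((PolyEmb.id _).prodMap (PolyEmb.prodMk c)), fun x => hJ.sign _⟩
  refine (push_htpy hj (e 0) (SJ.kap hq' hk) fun s hs => ?_).trans ((key.congr (fun s hs => ?_)
    fun s hs => ?_).trans (push_htpy (e 1) hj' (SJ.kap hF' hk) fun s hs => ?_))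
  · refine QI.kap (h s hs).qq (QI.of_idem (h s hs).qq ?_)
    rw [add_sub_cancel, hpp s hs]
  · refine congrArg (R0T + ·) ?_
    dsimp only
    rw [conjPath_zero (h s hs).xx, show diagB (x s + y s) (F s) 0 - diagB (q s) (F s) 0 =
      push (fun w : Ω => ((0 : Fin 3), w)) (PolyEmb.prodMk 0) (x s + y s - q s) by
        rw [diagB_eq_push, diagB_eq_push, map_sub]; abel, (Restr.diagB_zero _ _).kap_push, push_push]
  · refine congrArg (R0T + ·) ?_
    have H := h s hs
    dsimp only
    rw [conjPath_one H.xx H.yy H.qq H.xy H.yx H.yF H.Fy H.qz H.zq H.xz H.zx H.sum,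
      show diagB (q s) (z s + x s) 0 - diagB (q s) (F s) 0 =
      push (fun w : Ω => ((1 : Fin 3), w)) (PolyEmb.prodMk 1) (x s + y s - q s) by
        rw [diagB_eq_push, diagB_eq_push, ← H.sub_eq, map_sub]; abel, (Restr.diagB_one _ _).kap_push,
      push_push]
  · have H := h s hs
    refine QI.kap H.FF (QI.of_idem H.FF ?_)
    rw [← H.sub_eq, add_sub_cancel, add_mul, mul_add, mul_add, H.xx, H.zz, H.xz, H.zx, add_zero, zero_add]

theorem polyEmb_swap : PolyEmb (Prod.swap : Ω × Ξ → Ξ × Ω) :=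
  PolyEmb.of_size Prod.swap_injective fun x => by simp [add_comm]

theorem kr_swap (x : TM Ω A) (y : TM Ξ A) : kr y x = push Prod.swap polyEmb_swap (kr x y) :=
  push_eq_of_surjective _ Prod.swap_surjective fun i l => by
    rw [kr_apply, kr_apply, mul_comm]; rfl

theorem mix_swap (q : TM Ω A) (d c : TM Ξ A) :
    kr d q + kr c (1 - q) = push Prod.swap polyEmb_swap (mix q d c) := by
  rw [mix, map_add, ← kr_swap, ← kr_swap]

theorem exchange_kr {b a d c : TM Idx A} (hb : b * b = b) (ha : a * a = a) (hd : d * d = d)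
    (hc : c * c = c) :
    Exchange (kr b d) (kr (1 - b) c) (mix a d c) (kr a (1 - d)) (kr b c + kr a (1 - c)) where
  xx := by rw [kr_mul_kr, hb, hd]
  yy := by rw [kr_mul_kr, one_sub_mul_one_sub hb, hc]
  qq := by rw [mix_mul_mix ha, hd, hc]
  FF := by
    simp only [add_mul, mul_add, kr_mul_kr, hb, hc, ha, one_sub_mul_self hc, mul_one_sub_self hc,
      one_sub_mul_one_sub hc, map_zero, add_zero, zero_add]
  xy := by rw [kr_mul_kr, mul_one_sub_self hb, kr_zero_left]
  yx := by rw [kr_mul_kr, one_sub_mul_self hb, kr_zero_left]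
  yF := by
    rw [mul_add, kr_mul_kr, kr_mul_kr, one_sub_mul_self hb, mul_one_sub_self hc, kr_zero_left, map_zero,
      add_zero]
  Fy := by
    rw [add_mul, kr_mul_kr, kr_mul_kr, mul_one_sub_self hb, one_sub_mul_self hc, kr_zero_left, map_zero,
      add_zero]
  qz := by
    rw [mix, add_mul, kr_mul_kr, kr_mul_kr, mul_one_sub_self hd, one_sub_mul_self ha, kr_zero_left,
      map_zero, add_zero]
  zq := by
    rw [mix, mul_add, kr_mul_kr, kr_mul_kr, one_sub_mul_self hd, mul_one_sub_self ha, kr_zero_left,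
      map_zero, add_zero]
  xz := by rw [kr_mul_kr, mul_one_sub_self hd, map_zero]
  zx := by rw [kr_mul_kr, one_sub_mul_self hd, map_zero]
  zz := by rw [kr_mul_kr, one_sub_mul_one_sub hd, ha]
  sum := by
    simp only [mix, map_sub, LinearMap.sub_apply]
    abel

theorem kr_add_sub_mix (b a d c : TM Idx A) :
    kr b d + kr (1 - b) c - mix a d c = kr (b - a) (d - c) := by
  simp only [mix, map_sub, LinearMap.sub_apply]
  abel

theorem kr_mul_sub {b a d c : TM Idx A} (hb : b * b = b) (hd : d * d = d) :
    kr b d * (kr b c + kr a (1 - c) - kr b d) = -kr (b * (b - a)) (d * (d - c)) := by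
  simp only [mul_add, mul_sub, kr_mul_kr, hb, hd, map_sub, LinearMap.sub_apply, mul_one]
  abel

theorem kr_sub_mul {b a d c : TM Idx A} (hb : b * b = b) (hd : d * d = d) :
    (kr b c + kr a (1 - c) - kr b d) * kr b d = -kr ((b - a) * b) ((d - c) * d) := by
  simp only [add_mul, sub_mul, kr_mul_kr, hb, hd, map_sub, LinearMap.sub_apply, one_mul]
  abel

theorem mulT_htpy_comm {j j' : Fin 2 × (Idx × Idx) → Idx} (hj : SEmb Prod.fst j) (hj' : SEmb Prod.fst j')
    {F D : E → TM Idx A} (hF : IsGr S F) (hD : IsGr S D) :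
    Htpy S (fun x => mulT hj (F x) (D x)) fun x => mulT hj' (D x) (F x) := by
  have hF' := (hF.fst (𝕀)).sm
  have hD' := (hD.fst (𝕀)).sm
  have hR : ∀ T : Set (E × ℝ), SM T fun _ => (R0T : TM Idx A) := fun T => SM.const R0T
  have hRE : SM S fun _ => (R0T : TM Idx A) := SM.const R0T
  have hRE' : SM S fun _ => (1 - R0T : TM Idx A) := SM.const _
  have hR' : ∀ T : Set (E × ℝ), SM T fun _ => (1 - R0T : TM Idx A) := fun T => SM.const _
  have hF'' : SM (S ×ˢ 𝕀) fun z : E × ℝ => 1 - F z.1 := (SM.const 1).sub hF'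
  have hsw : SEmb Prod.fst (j' ∘ Prod.map id (Prod.swap : Idx × Idx → Idx × Idx)) :=
    ⟨hj'.emb.comp ((PolyEmb.id _).prodMap polyEmb_swap), fun x => hj'.sign _⟩
  refine (exchange_htpy hj hsw (x := fun s => kr (F s) (D s)) (y := fun s => kr (1 - F s) R0T)
    (q := fun s => mix R0T (D s) R0T) (z := fun s => kr R0T (1 - D s))
    (F := fun s => kr (F s) R0T + kr R0T (1 - R0T))
    (fun s hs => exchange_kr (hF.2 s hs) R0T_mul_R0T (hD.2 s hs) R0T_mul_R0T)
    (hF'.kr hD') (hF''.kr (hR _)) (hD.fst _).sm_mix ((hF'.kr (hR _)).add ((hR _).kr (hR' _)))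
    hD.sm_mix ((hF.sm.kr hRE).add (hRE.kr hRE')) ((hF.1.kr hD.1).congr fun s _ => kr_add_sub_mix _ _ _ _)
    (((hF.sm.mul_left hF.1).kr (hD.sm.mul_left hD.1)).neg.congr fun s hs =>
      kr_mul_sub (hF.2 s hs) (hD.2 s hs))
    (((hF.sm.mul_right hF.1).kr (hD.sm.mul_right hD.1)).neg.congr fun s hs =>
      kr_sub_mul (hF.2 s hs) (hD.2 s hs))).congr (fun s _ => ?_) fun s _ => ?_
  · rw [mulT]
    rw [kr_add_sub_mix]
  · rw [mulT]
    rw [kr_add_sub_mix, mix_swap, kr_swap (D s - R0T), (Restr.push polyEmb_swap _).kap_push, push_push]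
    refine congrArg (R0T + ·) (TM.mat_injective ?_)
    rw [push_mat, push_mat]
    congr 1

theorem mulT_htpy_add_mul {j : Fin 2 × (Idx × Idx) → Idx} (hj : SEmb Prod.fst j) {α β : Idx → Idx}
    (h : AddEmb α β) {F D G : E → TM Idx A} (hF : IsGr S F) (hD : IsGr S D) (hG : IsGr S G) :
    Htpy S (fun x => mulT hj (addT h (F x) (D x)) (G x))
      fun x => addT h (mulT hj (F x) (G x)) (mulT hj (D x) (G x)) :=
  (mulT_htpy_comm hj hj (hF.addT h hD) hG).trans ((mulT_htpy_mul_add hj h hG hF hD).trans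
    (Htpy.map₂ (op := addT h) (IsGr.addT h) (mulT_htpy_comm hj hj hG hF) (mulT_htpy_comm hj hj hG hD)))

/-! ### Comparison with the matrix operations -/

theorem sEmb_map {Ω : Type} [GrowthIndex Ω] {r : Ω → ℕ} (hr : PolyEmb r) :
    SEmb Prod.fst (Prod.map id r : Fin 2 × Ω → Idx) := ⟨(PolyEmb.id _).prodMap hr, fun _ => rfl⟩

theorem sEmb_graph {r : Idx → ℕ} (hr : PolyEmb r) : SEmb Prod.fst fun x : Idx => ((x.1, r x) : Idx) :=
  ⟨((PolyEmb.id _).prodMap hr).comp (PolyEmb.sign_graph Prod.fst), fun _ => rfl⟩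

theorem addEmb_of_polyEmb {θ : Idx ⊕ Idx → ℕ} (hθ : PolyEmb θ) :
    AddEmb (fun x => (x.1, θ (Sum.inl x))) fun x => (x.1, θ (Sum.inr x)) where
  left := sEmb_graph (hθ.comp (PolyEmb.of_size Sum.inl_injective fun _ => rfl))
  right := sEmb_graph (hθ.comp (PolyEmb.of_size Sum.inr_injective fun _ => rfl))
  disjoint x y e := by
    have := hθ.injective (Prod.ext_iff.1 e).2
    simp at this

theorem negEmb_of_polyEmb {θ : Idx → ℕ} (hθ : PolyEmb θ) : NegEmb fun x => (1 - x.1, θ x) :=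
  ⟨((PolyEmb.id _).prodMap hθ).comp (PolyEmb.sign_graph _), fun _ => rfl⟩

theorem sEmb_unit {θ : Unit → ℕ} (hθ : PolyEmb θ) :
    SEmb (fun _ => 0) fun x : Unit => ((0, θ x) : Idx) :=
  ⟨(PolyEmb.prodMk 0).comp hθ, fun _ => rfl⟩

theorem relabel_fromBlocks {θ : Idx ⊕ Idx → ℕ} (hθ : PolyEmb θ) (hl : PolyEmb (θ ∘ Sum.inl))
    (hr : PolyEmb (θ ∘ Sum.inr)) (b d : TM Idx A) : relabel θ (Matrix.fromBlocks b.mat 0 0 d.mat) =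
      (push (θ ∘ Sum.inl) hl b + push (θ ∘ Sum.inr) hr d).mat := by
  have hne : ∀ x, θ (Sum.inl x) ∉ range (θ ∘ Sum.inr) := by
    rintro x ⟨y, hy⟩; simpa using hθ.injective hy
  have hne' : ∀ x, θ (Sum.inr x) ∉ range (θ ∘ Sum.inl) := by
    rintro x ⟨y, hy⟩; simpa using hθ.injective hy
  have : PolyIdx (Idx ⊕ Idx) := ⟨θ, hθ⟩
  refine Matrix.ext (forall_range_or (j := θ) (fun x y => ?_) fun i l h => ?_)
  · rw [relabel_apply hθ.injective, TM.mat_add]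
    obtain x | x := x <;> obtain y | y := y
    · rw [show (push _ hl b).mat (θ (Sum.inl x)) (θ (Sum.inl y)) = b.mat x y from push_apply _ hl b x y,
        push_apply_of_notMem _ _ _ (Or.inl (hne x)), add_zero]
      rfl
    · rw [push_apply_of_notMem _ _ _ (Or.inl (hne x)), push_apply_of_notMem _ _ _ (Or.inr (hne' y)),
        add_zero]
      rfl
    · rw [push_apply_of_notMem _ _ _ (Or.inl (hne' x)), push_apply_of_notMem _ _ _ (Or.inr (hne y)),
        add_zero]
      rfl
    · rw [show (push _ hr d).mat (θ (Sum.inr x)) (θ (Sum.inr y)) = d.mat x y from push_apply _ hr d x y,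
        push_apply_of_notMem _ _ _ (Or.inl (hne' x)), zero_add]
      rfl
  · have hc : ∀ {f : Idx → Idx ⊕ Idx}, i ∉ range (θ ∘ f) ∨ l ∉ range (θ ∘ f) := fun {f} =>
      h.imp (fun h h' => h (range_comp_subset_range f θ h')) fun h h' => h (range_comp_subset_range f θ h')
    rw [relabel_apply_of_notMem _ h, TM.mat_add, push_apply_of_notMem _ _ _ hc,
      push_apply_of_notMem _ _ _ hc, add_zero]

theorem add_mat {θ : Idx ⊕ Idx → ℕ} (hθ : PolyEmb θ) (b d : TM Idx A) :
    add θ b.mat d.mat = (addT (addEmb_of_polyEmb hθ) b d).mat := by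
  have hl : PolyEmb (θ ∘ Sum.inl) := hθ.comp (PolyEmb.of_size Sum.inl_injective fun _ => rfl)
  have hr : PolyEmb (θ ∘ Sum.inr) := hθ.comp (PolyEmb.of_size Sum.inr_injective fun _ => rfl)
  have hd : ∀ x y, (θ ∘ Sum.inl) x ≠ (θ ∘ Sum.inr) y := fun x y e => by
    simpa using hθ.injective e
  have hd' : ∀ x y, (θ ∘ Sum.inr) x ≠ (θ ∘ Sum.inl) y := fun x y e => hd y x e.symm
  have r1 : Restr (θ ∘ Sum.inl) (push _ hl R0T + push _ hr R0T) (R0T : TM Idx A) := by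
    have := (Restr.push hl (R0T : TM Idx A)).add (Restr.push_of_disjoint hr hd (R0T : TM Idx A))
    rwa [add_zero] at this
  have r2 : Restr (θ ∘ Sum.inr) (push _ hl R0T + push _ hr R0T) (R0T : TM Idx A) := by
    have := (Restr.push_of_disjoint hl hd' (R0T : TM Idx A)).add (Restr.push hr (R0T : TM Idx A))
    rwa [zero_add] at this
  rw [add, ← R0T_mat, relabel_fromBlocks hθ hl hr, relabel_fromBlocks hθ hl hr, regularize_mat, addT,
    add_sub_add_comm, ← map_sub, ← map_sub, kap_add, r1.kap_push hl, r2.kap_push hr, R0T, kap_sgn, kap_sgn,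
    push_push, push_push]
  · rfl
  · simp only [add_mul, mul_add, push_mul_push, push_mul_push_of_disjoint _ _ hd,
      push_mul_push_of_disjoint _ _ hd', R0T_mul_R0T, add_zero, zero_add]

theorem neg_mat {θ : Idx → ℕ} (hθ : PolyEmb θ) (b : TM Idx A) :
    neg θ b.mat = (negT (negEmb_of_polyEmb hθ) b).mat := by
  rw [neg, ← R0T_mat, ← TM.mat_one_sub, ← TM.mat_one_sub, ← push_mat θ hθ, ← push_mat θ hθ, regularize_mat,
    negT, ← map_sub, sub_sub_sub_cancel_left, ← neg_sub b, map_neg, kap_neg, (Restr.push hθ _).kap_push,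
    R0T, one_sub_sgn, kap_sgn, push_push, ← sub_eq_add_neg]
  · rfl
  · rw [push_mul_push, one_sub_mul_one_sub R0T_mul_R0T]

theorem regularize_push_mix {r : Idx × Idx → ℕ} (hr : PolyEmb r) (b : TM Idx A) {d : TM Idx A}
    (hd : d * d = d) : regularize (push r hr (kr b d + kr (1 - b) R0T)).mat (push r hr (mix R0T d R0T)).mat =
      (mulT (sEmb_map hr) b d).mat := by
  rw [regularize_mat, mulT, ← map_sub, kr_add_sub_mix, (Restr.push hr _).kap_push]
  · rfl
  · rw [push_mul_push, mix_R0T_idem hd]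

theorem mulLeft_mat {θ : Idx × Idx → ℕ} (hθ : PolyEmb θ) (b : TM Idx A) {d : TM Idx A} (hd : d * d = d) :
    mulLeft θ b.mat d.mat = (mulT (sEmb_map hθ) b d).mat := by
  rw [← regularize_push_mix hθ b hd, mulLeft, push_mat, push_mat, ← R0T_mat, ← TM.mat_one_sub,
    ← TM.mat_one_sub, kronecker_eq, kronecker_eq, kronecker_eq, kronecker_eq]
  rfl

theorem mulRight_mat {θ : Idx × Idx → ℕ} (hθ : PolyEmb θ) {b : TM Idx A} (hb : b * b = b) (d : TM Idx A) :
    mulRight θ b.mat d.mat = (mulT (sEmb_map (hθ.comp polyEmb_swap)) d b).mat := by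
  rw [← regularize_push_mix (hθ.comp polyEmb_swap) d hb, ← push_push θ hθ _ polyEmb_swap,
    ← push_push θ hθ _ polyEmb_swap, ← mix_swap, map_add, ← kr_swap, ← kr_swap, mulRight, push_mat, push_mat,
    ← R0T_mat, ← TM.mat_one_sub, ← TM.mat_one_sub, kronecker_eq, kronecker_eq, kronecker_eq, kronecker_eq]
  rfl

theorem one_mat {θ : Unit → ℕ} (hθ : PolyEmb θ) (e : A) : one θ e = (oneT (sEmb_unit hθ) e).mat := by
  have h1 : one θ e = regularize (push θ hθ (unitT e)).mat (0 : TM ℕ A).mat := by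
    rw [one, push_mat]
    congr 1
    refine Matrix.ext (forall_range_or (j := θ) (fun x y => ?_) fun i l h => ?_)
    · rw [relabel_apply hθ.injective]; rfl
    · rw [relabel_apply_of_notMem _ h]; rfl
  rw [h1, regularize_mat (mul_zero _), oneT, sub_zero, show kap 0 (push θ hθ (unitT e)) =
    push _ (PolyEmb.prodMk 0) (push θ hθ (unitT e)) by simp [kap, blockT_eq_push], push_push]
  rfl

/-! ### The two products -/

section Operations

/-- The product of idempotents, or the opposite product. -/
noncomputable def mulOp (c : Bool) {j : Fin 2 × (Idx × Idx) → Idx} (hj : SEmb Prod.fst j)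
    (b d : TM Idx A) : TM Idx A := bif c then mulT hj b d else mulT hj d b

variable (c : Bool) {j : Fin 2 × (Idx × Idx) → Idx} (hj : SEmb Prod.fst j) {F D G : E → TM Idx A}

protected theorem IsGr.mulOp (hF : IsGr S F) (hD : IsGr S D) : IsGr S fun x => mulOp c hj (F x) (D x) := by
  cases c
  exacts [hD.mulT hj hF, hF.mulT hj hD]

theorem mulOp_htpy_assoc (hF : IsGr S F) (hD : IsGr S D) (hG : IsGr S G) :
    Htpy S (fun x => mulOp c hj (mulOp c hj (F x) (D x)) (G x))
      fun x => mulOp c hj (F x) (mulOp c hj (D x) (G x)) := by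
  cases c
  exacts [(mulT_htpy_assoc hj hG hD hF).symm, mulT_htpy_assoc hj hF hD hG]

theorem mulOp_htpy_comm (hF : IsGr S F) (hD : IsGr S D) :
    Htpy S (fun x => mulOp c hj (F x) (D x)) fun x => mulOp c hj (D x) (F x) := by
  cases c
  exacts [mulT_htpy_comm hj hj hD hF, mulT_htpy_comm hj hj hF hD]

theorem mulOp_htpy_mul_add {α β : Idx → Idx} (h : AddEmb α β) (hF : IsGr S F) (hD : IsGr S D)
    (hG : IsGr S G) : Htpy S (fun x => mulOp c hj (F x) (addT h (D x) (G x)))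
      fun x => addT h (mulOp c hj (F x) (D x)) (mulOp c hj (F x) (G x)) := by
  cases c
  exacts [mulT_htpy_add_mul hj h hD hG hF, mulT_htpy_mul_add hj h hF hD hG]

theorem mulOp_htpy_add_mul {α β : Idx → Idx} (h : AddEmb α β) (hF : IsGr S F) (hD : IsGr S D)
    (hG : IsGr S G) : Htpy S (fun x => mulOp c hj (addT h (F x) (D x)) (G x))
      fun x => addT h (mulOp c hj (F x) (G x)) (mulOp c hj (D x) (G x)) := by
  cases c
  exacts [mulT_htpy_mul_add hj h hG hF hD, mulT_htpy_add_mul hj h hF hD hG]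

theorem mulOp_htpy_one_mul {υ : Unit → Idx} (hυ : SEmb (fun _ => 0) υ) {e : A} (he : ∀ a, e * a = a)
    (hF : IsGr S F) : Htpy S (fun x => mulOp c hj (oneT hυ e) (F x)) F := by
  have h := mulT_htpy_one_mul hj hυ he hF
  cases c
  exacts [(mulT_htpy_comm hj hj hF (isGr_oneT hυ (he e))).trans h, h]

theorem mulOp_htpy_mul_one {υ : Unit → Idx} (hυ : SEmb (fun _ => 0) υ) {e : A} (he : ∀ a, e * a = a)
    (hF : IsGr S F) : Htpy S (fun x => mulOp c hj (F x) (oneT hυ e)) F :=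
  (mulOp_htpy_comm c hj hF (isGr_oneT hυ (he e))).trans (mulOp_htpy_one_mul c hj hυ he hF)

/-- The operation is one of the two products. -/
def IsMulOp (mul : Mat A → Mat A → Mat A) (c : Bool) (hj : SEmb Prod.fst j) : Prop :=
  ∀ b d : TM Idx A, b * b = b → d * d = d → mul b.mat d.mat = (mulOp c hj b d).mat

theorem IsMulOp.apply {mul : Mat A → Mat A → Mat A} {c : Bool} {hj : SEmb Prod.fst j}
    (h : IsMulOp mul c hj) (hF : IsGr S F) (hD : IsGr S D) {x : E} (hx : x ∈ S) :
    mul (F x).mat (D x).mat = (mulOp c hj (F x) (D x)).mat := h _ _ (hF.2 x hx) (hD.2 x hx)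

theorem exists_isMulOp {θ : Idx × Idx → ℕ} (hθ : PolyEmb θ) {mul : Mat A → Mat A → Mat A}
    (h : mul = mulLeft θ ∨ mul = mulRight θ) : ∃ (c : Bool) (j : Fin 2 × (Idx × Idx) → Idx)
      (hj : SEmb Prod.fst j), IsMulOp mul c hj := by
  obtain rfl | rfl := h
  · exact ⟨true, _, sEmb_map hθ, fun b d _ hd => mulLeft_mat hθ b hd⟩
  · exact ⟨false, _, sEmb_map (hθ.comp polyEmb_swap), fun b d hb _ => mulRight_mat hθ hb d⟩

/-! ### Powers of the Grassmannian -/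

/-- The coordinates of the powers of the Grassmannian. -/
noncomputable def coord {k : ℕ} (i : Fin k) (x : Fin k → RapidMatrix Idx A) : TM Idx A :=
  R0T + incl (x i)

theorem pt_eq {k : ℕ} (i : Fin k) (x : Fin k → RapidMatrix Idx A) : pt (x i) = (coord i x).mat := by
  rw [pt, ← R0T_mat, perturb_eq, coord]

variable (A) in
theorem isGr_coord (k : ℕ) (i : Fin k) : IsGr (GrPow A k) (coord i) := by
  refine ⟨⟨univ, isOpen_univ, subset_univ _, fun x => x i, fun n => ?_, fun x _ =>
    add_sub_cancel_left _ _⟩, fun x hx => ?_⟩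
  · exact IsCk.clm (ContinuousLinearMap.proj (R := ℝ) (φ := fun _ : Fin k => RapidMatrix Idx A) i) n univ
  · have := hx i
    rw [pt_eq, mat_mem_Gr_iff] at this
    exact this.1

theorem isGr_R0T : IsGr S fun _ => (R0T : TM Idx A) :=
  ⟨SJ.zero.congr fun _ _ => sub_self _, fun _ _ => R0T_mul_R0T⟩

theorem isSmoothConjHRing {add mul : Mat A → Mat A → Mat A} {neg : Mat A → Mat A}
    {α β ν : Idx → Idx} {h : AddEmb α β} (hadd : ∀ b d : TM Idx A, add b.mat d.mat = (addT h b d).mat)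
    {hν : NegEmb ν} (hneg : ∀ b : TM Idx A, neg b.mat = (negT hν b).mat) {c : Bool}
    {hj : SEmb Prod.fst j} (hmul : IsMulOp mul c hj) : IsSmoothConjHRing.{u, w} add neg R0 mul where
  smooth_add := smoothToGr_iff.2 ⟨_, (isGr_coord A 2 0).addT h (isGr_coord A 2 1),
    fun x _ => by rw [pt_eq, pt_eq, hadd]⟩
  smooth_neg := smoothToGr_iff.2 ⟨_, (isGr_coord A 1 0).negT hν,
    fun x _ => by rw [pt_eq, hneg]⟩
  zero_mem := by
    rw [← R0T_mat, mat_mem_Gr_iff]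
    exact ⟨R0T_mul_R0T, 0, by rw [map_zero, add_zero]⟩
  smooth_mul := smoothToGr_iff.2 ⟨_, (isGr_coord A 2 0).mulOp c hj (isGr_coord A 2 1),
    fun x hx => by rw [pt_eq, pt_eq, hmul.apply (isGr_coord A 2 0) (isGr_coord A 2 1) hx]⟩
  add_assoc := (addT_htpy_assoc h (isGr_coord A 3 0) (isGr_coord A 3 1)
    (isGr_coord A 3 2)).conjHomotopic (fun x _ => by simp only [pt_eq, hadd])
    fun x _ => by simp only [pt_eq, hadd]
  add_comm := (addT_htpy_comm h (isGr_coord A 2 0) (isGr_coord A 2 1)).conjHomotopic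
    (fun x _ => by simp only [pt_eq, hadd]) fun x _ => by simp only [pt_eq, hadd]
  add_zero := (addT_htpy_zero h (isGr_coord A 1 0)).conjHomotopic
    (fun x _ => by simp only [pt_eq, ← R0T_mat, hadd]) fun x _ => pt_eq _ _
  zero_add := ((addT_htpy_comm h isGr_R0T (isGr_coord A 1 0)).trans
    (addT_htpy_zero h (isGr_coord A 1 0))).conjHomotopic
    (fun x _ => by simp only [pt_eq, ← R0T_mat, hadd]) fun x _ => pt_eq _ _
  add_neg := (addT_htpy_neg h hν (isGr_coord A 1 0)).conjHomotopic
    (fun x _ => by simp only [pt_eq, hneg, hadd]) fun x _ => R0T_mat.symm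
  neg_add := ((addT_htpy_comm h ((isGr_coord A 1 0).negT hν)
    (isGr_coord A 1 0)).trans (addT_htpy_neg h hν
      (isGr_coord A 1 0))).conjHomotopic
    (fun x _ => by simp only [pt_eq, hneg, hadd]) fun x _ => R0T_mat.symm
  mul_assoc := (mulOp_htpy_assoc c hj (isGr_coord A 3 0) (isGr_coord A 3 1) (isGr_coord A 3 2)).conjHomotopic
    (fun x hx => by
      rw [pt_eq, pt_eq, pt_eq, hmul.apply (isGr_coord A 3 0) (isGr_coord A 3 1) hx,
        hmul.apply ((isGr_coord A 3 0).mulOp c hj (isGr_coord A 3 1)) (isGr_coord A 3 2) hx])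
    fun x hx => by
      rw [pt_eq, pt_eq, pt_eq, hmul.apply (isGr_coord A 3 1) (isGr_coord A 3 2) hx,
        hmul.apply (isGr_coord A 3 0) ((isGr_coord A 3 1).mulOp c hj (isGr_coord A 3 2)) hx]
  mul_comm := (mulOp_htpy_comm c hj (isGr_coord A 2 0) (isGr_coord A 2 1)).conjHomotopic
    (fun x hx => by rw [pt_eq, pt_eq, hmul.apply (isGr_coord A 2 0) (isGr_coord A 2 1) hx])
    fun x hx => by rw [pt_eq, pt_eq, hmul.apply (isGr_coord A 2 1) (isGr_coord A 2 0) hx]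
  mul_add := (mulOp_htpy_mul_add c hj h (isGr_coord A 3 0) (isGr_coord A 3 1)
    (isGr_coord A 3 2)).conjHomotopic
    (fun x hx => by
      rw [pt_eq, pt_eq, pt_eq, hadd,
          hmul.apply (isGr_coord A 3 0) ((isGr_coord A 3 1).addT h (isGr_coord A 3 2)) hx])
    fun x hx => by
      rw [pt_eq, pt_eq, pt_eq, hmul.apply (isGr_coord A 3 0) (isGr_coord A 3 1) hx,
        hmul.apply (isGr_coord A 3 0) (isGr_coord A 3 2) hx, hadd]
  add_mul := (mulOp_htpy_add_mul c hj h (isGr_coord A 3 0) (isGr_coord A 3 1)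
    (isGr_coord A 3 2)).conjHomotopic
    (fun x hx => by
      rw [pt_eq, pt_eq, pt_eq, hadd,
          hmul.apply ((isGr_coord A 3 0).addT h (isGr_coord A 3 1)) (isGr_coord A 3 2) hx])
    fun x hx => by
      rw [pt_eq, pt_eq, pt_eq, hmul.apply (isGr_coord A 3 0) (isGr_coord A 3 2) hx,
        hmul.apply (isGr_coord A 3 1) (isGr_coord A 3 2) hx, hadd]
  add_compat E _ _ _ _ _ _ _ X f₀ f₁ k₀ k₁ hf hk := by
    obtain ⟨H, hH, hf⟩ := hf.exists_htpy
    obtain ⟨K, hK, hk⟩ := hk.exists_htpy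
    have : Htpy X _ _ := ⟨_, hH.addT h hK, fun x hx => ⟨rfl, rfl⟩⟩
    exact this.conjHomotopic (fun x hx => by rw [(hf x hx).1, (hk x hx).1, hadd])
      fun x hx => by rw [(hf x hx).2, (hk x hx).2, hadd]
  neg_compat E _ _ _ _ _ _ _ X f₀ f₁ hf := by
    obtain ⟨H, hH, hf⟩ := hf.exists_htpy
    have : Htpy X _ _ := ⟨_, hH.negT hν, fun x hx => ⟨rfl, rfl⟩⟩
    exact this.conjHomotopic (fun x hx => by rw [(hf x hx).1, hneg])
      fun x hx => by rw [(hf x hx).2, hneg]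
  mul_compat E _ _ _ _ _ _ _ X f₀ f₁ k₀ k₁ hf hk := by
    obtain ⟨H, hH, hf⟩ := hf.exists_htpy
    obtain ⟨K, hK, hk⟩ := hk.exists_htpy
    have : Htpy X _ _ := ⟨_, hH.mulOp c hj hK, fun x hx => ⟨rfl, rfl⟩⟩
    exact this.conjHomotopic
      (fun x hx => by rw [(hf x hx).1, (hk x hx).1, hmul _ _ (hH.2 _ ⟨hx, zero_mem_I⟩)
        (hK.2 _ ⟨hx, zero_mem_I⟩)])
      fun x hx => by rw [(hf x hx).2, (hk x hx).2, hmul _ _ (hH.2 _ ⟨hx, one_mem_I⟩)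
        (hK.2 _ ⟨hx, one_mem_I⟩)]

theorem isSmoothConjUnit {θ : Unit → ℕ} (hθ : PolyEmb θ) {mul : Mat A → Mat A → Mat A} {c : Bool}
    {hj : SEmb Prod.fst j} (hmul : IsMulOp mul c hj) {e : A} (he : ∀ a, e * a = a) :
    IsSmoothConjUnit mul (one θ e) where
  one_mem := (smoothToGr_iff.2 ⟨_, isGr_oneT (S := (univ : Set ℝ)) (sEmb_unit hθ) (he e),
    fun _ _ => one_mat hθ e⟩).2 0 (mem_univ _)
  one_mul := (mulOp_htpy_one_mul c hj (sEmb_unit hθ) he (isGr_coord A 1 0)).conjHomotopic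
    (fun x hx => by
      rw [pt_eq, one_mat hθ, hmul.apply (isGr_oneT (sEmb_unit hθ) (he e)) (isGr_coord A 1 0) hx]) fun x _ => pt_eq _ _
  mul_one := (mulOp_htpy_mul_one c hj (sEmb_unit hθ) he (isGr_coord A 1 0)).conjHomotopic
    (fun x hx => by
      rw [pt_eq, one_mat hθ, hmul.apply (isGr_coord A 1 0) (isGr_oneT (sEmb_unit hθ) (he e)) hx]) fun x _ => pt_eq _ _

theorem mulLeft_conjHomotopic_mulRight {θ : Idx × Idx → ℕ} (hθ : PolyEmb θ) :
    ConjHomotopic (GrPow A 2) (fun x => mulLeft θ (pt (x 0)) (pt (x 1)))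
      fun x => mulRight θ (pt (x 0)) (pt (x 1)) :=
  (mulT_htpy_comm (sEmb_map hθ) (sEmb_map (hθ.comp polyEmb_swap)) (isGr_coord A 2 0)
    (isGr_coord A 2 1)).conjHomotopic
    (fun x hx => by rw [pt_eq, pt_eq, mulLeft_mat hθ _ ((isGr_coord A 2 1).2 x hx)])
    fun x hx => by rw [pt_eq, pt_eq, mulRight_mat hθ ((isGr_coord A 2 0).2 x hx)]

end Operations

end RapidAlgebra

end InfGrassmannian

theorem mainTheorem3 {A : Type u} [NonUnitalCommRing A] [Module ℝ A] [IsScalarTower ℝ A A]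
    [SMulCommClass ℝ A A] [TopologicalSpace A] [IsTopologicalRing A] [ContinuousSMul ℝ A]
    [LocallyConvexSpace ℝ A] [T2Space A]
    (hcomplete : InfGrassmannian.SeqComplete A) (hstrong : InfGrassmannian.IsStrong A)
    (θ₁ : InfGrassmannian.Idx ⊕ InfGrassmannian.Idx → ℕ) (hθ₁ : InfGrassmannian.IsRelabeling θ₁)
    (θ₂ : InfGrassmannian.Idx → ℕ) (hθ₂ : InfGrassmannian.IsRelabeling θ₂)
    (θ₃ : InfGrassmannian.Idx × InfGrassmannian.Idx → ℕ) (hθ₃ : InfGrassmannian.IsRelabeling θ₃)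
    (θ₄ : Unit → ℕ) (hθ₄ : InfGrassmannian.IsRelabeling θ₄) :
    (∀ mul : InfGrassmannian.Mat A → InfGrassmannian.Mat A → InfGrassmannian.Mat A,
      mul = InfGrassmannian.mulLeft θ₃ ∨ mul = InfGrassmannian.mulRight θ₃ →
      InfGrassmannian.IsSmoothConjHRing.{u, w} (InfGrassmannian.add θ₁) (InfGrassmannian.neg θ₂)
        InfGrassmannian.R0 mul ∧
      ∀ e : A, (∀ a : A, e * a = a) →
        InfGrassmannian.IsSmoothConjUnit mul (InfGrassmannian.one θ₄ e)) ∧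
    InfGrassmannian.ConjHomotopic (InfGrassmannian.GrPow A 2)
      (fun x => InfGrassmannian.mulLeft θ₃ (InfGrassmannian.pt (x 0)) (InfGrassmannian.pt (x 1)))
      (fun x => InfGrassmannian.mulRight θ₃ (InfGrassmannian.pt (x 0)) (InfGrassmannian.pt (x 1))) ∧
    ∀ (E : Type w) [AddCommGroup E] [Module ℝ E] [TopologicalSpace E] [IsTopologicalAddGroup E]
      [ContinuousSMul ℝ E] [LocallyConvexSpace ℝ E] [T2Space E] (X : Set E)
      (H : E × ℝ → InfGrassmannian.Mat A),
      InfGrassmannian.SmoothToGr (X ×ˢ Set.Icc (0 : ℝ) 1) H →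
      InfGrassmannian.InducedByConj X H := by
  have : PolynormableSpace ℝ A := inferInstance
  have : InfGrassmannian.GoodAlg A := ⟨hcomplete, hstrong.mconvex⟩
  refine ⟨fun mul hmul => ?_, InfGrassmannian.mulLeft_conjHomotopic_mulRight hθ₃.polyEmb,
    fun E _ _ _ _ _ _ _ X H hH => InfGrassmannian.inducedByConj hH⟩
  obtain ⟨c, j, hj, hop⟩ := InfGrassmannian.exists_isMulOp hθ₃.polyEmb hmul
  exact ⟨InfGrassmannian.isSmoothConjHRing (InfGrassmannian.add_mat hθ₁.polyEmb)
    (InfGrassmannian.neg_mat hθ₂.polyEmb) hop,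
    fun e he => InfGrassmannian.isSmoothConjUnit hθ₄.polyEmb hop he⟩
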